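/- **Setup.** Fix $l\ge 2$, write $\overline{\phantom{x}}$ for the involution $q\mapsto q^{-1}$ of $\mathbb Z[q,q^{-1}]$, call an additive map anti-linear if it twists scalars by it, and let $[n]=\frac{q^n-q^{-n}}{q-q^{-1}}$, $[n]!=[1]\cdots[n]$. *The module.* Let $\mathrm U$ be the $\mathbb Z[q,q^{-1}]$-form of $U_q(\mathfrak{sl}_2)$ generated by $k^{\pm1}$ and the divided powers $e^{(n)}=e^n/[n]!$, $f^{(n)}=f^n/[n]!$, with the linear anti-involution $\rho$ given by $\rho(f)=qk^{-1}e$, $\rho(e)=q^{-1}fk$, $\rho(k)=k$. Let $\mathrm V(l)=\mathrm U\eta_l$, where $\eta_l$ is a highest weight vector of weight $q^l$ in the $(l+1)$-dimensional irreducible module. Put $b=f+\rho(f)\in\mathrm U$. There is a unique anti-linear map $v\mapsto\overline v$ on $\mathrm V(l)$ that fixes $\eta_l$ and satisfies $\overline{bv}=b\overline v$, and a unique symmetric bilinear form $(\cdot,\cdot)_l:\mathrm V(l)\times\mathrm V(l)\to\mathbb Z[q,q^{-1}]$ with $(\eta_l,\eta_l)_l=1$ and $(uv,w)_l=(v,\rho(u)w)_l$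 for all $u\in\mathrm U$. Let $$b^{(n)}=\frac{b^{\epsilon}}{[n]!}\prod_{\epsilon\le k\le n-1,\ k\equiv l\ (2)}(b^2-[k]^2),\qquad \epsilon\in\{0,1\},\ \epsilon\equiv n \pmod 2,$$ let $\mathrm U^\imath\subset\mathbb Q(q)[b]$ be the $\mathbb Z[q,q^{-1}]$-subalgebra generated by all $b^{(n)}$, $n\ge0$, and let $\mathrm I_l=\{u\in\mathrm U^\imath: u\eta_l=0\}$. The vectors $b^{(n)}\eta_l$, $0\le n\le l$, form the icanonical basis of $\mathrm V(l)$. *The Schur algebra.* Let $s_0,s_1,\dots,s_{l-1}$ act on signed permutations of $x_1,\dots,x_l$ by $s_0:x_1\mapsto -x_1$ and $s_i:x_i\leftrightarrow x_{i+1}$, let $s_{-1}=s_0s_1s_0$, $N=\{-1,1,2,\dots,l-1\}$, and let $W$ be the Weyl group of type $\mathrm D_l$ generated by $s_i$, $i\in N$, with length function $\ell$. Let $\mathrm H$ be its Hecke algebra, with $\mathbb Z[q,q^{-1}]$-basis $h_w$ $(w\in W)$ and $h_{s_i}h_w=h_{s_iw}$ if $\ell(s_iw)>\ell(w)$, $h_{s_i}h_w=h_{s_iw}-(q-q^{-1})h_w$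 otherwise; let $\overline{h_w}=h_{w^{-1}}^{-1}$ (extended anti-linearly), $\rho(h_w)=h_{w^{-1}}$ (extended linearly), let $\operatorname{tr}$ be the coefficient of $h_1$, and let $b_w$ be the Kazhdan–Lusztig basis element, i.e. the unique bar-invariant element of $h_w+\sum_{w'<w}q\mathbb Z[q]h_{w'}$ for the Bruhat order. For $I\subseteq N$ let $W_I$ be the parabolic subgroup, $w_I$ its longest element and $\pi_I=\sum_{w\in W_I}q^{2\ell(w)-\ell(w_I)}$. The $q$-Schur algebra is $\mathrm S=\bigoplus_{I,J\subseteq N}(b_{w_I}\mathrm H)\cap(\mathrm Hb_{w_J})$, where the product $x\circ y$ of $x$ in the $(I,J)$ summand and $y$ in the $(J',K)$ summand is $\pi_J^{-1}xy$ if $J=J'$ and $0$ otherwise; $1_I$ denotes $b_{w_I}$ in the $(I,I)$ summand. The bar involution acts summandwise; distinct summands are orthogonal for the form, and $(x,y)=\pi_I^{-1}\operatorname{tr}(\rho(x)y)$ on the $(I,J)$ summand. For $d$ of minimal length in $W_IdW_J$ let $L=\{i\in I: s_id=ds_j\text{ for some }j\in J\}$, let $w_Iw_L^{-1}dw_J$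 be the longest element of $W_IdW_J$, of length $\ell(IdJ)=\ell(w_I)-\ell(w_L)+\ell(d)+\ell(w_J)$, and define, in the $(I,J)$ summand, $$h_{IdJ}=\sum_{w\in W_IdW_J}q^{\ell(IdJ)-\ell(w)}h_w,\qquad b_{IdJ}=b_{w_Iw_L^{-1}dw_J}.$$ Let $\gamma$ be the automorphism of $W$, $\mathrm H$ and $\mathrm S$ induced by conjugation by $s_0$ (it exchanges the nodes $1$ and $-1$). The extended $q$-Schur algebra $\mathrm S\oplus s_0\mathrm S$ has the product $$(x+s_0y)\circ(u+s_0v)=(x\circ u+\gamma(y)\circ v)+s_0(y\circ u+\gamma(x)\circ v),$$ bar involution $\overline{x+s_0y}=\overline x+s_0\overline y$ and form $(x+s_0y,u+s_0v)=(x,u)+(y,v)$. Put $O{+}=N\setminus\{-1\}$, $O{-}=N\setminus\{1\}$, $\mathrm V=1_{O+}\circ(\mathrm S\oplus s_0\mathrm S)\circ1_{O+}$, and $b=s_0b_{O-,O+}\in\mathrm V$, where $b_{I,J}=b_{I1J}$. For $0\le n\le l$ let $d_n$ be the signed permutation with $x_j\mapsto -x_{n+1-j}$ for $j\le n$ and $x_j\mapsto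 x_j$ for $j>n$. **Theorem.** The $\mathbb Z[q,q^{-1}]$-modules $\mathrm V(l)$ and $\mathrm V$ are free, and there is a unique $\mathbb Z[q,q^{-1}]$-module isomorphism $\phi:\mathrm V(l)\to\mathrm V$ such that for all $0\le n\le l$ $$\phi\big(\overline{f^{(n)}\eta_l}\big)=\begin{cases}h_{(O+)d_n(O+)}&n\text{ even}\\ s_0h_{(O-)s_0d_n(O+)}&n\text{ odd,}\end{cases}\qquad \phi\big(b^{(n)}\eta_l\big)=\begin{cases}b_{(O+)d_n(O+)}&n\text{ even}\\ s_0b_{(O-)s_0d_n(O+)}&n\text{ odd.}\end{cases}$$ Moreover, $u\mapsto u\eta_l$ induces a $\mathbb Z[q,q^{-1}]$-module isomorphism $\mathrm U^\imath/\mathrm I_l\cong\mathrm V(l)$, and for the resulting algebra structure on $\mathrm V(l)$ the map $\phi$ is an algebra isomorphism (with $\phi(\eta_l)=1_{O+}$). Also, for all $v,w\in\mathrm V(l)$, $$\phi(bv)=b\circ\phi(v),\qquad \phi(\overline v)=\overline{\phi(v)},\qquad \overline{(\overline v,\overline w)_l}=q^{-\binom l2}\,(\phi(v),\phi(w)).$$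 -/

import Mathlib

noncomputable section

open scoped LaurentPolynomial Polynomial

namespace ISchur

/-! ### Scalars -/

/-- The ground ring `ℤ[q,q⁻¹]`. -/
abbrev A : Type := LaurentPolynomial ℤ

/-- The field `ℚ(q)`, as the field of fractions of `ℤ[q,q⁻¹]`. -/
def K : Type := FractionRing A

instance : Field K := inferInstanceAs (Field (FractionRing A))

instance : Algebra A K := inferInstanceAs (Algebra A (FractionRing A))

instance : IsFractionRing A K := inferInstanceAs (IsFractionRing A (FractionRing A))

/-- The element `q ^ m` of `ℤ[q,q⁻¹]`, for an integer `m`. -/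
def qpow (m : ℤ) : A := LaurentPolynomial.T m

/-- The indeterminate `q` as an element of `ℚ(q)`. -/
def qK : K := algebraMap A K (qpow 1)

/-- The bar involution `f(q) ↦ f(q⁻¹)` of `ℤ[q,q⁻¹]`. -/
def barA : A →+* A := (LaurentPolynomial.invert (R := ℤ)).toRingEquiv.toRingHom

/-- The quantum integer `[n] = (q ^ n - q ^ (-n)) / (q - q⁻¹)`, in `ℚ(q)`. -/
def qint (n : ℤ) : K := (qK ^ n - qK ^ (-n)) / (qK - qK⁻¹)

/-- The quantum factorial `[n]! = [1][2]⋯[n]`, in `ℚ(q)`. -/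
def qfact (n : ℕ) : K := ∏ i ∈ Finset.range n, qint ((i : ℤ) + 1)

lemma qpow_add (m n : ℤ) : qpow (m + n) = qpow m * qpow n := LaurentPolynomial.T_add m n

lemma qK_ne_zero : qK ≠ 0 := by
  have h : qpow 1 * qpow (-1) = 1 := by
    rw [← qpow_add]; simp [qpow]
  intro h0
  have h2 := congrArg (algebraMap A K) h
  rw [map_mul, map_one] at h2
  change qK * _ = 1 at h2
  rw [h0, zero_mul] at h2
  exact zero_ne_one h2

lemma algebraMap_qpow (m : ℤ) : algebraMap A K (qpow m) = qK ^ m := by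
  have hn : ∀ n : ℕ, algebraMap A K (qpow n) = qK ^ n := by
    intro n
    rw [qK, ← map_pow]
    congr 1
    simp [qpow, LaurentPolynomial.T_pow]
  obtain ⟨n, rfl | rfl⟩ := m.eq_nat_or_neg
  · simpa using hn n
  · have h : qpow (-(n : ℤ)) * qpow n = 1 := by
      rw [← qpow_add]; simp [qpow]
    have h2 := congrArg (algebraMap A K) h
    rw [map_mul, map_one, hn] at h2
    rw [zpow_neg, zpow_natCast]
    exact eq_inv_of_mul_eq_one_left h2

lemma qK_sub_inv_ne_zero : qK - qK⁻¹ ≠ 0 := by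
  intro h
  have h1 : algebraMap A K (qpow 1) = algebraMap A K (qpow (-1)) := by
    rw [algebraMap_qpow, algebraMap_qpow, zpow_one, zpow_neg_one]
    exact sub_eq_zero.mp h
  have h2 : qpow 1 = qpow (-1) := IsFractionRing.injective A K h1
  have h3 := congrArg LaurentPolynomial.degree h2
  simp [qpow] at h3

/-! ### The quantum group of `sl₂` -/

/-- Names of the generators of the quantum group. -/
inductive Gen
  | e | f | k | kinv

open FreeAlgebra in
/-- Defining relations of the quantized enveloping algebra of `sl₂`. -/
inductive QRel : FreeAlgebra K Gen → FreeAlgebra K Gen → Prop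
  | k_kinv : QRel (ι K Gen.k * ι K Gen.kinv) 1
  | kinv_k : QRel (ι K Gen.kinv * ι K Gen.k) 1
  | k_e : QRel (ι K Gen.k * ι K Gen.e) (qK ^ 2 • (ι K Gen.e * ι K Gen.k))
  | k_f : QRel (ι K Gen.k * ι K Gen.f) ((qK ^ 2)⁻¹ • (ι K Gen.f * ι K Gen.k))
  | e_f : QRel (ι K Gen.e * ι K Gen.f - ι K Gen.f * ι K Gen.e)
      ((qK - qK⁻¹)⁻¹ • (ι K Gen.k - ι K Gen.kinv))

/-- The quantized enveloping algebra `U_q(sl₂)` over `ℚ(q)`. -/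
abbrev Uq : Type := RingQuot QRel

/-- The generators of `U_q(sl₂)`. -/
def gen (g : Gen) : Uq := RingQuot.mkAlgHom K QRel (FreeAlgebra.ι K g)

lemma gen_k_kinv : gen .k * gen .kinv = 1 := by
  simpa [gen] using RingQuot.mkAlgHom_rel K QRel.k_kinv

lemma gen_kinv_k : gen .kinv * gen .k = 1 := by
  simpa [gen] using RingQuot.mkAlgHom_rel K QRel.kinv_k

lemma gen_k_e : gen .k * gen .e = qK ^ 2 • (gen .e * gen .k) := by
  simpa [gen] using RingQuot.mkAlgHom_rel K QRel.k_e

lemma gen_k_f : gen .k * gen .f = (qK ^ 2)⁻¹ • (gen .f * gen .k) := by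
  simpa [gen] using RingQuot.mkAlgHom_rel K QRel.k_f

lemma gen_e_f : gen .e * gen .f - gen .f * gen .e =
    (qK - qK⁻¹)⁻¹ • (gen .k - gen .kinv) := by
  simpa [gen] using RingQuot.mkAlgHom_rel K QRel.e_f

lemma gen_e_k : gen .e * gen .k = (qK ^ 2)⁻¹ • (gen .k * gen .e) := by
  rw [gen_k_e, smul_smul, inv_mul_cancel₀ (pow_ne_zero 2 qK_ne_zero), one_smul]

lemma gen_f_k : gen .f * gen .k = qK ^ 2 • (gen .k * gen .f) := by
  rw [gen_k_f, smul_smul, mul_inv_cancel₀ (pow_ne_zero 2 qK_ne_zero), one_smul]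

lemma gen_kinv_f : gen .kinv * gen .f = qK ^ 2 • (gen .f * gen .kinv) := by
  calc gen .kinv * gen .f = gen .kinv * (gen .f * gen .k) * gen .kinv := by
        rw [mul_assoc, mul_assoc, gen_k_kinv, mul_one]
    _ = _ := by
        rw [gen_f_k, mul_smul_comm, smul_mul_assoc, ← mul_assoc, gen_kinv_k, one_mul]

lemma gen_kinv_e : gen .kinv * gen .e = (qK ^ 2)⁻¹ • (gen .e * gen .kinv) := by
  calc gen .kinv * gen .e = gen .kinv * (gen .e * gen .k) * gen .kinv := by
        rw [mul_assoc, mul_assoc, gen_k_kinv, mul_one]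
    _ = _ := by
        rw [gen_e_k, mul_smul_comm, smul_mul_assoc, ← mul_assoc, gen_kinv_k, one_mul]

/-- The values of the anti-involution `ρ` on generators. -/
def rhoGen : Gen → Uq
  | .e => qK⁻¹ • (gen .f * gen .k)
  | .f => qK • (gen .kinv * gen .e)
  | .k => gen .k
  | .kinv => gen .kinv

/-- The anti-involution `ρ` of `U_q(sl₂)`, as a homomorphism to the opposite algebra:
`ρ(f) = q k⁻¹ e`, `ρ(e) = q⁻¹ f k`, `ρ(k) = k`. -/
def rhoHom : Uq →ₐ[K] Uqᵐᵒᵖ :=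
  RingQuot.liftAlgHom K ⟨FreeAlgebra.lift K (fun g => MulOpposite.op (rhoGen g)), by
    intro x y h
    have hq := qK_ne_zero
    induction h with
    | k_kinv => simp [rhoGen, ← MulOpposite.op_mul, gen_kinv_k]
    | kinv_k => simp [rhoGen, ← MulOpposite.op_mul, gen_k_kinv]
    | k_e =>
      simp only [map_mul, map_smul, FreeAlgebra.lift_ι_apply, rhoGen, ← MulOpposite.op_mul,
        ← MulOpposite.op_smul, smul_mul_assoc, mul_smul_comm, smul_smul]
      congr 1
      rw [← mul_assoc, gen_k_f, smul_mul_assoc, smul_smul]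
      congr 1
      field_simp
    | k_f =>
      simp only [map_mul, map_smul, FreeAlgebra.lift_ι_apply, rhoGen, ← MulOpposite.op_mul,
        ← MulOpposite.op_smul, smul_mul_assoc, mul_smul_comm, smul_smul]
      congr 1
      rw [mul_assoc, gen_e_k, mul_smul_comm, smul_smul, ← mul_assoc, ← mul_assoc, gen_kinv_k,
        gen_k_kinv, mul_comm]
    | e_f =>
      simp only [map_mul, map_sub, map_smul, FreeAlgebra.lift_ι_apply, rhoGen,
        ← MulOpposite.op_mul, ← MulOpposite.op_smul, ← MulOpposite.op_sub, smul_mul_assoc,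
        mul_smul_comm, smul_smul]
      congr 1
      have h1 : gen .kinv * gen .e * (gen .f * gen .k) = gen .e * gen .f := by
        have : gen .kinv * gen .e * (gen .f * gen .k)
            = (gen .kinv * gen .e) * gen .f * gen .k := by rw [mul_assoc (gen .kinv * gen .e)]
        rw [this, gen_kinv_e, smul_mul_assoc, smul_mul_assoc, mul_assoc (gen .e), gen_kinv_f,
          mul_smul_comm, smul_mul_assoc, smul_smul, inv_mul_cancel₀ (pow_ne_zero 2 hq), one_smul,
          mul_assoc, mul_assoc, gen_kinv_k, mul_one]
      have h2 : gen .f * gen .k * (gen .kinv * gen .e) = gen .f * gen .e := by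
        rw [mul_assoc, ← mul_assoc (gen .k), gen_k_kinv, one_mul]
      rw [h1, h2, mul_inv_cancel₀ hq, inv_mul_cancel₀ hq, one_smul, one_smul, gen_e_f]⟩

/-- The anti-involution `ρ` of `U_q(sl₂)`. -/
def rho (u : Uq) : Uq := MulOpposite.unop (rhoHom u)

/-- The divided powers `e⁽ⁿ⁾ = eⁿ / [n]!` and `f⁽ⁿ⁾ = fⁿ / [n]!`. -/
def divPow (g : Gen) (n : ℕ) : Uq := (qfact n)⁻¹ • gen g ^ n

/-- The `ℤ[q,q⁻¹]`-form `U` of `U_q(sl₂)`, generated by `k`, `k⁻¹` and all divided powers. -/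
def UZ : Subalgebra A Uq :=
  Algebra.adjoin A ({gen .k, gen .kinv} ∪ Set.range (divPow .e) ∪ Set.range (divPow .f))

lemma k_mem_UZ : gen .k ∈ UZ := Algebra.subset_adjoin (by simp)

lemma kinv_mem_UZ : gen .kinv ∈ UZ := Algebra.subset_adjoin (by simp)

lemma divPow_e_mem_UZ (n : ℕ) : divPow .e n ∈ UZ := Algebra.subset_adjoin (by simp)

lemma divPow_f_mem_UZ (n : ℕ) : divPow .f n ∈ UZ := Algebra.subset_adjoin (by simp)

lemma f_mem_UZ : gen .f ∈ UZ := by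
  have h : divPow .f 1 = gen .f := by
    simp [divPow, qfact, qint, div_self qK_sub_inv_ne_zero]
  exact h ▸ divPow_f_mem_UZ 1

lemma qK_zpow_smul_mem {u : Uq} (hu : u ∈ UZ) (m : ℤ) : qK ^ m • u ∈ UZ := by
  rw [← algebraMap_qpow, algebraMap_smul]
  exact UZ.smul_mem hu _

/-- If `x y = c y x` then `(y x)ⁿ` is a multiple of `yⁿ xⁿ` by a power of `c`. -/
lemma mul_pow_qcomm {x y : Uq} {j : ℤ} (h : x * y = qK ^ j • (y * x)) (n : ℕ) :
    ∃ m : ℤ, (y * x) ^ n = qK ^ m • (y ^ n * x ^ n) := by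
  have hx : ∀ n : ℕ, x ^ n * y = qK ^ (j * n) • (y * x ^ n) := by
    intro n
    induction n with
    | zero => simp
    | succ n ih =>
      rw [pow_succ, mul_assoc, h, mul_smul_comm, ← mul_assoc, ih, smul_mul_assoc, smul_smul,
        ← zpow_add₀ qK_ne_zero, mul_assoc]
      congr 2
      push_cast
      ring
  induction n with
  | zero => exact ⟨0, by simp⟩
  | succ n ih =>
    obtain ⟨m, hm⟩ := ih
    refine ⟨m + j * n, ?_⟩
    rw [pow_succ, hm, smul_mul_assoc, mul_assoc, ← mul_assoc (x ^ n), hx, smul_mul_assoc,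
      mul_smul_comm, smul_smul, ← zpow_add₀ qK_ne_zero, pow_succ y, pow_succ x]
    simp only [mul_assoc]

lemma rho_mem_UZ {u : Uq} (hu : u ∈ UZ) : rho u ∈ UZ := by
  induction hu using Algebra.adjoin_induction with
  | mem x hx =>
    rcases hx with ((rfl | rfl) | ⟨n, rfl⟩) | ⟨n, rfl⟩
    · simpa [rho, rhoHom, gen, rhoGen] using k_mem_UZ
    · simpa [rho, rhoHom, gen, rhoGen] using kinv_mem_UZ
    · have h : rho (divPow .e n) = (qfact n)⁻¹ • (qK⁻¹ • (gen .f * gen .k)) ^ n := by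
        simp [rho, rhoHom, divPow, gen, rhoGen]
      obtain ⟨m, hm⟩ := mul_pow_qcomm (x := gen .k) (y := gen .f) (j := -2)
        (by rw [gen_k_f]; rfl) n
      rw [h, smul_pow, hm, smul_smul, smul_smul]
      have : ((qfact n)⁻¹ * ((qK⁻¹) ^ n * qK ^ m)) • (gen .f ^ n * gen .k ^ n)
          = qK ^ (-(n : ℤ) + m) • (divPow .f n * gen .k ^ n) := by
        rw [divPow, smul_mul_assoc, smul_smul, zpow_add₀ qK_ne_zero, zpow_neg, zpow_natCast,
          inv_pow, mul_comm]
      rw [mul_assoc, this]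
      exact qK_zpow_smul_mem (UZ.mul_mem (divPow_f_mem_UZ n) (UZ.pow_mem k_mem_UZ n)) _
    · have h : rho (divPow .f n) = (qfact n)⁻¹ • (qK • (gen .kinv * gen .e)) ^ n := by
        simp [rho, rhoHom, divPow, gen, rhoGen]
      have hc : gen .e * gen .kinv = qK ^ (2 : ℤ) • (gen .kinv * gen .e) := by
        rw [gen_kinv_e, smul_smul]
        have : qK ^ (2 : ℤ) * (qK ^ 2)⁻¹ = 1 := mul_inv_cancel₀ (pow_ne_zero 2 qK_ne_zero)
        rw [this, one_smul]
      obtain ⟨m, hm⟩ := mul_pow_qcomm hc n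
      rw [h, smul_pow, hm, smul_smul, smul_smul]
      have : ((qfact n)⁻¹ * (qK ^ n * qK ^ m)) • (gen .kinv ^ n * gen .e ^ n)
          = qK ^ ((n : ℤ) + m) • (gen .kinv ^ n * divPow .e n) := by
        rw [divPow, mul_smul_comm, smul_smul, zpow_add₀ qK_ne_zero, zpow_natCast, mul_comm]
      rw [mul_assoc, this]
      exact qK_zpow_smul_mem (UZ.mul_mem (UZ.pow_mem kinv_mem_UZ n) (divPow_e_mem_UZ n)) _
  | algebraMap r =>
    have h : rho (algebraMap A Uq r) = algebraMap A Uq r := by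
      rw [IsScalarTower.algebraMap_apply A K Uq, rho, AlgHom.commutes]
      rfl
    rw [h]
    exact UZ.algebraMap_mem r
  | add x y _ _ hx hy => simpa [rho] using UZ.add_mem hx hy
  | mul x y _ _ hx hy => simpa [rho] using UZ.mul_mem hy hx

/-- The anti-involution `ρ` of the integral form `U`. -/
def rhoZ (u : UZ) : UZ := ⟨rho u, rho_mem_UZ u.2⟩

/-! ### The module `V(l)` -/

/-- Action of `e` on the space with basis `v₀, …, v_l`: `e vₙ = [l + 1 - n] vₙ₋₁`. -/
def opE (l : ℕ) : Module.End K (Fin (l + 1) → K) where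
  toFun v n := if h : (n : ℕ) + 1 < l + 1 then qint ((l : ℤ) - n) * v ⟨n + 1, h⟩ else 0
  map_add' v w := by funext n; simp only [Pi.add_apply]; split_ifs <;> ring
  map_smul' c v := by
    funext n; simp only [Pi.smul_apply, smul_eq_mul, RingHom.id_apply]; split_ifs <;> ring

/-- Action of `f`: `f vₙ = [n + 1] vₙ₊₁`. -/
def opF (l : ℕ) : Module.End K (Fin (l + 1) → K) where
  toFun v n := if 0 < (n : ℕ) then qint (n : ℤ) * v ⟨n - 1, by omega⟩ else 0
  map_add' v w := by funext n; simp only [Pi.add_apply]; split_ifs <;> ring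
  map_smul' c v := by
    funext n; simp only [Pi.smul_apply, smul_eq_mul, RingHom.id_apply]; split_ifs <;> ring

/-- Action of `k ^ ε`: `k ^ ε vₙ = q ^ (ε (l - 2 n)) vₙ`. -/
def opK (l : ℕ) (ε : ℤ) : Module.End K (Fin (l + 1) → K) where
  toFun v n := qK ^ (ε * ((l : ℤ) - 2 * n)) * v n
  map_add' v w := by ext n; simp [mul_add]
  map_smul' c v := by ext n; simp [mul_left_comm]

/-- The action of the generators. -/
def opGen (l : ℕ) : Gen → Module.End K (Fin (l + 1) → K)
  | .e => opE l
  | .f => opF l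
  | .k => opK l 1
  | .kinv => opK l (-1)

lemma qint_zero : qint 0 = 0 := by simp [qint]

lemma qint_comm (l n : ℤ) : qint (l - n) * qint (n + 1) - qint n * qint (l - n + 1) =
    (qK - qK⁻¹)⁻¹ * (qK ^ (l - 2 * n) - qK ^ (-(l - 2 * n))) := by
  have hq := qK_ne_zero
  have hd := qK_sub_inv_ne_zero
  have e1 : qint (l - n) * qint (n + 1) - qint n * qint (l - n + 1) =
      ((qK ^ (l - n) - (qK ^ (l - n))⁻¹) * (qK ^ n * qK - (qK ^ n * qK)⁻¹)
        - (qK ^ n - (qK ^ n)⁻¹) * (qK ^ (l - n) * qK - (qK ^ (l - n) * qK)⁻¹))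
        / ((qK - qK⁻¹) * (qK - qK⁻¹)) := by
    rw [qint, qint, qint, qint, zpow_neg, zpow_neg, zpow_neg, zpow_neg, zpow_add_one₀ hq,
      zpow_add_one₀ hq, div_mul_div_comm, div_mul_div_comm, ← sub_div]
  have e2 : qK ^ (l - 2 * n) = qK ^ (l - n) * (qK ^ n)⁻¹ := by
    rw [← zpow_neg, ← zpow_add₀ hq]; congr 1; ring
  rw [e1, zpow_neg, e2]
  have ha : qK ^ (l - n) ≠ 0 := zpow_ne_zero _ hq
  have hb : qK ^ n ≠ 0 := zpow_ne_zero _ hq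
  generalize qK ^ (l - n) = a at *
  generalize qK ^ n = b at *
  rw [div_eq_iff (mul_ne_zero hd hd)]
  rw [show (qK - qK⁻¹)⁻¹ * (a * b⁻¹ - (a * b⁻¹)⁻¹) * ((qK - qK⁻¹) * (qK - qK⁻¹))
    = ((qK - qK⁻¹)⁻¹ * (qK - qK⁻¹)) * ((a * b⁻¹ - (a * b⁻¹)⁻¹) * (qK - qK⁻¹)) by ring,
    inv_mul_cancel₀ hd, one_mul]
  field_simp
  ring

/-- The `(l + 1)`-dimensional irreducible representation of `U_q(sl₂)` of type 1. -/
def repV (l : ℕ) : Uq →ₐ[K] Module.End K (Fin (l + 1) → K) :=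
  RingQuot.liftAlgHom K ⟨FreeAlgebra.lift K (opGen l), by
    intro x y h
    have hq := qK_ne_zero
    induction h with
    | k_kinv =>
      ext v n
      simp [opGen, opK, ← mul_assoc, ← zpow_add₀ hq]
    | kinv_k =>
      ext v n
      simp [opGen, opK, ← mul_assoc, ← zpow_add₀ hq]
    | k_e =>
      refine LinearMap.ext fun v => funext fun n => ?_
      simp only [map_mul, map_smul, FreeAlgebra.lift_ι_apply, opGen, Module.End.mul_apply,
        LinearMap.smul_apply, Pi.smul_apply, smul_eq_mul]
      by_cases h : (n : ℕ) + 1 < l + 1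
      · simp only [opE, opK, LinearMap.coe_mk, AddHom.coe_mk, h, dif_pos]
        have : qK ^ (1 * ((l : ℤ) - 2 * (n : ℕ))) =
            qK ^ 2 * qK ^ (1 * ((l : ℤ) - 2 * ((n : ℕ) + 1 : ℕ))) := by
          rw [← zpow_natCast qK 2, ← zpow_add₀ hq]; congr 1; push_cast; ring
        rw [this]
        ring
      · simp only [opE, opK, LinearMap.coe_mk, AddHom.coe_mk, h, dif_neg, not_false_eq_true,
          mul_zero]
    | k_f =>
      refine LinearMap.ext fun v => funext fun n => ?_
      simp only [map_mul, map_smul, FreeAlgebra.lift_ι_apply, opGen, Module.End.mul_apply,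
        LinearMap.smul_apply, Pi.smul_apply, smul_eq_mul]
      by_cases h : 0 < (n : ℕ)
      · simp only [opF, opK, LinearMap.coe_mk, AddHom.coe_mk, h, if_pos]
        have : qK ^ (1 * ((l : ℤ) - 2 * (n : ℕ))) =
            (qK ^ 2)⁻¹ * qK ^ (1 * ((l : ℤ) - 2 * ((n : ℕ) - 1 : ℕ))) := by
          rw [← zpow_natCast qK 2, ← zpow_neg, ← zpow_add₀ hq]
          congr 1
          push_cast [Nat.cast_sub (show 1 ≤ (n : ℕ) from h)]
          ring
        rw [this]
        ring
      · simp only [opF, opK, LinearMap.coe_mk, AddHom.coe_mk, h, if_neg, not_false_eq_true,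
          mul_zero]
    | e_f =>
      refine LinearMap.ext fun v => funext fun n => ?_
      have key := qint_comm l (n : ℕ)
      have h1 : (opE l (opF l v)) n = qint ((l : ℤ) - (n : ℕ)) * qint ((n : ℕ) + 1 : ℤ) * v n := by
        by_cases h : (n : ℕ) + 1 < l + 1
        · simp only [opE, opF, LinearMap.coe_mk, AddHom.coe_mk, dif_pos h, Nat.succ_pos, if_true,
            Nat.add_sub_cancel, Fin.eta, mul_assoc, Nat.cast_add, Nat.cast_one]
        · have : ((n : ℕ) : ℤ) = l := by have := n.2; omega
          simp [opE, this, qint_zero]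
      have h2 : (opF l (opE l v)) n = qint ((n : ℕ) : ℤ) * qint ((l : ℤ) - (n : ℕ) + 1) * v n := by
        by_cases h : 0 < (n : ℕ)
        · have hn : (n : ℕ) - 1 + 1 < l + 1 := by have := n.2; omega
          have hn2 : (⟨(n : ℕ) - 1 + 1, hn⟩ : Fin (l + 1)) = n := by ext; simp; omega
          have hc : (l : ℤ) - ((n : ℕ) - 1 : ℕ) = l - (n : ℕ) + 1 := by omega
          simp only [opE, opF, LinearMap.coe_mk, AddHom.coe_mk, h, if_pos, dif_pos hn, hn2, hc]
          ring
        · have : (n : ℕ) = 0 := by omega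
          simp [opF, this, qint_zero]
      simp only [map_mul, map_sub, map_smul, FreeAlgebra.lift_ι_apply, opGen,
        Module.End.mul_apply, LinearMap.sub_apply, LinearMap.smul_apply, Pi.sub_apply,
        Pi.smul_apply, smul_eq_mul, h1, h2]
      rw [← sub_mul, key]
      simp only [opK, LinearMap.coe_mk, AddHom.coe_mk, one_mul, neg_mul]
      ring⟩

/-- The highest weight vector `η_l = v₀`. -/
def eta (l : ℕ) : Fin (l + 1) → K := Pi.single 0 1

/-- The integral form `V(l) = U η_l`. -/
def VZ (l : ℕ) : Submodule A (Fin (l + 1) → K) where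
  carrier := {v | ∃ u ∈ UZ, repV l u (eta l) = v}
  add_mem' := by
    rintro _ _ ⟨u, hu, rfl⟩ ⟨u', hu', rfl⟩
    exact ⟨u + u', UZ.add_mem hu hu', by simp⟩
  zero_mem' := ⟨0, UZ.zero_mem, by simp⟩
  smul_mem' := by
    rintro c _ ⟨u, hu, rfl⟩
    refine ⟨c • u, UZ.smul_mem hu c, ?_⟩
    rw [← algebraMap_smul K c u, map_smul, LinearMap.smul_apply, algebraMap_smul]

/-- The action of `U` on `V(l)`. -/
def actV {l : ℕ} (u : UZ) (v : VZ l) : VZ l :=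
  ⟨repV l u v, by
    obtain ⟨u', hu', h⟩ := v.2
    exact ⟨u * u', UZ.mul_mem u.2 hu', by rw [map_mul, Module.End.mul_apply, h]⟩⟩

/-- `η_l` as an element of `V(l)`. -/
def etaV (l : ℕ) : VZ l := ⟨eta l, 1, UZ.one_mem, by simp⟩

/-- The standard basis vector `f⁽ⁿ⁾ η_l` of `V(l)`. -/
def stdV (l n : ℕ) : VZ l := actV ⟨divPow .f n, divPow_f_mem_UZ n⟩ (etaV l)

/-- The element `b = f + ρ(f)` of `U`. -/
def bU : UZ := ⟨gen .f, f_mem_UZ⟩ + rhoZ ⟨gen .f, f_mem_UZ⟩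

/-- `β` is the ibar involution of `V(l)`: the anti-linear map that fixes `η_l` and commutes
with the action of `b`. -/
def IsIBar (l : ℕ) (β : VZ l →ₛₗ[barA] VZ l) : Prop :=
  β (etaV l) = etaV l ∧ ∀ v, β (actV bU v) = actV bU (β v)

/-- `B` is the bilinear form `(·,·)_l` on `V(l)`: symmetric, `(η_l, η_l)_l = 1`, and
`(u v, w)_l = (v, ρ(u) w)_l` for all `u` in `U`. -/
def IsContraForm (l : ℕ) (B : LinearMap.BilinForm A (VZ l)) : Prop :=
  (∀ v w, B v w = B w v) ∧ B (etaV l) (etaV l) = 1 ∧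
    ∀ (u : UZ) v w, B (actV u v) w = B v (actV (rhoZ u) w)

/-! ### The iquantum group and the icanonical basis -/

/-- The idivided power `b⁽ⁿ⁾` of parity `t`, as a polynomial in `b` over `ℚ(q)`. -/
def idivPow (t n : ℕ) : K[X] :=
  Polynomial.C (qfact n)⁻¹ * (if Even n then 1 else Polynomial.X) *
    ∏ k ∈ (if Even n then Finset.range n else Finset.Ico 1 n) with k % 2 = t % 2,
      (Polynomial.X ^ 2 - Polynomial.C (qint k ^ 2))

/-- The integral form of the split iquantum group of rank one with parity `t`: the
`ℤ[q,q⁻¹]`-subalgebra of `ℚ(q)[b]` generated by the idivided powers. -/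
def UI (t : ℕ) : Subalgebra A K[X] := Algebra.adjoin A (Set.range (idivPow t))

/-- The vector `u η_l` for a polynomial `u` in `b = f + ρ(f)`. -/
def iact (l : ℕ) (u : K[X]) : Fin (l + 1) → K :=
  repV l (Polynomial.aeval (bU : Uq) u) (eta l)

/-- The annihilator `I_l` of `η_l` in the iquantum group of the parity of `l`. -/
def annEta (l : ℕ) : Ideal (UI l) where
  carrier := {u | iact l u = 0}
  add_mem' := by
    intro u v hu hv
    simp only [Set.mem_ofPred_eq, iact] at *
    simp [hu, hv]
  zero_mem' := by simp [iact]
  smul_mem' := by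
    intro c u hu
    simp only [Set.mem_ofPred_eq, iact] at *
    simp [hu]

/-! ### The Weyl group of type `D_l`

Signed permutations are permutations of `ℤ`; the integers `i` and `-i` stand for `xᵢ` and `-xᵢ`. -/

/-- The nodes `-1, 1, 2, …, l - 1` of the Dynkin diagram (there are none if `l < 2`). -/
abbrev Node (l : ℕ) : Type := {i : ℤ // (i = -1 ∧ 2 ≤ l) ∨ (1 ≤ i ∧ i < l)}

instance (l : ℕ) : Finite (Node l) :=
  Set.Finite.to_subtype ((Set.finite_Icc (-1 : ℤ) l).subset (by
    rintro i (h | h)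
    · exact ⟨by omega, by omega⟩
    · exact ⟨by omega, by omega⟩))

instance (l : ℕ) : Fintype (Node l) := Fintype.ofFinite _

/-- The reflection `s₀`, sending `x₁` to `-x₁`. -/
def s0 : Equiv.Perm ℤ := Equiv.swap 1 (-1)

/-- The reflections `s₋₁` (exchanging `x₁` and `-x₂`) and `sᵢ` (exchanging `xᵢ` and `xᵢ₊₁`) for
`i ≥ 1`. -/
def sPerm (i : ℤ) : Equiv.Perm ℤ :=
  if i = -1 then Equiv.swap (-1) 2 * Equiv.swap 1 (-2)
  else Equiv.swap i (i + 1) * Equiv.swap (-i) (-(i + 1))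

/-- The Weyl group of type `D_l`. -/
def WD (l : ℕ) : Subgroup (Equiv.Perm ℤ) :=
  Subgroup.closure (Set.range fun i : Node l => sPerm i)

/-- The simple reflections. -/
def sW {l : ℕ} (i : Node l) : WD l := ⟨sPerm i, Subgroup.subset_closure ⟨i, rfl⟩⟩

lemma WD_fix {l : ℕ} {w : Equiv.Perm ℤ} (hw : w ∈ WD l) :
    ∀ z : ℤ, ¬ (-(l + 2) ≤ z ∧ z ≤ (l + 2)) → w z = z := by
  induction hw using Subgroup.closure_induction with
  | mem x hx =>
    obtain ⟨⟨i, hi⟩, rfl⟩ := hx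
    intro z hz
    simp only [sPerm]
    split_ifs with h <;>
    · rw [Equiv.Perm.mul_apply, Equiv.swap_apply_of_ne_of_ne (a := _) (x := z),
        Equiv.swap_apply_of_ne_of_ne] <;> omega
  | one => intro z _; rfl
  | mul x y _ _ hx hy => intro z hz; rw [Equiv.Perm.mul_apply, hy z hz, hx z hz]
  | inv x _ hx => intro z hz; rw [Equiv.Perm.inv_eq_iff_eq, hx z hz]

instance (l : ℕ) : Finite (WD l) := by
  classical
  let p : ℤ → Prop := fun z => z ∈ Set.Icc (-((l : ℤ) + 2)) (l + 2)
  have : Finite (Subtype p) := (Set.finite_Icc (-((l : ℤ) + 2)) (l + 2)).to_subtype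
  have h2 : Finite {f : Equiv.Perm ℤ // ∀ a, ¬ p a → f a = a} :=
    Finite.of_equiv _ (Equiv.Perm.subtypeEquivSubtypePerm p)
  exact Finite.of_injective
    (fun w : WD l => (⟨w.1, fun a ha => WD_fix w.2 a ha⟩ :
      {f : Equiv.Perm ℤ // ∀ a, ¬ p a → f a = a}))
    (fun a b h => Subtype.ext (by simpa using h))

instance (l : ℕ) : Fintype (WD l) := Fintype.ofFinite _

lemma s0_mul_s0 : s0 * s0 = 1 := Equiv.swap_mul_self _ _

lemma s0_conj_swap (a b : ℤ) : s0 * Equiv.swap a b * s0 = Equiv.swap (s0 a) (s0 b) := by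
  rw [Equiv.mul_swap_eq_swap_mul, mul_assoc, s0_mul_s0, mul_one]

lemma s0_conj_mem {l : ℕ} {w : Equiv.Perm ℤ} (hw : w ∈ WD l) : s0 * w * s0 ∈ WD l := by
  induction hw using Subgroup.closure_induction with
  | mem x hx =>
    obtain ⟨⟨i, hi⟩, rfl⟩ := hx
    have key : ∀ a b c d : ℤ, s0 * (Equiv.swap a b * Equiv.swap c d) * s0 =
        Equiv.swap (s0 a) (s0 b) * Equiv.swap (s0 c) (s0 d) := by
      intro a b c d
      rw [← s0_conj_swap, ← s0_conj_swap]
      calc s0 * (Equiv.swap a b * Equiv.swap c d) * s0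
          = s0 * Equiv.swap a b * 1 * Equiv.swap c d * s0 := by group
        _ = _ := by rw [← s0_mul_s0]; group
    have h1 : s0 1 = -1 := Equiv.swap_apply_left _ _
    have h2 : s0 (-1) = 1 := Equiv.swap_apply_right _ _
    have h3 : ∀ z : ℤ, z ≠ 1 → z ≠ -1 → s0 z = z := fun z h h' =>
      Equiv.swap_apply_of_ne_of_ne h h'
    by_cases hm : i = -1
    · have : s0 * sPerm i * s0 = sPerm 1 := by
        simp only [sPerm, hm, if_true, key, h1, h2, h3 2 (by omega) (by omega),
          h3 (-2) (by omega) (by omega)]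
        norm_num
      simp only [this]
      exact Subgroup.subset_closure ⟨⟨1, Or.inr (by omega)⟩, rfl⟩
    · by_cases hp : i = 1
      · have : s0 * sPerm i * s0 = sPerm (-1) := by
          norm_num [sPerm, hp]
          rw [key, h1, h2, h3 2 (by omega) (by omega), h3 (-2) (by omega) (by omega)]
        simp only [this]
        exact Subgroup.subset_closure ⟨⟨-1, Or.inl (by omega)⟩, rfl⟩
      · have : s0 * sPerm i * s0 = sPerm i := by
          simp only [sPerm, hm, if_false, key]
          rw [h3 i (by omega) (by omega), h3 (i + 1) (by omega) (by omega),
            h3 (-i) (by omega) (by omega), h3 (-(i + 1)) (by omega) (by omega)]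
        simp only [this]
        exact Subgroup.subset_closure ⟨⟨i, hi⟩, rfl⟩
  | one => rw [mul_one, s0_mul_s0]; exact Subgroup.one_mem _
  | mul x y _ _ hx hy =>
    have : s0 * (x * y) * s0 = s0 * x * s0 * (s0 * y * s0) := by
      have h := s0_mul_s0
      calc s0 * (x * y) * s0 = s0 * x * 1 * y * s0 := by group
        _ = _ := by rw [← h]; group
    rw [this]
    exact Subgroup.mul_mem _ hx hy
  | inv x _ hx =>
    have : s0 * x⁻¹ * s0 = (s0 * x * s0)⁻¹ := by
      have h : s0⁻¹ = s0 := Equiv.swap_inv _ _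
      rw [mul_inv_rev, mul_inv_rev, h, mul_assoc]
    rw [this]
    exact Subgroup.inv_mem _ hx

/-- The automorphism `γ` of the Weyl group, conjugation by `s₀`. -/
def gammaW {l : ℕ} (w : WD l) : WD l := ⟨s0 * w * s0, s0_conj_mem w.2⟩

/-- The signed permutation `dₙ`, sending `xⱼ` to `-xₙ₊₁₋ⱼ` for `1 ≤ j ≤ n` and fixing `xⱼ` for
`j > n`. -/
def dPerm (n : ℕ) : Equiv.Perm ℤ :=
  Function.Involutive.toPerm
    (fun z => if 1 ≤ z ∧ z ≤ n then z - (n + 1) else if -(n : ℤ) ≤ z ∧ z ≤ -1 then z + (n + 1) else z)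
    (by intro z; dsimp only; split_ifs <;> omega)

lemma dPerm_apply (n : ℕ) (z : ℤ) : dPerm n z =
    if 1 ≤ z ∧ z ≤ n then z - (n + 1) else if -(n : ℤ) ≤ z ∧ z ≤ -1 then z + (n + 1) else z := rfl

lemma dPerm_mul_self (n : ℕ) : dPerm n * dPerm n = 1 :=
  Equiv.ext fun z => Function.Involutive.toPerm_involutive _ z

lemma dPerm_mul_dPerm_succ (n : ℕ) :
    dPerm (n + 1) * dPerm (n + 2) = sPerm (n + 1) * (dPerm n * dPerm (n + 1)) := by
  have h : ((n : ℤ) + 1) ≠ -1 := by omega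
  have hs : ∀ z : ℤ, sPerm (n + 1) z = if z = n + 1 then (n : ℤ) + 2 else
      if z = n + 2 then (n : ℤ) + 1 else if z = -((n : ℤ) + 1) then -((n : ℤ) + 2) else
      if z = -((n : ℤ) + 2) then -((n : ℤ) + 1) else z := by
    intro z
    simp only [sPerm, h, if_false, Equiv.Perm.mul_apply, Equiv.swap_apply_def]
    split_ifs <;> omega
  ext z
  simp only [Equiv.Perm.mul_apply]
  rw [hs]
  have hd : ∀ (m : ℕ) (y : ℤ), (1 ≤ y ∧ y ≤ m ∧ dPerm m y = y - (m + 1)) ∨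
      (-(m : ℤ) ≤ y ∧ y ≤ -1 ∧ dPerm m y = y + (m + 1)) ∨
      ((y = 0 ∨ m < y ∨ y < -m) ∧ dPerm m y = y) := by
    intro m y
    rw [dPerm_apply]
    split_ifs <;> omega
  have a1 := hd (n + 2) z
  have a2 := hd (n + 1) (dPerm (n + 2) z)
  have a3 := hd (n + 1) z
  have a4 := hd n (dPerm (n + 1) z)
  push_cast at a1 a2 a3 a4
  generalize dPerm (n + 1) (dPerm (n + 2) z) = r at *
  generalize dPerm (n + 2) z = y at *
  generalize dPerm n (dPerm (n + 1) z) = r' at *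
  generalize dPerm (n + 1) z = y' at *
  split_ifs <;> omega

lemma s0_pow_mul_dPerm_mem {l n : ℕ} (hn : n ≤ l) : s0 ^ n * dPerm n ∈ WD l := by
  have hr : ∀ n : ℕ, n < l → dPerm n * dPerm (n + 1) * s0 ∈ WD l := by
    intro n
    induction n with
    | zero =>
      intro _
      have h0 : dPerm 0 = 1 := by
        ext z
        rw [dPerm_apply]
        push_cast
        split_ifs <;> simp <;> omega
      have h1 : dPerm 1 = s0 := by
        ext z
        rw [dPerm_apply, s0, Equiv.swap_apply_def]
        push_cast
        split_ifs <;> omega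
      rw [h0, zero_add, h1, one_mul, s0_mul_s0]
      exact Subgroup.one_mem _
    | succ n ih =>
      intro hl
      rw [dPerm_mul_dPerm_succ, mul_assoc]
      exact Subgroup.mul_mem _
        (Subgroup.subset_closure ⟨⟨(n : ℤ) + 1, Or.inr (by omega)⟩, rfl⟩) (ih (by omega))
  induction n with
  | zero =>
    have h0 : dPerm 0 = 1 := by
      ext z
      rw [dPerm_apply]
      push_cast
      split_ifs <;> simp <;> omega
    rw [h0, pow_zero, one_mul]
    exact Subgroup.one_mem _
  | succ n ih =>
    have h := s0_conj_mem (Subgroup.mul_mem _ (ih (by omega)) (hr n (by omega)))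
    have e : s0 * (s0 ^ n * dPerm n * (dPerm n * dPerm (n + 1) * s0)) * s0
        = s0 ^ (n + 1) * dPerm (n + 1) := by
      calc s0 * (s0 ^ n * dPerm n * (dPerm n * dPerm (n + 1) * s0)) * s0
          = (s0 * s0 ^ n) * ((dPerm n * dPerm n) * dPerm (n + 1)) * (s0 * s0) := by
            simp only [mul_assoc]
        _ = _ := by rw [dPerm_mul_self, s0_mul_s0, one_mul, mul_one, pow_succ']
    rw [← e]
    exact h

/-- The element `s₀ⁿ dₙ` of `W` (which is `dₙ` for even `n` and `s₀ dₙ` for odd `n`). -/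
def dW {l n : ℕ} (hn : n ≤ l) : WD l := ⟨s0 ^ n * dPerm n, s0_pow_mul_dPerm_mem hn⟩

/-- The length function of `W` with respect to the simple reflections. -/
def len {l : ℕ} (w : WD l) : ℕ :=
  sInf {n | ∃ ω : List (Node l), (ω.map sW).prod = w ∧ ω.length = n}

/-- The strict Bruhat order on `W`. -/
def BruhatLT {l : ℕ} : WD l → WD l → Prop :=
  Relation.TransGen fun x y =>
    (∃ (g : WD l) (i : Node l), y = x * (g * sW i * g⁻¹)) ∧ len x < len y

/-- The parabolic subgroup `W_I`. -/
def parab {l : ℕ} (I : Set (Node l)) : Subgroup (WD l) := Subgroup.closure (sW '' I)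

open Classical in
/-- The longest element `w_I` of `W_I`. -/
def longest {l : ℕ} (I : Set (Node l)) : WD l :=
  Classical.epsilon fun w => w ∈ parab I ∧ ∀ w' ∈ parab I, len w' ≤ len w

/-- The double coset `W_I d W_J`. -/
def dcoset {l : ℕ} (I : Set (Node l)) (d : WD l) (J : Set (Node l)) : Set (WD l) :=
  DoubleCoset.doubleCoset d (parab I : Set (WD l)) (parab J : Set (WD l))

/-- The left redundancy of `W_I d W_J`. -/
def leftRed {l : ℕ} (I : Set (Node l)) (d : WD l) (J : Set (Node l)) : Set (Node l) :=
  {i | i ∈ I ∧ ∃ j ∈ J, sW i * d = d * sW j}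

/-- The longest element of `W_I d W_J`, for `d` of minimal length in its double coset. -/
def dcMax {l : ℕ} (I : Set (Node l)) (d : WD l) (J : Set (Node l)) : WD l :=
  longest I * (longest (leftRed I d J))⁻¹ * d * longest J

/-- The length `ℓ(IdJ)` of that longest element. -/
def dcLen {l : ℕ} (I : Set (Node l)) (d : WD l) (J : Set (Node l)) : ℤ :=
  len (longest I) - len (longest (leftRed I d J)) + len d + len (longest J)

open Classical in
/-- The normalized Poincaré polynomial `π_I`, the sum of `q ^ (2 ℓ(w) - ℓ(w_I))` over `W_I`. -/
def poin {l : ℕ} (I : Set (Node l)) : A :=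
  ∑ w : WD l with w ∈ parab I, qpow (2 * len w - len (longest I))

/-- The node set `O+ = {1, 2, …, l - 1}`. -/
def Oplus (l : ℕ) : Set (Node l) := {i | i.1 ≠ -1}

/-- The node set `O- = {-1, 2, …, l - 1}`. -/
def Ominus (l : ℕ) : Set (Node l) := {i | i.1 ≠ 1}

/-! ### The Hecke algebra -/

/-- The operator of left multiplication by `hᵢ` on the free module with basis `h_w`, `w ∈ W`, in
coordinates: `hᵢ h_w` is `h_(sᵢ w)`, minus `(q - q⁻¹) h_w` if `ℓ(sᵢ w) < ℓ(w)`. -/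
def heckeOp {l : ℕ} (i : Node l) : Module.End A (WD l → A) where
  toFun v w := v (sW i * w) - if len (sW i * w) < len w then (qpow 1 - qpow (-1)) * v w else 0
  map_add' v v' := by funext w; simp only [Pi.add_apply]; split_ifs <;> ring
  map_smul' c v := by
    funext w; simp only [Pi.smul_apply, smul_eq_mul, RingHom.id_apply]; split_ifs <;> ring

/-- The Hecke algebra of `W`, in its (faithful) left regular representation on the free module
with basis `W`: the algebra generated by the operators of left multiplication by the `hᵢ`. -/
def heckeAlg (l : ℕ) : Subalgebra A (Module.End A (WD l → A)) :=
  Algebra.adjoin A (Set.range heckeOp)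

/-- Elements of the Hecke algebra. -/
abbrev H (l : ℕ) : Type := heckeAlg l

/-- The generators `hᵢ`. -/
def hGen {l : ℕ} (i : Node l) : H l := ⟨heckeOp i, Algebra.subset_adjoin ⟨i, rfl⟩⟩

/-- A reduced expression of `w`. -/
def redWord {l : ℕ} (w : WD l) : List (Node l) :=
  Classical.epsilon fun ω => (ω.map sW).prod = w ∧ ω.length = len w

/-- The standard basis element `h_w`, the product of the `hᵢ` along a reduced expression of `w`. -/
def hB {l : ℕ} (w : WD l) : H l := ((redWord w).map hGen).prod

open Classical in
/-- The coefficient of `h_w` in `x`, read off from the vector `x · 1`. -/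
def coef {l : ℕ} (x : H l) (w : WD l) : A := (x : Module.End A (WD l → A)) (Pi.single 1 1) w

/-- The bar involution of the Hecke algebra: anti-linear, with `h_w` sent to the inverse of
`h_(w⁻¹)`. -/
def barH {l : ℕ} (x : H l) : H l := ∑ w, barA (coef x w) • Ring.inverse (hB w⁻¹)

/-- The linear anti-involution `ρ`, sending `h_w` to `h_(w⁻¹)`. -/
def rhoH {l : ℕ} (x : H l) : H l := ∑ w, coef x w • hB w⁻¹

/-- The automorphism `γ`, sending `h_w` to `h_(γ(w))`. -/
def gammaH {l : ℕ} (x : H l) : H l := ∑ w, coef x w • hB (gammaW w)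

/-- The symmetrizing trace, the coefficient of `h_1`. -/
def trH {l : ℕ} (x : H l) : A := coef x 1

/-- `x` is the Kazhdan-Lusztig element of `w`: bar invariant, and equal to `h_w` plus a
`qℤ[q]`-linear combination of the `h_y` for `y < w` in the Bruhat order. -/
def IsKL {l : ℕ} (w : WD l) (x : H l) : Prop :=
  barH x = x ∧ coef x w = 1 ∧
    (∀ y, BruhatLT y w → ∃ p : ℤ[X], coef x y = qpow 1 * p.toLaurent) ∧
    ∀ y, y ≠ w → ¬ BruhatLT y w → coef x y = 0

/-- The Kazhdan-Lusztig basis element `b_w`. -/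
def klB {l : ℕ} (w : WD l) : H l := Classical.epsilon (IsKL w)

/-! ### The `q`-Schur algebra -/

/-- Families of elements of the Hecke algebra indexed by pairs of sets of nodes. -/
abbrev Fam (l : ℕ) : Type := Set (Node l) → Set (Node l) → H l

/-- The `q`-Schur algebra: the direct sum over all `I`, `J` of the intersections of `b_(w_I) H`
and `H b_(w_J)`. -/
def schur (l : ℕ) : Submodule A (Fam l) where
  carrier := {x | ∀ I J, (∃ a, x I J = klB (longest I) * a) ∧ ∃ a, x I J = a * klB (longest J)}
  add_mem' := by
    intro x y hx hy I J
    obtain ⟨⟨a, ha⟩, c, hc⟩ := hx I J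
    obtain ⟨⟨a', ha'⟩, c', hc'⟩ := hy I J
    exact ⟨⟨a + a', by rw [mul_add, ← ha, ← ha']; rfl⟩, c + c', by rw [add_mul, ← hc, ← hc']; rfl⟩
  zero_mem' := fun I J => ⟨⟨0, by rw [mul_zero]; rfl⟩, 0, by rw [zero_mul]; rfl⟩
  smul_mem' := by
    intro r x hx I J
    obtain ⟨⟨a, ha⟩, c, hc⟩ := hx I J
    exact ⟨⟨r • a, by rw [mul_smul_comm, ← ha]; rfl⟩, r • c, by rw [smul_mul_assoc, ← hc]; rfl⟩

/-- The quotient of `x` by a scalar that divides it. -/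
def divBy {M : Type} [AddCommGroup M] [Module A M] (p : A) (x : M) : M :=
  Classical.epsilon fun z => p • z = x

/-- The multiplication `∘` of the `q`-Schur algebra: the product of `x` in the component `(I, J)`
and `y` in the component `(J, K)` is `π_J⁻¹ x y`. -/
def schurMul {l : ℕ} (x y : Fam l) : Fam l := fun I L =>
  ∑ J : Set (Node l), divBy (poin J) (x I J * y J L)

open Classical in
/-- The element of the `q`-Schur algebra with `x` in the component `(I, J)`. -/
def comp {l : ℕ} (I J : Set (Node l)) (x : H l) : Fam l :=
  fun I' J' => if I' = I ∧ J' = J then x else 0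

/-- The idempotent `1_I`, which is `b_(w_I)` in the component `(I, I)`. -/
def idem {l : ℕ} (I : Set (Node l)) : Fam l := comp I I (klB (longest I))

open Classical in
/-- The standard basis element `h_(IdJ)`. -/
def hS {l : ℕ} (I : Set (Node l)) (d : WD l) (J : Set (Node l)) : Fam l :=
  comp I J (∑ w : WD l with w ∈ dcoset I d J, qpow (dcLen I d J - len w) • hB w)

/-- The Kazhdan-Lusztig basis element `b_(IdJ)`. -/
def bS {l : ℕ} (I : Set (Node l)) (d : WD l) (J : Set (Node l)) : Fam l :=
  comp I J (klB (dcMax I d J))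

/-- The graph automorphism of the set of nodes, exchanging `1` and `-1`. -/
def gammaN {l : ℕ} (i : Node l) : ℤ := if i.1 = 1 then -1 else if i.1 = -1 then 1 else i

/-- The image of a set of nodes under the graph automorphism. -/
def gammaSet {l : ℕ} (I : Set (Node l)) : Set (Node l) := {i | ∃ j ∈ I, gammaN j = i.1}

/-- The automorphism `γ` of the `q`-Schur algebra, taking the component `(I, J)` to the component
`(γ(I), γ(J))`. -/
def gammaS {l : ℕ} (x : Fam l) : Fam l := fun I J => gammaH (x (gammaSet I) (gammaSet J))

/-- The bar involution of the `q`-Schur algebra. -/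
def barS {l : ℕ} (x : Fam l) : Fam l := fun I J => barH (x I J)

/-- The bilinear form of the `q`-Schur algebra: distinct components are orthogonal, and
`(x, y) = π_I⁻¹ tr(ρ(x) y)` on the component `(I, J)`. -/
def formS {l : ℕ} (x y : Fam l) : A :=
  ∑ I : Set (Node l), ∑ J : Set (Node l), divBy (poin I) (trH (rhoH (x I J) * y I J))

/-! ### The extended `q`-Schur algebra; the pair `(x, y)` stands for `x + s₀ y` -/

/-- The extended `q`-Schur algebra. -/
def extSchur (l : ℕ) : Submodule A (Fam l × Fam l) := (schur l).prod (schur l)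

/-- Its multiplication:
`(x + s₀ y) ∘ (u + s₀ v) = (x ∘ u + γ(y) ∘ v) + s₀ (y ∘ u + γ(x) ∘ v)`. -/
def extMul {l : ℕ} (X Y : Fam l × Fam l) : Fam l × Fam l :=
  (schurMul X.1 Y.1 + schurMul (gammaS X.2) Y.2, schurMul X.2 Y.1 + schurMul (gammaS X.1) Y.2)

/-- Its bar involution. -/
def extBar {l : ℕ} (X : Fam l × Fam l) : Fam l × Fam l := (barS X.1, barS X.2)

/-- Its bilinear form. -/
def extForm {l : ℕ} (X Y : Fam l × Fam l) : A := formS X.1 Y.1 + formS X.2 Y.2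

/-- The idempotent `1_(O+)` of the extended algebra. -/
def extOne (l : ℕ) : Fam l × Fam l := (idem (Oplus l), 0)

/-- The subalgebra `V = 1_(O+) ∘ (S ⊕ s₀ S) ∘ 1_(O+)`. -/
def VS (l : ℕ) : Submodule A (Fam l × Fam l) :=
  Submodule.span A {Z | ∃ X ∈ extSchur l, Z = extMul (extMul (extOne l) X) (extOne l)}

/-- The element `b = s₀ b_(O-,O+)`. -/
def bV (l : ℕ) : Fam l × Fam l := (0, bS (Ominus l) 1 (Oplus l))

/-- The standard basis elements `h_((O+) dₙ (O+))` (`n` even) and `s₀ h_((O-) s₀dₙ (O+))`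
(`n` odd) of `V`. -/
def stdVS {l n : ℕ} (hn : n ≤ l) : Fam l × Fam l :=
  if Even n then (hS (Oplus l) (dW hn) (Oplus l), 0) else (0, hS (Ominus l) (dW hn) (Oplus l))

/-- The Kazhdan-Lusztig basis elements `b_((O+) dₙ (O+))` (`n` even) and `s₀ b_((O-) s₀dₙ (O+))`
(`n` odd) of `V`. -/
def klVS {l n : ℕ} (hn : n ≤ l) : Fam l × Fam l :=
  if Even n then (bS (Oplus l) (dW hn) (Oplus l), 0) else (0, bS (Ominus l) (dW hn) (Oplus l))

/-- The defining conditions on `φ`: it sends the ibar conjugate of `f⁽ⁿ⁾ η_l` to the `n`-th standard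
basis element of `V`, and `b⁽ⁿ⁾ η_l` to the `n`-th Kazhdan-Lusztig basis element. -/
def IsPhi (l : ℕ) (β : VZ l →ₛₗ[barA] VZ l) (φ : VZ l ≃ₗ[A] VS l) : Prop :=
  (∀ (n : ℕ) (hn : n ≤ l), (φ (β (stdV l n)) : Fam l × Fam l) = stdVS hn) ∧
  ∀ (n : ℕ) (hn : n ≤ l), ∃ v : VZ l, (v : Fin (l + 1) → K) = iact l (idivPow l n) ∧
    (φ v : Fam l × Fam l) = klVS hn

end ISchur

end

open ISchur

/-!
The module `V(l)` with the operator `b` and the module `V` with multiplication by `b` are isomorphic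
because both have a basis on which `b` acts by the same tridiagonal matrix.

On the side of the quantum group this basis is formed by the ibar conjugates of the vectors
`f⁽ⁿ⁾ η_l`. The key is an explicit formula (`iact_idivPow`): the coordinates of `b⁽ⁿ⁾ η_l` are powers
of `q⁻¹` times Gaussian binomials in `q⁻⁴`, which follows from the recurrence
`[n + 1] b⁽ⁿ⁺¹⁾ = b b⁽ⁿ⁾ - [n] b⁽ⁿ⁻¹⁾` (the last term only for `n ≡ l`). In particular the `b⁽ⁿ⁾ η_l`
form a basis of `V(l)`, which gives the ibar involution, and the coefficients of `b⁽ⁿ⁾ η_l` with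
respect to the ibar conjugates of the `f⁽ᵐ⁾ η_l` with `m < n` lie in `qℤ[q]`.

On the side of the Hecke algebra, elements of `W` are treated as signed permutations, with lengths
given by inversions. The double cosets of `W_(O±)` and `W_(O+)` are told apart by the number of minus
signs (`mem_dcoset_iff`), and `V` consists of the pairs of Hecke algebra elements whose normalized
coefficients are constant on them (`VS_eq`, `ncoef_eq_of_negCount_eq`). Since the idempotents are
absorbed by such elements, `b` acts by a sum over the coset representatives `sₖ ⋯ s₁`, and evaluating
coefficients at minimal coset representatives yields its matrix (`bMul_stdElt`).

All other claims follow from the compatibility of the isomorphism with `b`, as `η_l` generates `V(l)`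
under `b` up to torsion. The image of `b⁽ⁿ⁾ η_l` is bar invariant by induction on `n`, so by
triangularity it is the Kazhdan-Lusztig element (`isKL_maxW`, `phiC_icV`); the Bruhat order enters
through `eq_dcMax_or_bruhatLT`. Hence the isomorphism intertwines the bar involutions. The idivided
powers act on `V(l)` as multiplication in `V` by their images (`repV_idivPow`), which gives the
algebra structure, and `b` is self-adjoint for both forms, which are therefore determined by their
values at `(η_l, w)` (`bilinForm_ext`).
-/

noncomputable section

open scoped LaurentPolynomial Polynomial

namespace ISchur

/-! ### Quantum integers and Gaussian binomials -/

lemma qpow_zero : qpow 0 = 1 := LaurentPolynomial.T_zero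

lemma qpow_mul_neg (m : ℤ) : qpow m * qpow (-m) = 1 := by
  rw [← qpow_add, add_neg_cancel, qpow_zero]

lemma qpow_ne_zero (m : ℤ) : qpow m ≠ 0 := left_ne_zero_of_mul_eq_one (qpow_mul_neg m)

lemma qpow_pow (m : ℤ) (n : ℕ) : qpow m ^ n = qpow (n * m) := LaurentPolynomial.T_pow m n

@[simp] lemma barA_qpow (m : ℤ) : barA (qpow m) = qpow (-m) := LaurentPolynomial.invert_T m

@[simp] lemma barA_barA (a : A) : barA (barA a) = a := LaurentPolynomial.involutive_invert a

lemma algebraMap_A_inj {a b : A} (h : algebraMap A K a = algebraMap A K b) : a = b :=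
  IsFractionRing.injective A K h

lemma algebraMap_A_ne_zero {a : A} (h : a ≠ 0) : algebraMap A K a ≠ 0 := fun h0 =>
  h (algebraMap_A_inj (by rw [h0, map_zero]))

/-- The quantum integer `[n]` as an element of `ℤ[q,q⁻¹]`. -/
def qnum (n : ℕ) : A := ∑ i ∈ Finset.range n, qpow ((n : ℤ) - 1 - 2 * i)

lemma qnum_mul_sub (n : ℕ) : qnum n * (qpow 1 - qpow (-1)) = qpow n - qpow (-n) := by
  have h : ∀ i ∈ Finset.range n, qpow ((n : ℤ) - 1 - 2 * i) * (qpow 1 - qpow (-1)) =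
      qpow ((n : ℤ) - 2 * i) - qpow ((n : ℤ) - 2 * (i + 1 : ℕ)) := by
    intro i _
    rw [mul_sub, ← qpow_add, ← qpow_add]
    congr 2 <;> push_cast <;> ring
  rw [qnum, Finset.sum_mul, Finset.sum_congr rfl h,
    Finset.sum_range_sub' (fun i : ℕ => qpow ((n : ℤ) - 2 * i))]
  congr 2
  ring

lemma algebraMap_qnum (n : ℕ) : algebraMap A K (qnum n) = qint n := by
  rw [qint, eq_div_iff qK_sub_inv_ne_zero]
  have h := congrArg (algebraMap A K) (qnum_mul_sub n)
  rw [map_mul, map_sub, map_sub, algebraMap_qpow, algebraMap_qpow, algebraMap_qpow,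
    algebraMap_qpow, zpow_one, zpow_neg_one] at h
  exact h

/-- The specialisation of `ℤ[q,q⁻¹]` at `q = 1`. -/
def evalOne : A →+* ℤ := LaurentPolynomial.eval₂ (RingHom.id ℤ) 1

@[simp] lemma evalOne_qpow (m : ℤ) : evalOne (qpow m) = 1 := by
  simp [evalOne, qpow]

lemma qnum_ne_zero {n : ℕ} (h : n ≠ 0) : qnum n ≠ 0 := by
  intro h0
  have := congrArg evalOne h0
  simp [qnum] at this
  exact h this

@[simp] lemma barA_qnum (n : ℕ) : barA (qnum n) = qnum n := by
  rw [qnum, map_sum, ← Finset.sum_range_reflect]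
  refine Finset.sum_congr rfl fun i hi => ?_
  have := Finset.mem_range.mp hi
  rw [barA_qpow]
  congr 1
  omega

lemma qint_natCast_ne_zero {n : ℕ} (h : n ≠ 0) : qint n ≠ 0 := by
  rw [← algebraMap_qnum]
  exact algebraMap_A_ne_zero (qnum_ne_zero h)

lemma qfact_succ (n : ℕ) : qfact (n + 1) = qfact n * qint ((n + 1 : ℕ) : ℤ) := by
  rw [qfact, Finset.prod_range_succ, ← qfact]
  push_cast
  rfl

lemma qfact_ne_zero (n : ℕ) : qfact n ≠ 0 := by
  refine Finset.prod_ne_zero_iff.mpr fun i _ => ?_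
  exact_mod_cast qint_natCast_ne_zero (Nat.succ_ne_zero i)

/-- The Gaussian binomial coefficient in the variable `x`, in its unbalanced form. -/
def gauss {R : Type*} [CommRing R] (x : R) : ℕ → ℕ → R
  | _, 0 => 1
  | 0, _ + 1 => 0
  | n + 1, k + 1 => gauss x n k + x ^ (k + 1) * gauss x n (k + 1)

section gauss

variable {R : Type*} [CommRing R] (x : R)

@[simp] lemma gauss_zero_right (n : ℕ) : gauss x n 0 = 1 := by cases n <;> rfl

@[simp] lemma gauss_zero_succ (k : ℕ) : gauss x 0 (k + 1) = 0 := rfl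

lemma gauss_succ_succ (n k : ℕ) :
    gauss x (n + 1) (k + 1) = gauss x n k + x ^ (k + 1) * gauss x n (k + 1) := rfl

lemma gauss_eq_zero_of_lt {n k : ℕ} (h : n < k) : gauss x n k = 0 := by
  induction n generalizing k with
  | zero => obtain ⟨k, rfl⟩ := Nat.exists_eq_succ_of_ne_zero (by omega : k ≠ 0); rfl
  | succ n ih =>
    obtain ⟨k, rfl⟩ := Nat.exists_eq_succ_of_ne_zero (by omega : k ≠ 0)
    rw [gauss_succ_succ, ih (by omega), ih (by omega), mul_zero, add_zero]

/-- Raising the lower index. -/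
lemma gauss_raise_lower (k d : ℕ) :
    (1 - x ^ (k + 1)) * gauss x (k + d) (k + 1) = (1 - x ^ d) * gauss x (k + d) k := by
  generalize hn : k + d = n
  induction n generalizing k d with
  | zero =>
    obtain ⟨rfl, rfl⟩ : k = 0 ∧ d = 0 := by omega
    simp
  | succ n ih =>
    -- raising both indices follows from the inductive hypothesis
    rcases d with _ | d
    · rw [show k = n + 1 by omega, gauss_eq_zero_of_lt x (Nat.lt_succ_self (n + 1))]
      simp
    have both : (1 - x ^ (k + 1)) * gauss x (n + 1) (k + 1) =
        (1 - x ^ (n + 1)) * gauss x n k := by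
      rw [gauss_succ_succ, show n + 1 = d + (k + 1) by omega, pow_add]
      linear_combination x ^ (k + 1) * ih k d (by omega)
    rw [both]
    rcases k with _ | k
    · rw [gauss_zero_right, gauss_zero_right, show n + 1 = d + 1 by omega]
    · rw [gauss_succ_succ, show n + 1 = (d + 1) + (k + 1) by omega, pow_add]
      linear_combination ih k (d + 1) (by omega)

/-- Raising both indices. -/
lemma gauss_raise_both (n k : ℕ) :
    (1 - x ^ (k + 1)) * gauss x (n + 1) (k + 1) = (1 - x ^ (n + 1)) * gauss x n k := by
  rcases Nat.lt_or_ge n k with h | h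
  · rw [gauss_eq_zero_of_lt x h, gauss_eq_zero_of_lt x (by omega : n + 1 < k + 1)]
    simp
  · obtain ⟨d, rfl⟩ := Nat.exists_eq_add_of_le h
    rw [gauss_succ_succ, show k + d + 1 = d + (k + 1) by omega, pow_add]
    linear_combination x ^ (k + 1) * gauss_raise_lower x k d

lemma map_gauss {S : Type*} [CommRing S] (f : R →+* S) (n k : ℕ) :
    f (gauss x n k) = gauss (f x) n k := by
  induction n generalizing k with
  | zero => cases k <;> simp
  | succ n ih => cases k <;> simp [gauss_succ_succ, ih]

end gauss

/-- The quantum factorial `[n + k]!` is divisible by `[n]! [k]!` in `ℤ[q,q⁻¹]`. -/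
lemma exists_qbinom (n k : ℕ) : ∃ c : A, algebraMap A K c * (qfact n * qfact k) = qfact (n + k) := by
  induction n generalizing k with
  | zero => exact ⟨1, by simp [qfact]⟩
  | succ n ihn =>
    induction k with
    | zero => exact ⟨1, by simp [qfact]⟩
    | succ k ihk =>
      obtain ⟨c, hc⟩ := ihn (k + 1)
      obtain ⟨d, hd⟩ := ihk
      refine ⟨qpow (n + 1) * d + qpow (-(k + 1 : ℤ)) * c, ?_⟩
      have key : qint ((n + 1 + (k + 1) : ℕ) : ℤ) =
          qK ^ ((n : ℤ) + 1) * qint ((k + 1 : ℕ) : ℤ) +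
            qK ^ (-(k + 1 : ℤ)) * qint ((n + 1 : ℕ) : ℤ) := by
        rw [qint, qint, qint, ← mul_div_assoc, ← mul_div_assoc, ← add_div, mul_sub, mul_sub,
          ← zpow_add₀ qK_ne_zero, ← zpow_add₀ qK_ne_zero, ← zpow_add₀ qK_ne_zero,
          ← zpow_add₀ qK_ne_zero]
        congr 1
        push_cast
        ring_nf
      rw [show n + 1 + (k + 1) = (n + 1 + k) + 1 by omega, qfact_succ (n + 1 + k),
        show (n + 1 + k) + 1 = n + 1 + (k + 1) by omega, key, map_add, map_mul, map_mul,
        algebraMap_qpow, algebraMap_qpow]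
      have hc' : algebraMap A K c * (qfact n * qfact (k + 1)) = qfact (n + 1 + k) := by
        rw [hc]; congr 1; omega
      rw [qfact_succ n, qfact_succ k] at *
      linear_combination (qK ^ ((n : ℤ) + 1) * qint ((k + 1 : ℕ) : ℤ)) * hd +
        (qK ^ (-(k + 1 : ℤ)) * qint ((n + 1 : ℕ) : ℤ)) * hc'

/-! ### The transition coefficients between the standard and the icanonical basis -/

/-- The coefficient of the `m`-th standard vector in `b⁽ⁿ⁾ η_l` only depends on `r = l - m` and
`c = (n - m) / 2`, and is this power of `q` times a Gaussian binomial in `q⁴`. -/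
def icoef {R : Type*} [CommRing R] (q : R) (r c : ℕ) : R :=
  q ^ (if Even r then c * (2 * c - 1) else c * (2 * c + 1)) * gauss (q ^ 4) (r / 2) c

lemma icoef_zero_right {R : Type*} [CommRing R] (q : R) (r : ℕ) : icoef q r 0 = 1 := by
  simp [icoef]

lemma map_icoef {R S : Type*} [CommRing R] [CommRing S] (f : R →+* S) (q : R) (r c : ℕ) :
    f (icoef q r c) = icoef (f q) r c := by
  rw [icoef, map_mul, map_pow, map_gauss, map_pow]
  rfl

section recurrence

variable {F : Type*} [Field F] {Q : F}

/-- The quantum integer `[z]` for the parameter `Q`. -/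
def qintOf (Q : F) (z : ℤ) : F := (Q ^ z - Q ^ (-z)) / (Q - Q⁻¹)

/-- The recurrence of `icanCoef_recurrence` for `l - m = 2 a + 2` and `n = m + 2 c + 1`. -/
lemma icoef_recurrence_even (hQ : Q ≠ 0) (m a c : ℕ) :
    qintOf Q (m + 2 * c + 2) * icoef Q (2 * a + 2) (c + 1) =
      qintOf Q m * icoef Q (2 * a + 3) (c + 1) +
        Q ^ (2 * (a : ℤ) - m + 1) * qintOf Q (2 * a + 2) * icoef Q (2 * a + 1) c := by
  have h := gauss_raise_both (Q ^ 4) a c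
  have e1 : Even (2 * a + 2) := ⟨a + 1, by ring⟩
  have e2 : ¬ Even (2 * a + 3) := by rw [Nat.not_even_iff_odd]; exact ⟨a + 1, by ring⟩
  have e3 : ¬ Even (2 * a + 1) := by rw [Nat.not_even_iff_odd]; exact ⟨a, by ring⟩
  simp only [icoef, e1, e2, e3, if_true, if_false, qintOf]
  rw [show (2 * a + 2) / 2 = a + 1 by omega, show (2 * a + 3) / 2 = a + 1 by omega,
    show (2 * a + 1) / 2 = a by omega,
    show (c + 1) * (2 * (c + 1) - 1) = c * (2 * c + 1) + 2 * c + 1 by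
      rw [show 2 * (c + 1) - 1 = 2 * c + 1 by omega]; ring,
    show (c + 1) * (2 * (c + 1) + 1) = c * (2 * c + 1) + 4 * c + 3 by ring]
  generalize gauss (Q ^ 4) (a + 1) (c + 1) = G at *
  generalize gauss (Q ^ 4) a c = G' at *
  have z1 : Q ^ ((m : ℤ) + 2 * c + 2) = Q ^ m * (Q ^ c) ^ 2 * Q ^ 2 := by
    rw [← pow_mul, ← pow_add, ← pow_add, ← zpow_natCast]; congr 1; push_cast; ring
  have z2 : Q ^ (2 * (a : ℤ) + 2) = (Q ^ a) ^ 2 * Q ^ 2 := by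
    rw [← pow_mul, ← pow_add, ← zpow_natCast]; congr 1; push_cast; ring
  have z3 : Q ^ (2 * (a : ℤ) - m + 1) = (Q ^ a) ^ 2 * Q * (Q ^ m)⁻¹ := by
    rw [← pow_mul, ← pow_succ, ← zpow_natCast, ← zpow_natCast, ← zpow_neg, ← zpow_add₀ hQ]
    congr 1; push_cast; ring
  rw [zpow_neg, zpow_neg, zpow_neg, z1, z2, z3, zpow_natCast]
  have p1 : Q ^ (c * (2 * c + 1) + 2 * c + 1) = Q ^ (c * (2 * c + 1)) * (Q ^ c) ^ 2 * Q := by ring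
  have p2 : Q ^ (c * (2 * c + 1) + 4 * c + 3) = Q ^ (c * (2 * c + 1)) * (Q ^ c) ^ 4 * Q ^ 3 := by
    ring
  have h' : (1 - (Q ^ c) ^ 4 * Q ^ 4) * G = (1 - (Q ^ a) ^ 4 * Q ^ 4) * G' := by
    convert h using 2 <;> ring
  rw [p1, p2]
  have hM : Q ^ m ≠ 0 := pow_ne_zero _ hQ
  have hC : Q ^ c ≠ 0 := pow_ne_zero _ hQ
  have hA : Q ^ a ≠ 0 := pow_ne_zero _ hQ
  generalize Q ^ (c * (2 * c + 1)) = S at *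
  generalize Q ^ m = M at *
  generalize Q ^ c = C at *
  generalize Q ^ a = α at *
  clear h z1 z2 z3 p1 p2
  rw [div_mul_eq_mul_div, div_mul_eq_mul_div, mul_div_assoc', div_mul_eq_mul_div, ← add_div]
  congr 1
  field_simp
  linear_combination -S * h'

/-- The recurrence of `icanCoef_recurrence` for `l - m = 2 a + 1` and `n = m + 2 c + 1`. -/
lemma icoef_recurrence_odd (hQ : Q ≠ 0) (m a c : ℕ) :
    qintOf Q (m + 2 * c + 2) * icoef Q (2 * a + 1) (c + 1) =
      qintOf Q m * icoef Q (2 * a + 2) (c + 1) +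
        Q ^ (2 * (a : ℤ) - m) * qintOf Q (2 * a + 1) * icoef Q (2 * a) c -
        qintOf Q (m + 2 * c + 1) * icoef Q (2 * a + 1) c := by
  have e1 : Even (2 * a + 2) := ⟨a + 1, by ring⟩
  have e2 : Even (2 * a) := ⟨a, by ring⟩
  have e3 : ¬ Even (2 * a + 1) := by rw [Nat.not_even_iff_odd]; exact ⟨a, by ring⟩
  simp only [icoef, e1, e2, e3, if_true, if_false, qintOf]
  rw [show (2 * a + 2) / 2 = a + 1 by omega, show (2 * a) / 2 = a by omega,
    show (2 * a + 1) / 2 = a by omega, gauss_succ_succ]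
  rcases Nat.lt_or_ge a c with hac | hac
  · rw [gauss_eq_zero_of_lt _ hac, gauss_eq_zero_of_lt _ (by omega : a < c + 1)]
    simp
  obtain ⟨d, rfl⟩ := Nat.exists_eq_add_of_le hac
  have h := gauss_raise_lower (Q ^ 4) c d
  obtain ⟨s, hs1, hs2, hs3, hs4⟩ : ∃ s, c * (2 * c - 1) = s ∧ c * (2 * c + 1) = s + 2 * c ∧
      (c + 1) * (2 * (c + 1) - 1) = s + 4 * c + 1 ∧
      (c + 1) * (2 * (c + 1) + 1) = s + 6 * c + 3 := by
    rcases c with _ | c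
    · exact ⟨0, by simp⟩
    · refine ⟨(c + 1) * (2 * c + 1), ?_, by ring, ?_, by ring⟩
      · rw [show 2 * (c + 1) - 1 = 2 * c + 1 by omega]
      · rw [show 2 * (c + 1 + 1) - 1 = 2 * c + 3 by omega]; ring
  rw [hs1, hs2, hs3, hs4]
  generalize gauss (Q ^ 4) (c + d) (c + 1) = G at *
  generalize gauss (Q ^ 4) (c + d) c = G' at *
  have z1 : Q ^ ((m : ℤ) + 2 * c + 2) = Q ^ m * (Q ^ c) ^ 2 * Q ^ 2 := by
    rw [← pow_mul, ← pow_add, ← pow_add, ← zpow_natCast]; congr 1; push_cast; ring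
  have z1' : Q ^ ((m : ℤ) + 2 * c + 1) = Q ^ m * (Q ^ c) ^ 2 * Q := by
    rw [← pow_mul, ← pow_add, ← pow_succ, ← zpow_natCast]; congr 1; push_cast; ring
  have z2 : Q ^ (2 * ((c + d : ℕ) : ℤ) + 1) = (Q ^ c) ^ 2 * (Q ^ d) ^ 2 * Q := by
    rw [← pow_mul, ← pow_mul, ← pow_add, ← pow_succ, ← zpow_natCast]; congr 1; push_cast; ring
  have z3 : Q ^ (2 * ((c + d : ℕ) : ℤ) - m) = (Q ^ c) ^ 2 * (Q ^ d) ^ 2 * (Q ^ m)⁻¹ := by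
    rw [← pow_mul, ← pow_mul, ← pow_add, ← zpow_natCast, ← zpow_natCast, ← zpow_neg,
      ← zpow_add₀ hQ]
    congr 1; push_cast; ring
  rw [zpow_neg, zpow_neg, zpow_neg, zpow_neg, z1, z1', z2, z3, zpow_natCast]
  have p1 : Q ^ (s + 2 * c) = Q ^ s * (Q ^ c) ^ 2 := by ring
  have p2 : Q ^ (s + 4 * c + 1) = Q ^ s * (Q ^ c) ^ 4 * Q := by ring
  have p3 : Q ^ (s + 6 * c + 3) = Q ^ s * (Q ^ c) ^ 6 * Q ^ 3 := by ring
  have p4 : (Q ^ 4) ^ (c + 1) = (Q ^ c) ^ 4 * Q ^ 4 := by ring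
  have h' : (1 - (Q ^ c) ^ 4 * Q ^ 4) * G = (1 - (Q ^ d) ^ 4) * G' := by
    convert h using 2 <;> ring
  rw [p1, p2, p3, p4]
  have hM : Q ^ m ≠ 0 := pow_ne_zero _ hQ
  have hC : Q ^ c ≠ 0 := pow_ne_zero _ hQ
  have hA : Q ^ d ≠ 0 := pow_ne_zero _ hQ
  generalize Q ^ s = S at *
  generalize Q ^ m = M at *
  generalize Q ^ c = C at *
  generalize Q ^ d = α at *
  clear h z1 z1' z2 z3 p1 p2 p3 p4 hs1 hs2 hs3 hs4
  simp only [div_mul_eq_mul_div, mul_div_assoc']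
  rw [← add_div, ← sub_div]
  congr 1
  field_simp
  linear_combination -(C ^ 4 * Q ^ 2 * S) * h'

end recurrence

/-- The coefficient of the `m`-th standard vector in `b⁽ⁿ⁾ η_l`. -/
def icanCoef {R : Type*} [CommRing R] (q : R) (l n m : ℕ) : R :=
  if m ≤ n ∧ Even (n - m) then icoef q (l - m) ((n - m) / 2) else 0

lemma icanCoef_of_eq {R : Type*} [CommRing R] (q : R) {l n m c : ℕ} (h : n = m + 2 * c) :
    icanCoef q l n m = icoef q (l - m) c := by
  subst h
  rw [icanCoef, if_pos ⟨by omega, by rw [Nat.add_sub_cancel_left]; exact even_two_mul c⟩,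
    Nat.add_sub_cancel_left, Nat.mul_div_cancel_left _ two_pos]

lemma icanCoef_of_not {R : Type*} [CommRing R] (q : R) {l n m : ℕ}
    (h : n < m ∨ n % 2 ≠ m % 2) : icanCoef q l n m = 0 := by
  rw [icanCoef, if_neg]
  rintro ⟨h1, h2⟩
  rw [Nat.even_iff] at h2
  omega

lemma icanCoef_self {R : Type*} [CommRing R] (q : R) (l n : ℕ) : icanCoef q l n n = 1 := by
  rw [icanCoef_of_eq q (c := 0) (by omega), icoef_zero_right]

lemma map_icanCoef {R S : Type*} [CommRing R] [CommRing S] (f : R →+* S) (q : R) (l n m : ℕ) :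
    f (icanCoef q l n m) = icanCoef (f q) l n m := by
  simp only [icanCoef, apply_ite f, map_zero, map_icoef]

lemma icanCoef_succ_self {R : Type*} [CommRing R] (q : R) {l m : ℕ} (hm : m ≤ l) :
    icanCoef q l (l + 1) m = 0 := by
  by_cases h : (l + 1) % 2 = m % 2
  · obtain ⟨c, hc⟩ : ∃ c, l + 1 = m + 2 * c := ⟨(l + 1 - m) / 2, by omega⟩
    rw [icanCoef_of_eq q hc, icoef, gauss_eq_zero_of_lt _ (by omega), mul_zero]
  · exact icanCoef_of_not q (Or.inr h)

/-- The coefficients satisfy the recurrence coming from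
`[n + 1] b⁽ⁿ⁺¹⁾ = b b⁽ⁿ⁾ - [n] b⁽ⁿ⁻¹⁾`, where the last term is present if `n ≡ l`. -/
lemma icanCoef_recurrence {F : Type*} [Field F] {Q : F} (hQ : Q ≠ 0) {l n m : ℕ} (hm : m ≤ l) :
    qintOf Q ((n + 1 : ℕ) : ℤ) * icanCoef Q l (n + 1) m =
      qintOf Q m * icanCoef Q l n (m - 1) +
        Q ^ ((l : ℤ) - 2 * m - 1) * qintOf Q ((l - m : ℕ) : ℤ) * icanCoef Q l n (m + 1) -
        (if n % 2 = l % 2 then qintOf Q n * icanCoef Q l (n - 1) m else 0) := by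
  have q0 : qintOf Q 0 = 0 := by simp [qintOf]
  by_cases hpar : (n + 1) % 2 = m % 2
  swap
  · rw [icanCoef_of_not Q (n := n + 1) (Or.inr hpar), icanCoef_of_not Q (m := m + 1) (by omega)]
    have h1 : qintOf Q m * icanCoef Q l n (m - 1) = 0 := by
      rcases m with _ | m
      · simp [q0]
      · rw [icanCoef_of_not Q (by omega), mul_zero]
    have h2 : qintOf Q n * icanCoef Q l (n - 1) m = 0 := by
      rcases n with _ | n
      · simp [q0]
      · rw [icanCoef_of_not Q (by omega), mul_zero]
    rw [h1, h2]
    simp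
  have h2 : n ≤ m → qintOf Q n * icanCoef Q l (n - 1) m = 0 := by
    intro h
    rcases n with _ | n
    · simp [q0]
    · rw [icanCoef_of_not Q (by omega), mul_zero]
  rcases Nat.lt_or_ge (n + 1) m with hlt | hge
  · rw [h2 (by omega), icanCoef_of_not Q (n := n + 1) (by omega),
      icanCoef_of_not Q (m := m + 1) (by omega), icanCoef_of_not Q (m := m - 1) (by omega)]
    simp
  obtain ⟨c, hc⟩ : ∃ c, n + 1 = m + 2 * c := ⟨(n + 1 - m) / 2, by omega⟩
  rcases c with _ | c
  · have hm' : m = n + 1 := by omega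
    subst hm'
    rw [h2 (by omega), icanCoef_self, icanCoef_of_not Q (m := n + 1 + 1) (by omega),
      Nat.add_sub_cancel, icanCoef_self]
    simp
  have hn1 : ((n + 1 : ℕ) : ℤ) = m + 2 * c + 2 := by omega
  have hn : (n : ℤ) = m + 2 * c + 1 := by omega
  have t1 : ∀ r, l - m = r → qintOf Q m * icanCoef Q l n (m - 1) =
      qintOf Q m * icoef Q (r + 1) (c + 1) := by
    intro r hr
    rcases m with _ | m
    · simp [q0]
    · rw [icanCoef_of_eq Q (c := c + 1) (by omega)]
      congr 2
      omega
  rw [hn1, icanCoef_of_eq Q hc, icanCoef_of_eq Q (m := m + 1) (c := c) (by omega)]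
  rcases Nat.even_or_odd' (l - m) with ⟨a, ha | ha⟩
  · rw [t1 _ ha, if_neg (by omega), sub_zero, ha]
    rcases a with _ | a
    · simp [q0, icoef]
    · rw [show l - (m + 1) = 2 * a + 1 by omega]
      have := icoef_recurrence_even hQ m a c
      rw [show (l : ℤ) - 2 * m - 1 = 2 * a - m + 1 by omega]
      push_cast
      exact this
  · rw [t1 _ ha, if_pos (by omega), ha, show l - (m + 1) = 2 * a by omega, hn,
      icanCoef_of_eq Q (c := c) (by omega : n - 1 = _), ha]
    have := icoef_recurrence_odd hQ m a c
    rw [show (l : ℤ) - 2 * m - 1 = 2 * a - m by omega]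
    push_cast
    exact this

lemma qintOf_qK_inv (z : ℤ) : qintOf qK⁻¹ z = qint z := by
  rw [qintOf, qint, inv_zpow', inv_zpow', neg_neg, inv_inv, ← neg_sub, ← neg_sub qK, neg_div_neg_eq]

/-! ### The integral form `V(l)` in coordinates -/

lemma repV_gen (l : ℕ) (g : Gen) : repV l (gen g) = opGen l g := by
  simp [repV, gen]

lemma rho_gen (g : Gen) : rho (gen g) = rhoGen g := by
  simp [rho, rhoHom, gen]

lemma opE_apply {l : ℕ} (f : ℕ → K) (n : Fin (l + 1)) :
    opE l (fun j => f j) n = qint ((l : ℤ) - n) * f (n + 1) := by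
  by_cases h : (n : ℕ) + 1 < l + 1
  · simp only [opE, LinearMap.coe_mk, AddHom.coe_mk, dif_pos h]
  · have : ((n : ℕ) : ℤ) = l := by have := n.2; omega
    simp [opE, this, qint_zero]

lemma opF_apply {l : ℕ} (f : ℕ → K) (n : Fin (l + 1)) :
    opF l (fun j => f j) n = qint (n : ℤ) * f (n - 1) := by
  by_cases h : 0 < (n : ℕ)
  · simp only [opF, LinearMap.coe_mk, AddHom.coe_mk, if_pos h]
  · have : (n : ℕ) = 0 := by omega
    simp [opF, this, qint_zero]

lemma opE_pow_apply {l : ℕ} (m : ℕ) (v : Fin (l + 1) → K) (n : Fin (l + 1)) :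
    (opE l ^ m) v n = if h : (n : ℕ) + m < l + 1 then
      qfact (l - n) / qfact (l - n - m) * v ⟨n + m, h⟩ else 0 := by
  induction m generalizing v with
  | zero =>
    rw [dif_pos (by have := n.2; omega)]
    simp [div_self (qfact_ne_zero _)]
  | succ m ih =>
    rw [pow_succ, Module.End.mul_apply, ih]
    by_cases h : (n : ℕ) + m < l + 1
    · by_cases h' : (n : ℕ) + (m + 1) < l + 1
      · have e1 : l - n - m = (l - n - (m + 1)) + 1 := by omega
        have e2 : (l : ℤ) - ((n : ℕ) + m : ℕ) = ((l - n - (m + 1) + 1 : ℕ) : ℤ) := by omega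
        rw [dif_pos h, dif_pos h', e1, qfact_succ]
        simp only [opE, LinearMap.coe_mk, AddHom.coe_mk]
        rw [dif_pos (by omega), e2]
        have := qint_natCast_ne_zero (Nat.succ_ne_zero (l - n - (m + 1)))
        have := qfact_ne_zero (l - n - (m + 1))
        simp only [Nat.succ_eq_add_one, add_assoc] at *
        field_simp
      · rw [dif_pos h, dif_neg h']
        simp only [opE, LinearMap.coe_mk, AddHom.coe_mk]
        rw [dif_neg (by omega), mul_zero]
    · rw [dif_neg h, dif_neg (by omega)]

lemma opF_pow_apply {l : ℕ} (m : ℕ) (v : Fin (l + 1) → K) (n : Fin (l + 1)) :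
    (opF l ^ m) v n = if m ≤ (n : ℕ) then
      qfact n / qfact (n - m) * v ⟨n - m, by omega⟩ else 0 := by
  induction m generalizing v with
  | zero => simp [div_self (qfact_ne_zero _)]
  | succ m ih =>
    rw [pow_succ, Module.End.mul_apply, ih]
    by_cases h : m ≤ (n : ℕ)
    · by_cases h' : m + 1 ≤ (n : ℕ)
      · have e1 : (n : ℕ) - m = (n - (m + 1)) + 1 := by omega
        have e2 : qfact (n - m) = qfact (n - (m + 1)) * qint ((n - m : ℕ) : ℤ) := by
          rw [e1, qfact_succ]
        rw [if_pos h, if_pos h']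
        simp only [opF, LinearMap.coe_mk, AddHom.coe_mk]
        rw [if_pos (by omega), e2]
        have := qint_natCast_ne_zero (show (n : ℕ) - m ≠ 0 by omega)
        have := qfact_ne_zero (n - (m + 1))
        simp only [Nat.sub_sub] at *
        field_simp
      · rw [if_pos h, if_neg h']
        simp only [opF, LinearMap.coe_mk, AddHom.coe_mk]
        rw [if_neg (by omega), mul_zero]
    · rw [if_neg h, if_neg (by omega)]

lemma exists_algebraMap_qfact_div {m n : ℕ} (h : m ≤ n) :
    ∃ c : A, (qfact m)⁻¹ * (qfact n / qfact (n - m)) = algebraMap A K c := by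
  obtain ⟨c, hc⟩ := exists_qbinom (n - m) m
  refine ⟨c, ?_⟩
  rw [Nat.sub_add_cancel h] at hc
  have := qfact_ne_zero m
  have := qfact_ne_zero (n - m)
  rw [← hc]
  field_simp

/-- The lattice of vectors with coordinates in `ℤ[q,q⁻¹]` is stable under `U`. -/
lemma repV_mem_lattice {l : ℕ} {u : Uq} (hu : u ∈ UZ) :
    ∀ v : Fin (l + 1) → K, (∀ n, v n ∈ (algebraMap A K).range) →
      ∀ n, repV l u v n ∈ (algebraMap A K).range := by
  induction hu using Algebra.adjoin_induction with
  | mem x hx =>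
    intro v hv n
    rcases hx with ((rfl | rfl) | ⟨m, rfl⟩) | ⟨m, rfl⟩
    · rw [repV_gen]
      exact Subring.mul_mem _ ⟨_, algebraMap_qpow _⟩ (hv n)
    · rw [repV_gen]
      exact Subring.mul_mem _ ⟨_, algebraMap_qpow _⟩ (hv n)
    · rw [divPow, map_smul, map_pow, repV_gen, LinearMap.smul_apply, Pi.smul_apply, opGen,
        opE_pow_apply]
      split_ifs with h
      · obtain ⟨c, hc⟩ := exists_algebraMap_qfact_div (m := m) (n := l - n) (by omega)
        rw [smul_eq_mul, ← mul_assoc, hc]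
        exact Subring.mul_mem _ ⟨c, rfl⟩ (hv _)
      · rw [smul_zero]
        exact Subring.zero_mem _
    · rw [divPow, map_smul, map_pow, repV_gen, LinearMap.smul_apply, Pi.smul_apply, opGen,
        opF_pow_apply]
      split_ifs with h
      · obtain ⟨c, hc⟩ := exists_algebraMap_qfact_div h
        rw [smul_eq_mul, ← mul_assoc, hc]
        exact Subring.mul_mem _ ⟨c, rfl⟩ (hv _)
      · rw [smul_zero]
        exact Subring.zero_mem _
  | algebraMap r =>
    intro v hv n
    rw [IsScalarTower.algebraMap_apply A K Uq, AlgHom.commutes]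
    exact Subring.mul_mem _ ⟨r, rfl⟩ (hv n)
  | add x y _ _ hx hy =>
    intro v hv n
    rw [map_add]
    exact Subring.add_mem _ (hx v hv n) (hy v hv n)
  | mul x y _ _ hx hy =>
    intro v hv n
    rw [map_mul]
    exact hx _ (hy v hv) n

lemma stdV_apply {l n : ℕ} (j : Fin (l + 1)) :
    (stdV l n : Fin (l + 1) → K) j = if (j : ℕ) = n then 1 else 0 := by
  change repV l (divPow .f n) (eta l) j = _
  rw [divPow, map_smul, map_pow, repV_gen, LinearMap.smul_apply, Pi.smul_apply, opGen,
    opF_pow_apply, eta]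
  by_cases h : (j : ℕ) = n
  · have h0 : (⟨(j : ℕ) - n, by omega⟩ : Fin (l + 1)) = 0 := by ext; simp [h]
    rw [if_pos h, if_pos h.ge, h0, Pi.single_eq_same, h, Nat.sub_self]
    rw [show qfact 0 = 1 from rfl, div_one, mul_one, smul_eq_mul,
      inv_mul_cancel₀ (qfact_ne_zero n)]
  · rw [if_neg h]
    split_ifs with h'
    · rw [Pi.single_eq_of_ne, mul_zero, smul_zero]
      intro h0
      have := congrArg Fin.val h0
      simp at this
      omega
    · rw [smul_zero]

lemma mem_VZ_iff {l : ℕ} {v : Fin (l + 1) → K} :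
    v ∈ VZ l ↔ ∀ n, v n ∈ (algebraMap A K).range := by
  constructor
  · rintro ⟨u, hu, rfl⟩
    refine repV_mem_lattice hu _ fun n => ?_
    by_cases h : n = 0
    · subst h; exact ⟨1, by simp [eta]⟩
    · exact ⟨0, by simp [eta, h]⟩
  · intro h
    choose a ha using h
    have : v = ((∑ n : Fin (l + 1), a n • stdV l n : VZ l) : Fin (l + 1) → K) := by
      funext j
      simp only [AddSubmonoidClass.coe_finsetSum, Finset.sum_apply, Submodule.coe_smul,
        Pi.smul_apply, stdV_apply]
      simp [Algebra.smul_def, ha, ← Fin.ext_iff]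
    rw [this]
    exact Submodule.coe_mem _

/-- Coordinates identify `V(l)` with the free module of rank `l + 1`. -/
def toVZ (l : ℕ) : (Fin (l + 1) → A) ≃ₗ[A] VZ l :=
  LinearEquiv.ofBijective
    { toFun := fun a => ⟨fun n => algebraMap A K (a n), mem_VZ_iff.mpr fun n => ⟨a n, rfl⟩⟩
      map_add' := fun a b => by ext n; simp
      map_smul' := fun c a => by ext n; simp [Algebra.smul_def] }
    (by
      constructor
      · intro a b h
        funext n
        exact algebraMap_A_inj (congrFun (congrArg Subtype.val h) n)
      · intro v
        choose a ha using mem_VZ_iff.mp v.2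
        exact ⟨a, Subtype.ext (funext ha)⟩)

@[simp] lemma toVZ_apply {l : ℕ} (a : Fin (l + 1) → A) (n : Fin (l + 1)) :
    (toVZ l a : Fin (l + 1) → K) n = algebraMap A K (a n) := rfl

lemma algebraMap_toVZ_symm {l : ℕ} (v : VZ l) (n : Fin (l + 1)) :
    algebraMap A K ((toVZ l).symm v n) = (v : Fin (l + 1) → K) n := by
  rw [← toVZ_apply, LinearEquiv.apply_symm_apply]

lemma stdV_eq_toVZ {l : ℕ} (n : Fin (l + 1)) : stdV l n = toVZ l (Pi.single n 1) := by
  ext j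
  rw [stdV_apply, toVZ_apply, Pi.single_apply]
  simp only [Fin.ext_iff]
  split_ifs <;> simp

lemma stdV_eq_zero {l n : ℕ} (h : l < n) : stdV l n = 0 := by
  ext j
  rw [stdV_apply, if_neg (by omega)]
  rfl

lemma stdV_zero (l : ℕ) : stdV l 0 = etaV l := by
  ext j
  change _ = (Pi.single 0 1 : Fin (l + 1) → K) j
  rw [stdV_apply, Pi.single_apply]
  simp only [Fin.ext_iff, Fin.val_zero]

/-- The action of `b` on `V(l)` as a linear map. -/
def bLin (l : ℕ) : VZ l →ₗ[A] VZ l where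
  toFun := actV bU
  map_add' v w := by ext n; simp [actV]
  map_smul' c v := by
    ext n
    simp only [actV, SetLike.val_smul, RingHom.id_apply]
    rw [← algebraMap_smul K c (v : Fin (l + 1) → K), map_smul, algebraMap_smul]

@[simp] lemma bLin_apply {l : ℕ} (v : VZ l) : bLin l v = actV bU v := rfl

lemma repV_bU_apply {l : ℕ} (f : ℕ → K) (n : Fin (l + 1)) :
    repV l (bU : Uq) (fun j => f j) n = qint (n : ℤ) * f (n - 1) +
      qK ^ (2 * (n : ℤ) + 1 - l) * qint ((l : ℤ) - n) * f (n + 1) := by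
  have : (bU : Uq) = gen .f + qK • (gen .kinv * gen .e) := by
    change gen .f + rho (gen .f) = _
    rw [rho_gen, rhoGen]
  rw [this, map_add, map_smul, map_mul, repV_gen, repV_gen, repV_gen, LinearMap.add_apply,
    LinearMap.smul_apply, Module.End.mul_apply, Pi.add_apply, Pi.smul_apply, opGen, opGen, opGen,
    opF_apply]
  simp only [opK, LinearMap.coe_mk, AddHom.coe_mk, opE_apply, smul_eq_mul]
  rw [← mul_assoc, ← mul_assoc, ← zpow_one_add₀ qK_ne_zero]
  congr 4
  ring

lemma VZ_smul_apply {l : ℕ} (c : A) (v : VZ l) (j : Fin (l + 1)) :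
    ((c • v : VZ l) : Fin (l + 1) → K) j = algebraMap A K c * (v : Fin (l + 1) → K) j := by
  rw [← Algebra.smul_def]
  rfl

lemma actV_bU_stdV {l n : ℕ} (hn : n ≤ l) :
    actV bU (stdV l n) = qnum (n + 1) • stdV l (n + 1) +
      (qpow (2 * (n : ℤ) - 1 - l) * qnum (l + 1 - n)) •
        (if n = 0 then 0 else stdV l (n - 1)) := by
  have h : ((stdV l n : VZ l) : Fin (l + 1) → K) =
      fun j : Fin (l + 1) => (fun i : ℕ => if i = n then (1 : K) else 0) j := by
    funext j
    rw [stdV_apply]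
  ext j
  change repV l (bU : Uq) (stdV l n) j = _
  rw [h, repV_bU_apply (fun i : ℕ => if i = n then (1 : K) else 0)]
  simp only [Submodule.coe_add, Pi.add_apply, VZ_smul_apply, stdV_apply, map_mul, algebraMap_qpow,
    algebraMap_qnum]
  congr 1
  · by_cases h1 : (j : ℕ) = n + 1
    · rw [if_pos (by omega), if_pos h1, h1]
    · rw [if_neg h1]
      by_cases h2 : (j : ℕ) = 0
      · simp [h2, qint_zero]
      · rw [if_neg (by omega), mul_zero, mul_zero]
  · by_cases h0 : n = 0
    · subst h0; simp
    · rw [if_neg h0, stdV_apply]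
      by_cases h1 : (j : ℕ) + 1 = n
      · rw [if_pos h1, if_pos (by omega)]
        congr 3
        · omega
        · omega
      · rw [if_neg h1, if_neg (by omega), mul_zero, mul_zero]

/-! ### The idivided powers -/

open Polynomial in
/-- The idivided powers satisfy `[n + 1] b⁽ⁿ⁺¹⁾ = b b⁽ⁿ⁾ - [n] b⁽ⁿ⁻¹⁾` if `n` has the parity of the
idivided powers, and `[n + 1] b⁽ⁿ⁺¹⁾ = b b⁽ⁿ⁾` otherwise. -/
lemma idivPow_recurrence (t n : ℕ) :
    C (qint ((n + 1 : ℕ) : ℤ)) * idivPow t (n + 1) = X * idivPow t n -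
      (if n % 2 = t % 2 then C (qint n) * idivPow t (n - 1) else 0) := by
  have hc : ∀ m : ℕ, C (qint ((m + 1 : ℕ) : ℤ)) * C (qfact (m + 1))⁻¹ =
      (C (qfact m)⁻¹ : K[X]) := by
    intro m
    rw [← C_mul, qfact_succ]
    congr 1
    have := qint_natCast_ne_zero (Nat.succ_ne_zero m)
    have := qfact_ne_zero m
    field_simp
  set p : ℕ → K[X] := fun k => X ^ 2 - C (qint k ^ 2) with hp
  set S : ℕ → K[X] := fun m => ∏ k ∈ Finset.Ico 1 m with k % 2 = t % 2, p k with hS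
  have step : ∀ m, 1 ≤ m → S (m + 1) = if m % 2 = t % 2 then p m * S m else S m := by
    intro m hm
    simp only [hS]
    rw [show Finset.Ico 1 (m + 1) = insert m (Finset.Ico 1 m) by ext i; simp; omega,
      Finset.filter_insert]
    split_ifs
    · rw [Finset.prod_insert (by simp)]
    · rfl
  have range_eq : ∀ m, 1 ≤ m → (∏ k ∈ Finset.range m with k % 2 = t % 2, p k) =
      if t % 2 = 0 then X ^ 2 * S m else S m := by
    intro m hm
    simp only [hS]
    rw [show Finset.range m = insert 0 (Finset.Ico 1 m) by ext i; simp; omega,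
      Finset.filter_insert]
    by_cases ht : t % 2 = 0
    · rw [if_pos (by omega), Finset.prod_insert (by simp), if_pos ht]
      simp [hp, qint_zero]
    · rw [if_neg (by omega), if_neg ht]
  have odd_eq : ∀ m, ¬ Even m → idivPow t m = C (qfact m)⁻¹ * X * S m := by
    intro m hm
    simp only [idivPow, hm, if_false, hS, hp]
  have even_eq : ∀ m, 1 ≤ m → Even m → idivPow t m =
      C (qfact m)⁻¹ * (if t % 2 = 0 then X ^ 2 * S m else S m) := by
    intro m h1 hm
    rw [← range_eq m h1]
    simp only [idivPow, hm, if_true, hp, mul_one]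
  rcases Nat.eq_zero_or_pos n with rfl | hn
  · rw [odd_eq (0 + 1) (by decide), ← mul_assoc, ← mul_assoc, hc]
    simp [idivPow, hS, qint_zero, qfact]
  have hc2 : C (qint n) * C (qfact n)⁻¹ = (C (qfact (n - 1))⁻¹ : K[X]) := by
    have := hc (n - 1)
    rwa [Nat.sub_add_cancel hn] at this
  have hpn : ∀ c : K[X], c * (X ^ 2 * S n) - c * (p n * S n) = c * C (qint n) * C (qint n) * S n := by
    intro c
    simp only [hp, map_pow]
    ring
  by_cases he : Even n
  · have h1 : ¬ Even (n + 1) := by simpa [Nat.even_add_one] using he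
    rw [odd_eq _ h1, even_eq n hn he, ← mul_assoc, ← mul_assoc, hc, step n hn]
    have he' := Nat.even_iff.mp he
    by_cases ht : t % 2 = 0
    · have h2 : ¬ Even (n - 1) := by rw [Nat.even_iff]; omega
      have h3 : S n = S (n - 1) := by
        have := step (n - 1) (by have := he.two_dvd; omega)
        rwa [if_neg (by omega), Nat.sub_add_cancel hn] at this
      rw [if_pos ht, if_pos (by omega), if_pos (by omega), odd_eq _ h2, ← h3, ← hc2]
      linear_combination -X * hpn (C (qfact n)⁻¹)
    · rw [if_neg ht, if_neg (by omega), if_neg (by omega)]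
      ring
  · have h1 : Even (n + 1) := by simpa [Nat.even_add_one] using he
    have he' : n % 2 = 1 := by rw [Nat.even_iff] at he; omega
    rw [odd_eq n he, even_eq (n + 1) (by omega) h1, ← mul_assoc, hc, step n hn]
    by_cases ht : t % 2 = 0
    · rw [if_pos ht, if_neg (by omega), if_neg (by omega)]
      ring
    · rw [if_neg ht, if_pos (by omega), if_pos (by omega)]
      have h2 : idivPow t (n - 1) = C (qfact (n - 1))⁻¹ * S n := by
        rcases Nat.lt_or_ge (n - 1) 1 with h | h
        · have : n = 1 := by omega
          subst this
          simp [idivPow, hS]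
        · have h3 : S n = S (n - 1) := by
            have := step (n - 1) h
            rwa [if_neg (by omega), Nat.sub_add_cancel hn] at this
          rw [even_eq _ h (by rw [Nat.even_iff]; omega), if_neg ht, h3]
      rw [h2, ← hc2]
      linear_combination - hpn (C (qfact n)⁻¹)

section iact

open Polynomial

lemma iact_add (l : ℕ) (u v : K[X]) : iact l (u + v) = iact l u + iact l v := by
  simp [iact]

lemma iact_sub (l : ℕ) (u v : K[X]) : iact l (u - v) = iact l u - iact l v := by
  simp [iact]

lemma iact_C_mul (l : ℕ) (c : K) (u : K[X]) : iact l (C c * u) = c • iact l u := by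
  simp [iact, Polynomial.C_mul']

lemma iact_X_mul (l : ℕ) (u : K[X]) : iact l (X * u) = repV l (bU : Uq) (iact l u) := by
  simp [iact]

lemma iact_one (l : ℕ) : iact l 1 = eta l := by
  simp [iact]

/-- The vector `b⁽ⁿ⁾ η_l` in coordinates: both sides satisfy the same recurrence in `n`. -/
lemma iact_idivPow (l n : ℕ) :
    iact l (idivPow l n) = fun j : Fin (l + 1) => icanCoef qK⁻¹ l n j := by
  induction n using Nat.strong_induction_on with
  | _ n ih =>
    rcases n with _ | n
    · rw [show idivPow l 0 = 1 by simp [idivPow, qfact], iact_one]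
      funext j
      by_cases h : j = 0
      · subst h; simp [eta, icanCoef_self]
      · have : (j : ℕ) ≠ 0 := fun h' => h (Fin.ext h')
        rw [icanCoef_of_not _ (by omega)]
        simp [eta, h]
    · have h0 := qint_natCast_ne_zero (Nat.succ_ne_zero n)
      have key := congrArg (iact l) (idivPow_recurrence l n)
      rw [iact_C_mul, iact_sub, iact_X_mul, ih n (by omega)] at key
      have h2 : iact l (if n % 2 = l % 2 then C (qint n) * idivPow l (n - 1) else 0) =
          fun j : Fin (l + 1) =>
            if n % 2 = l % 2 then qint n * icanCoef qK⁻¹ l (n - 1) j else 0 := by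
        split_ifs with hpar
        · rcases n with _ | n
          · rw [iact_C_mul]
            simp only [Nat.cast_zero, qint_zero, zero_smul, zero_mul]
            rfl
          · rw [iact_C_mul, ih _ (by omega)]
            rfl
        · simp only [iact, map_zero, LinearMap.zero_apply]
          rfl
      rw [h2] at key
      funext j
      refine mul_left_cancel₀ h0 ?_
      have kj := congrFun key j
      rw [Pi.smul_apply, smul_eq_mul, Pi.sub_apply,
        repV_bU_apply (fun i => icanCoef qK⁻¹ l n i)] at kj
      have hrec := icanCoef_recurrence (Q := qK⁻¹) (inv_ne_zero qK_ne_zero) (n := n)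
        (show (j : ℕ) ≤ l by omega)
      simp only [qintOf_qK_inv] at hrec
      rw [Nat.succ_eq_add_one, kj, hrec, inv_zpow', Nat.cast_sub (show (j : ℕ) ≤ l by omega)]
      congr 5
      ring

end iact

/-! ### The icanonical basis and the ibar involution -/

/-- The vector `b⁽ⁿ⁾ η_l`, as an element of `V(l)`. -/
def icV (l n : ℕ) : VZ l := toVZ l fun j => icanCoef (qpow (-1)) l n j

lemma icV_coe (l n : ℕ) : (icV l n : Fin (l + 1) → K) = iact l (idivPow l n) := by
  rw [iact_idivPow]
  funext j
  rw [icV, toVZ_apply, map_icanCoef, algebraMap_qpow, zpow_neg_one]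

lemma icV_zero (l : ℕ) : icV l 0 = etaV l := by
  ext j
  rw [icV_coe, show idivPow l 0 = 1 by simp [idivPow, qfact], iact_one]
  rfl

lemma icV_succ_self (l : ℕ) : icV l (l + 1) = 0 := by
  rw [icV]
  have : (fun j : Fin (l + 1) => icanCoef (qpow (-1)) l (l + 1) j) = 0 :=
    funext fun j => icanCoef_succ_self _ (by omega)
  rw [this, map_zero]

lemma actV_bU_icV (l n : ℕ) :
    actV bU (icV l n) = qnum (n + 1) • icV l (n + 1) +
      if n % 2 = l % 2 then qnum n • icV l (n - 1) else 0 := by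
  ext j
  have h := congrArg (fun u => iact l u j) (idivPow_recurrence l n)
  simp only [iact_C_mul, iact_sub, iact_X_mul] at h
  change repV l (bU : Uq) (icV l n) j = _
  rw [Submodule.coe_add, Pi.add_apply, VZ_smul_apply, icV_coe, icV_coe, algebraMap_qnum]
  rw [Pi.smul_apply, smul_eq_mul, Pi.sub_apply] at h
  rw [h, sub_add]
  split_ifs
  · rw [iact_C_mul, VZ_smul_apply, icV_coe, algebraMap_qnum]
    simp
  · simp [iact]

/-- The transition matrix from the standard to the icanonical basis. -/
def icanMatrix (l : ℕ) : Matrix (Fin (l + 1)) (Fin (l + 1)) A :=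
  Matrix.of fun m n => icanCoef (qpow (-1)) l n m

lemma det_icanMatrix (l : ℕ) : (icanMatrix l).det = 1 := by
  rw [Matrix.det_of_isUpperTriangular]
  · exact Finset.prod_eq_one fun i _ => icanCoef_self _ _ _
  · intro i j hij
    exact icanCoef_of_not _ (Or.inl hij)

/-- The icanonical basis of `V(l)`. -/
def icanBasis (l : ℕ) : Module.Basis (Fin (l + 1)) A (VZ l) :=
  Module.Basis.ofEquivFun (((Matrix.toLin'OfInv
    (Matrix.nonsing_inv_mul (icanMatrix l) (by rw [det_icanMatrix]; exact isUnit_one))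
    (Matrix.mul_nonsing_inv (icanMatrix l) (by rw [det_icanMatrix]; exact isUnit_one))).trans
      (toVZ l)).symm)

lemma icanBasis_apply {l : ℕ} (n : Fin (l + 1)) : icanBasis l n = icV l n := by
  rw [icanBasis, Module.Basis.coe_ofEquivFun]
  simp only [LinearEquiv.symm_symm, LinearEquiv.trans_apply, icV]
  congr 1
  funext j
  simp [icanMatrix]

/-- The ibar involution of `V(l)`, the anti-linear map that fixes the icanonical basis. -/
def ibar (l : ℕ) : VZ l →ₛₗ[barA] VZ l where
  toFun v := ∑ n, barA ((icanBasis l).repr v n) • icanBasis l n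
  map_add' v w := by simp [add_smul, Finset.sum_add_distrib]
  map_smul' c v := by simp [Finset.smul_sum, smul_smul]

lemma ibar_icV {l n : ℕ} (hn : n ≤ l) : ibar l (icV l n) = icV l n := by
  have := icanBasis_apply (⟨n, by omega⟩ : Fin (l + 1))
  rw [← this]
  simp [ibar, Finsupp.single_apply]

lemma isIBar_ibar (l : ℕ) : IsIBar l (ibar l) := by
  refine ⟨by rw [← icV_zero, ibar_icV (Nat.zero_le l)], fun v => ?_⟩
  have : (ibar l).comp (bLin l) = (bLin l).comp (ibar l) := by
    refine (icanBasis l).ext fun n => ?_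
    have hn : (n : ℕ) ≤ l := by omega
    rw [LinearMap.comp_apply, LinearMap.comp_apply, icanBasis_apply, ibar_icV hn, bLin_apply,
      actV_bU_icV, map_add, map_smulₛₗ, barA_qnum]
    congr 1
    · rcases Nat.lt_or_ge n l with h | h
      · rw [ibar_icV (by omega)]
      · rw [show (n : ℕ) = l by omega, icV_succ_self, map_zero]
    · split_ifs
      · rw [map_smulₛₗ, ibar_icV (by omega), barA_qnum]
      · rw [map_zero]
  exact LinearMap.congr_fun this v

/-- An ibar involution fixes the icanonical basis: up to the factor `[n + 1]`, each vector is obtained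
from the preceding ones by `b`. -/
lemma IsIBar.icV_fixed {l : ℕ} {β : VZ l →ₛₗ[barA] VZ l} (h : IsIBar l β) (n : ℕ) :
    β (icV l n) = icV l n := by
  induction n using Nat.strong_induction_on with
  | _ n ih =>
    rcases n with _ | n
    · rw [icV_zero, h.1]
    · have h1 := h.2 (icV l n)
      rw [ih n (by omega), actV_bU_icV, map_add, map_smulₛₗ, barA_qnum] at h1
      have h2 : β (if n % 2 = l % 2 then qnum n • icV l (n - 1) else 0) =
          if n % 2 = l % 2 then qnum n • icV l (n - 1) else 0 := by
        split_ifs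
        · rw [map_smulₛₗ, ih _ (by omega), barA_qnum]
        · exact map_zero β
      rw [h2] at h1
      have h3 := add_right_cancel h1
      refine smul_right_injective _ (qnum_ne_zero (Nat.succ_ne_zero n)) h3

lemma IsIBar.eq_ibar {l : ℕ} {β : VZ l →ₛₗ[barA] VZ l} (h : IsIBar l β) : β = ibar l := by
  refine (icanBasis l).ext fun n => ?_
  rw [icanBasis_apply, h.icV_fixed, (isIBar_ibar l).icV_fixed]

lemma ibar_ibar {l : ℕ} (v : VZ l) : ibar l (ibar l v) = v := by
  conv_rhs => rw [← (icanBasis l).sum_repr v]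
  conv_lhs => rw [← (icanBasis l).sum_repr v]
  rw [map_sum, map_sum]
  refine Finset.sum_congr rfl fun n _ => ?_
  rw [map_smulₛₗ, map_smulₛₗ, icanBasis_apply, (isIBar_ibar l).icV_fixed,
    (isIBar_ibar l).icV_fixed, barA_barA]

/-- The basis of `V(l)` formed by the ibar conjugates of the standard basis vectors. -/
def ibarStdBasis (l : ℕ) : Module.Basis (Fin (l + 1)) A (VZ l) :=
  Module.Basis.ofEquivFun
    { toFun := fun v n => barA ((toVZ l).symm (ibar l v) n)
      invFun := fun a => ibar l (toVZ l fun n => barA (a n))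
      map_add' := fun v w => by ext n; simp
      map_smul' := fun c v => by funext n; simp
      left_inv := fun v => by simp [ibar_ibar]
      right_inv := fun a => by ext n; simp [ibar_ibar] }

lemma ibarStdBasis_apply {l : ℕ} (n : Fin (l + 1)) :
    ibarStdBasis l n = ibar l (stdV l n) := by
  rw [ibarStdBasis, Module.Basis.coe_ofEquivFun, stdV_eq_toVZ]
  change ibar l (toVZ l fun m => barA ((Pi.single n 1 : Fin (l + 1) → A) m)) = _
  congr 2
  funext m
  simp only [Pi.single_apply]
  split_ifs <;> simp

lemma icV_eq_sum_ibar_stdV {l n : ℕ} :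
    icV l n = ∑ m : Fin (l + 1), icanCoef (qpow 1) l n m • ibar l (stdV l m) := by
  have h : icV l n = ∑ m : Fin (l + 1), icanCoef (qpow (-1)) l n m • stdV l m := by
    have h1 : (fun j : Fin (l + 1) => icanCoef (qpow (-1)) l n j) =
        ∑ m : Fin (l + 1), icanCoef (qpow (-1)) l n m • (Pi.single m 1 : Fin (l + 1) → A) := by
      funext j
      simp [Pi.single_apply]
    rw [icV, h1, map_sum]
    simp only [map_smul, stdV_eq_toVZ]
  conv_lhs => rw [← (isIBar_ibar l).icV_fixed, h]
  rw [map_sum]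
  refine Finset.sum_congr rfl fun m _ => ?_
  rw [map_smulₛₗ, map_icanCoef, barA_qpow, neg_neg]

/-- The action of `b` on the ibar conjugates of the standard basis. -/
lemma actV_bU_ibar_stdV {l n : ℕ} (hn : n ≤ l) :
    actV bU (ibar l (stdV l n)) = qnum (n + 1) • ibar l (stdV l (n + 1)) +
      (qpow ((l : ℤ) + 1 - 2 * n) * qnum (l + 1 - n)) •
        (if n = 0 then 0 else ibar l (stdV l (n - 1))) := by
  rw [← (isIBar_ibar l).2, actV_bU_stdV hn, map_add, map_smulₛₗ, map_smulₛₗ, map_mul, barA_qnum,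
    barA_qnum, barA_qpow, apply_ite (ibar l), map_zero]
  congr 4
  ring

/-! ### The contravariant form -/

/-- The square norm of the `n`-th standard basis vector. -/
def stdNorm (l n : ℕ) : A := gauss (qpow (-2)) l n

lemma stdNorm_succ {l n : ℕ} (hn : n ≤ l) :
    qnum (n + 1) * stdNorm l (n + 1) = qpow (2 * (n : ℤ) + 1 - l) * qnum (l - n) * stdNorm l n := by
  obtain ⟨d, rfl⟩ := Nat.exists_eq_add_of_le hn
  have h := gauss_raise_lower (qpow (-2)) n d
  have e : ∀ k : ℕ, 1 - qpow (-2) ^ k = qpow (-(k : ℤ)) * (qnum k * (qpow 1 - qpow (-1))) := by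
    intro k
    rw [qnum_mul_sub, qpow_pow, mul_sub, ← qpow_add, ← qpow_add, neg_add_cancel, qpow_zero]
    congr 2
    ring
  rw [e, e] at h
  have hne : qpow 1 - qpow (-1) ≠ 0 := by
    intro h0
    refine qK_sub_inv_ne_zero ?_
    have := congrArg (algebraMap A K) h0
    rwa [map_sub, algebraMap_qpow, algebraMap_qpow, map_zero, zpow_one, zpow_neg_one] at this
  refine mul_left_cancel₀ (mul_ne_zero (qpow_ne_zero (-((n + 1 : ℕ) : ℤ))) hne) ?_
  have e2 : qpow (-((n + 1 : ℕ) : ℤ)) * qpow (2 * (n : ℤ) + 1 - ((n + d : ℕ) : ℤ)) =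
      qpow (-(d : ℤ)) := by
    rw [← qpow_add]; congr 1; push_cast; ring
  rw [Nat.add_sub_cancel_left, stdNorm, stdNorm]
  linear_combination h - (qpow 1 - qpow (-1)) * qnum d * gauss (qpow (-2)) (n + d) n * e2

lemma stdNorm_succ' {l n : ℕ} (hn : n ≤ l) :
    qint ((n + 1 : ℕ) : ℤ) * algebraMap A K (stdNorm l (n + 1)) =
      qK ^ (2 * (n : ℤ) + 1 - l) * qint ((l : ℤ) - n) * algebraMap A K (stdNorm l n) := by
  have h := congrArg (algebraMap A K) (stdNorm_succ hn)
  rw [map_mul, map_mul, map_mul, algebraMap_qnum, algebraMap_qnum, algebraMap_qpow,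
    Nat.cast_sub hn] at h
  exact h

/-- The contravariant form over `ℚ(q)`. -/
def formK (l : ℕ) (v w : Fin (l + 1) → K) : K :=
  ∑ n : Fin (l + 1), algebraMap A K (stdNorm l n) * (v n * w n)

lemma formK_opE (l : ℕ) (v w : Fin (l + 1) → K) :
    formK l (opE l v) w = formK l v (qK⁻¹ • opF l (opK l 1 w)) := by
  rw [formK, formK, Fin.sum_univ_castSucc, Fin.sum_univ_succ]
  have h1 : opE l v (Fin.last l) = 0 := by simp [opE]
  have h2 : (qK⁻¹ • opF l (opK l 1 w)) 0 = 0 := by simp [opF]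
  rw [h1, h2, zero_mul, mul_zero, mul_zero, mul_zero, add_zero, zero_add]
  refine Finset.sum_congr rfl fun n _ => ?_
  have hn : (n : ℕ) < l := n.2
  have e1 : opE l v n.castSucc = qint ((l : ℤ) - n) * v n.succ := by
    simp only [opE, LinearMap.coe_mk, AddHom.coe_mk, Fin.val_castSucc]
    rw [dif_pos (by omega)]
    rfl
  have e2 : opF l (opK l 1 w) n.succ =
      qint ((n + 1 : ℕ) : ℤ) * (qK ^ (1 * ((l : ℤ) - 2 * n)) * w n.castSucc) := by
    simp only [opF, LinearMap.coe_mk, AddHom.coe_mk, Fin.val_succ]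
    rw [if_pos (by omega)]
    rfl
  have h := stdNorm_succ' hn.le
  have e3 : qK⁻¹ * qK ^ (1 * ((l : ℤ) - 2 * n)) * qK ^ (2 * (n : ℤ) + 1 - l) = 1 := by
    rw [← zpow_neg_one, ← zpow_add₀ qK_ne_zero, ← zpow_add₀ qK_ne_zero, ← zpow_zero qK]
    congr 1
    ring
  rw [e1, Pi.smul_apply, e2, Fin.val_castSucc, Fin.val_succ, smul_eq_mul]
  linear_combination (-(v n.succ * w n.castSucc * (qK⁻¹ * qK ^ (1 * ((l : ℤ) - 2 * n))))) * h -
    (v n.succ * w n.castSucc * qint ((l : ℤ) - n) * algebraMap A K (stdNorm l n)) * e3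

lemma formK_comm (l : ℕ) (v w : Fin (l + 1) → K) : formK l v w = formK l w v :=
  Finset.sum_congr rfl fun n _ => by rw [mul_comm (v n)]

lemma formK_opK (l : ℕ) (ε : ℤ) (v w : Fin (l + 1) → K) :
    formK l (opK l ε v) w = formK l v (opK l ε w) :=
  Finset.sum_congr rfl fun n _ => by simp only [opK, LinearMap.coe_mk, AddHom.coe_mk]; ring

lemma formK_add_left (l : ℕ) (v v' w : Fin (l + 1) → K) :
    formK l (v + v') w = formK l v w + formK l v' w := by
  simp only [formK, ← Finset.sum_add_distrib, Pi.add_apply]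
  exact Finset.sum_congr rfl fun n _ => by ring

lemma formK_smul_left (l : ℕ) (c : K) (v w : Fin (l + 1) → K) :
    formK l (c • v) w = c * formK l v w := by
  simp only [formK, Finset.mul_sum, Pi.smul_apply, smul_eq_mul]
  exact Finset.sum_congr rfl fun n _ => by ring

lemma formK_smul_right (l : ℕ) (c : K) (v w : Fin (l + 1) → K) :
    formK l v (c • w) = c * formK l v w := by
  rw [formK_comm, formK_smul_left, formK_comm]

lemma formK_add_right (l : ℕ) (v w w' : Fin (l + 1) → K) :
    formK l v (w + w') = formK l v w + formK l v w' := by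
  rw [formK_comm, formK_add_left, formK_comm, formK_comm l w']

/-- It suffices to check contravariance on the generators; there it is the recurrence for the square
norms. -/
lemma formK_contravariant (l : ℕ) (u : Uq) : ∀ v w : Fin (l + 1) → K,
    formK l (repV l u v) w = formK l v (repV l (rho u) w) := by
  obtain ⟨x, rfl⟩ := RingQuot.mkAlgHom_surjective K QRel u
  induction x using FreeAlgebra.induction with
  | grade0 r =>
    intro v w
    have : rho (algebraMap K Uq r) = algebraMap K Uq r := by rw [rho, AlgHom.commutes]; rfl
    rw [AlgHom.commutes, this, AlgHom.commutes, Module.algebraMap_end_apply,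
      Module.algebraMap_end_apply, formK_smul_left, formK_smul_right]
  | grade1 g =>
    intro v w
    change formK l (repV l (gen g) v) w = formK l v (repV l (rho (gen g)) w)
    rw [rho_gen, repV_gen]
    cases g with
    | e => simpa [rhoGen, repV_gen, opGen] using formK_opE l v w
    | f =>
      have h := formK_opE l w (opK l (-1) v)
      have e : opK l 1 (opK l (-1) v) = v := by
        funext n
        simp only [opK, LinearMap.coe_mk, AddHom.coe_mk, ← mul_assoc]
        rw [← zpow_add₀ qK_ne_zero]
        simp
      rw [e, formK_smul_right] at h
      simp only [rhoGen, map_smul, map_mul, repV_gen, opGen, LinearMap.smul_apply,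
        Module.End.mul_apply]
      rw [formK_smul_right, ← formK_opK, formK_comm l (opK l (-1) v), h, ← mul_assoc,
        mul_inv_cancel₀ qK_ne_zero, one_mul, formK_comm]
    | k => simpa [rhoGen, repV_gen, opGen] using formK_opK l 1 v w
    | kinv => simpa [rhoGen, repV_gen, opGen] using formK_opK l (-1) v w
  | mul x y hx hy =>
    intro v w
    have : rho (RingQuot.mkAlgHom K QRel x * RingQuot.mkAlgHom K QRel y) =
        rho (RingQuot.mkAlgHom K QRel y) * rho (RingQuot.mkAlgHom K QRel x) := by simp [rho]
    rw [map_mul, this, map_mul, map_mul, Module.End.mul_apply, Module.End.mul_apply, hx, hy]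
  | add x y hx hy =>
    intro v w
    have : rho (RingQuot.mkAlgHom K QRel x + RingQuot.mkAlgHom K QRel y) =
        rho (RingQuot.mkAlgHom K QRel x) + rho (RingQuot.mkAlgHom K QRel y) := by simp [rho]
    rw [map_add, this, map_add, map_add, LinearMap.add_apply, LinearMap.add_apply,
      formK_add_left, formK_add_right, hx, hy]

/-- The contravariant form on `V(l)`. -/
def contraForm (l : ℕ) : LinearMap.BilinForm A (VZ l) :=
  LinearMap.mk₂ A
    (fun v w => ∑ n : Fin (l + 1), stdNorm l n * ((toVZ l).symm v n * (toVZ l).symm w n))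
    (fun v v' w => by
      simp only [map_add, Pi.add_apply, ← Finset.sum_add_distrib]
      exact Finset.sum_congr rfl fun n _ => by ring)
    (fun c v w => by
      simp only [map_smul, Pi.smul_apply, smul_eq_mul, Finset.mul_sum]
      exact Finset.sum_congr rfl fun n _ => by ring)
    (fun v w w' => by
      simp only [map_add, Pi.add_apply, ← Finset.sum_add_distrib]
      exact Finset.sum_congr rfl fun n _ => by ring)
    (fun c v w => by
      simp only [map_smul, Pi.smul_apply, smul_eq_mul, Finset.mul_sum]
      exact Finset.sum_congr rfl fun n _ => by ring)

lemma algebraMap_contraForm {l : ℕ} (v w : VZ l) :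
    algebraMap A K (contraForm l v w) = formK l v w := by
  simp only [contraForm, LinearMap.mk₂_apply, map_sum, map_mul, algebraMap_toVZ_symm, formK]

lemma contraForm_etaV_left {l : ℕ} (w : VZ l) :
    contraForm l (etaV l) w = (toVZ l).symm w 0 := by
  have h : etaV l = toVZ l (Pi.single 0 1) := by
    rw [← stdV_zero]
    exact stdV_eq_toVZ 0
  rw [contraForm, LinearMap.mk₂_apply, h, LinearEquiv.symm_apply_apply]
  rw [Finset.sum_eq_single 0]
  · simp [stdNorm]
  · intro n _ hn
    simp [hn]
  · simp

lemma isContraForm_contraForm (l : ℕ) : IsContraForm l (contraForm l) := by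
  refine ⟨fun v w => ?_, ?_, fun u v w => ?_⟩
  · apply algebraMap_A_inj
    rw [algebraMap_contraForm, algebraMap_contraForm, formK_comm]
  · rw [contraForm_etaV_left]
    apply algebraMap_A_inj
    rw [algebraMap_toVZ_symm]
    simp [etaV, eta]
  · apply algebraMap_A_inj
    rw [algebraMap_contraForm, algebraMap_contraForm]
    exact formK_contravariant l u v w

lemma actV_rhoZ_divPow_f_etaV {l n : ℕ} (hn : n ≠ 0) :
    actV (rhoZ ⟨divPow .f n, divPow_f_mem_UZ n⟩) (etaV l) = 0 := by
  obtain ⟨n, rfl⟩ := Nat.exists_eq_succ_of_ne_zero hn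
  apply Subtype.ext
  change repV l (rho ((qfact (n + 1))⁻¹ • gen .f ^ (n + 1))) (eta l) = 0
  have h : rho ((qfact (n + 1))⁻¹ • gen .f ^ (n + 1)) =
      (qfact (n + 1))⁻¹ • (rho (gen .f) ^ n * rho (gen .f)) := by
    simp [rho, pow_succ']
  have he : opE l (eta l) = 0 := by
    funext j
    simp only [opE, LinearMap.coe_mk, AddHom.coe_mk, eta]
    split_ifs
    · rw [Pi.single_eq_of_ne, mul_zero]
      · rfl
      · intro h; simpa using congrArg Fin.val h
    · rfl
  rw [h, map_smul, map_mul, LinearMap.smul_apply, Module.End.mul_apply, rho_gen, rhoGen, map_smul,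
    map_mul, LinearMap.smul_apply, Module.End.mul_apply, repV_gen _ Gen.e, opGen, he, map_zero,
    smul_zero, map_zero, smul_zero]

lemma IsContraForm.eq_contraForm {l : ℕ} {B : LinearMap.BilinForm A (VZ l)}
    (h : IsContraForm l B) : B = contraForm l := by
  -- both forms agree on pairs `(η_l, w)`, as `η_l` is orthogonal to the other weight spaces
  have h0 : ∀ {B : LinearMap.BilinForm A (VZ l)}, IsContraForm l B → ∀ w,
      B (etaV l) w = (toVZ l).symm w 0 := by
    intro B h w
    have hw : w = ∑ n : Fin (l + 1), (toVZ l).symm w n • stdV l n := by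
      apply (toVZ l).symm.injective
      funext j
      simp [stdV_eq_toVZ, Pi.single_apply]
    conv_lhs => rw [hw]
    rw [map_sum, Finset.sum_eq_single 0]
    · rw [map_smul, Fin.val_zero, stdV_zero, h.2.1, smul_eq_mul, mul_one]
    · intro n _ hn
      have hn' : (n : ℕ) ≠ 0 := fun h' => hn (Fin.ext h')
      rw [map_smul, h.1, stdV, h.2.2, actV_rhoZ_divPow_f_etaV hn', map_zero, smul_zero]
    · simp
  refine LinearMap.ext fun v => LinearMap.ext fun w => ?_
  obtain ⟨u, hu, hv⟩ := v.2
  have : v = actV ⟨u, hu⟩ (etaV l) := Subtype.ext hv.symm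
  rw [this, h.2.2, (isContraForm_contraForm l).2.2, h0 h, h0 (isContraForm_contraForm l)]

lemma rhoZ_bU : rhoZ bU = bU := by
  have hq := qK_ne_zero
  apply Subtype.ext
  change rho (gen .f + rho (gen .f)) = gen .f + rho (gen .f)
  have h : rho (gen .f + rho (gen .f)) = rho (gen .f) + rho (rho (gen .f)) := by simp [rho]
  have h2 : rho (qK • (gen .kinv * gen .e)) = qK • (rho (gen .e) * rho (gen .kinv)) := by
    simp [rho]
  rw [h, rho_gen, add_comm]
  congr 1
  rw [rhoGen, h2, rho_gen, rho_gen, rhoGen, rhoGen, smul_mul_assoc, smul_smul,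
    mul_inv_cancel₀ hq, one_smul, mul_assoc, gen_k_kinv, mul_one]

/-! ### Signed permutations -/

lemma perm_apply_inv (g : Equiv.Perm ℤ) (z : ℤ) : g (g⁻¹ z) = z := by
  rw [← Equiv.Perm.mul_apply, mul_inv_cancel, Equiv.Perm.one_apply]

lemma perm_inv_apply (g : Equiv.Perm ℤ) (z : ℤ) : g⁻¹ (g z) = z := by
  rw [← Equiv.Perm.mul_apply, inv_mul_cancel, Equiv.Perm.one_apply]

/-- Signed permutations of `x₁, …, x_l`. -/
structure IsSigned (l : ℕ) (g : Equiv.Perm ℤ) : Prop where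
  map_neg : ∀ z, g (-z) = -g z
  fixed : ∀ z : ℤ, z < -l ∨ l < z → g z = z

namespace IsSigned

variable {l : ℕ} {g h : Equiv.Perm ℤ}

lemma one : IsSigned l 1 := ⟨fun _ => rfl, fun _ _ => rfl⟩

lemma mul (hg : IsSigned l g) (hh : IsSigned l h) : IsSigned l (g * h) :=
  ⟨fun z => by rw [Equiv.Perm.mul_apply, hh.map_neg, hg.map_neg, Equiv.Perm.mul_apply],
    fun z hz => by rw [Equiv.Perm.mul_apply, hh.fixed z hz, hg.fixed z hz]⟩

lemma inv (hg : IsSigned l g) : IsSigned l g⁻¹ :=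
  ⟨fun z => by rw [Equiv.Perm.inv_eq_iff_eq, hg.map_neg, perm_apply_inv],
    fun z hz => by rw [Equiv.Perm.inv_eq_iff_eq, hg.fixed z hz]⟩

lemma apply_zero (hg : IsSigned l g) : g 0 = 0 := by
  have := hg.map_neg 0
  rw [neg_zero] at this
  omega

lemma ne_zero (hg : IsSigned l g) {z : ℤ} (hz : z ≠ 0) : g z ≠ 0 := fun h =>
  hz (g.injective (h.trans hg.apply_zero.symm))

lemma mem_range (hg : IsSigned l g) {z : ℤ} (h1 : -l ≤ z) (h2 : z ≤ l) :
    -l ≤ g z ∧ g z ≤ l := by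
  by_contra hc
  have h3 := hg.fixed (g z) (by omega)
  have := g.injective h3
  omega

lemma ext (hg : IsSigned l g) (hh : IsSigned l h) (e : ∀ z : ℤ, 1 ≤ z → z ≤ l → g z = h z) :
    g = h := by
  ext z
  by_cases hz : z < -l ∨ l < z
  · rw [hg.fixed z hz, hh.fixed z hz]
  · rcases lt_trichotomy z 0 with h0 | h0 | h0
    · have := e (-z) (by omega) (by omega)
      rw [hg.map_neg, hh.map_neg] at this
      omega
    · rw [h0, hg.apply_zero, hh.apply_zero]
    · exact e z (by omega) (by omega)

end IsSigned

/-- The first entry of the pair `(a, b)` such that `x_b - x_a` is the simple root of the node. -/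
abbrev lo {l : ℕ} (i : Node l) : ℤ := i.1

/-- The second entry of the pair `(a, b)` such that `x_b - x_a` is the simple root of the node. -/
def hi {l : ℕ} (i : Node l) : ℤ := if i.1 = -1 then 2 else i.1 + 1

lemma lo_hi_cases {l : ℕ} (i : Node l) :
    (lo i = -1 ∧ hi i = 2 ∧ 2 ≤ l) ∨ (1 ≤ lo i ∧ hi i = lo i + 1 ∧ lo i < l) := by
  rcases i with ⟨i, h | h⟩
  · left; simp [hi, h.1, h.2]
  · right; simp only [hi]; rw [if_neg (by omega)]; exact ⟨h.1, rfl, h.2⟩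

lemma swap_mul_swap_neg_apply {a b : ℤ} (h1 : a + b ≠ 0) (ha : a ≠ 0) (hb : b ≠ 0) (z : ℤ) :
    (Equiv.swap a b * Equiv.swap (-a) (-b)) z = if z = a then b else if z = b then a else
      if z = -a then -b else if z = -b then -a else z := by
  rw [Equiv.Perm.mul_apply, Equiv.swap_apply_def (-a)]
  rcases eq_or_ne z (-a) with h3 | h3
  · rw [if_pos h3, Equiv.swap_apply_def]
    split_ifs <;> omega
  · rw [if_neg h3]
    rcases eq_or_ne z (-b) with h4 | h4
    · rw [if_pos h4, Equiv.swap_apply_def]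
      split_ifs <;> omega
    · rw [if_neg h4, Equiv.swap_apply_def]

lemma sPerm_apply {l : ℕ} (i : Node l) (z : ℤ) :
    sPerm i z = if z = lo i then hi i else if z = hi i then lo i else
      if z = -lo i then -hi i else if z = -hi i then -lo i else z := by
  have h := lo_hi_cases i
  rw [← swap_mul_swap_neg_apply (by omega) (by omega) (by omega), sPerm, hi]
  split_ifs with h1
  · rw [lo, h1]
    norm_num
  · rfl

lemma sPerm_sPerm {l : ℕ} (i : Node l) (z : ℤ) : sPerm i (sPerm i z) = z := by
  have := lo_hi_cases i
  simp only [sPerm_apply]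
  split_ifs <;> omega

lemma sPerm_mul_self {l : ℕ} (i : Node l) : sPerm i * sPerm i = 1 :=
  Equiv.ext fun z => sPerm_sPerm i z

lemma sPerm_inv {l : ℕ} (i : Node l) : (sPerm i)⁻¹ = sPerm i :=
  inv_eq_of_mul_eq_one_left (sPerm_mul_self i)

lemma isSigned_sPerm {l : ℕ} (i : Node l) : IsSigned l (sPerm i) := by
  have := lo_hi_cases i
  constructor
  · intro z
    simp only [sPerm_apply]
    split_ifs <;> omega
  · intro z hz
    rw [sPerm_apply]
    split_ifs <;> omega

lemma s0_apply (z : ℤ) : s0 z = if z = 1 then -1 else if z = -1 then 1 else z :=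
  Equiv.swap_apply_def _ _ _

lemma s0_pow_apply (t : ℕ) (z : ℤ) : (s0 ^ t) z =
    if t % 2 = 1 ∧ z = 1 then -1 else if t % 2 = 1 ∧ z = -1 then 1 else z := by
  induction t generalizing z with
  | zero => simp
  | succ t ih =>
    rw [pow_succ', Equiv.Perm.mul_apply, ih, s0_apply]
    rcases Nat.mod_two_eq_zero_or_one t with h | h
    · rw [show (t + 1) % 2 = 1 by omega, h]
      simp
    · rw [show (t + 1) % 2 = 0 by omega, h]
      rcases eq_or_ne z 1 with h1 | h1
      · simp [h1]
      · rcases eq_or_ne z (-1) with h2 | h2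
        · simp [h2]
        · simp [h1, h2]

lemma s0_pow_mul_self (t : ℕ) : s0 ^ t * s0 ^ t = 1 := by
  rw [← pow_add, ← two_mul, pow_mul, pow_two, s0_mul_s0, one_pow]

lemma s0_pow_inv (t : ℕ) : (s0 ^ t)⁻¹ = s0 ^ t := inv_eq_of_mul_eq_one_left (s0_pow_mul_self t)

lemma isSigned_s0_pow {l : ℕ} (hl : 1 ≤ l) (t : ℕ) : IsSigned l (s0 ^ t) := by
  constructor
  · intro z
    simp only [s0_pow_apply]
    split_ifs <;> omega
  · intro z hz
    rw [s0_pow_apply]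
    split_ifs <;> omega

lemma isSigned_coe {l : ℕ} (w : WD l) : IsSigned l (w : Equiv.Perm ℤ) := by
  obtain ⟨w, hw⟩ := w
  induction hw using Subgroup.closure_induction with
  | mem x hx => obtain ⟨i, rfl⟩ := hx; exact isSigned_sPerm i
  | one => exact IsSigned.one
  | mul x y _ _ hx hy => exact hx.mul hy
  | inv x _ hx => exact hx.inv

lemma isSigned_dPerm {l n : ℕ} (hn : n ≤ l) : IsSigned l (dPerm n) := by
  constructor
  · intro z
    simp only [dPerm_apply]
    split_ifs <;> omega
  · intro z hz
    rw [dPerm_apply]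
    split_ifs <;> omega

/-! ### Inversions -/

/-- The pairs `c < d` of nonzero indices in `[-l, l]` with `c ≠ -d`; each positive root
`x_d - x_c` of type `D_l` is represented twice, by `(c, d)` and by `(-d, -c)`. -/
def rootPairs (l : ℕ) : Finset (ℤ × ℤ) :=
  (Finset.Icc (-(l : ℤ)) l ×ˢ Finset.Icc (-(l : ℤ)) l).filter fun p =>
    p.1 ≠ 0 ∧ p.2 ≠ 0 ∧ p.1 + p.2 ≠ 0 ∧ p.1 < p.2

/-- The inversions of `g`, a set with two elements for each positive root that `g⁻¹` makes
negative. -/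
def invSet (l : ℕ) (g : Equiv.Perm ℤ) : Finset (ℤ × ℤ) :=
  (rootPairs l).filter fun p => g⁻¹ p.2 < g⁻¹ p.1

lemma mem_invSet {l : ℕ} {g : Equiv.Perm ℤ} {p : ℤ × ℤ} : p ∈ invSet l g ↔
    ((-(l : ℤ) ≤ p.1 ∧ p.1 ≤ l) ∧ (-(l : ℤ) ≤ p.2 ∧ p.2 ≤ l)) ∧
      (p.1 ≠ 0 ∧ p.2 ≠ 0 ∧ p.1 + p.2 ≠ 0 ∧ p.1 < p.2) ∧ g⁻¹ p.2 < g⁻¹ p.1 := by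
  simp only [invSet, rootPairs, Finset.mem_filter, Finset.mem_product, Finset.mem_Icc, and_assoc]

lemma sPerm_lt_iff {l : ℕ} (i : Node l) {c d : ℤ} (hc : c ≠ 0) (hd : d ≠ 0) (hcd : c + d ≠ 0)
    (h1 : ¬ (c = lo i ∧ d = hi i)) (h2 : ¬ (c = -hi i ∧ d = -lo i))
    (h3 : ¬ (c = hi i ∧ d = lo i)) (h4 : ¬ (c = -lo i ∧ d = -hi i)) :
    sPerm i c < sPerm i d ↔ c < d := by
  have := lo_hi_cases i
  rw [sPerm_apply, sPerm_apply]
  split_ifs <;> omega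

/-- If `sᵢ` is not a left descent of `g`, then `sᵢ g` has two more inversions than `g`. -/
lemma invSet_sPerm_mul {l : ℕ} {g : Equiv.Perm ℤ} (hg : IsSigned l g) (i : Node l)
    (h : g⁻¹ (lo i) < g⁻¹ (hi i)) :
    invSet l (sPerm i * g) = insert (lo i, hi i) (insert (-hi i, -lo i)
      ((invSet l g).map (Equiv.prodCongr (sPerm i) (sPerm i)).toEmbedding)) := by
  have hi0 := lo_hi_cases i
  have hlo : sPerm i (lo i) = hi i := by rw [sPerm_apply, if_pos rfl]
  have hhi : sPerm i (hi i) = lo i := by rw [← hlo, sPerm_sPerm]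
  have hs := isSigned_sPerm i
  ext ⟨c, d⟩
  rw [Finset.mem_insert, Finset.mem_insert, Finset.mem_map_equiv, mem_invSet, mem_invSet]
  have e1 : ∀ z, (sPerm i * g)⁻¹ z = g⁻¹ (sPerm i z) := by
    intro z
    rw [mul_inv_rev, sPerm_inv, Equiv.Perm.mul_apply]
  have e2 : (Equiv.prodCongr (sPerm i) (sPerm i)).symm (c, d) = (sPerm i c, sPerm i d) := by
    rw [Equiv.symm_apply_eq]
    simp [sPerm_sPerm]
  rw [e2]
  simp only [e1, Prod.mk.injEq]
  by_cases h1 : c = lo i ∧ d = hi i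
  · rw [h1.1, h1.2, hlo, hhi]
    simp only [and_self, true_or, iff_true]
    omega
  by_cases h2 : c = -hi i ∧ d = -lo i
  · rw [h2.1, h2.2, hs.map_neg, hs.map_neg, hlo, hhi, hg.inv.map_neg, hg.inv.map_neg]
    simp only [and_self, true_or, or_true, iff_true]
    omega
  simp only [h1, h2, false_or]
  have key : ∀ z : ℤ, ((-(l : ℤ) ≤ sPerm i z ∧ sPerm i z ≤ l) ↔ (-(l : ℤ) ≤ z ∧ z ≤ l)) ∧
      (sPerm i z ≠ 0 ↔ z ≠ 0) := by
    intro z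
    rw [sPerm_apply]
    split_ifs <;> omega
  have key2 : sPerm i c + sPerm i d ≠ 0 ↔ c + d ≠ 0 := by
    rw [sPerm_apply, sPerm_apply]
    split_ifs <;> omega
  rw [(key c).1, (key d).1, (key c).2, (key d).2, key2]
  constructor
  · rintro ⟨hb, ⟨a1, a2, a3, a4⟩, a5⟩
    exact ⟨hb, ⟨a1, a2, a3, (sPerm_lt_iff i a1 a2 a3 h1 h2 (by omega) (by omega)).mpr a4⟩, a5⟩
  · rintro ⟨hb, ⟨a1, a2, a3, a4⟩, a5⟩
    refine ⟨hb, ⟨a1, a2, a3, (sPerm_lt_iff i a1 a2 a3 h1 h2 ?_ ?_).mp a4⟩, a5⟩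
    · rintro ⟨rfl, rfl⟩
      rw [hlo, hhi] at a5
      omega
    · rintro ⟨rfl, rfl⟩
      rw [hs.map_neg, hs.map_neg, hlo, hhi, hg.inv.map_neg, hg.inv.map_neg] at a5
      omega

/-- The number of inversions; this is twice the length. -/
def invCard (l : ℕ) (g : Equiv.Perm ℤ) : ℕ := (invSet l g).card

lemma invCard_sPerm_mul_of_lt {l : ℕ} {g : Equiv.Perm ℤ} (hg : IsSigned l g) (i : Node l)
    (h : g⁻¹ (lo i) < g⁻¹ (hi i)) : invCard l (sPerm i * g) = invCard l g + 2 := by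
  have hi0 := lo_hi_cases i
  have hlo : sPerm i (lo i) = hi i := by rw [sPerm_apply, if_pos rfl]
  have hhi : sPerm i (hi i) = lo i := by rw [← hlo, sPerm_sPerm]
  have e2 : ∀ c d, (Equiv.prodCongr (sPerm i) (sPerm i)).symm (c, d) =
      (sPerm i c, sPerm i d) := by
    intro c d
    rw [Equiv.symm_apply_eq]
    simp [sPerm_sPerm]
  rw [invCard, invSet_sPerm_mul hg i h, Finset.card_insert_of_notMem,
    Finset.card_insert_of_notMem, Finset.card_map, invCard]
  · rw [Finset.mem_map_equiv, e2, (isSigned_sPerm i).map_neg, (isSigned_sPerm i).map_neg, hlo, hhi,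
      mem_invSet]
    simp only
    omega
  · rw [Finset.mem_insert, Finset.mem_map_equiv, e2, hlo, hhi, mem_invSet]
    simp only [Prod.mk.injEq]
    omega

lemma lo_ne_hi {l : ℕ} (i : Node l) : lo i ≠ hi i := by
  have := lo_hi_cases i
  omega

lemma invCard_sPerm_mul_of_gt {l : ℕ} {g : Equiv.Perm ℤ} (hg : IsSigned l g) (i : Node l)
    (h : g⁻¹ (hi i) < g⁻¹ (lo i)) : invCard l (sPerm i * g) + 2 = invCard l g := by
  have hlo : sPerm i (lo i) = hi i := by rw [sPerm_apply, if_pos rfl]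
  have hhi : sPerm i (hi i) = lo i := by rw [← hlo, sPerm_sPerm]
  rw [← invCard_sPerm_mul_of_lt ((isSigned_sPerm i).mul hg) i, ← mul_assoc, sPerm_mul_self, one_mul]
  rw [mul_inv_rev, sPerm_inv, Equiv.Perm.mul_apply, Equiv.Perm.mul_apply, hlo, hhi]
  exact h

/-- Multiplication by `s₀` does not change the number of inversions. -/
lemma invCard_s0_pow_mul {l : ℕ} {g : Equiv.Perm ℤ} (t : ℕ) :
    invCard l (s0 ^ t * g) = invCard l g := by
  have h := s0_pow_apply t
  refine Finset.card_bij (fun p _ => ((s0 ^ t) p.1, (s0 ^ t) p.2)) ?_ ?_ ?_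
  · rintro ⟨c, d⟩ hp
    rw [mem_invSet, mul_inv_rev, s0_pow_inv, Equiv.Perm.mul_apply, Equiv.Perm.mul_apply] at hp
    rw [mem_invSet]
    obtain ⟨h1, h2, h3⟩ := hp
    refine ⟨?_, ?_, h3⟩
    · simp only [h] at *; split_ifs <;> omega
    · simp only [h] at *; split_ifs <;> omega
  · rintro ⟨c, d⟩ _ ⟨c', d'⟩ _ he
    simpa using he
  · rintro ⟨c, d⟩ hp
    refine ⟨((s0 ^ t) c, (s0 ^ t) d), ?_, ?_⟩
    · have hh : ∀ z, (s0 ^ t) ((s0 ^ t) z) = z := fun z => by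
        rw [← Equiv.Perm.mul_apply, s0_pow_mul_self, Equiv.Perm.one_apply]
      rw [mem_invSet] at hp
      rw [mem_invSet, mul_inv_rev, s0_pow_inv, Equiv.Perm.mul_apply, Equiv.Perm.mul_apply, hh, hh]
      obtain ⟨h1, h2, h3⟩ := hp
      refine ⟨?_, ?_, h3⟩
      · simp only [h] at *; split_ifs <;> omega
      · simp only [h] at *; split_ifs <;> omega
    · rw [Prod.mk.injEq, ← Equiv.Perm.mul_apply, ← Equiv.Perm.mul_apply, s0_pow_mul_self]
      exact ⟨rfl, rfl⟩

lemma invCard_mul_s0_pow {l : ℕ} {g : Equiv.Perm ℤ} (hg : IsSigned l g) (t : ℕ) :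
    invCard l (g * s0 ^ t) = invCard l g := by
  have h := s0_pow_apply t
  rw [invCard, invCard]
  congr 1
  ext ⟨c, d⟩
  rw [mem_invSet, mem_invSet, mul_inv_rev, s0_pow_inv, Equiv.Perm.mul_apply, Equiv.Perm.mul_apply]
  refine and_congr_right fun h1 => and_congr_right fun h2 => ?_
  have h3 : g⁻¹ c + g⁻¹ d ≠ 0 := by
    intro h0
    have : g⁻¹ c = g⁻¹ (-d) := by rw [hg.inv.map_neg]; omega
    have := g⁻¹.injective this
    omega
  rw [h, h]
  dsimp only
  have := hg.inv.ne_zero (z := c) h2.1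
  have := hg.inv.ne_zero (z := d) h2.2.1
  split_ifs <;> omega

/-! ### The number of negative signs -/

/-- The number of minus signs of a signed permutation. -/
def negCount (l : ℕ) (g : Equiv.Perm ℤ) : ℕ :=
  ((Finset.Icc (1 : ℤ) l).filter fun z => g z < 0).card

lemma negCount_inv {l : ℕ} {g : Equiv.Perm ℤ} (hg : IsSigned l g) :
    negCount l g⁻¹ = negCount l g := by
  refine Finset.card_bij' (fun z _ => -g⁻¹ z) (fun z _ => -g z) ?_ ?_ ?_ ?_
  · intro z hz
    rw [Finset.mem_filter, Finset.mem_Icc] at *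
    have := hg.inv.mem_range (z := z) (by omega) (by omega)
    rw [hg.map_neg, perm_apply_inv]
    omega
  · intro z hz
    rw [Finset.mem_filter, Finset.mem_Icc] at *
    have := hg.mem_range (z := z) (by omega) (by omega)
    rw [hg.inv.map_neg, perm_inv_apply]
    omega
  · intro z hz
    rw [hg.map_neg, perm_apply_inv, neg_neg]
  · intro z hz
    rw [hg.inv.map_neg, perm_inv_apply, neg_neg]

lemma negCount_sPerm_mul {l : ℕ} {g : Equiv.Perm ℤ} (i : Node l) (h : 1 ≤ lo i) :
    negCount l (sPerm i * g) = negCount l g := by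
  rw [negCount, negCount]
  congr 1
  ext z
  rw [Finset.mem_filter, Finset.mem_filter, Equiv.Perm.mul_apply, sPerm_apply]
  have := lo_hi_cases i
  refine and_congr_right fun _ => ?_
  split_ifs <;> omega

lemma negCount_one (l : ℕ) : negCount l 1 = 0 := by
  rw [negCount, Finset.card_eq_zero, Finset.filter_eq_empty_iff]
  intro z hz
  rw [Finset.mem_Icc] at hz
  rw [Equiv.Perm.one_apply]
  omega

lemma negCount_s0_mul_of_pos {l : ℕ} (hl : 1 ≤ l) {g : Equiv.Perm ℤ} (hg : IsSigned l g)
    (h : 0 < g⁻¹ 1) : negCount l (s0 * g) = negCount l g + 1 := by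
  have hr := hg.inv.mem_range (z := 1) (by omega) (by omega)
  have : (Finset.Icc (1 : ℤ) l).filter (fun z => (s0 * g) z < 0) =
      insert (g⁻¹ 1) ((Finset.Icc (1 : ℤ) l).filter fun z => g z < 0) := by
    ext z
    rw [Finset.mem_insert, Finset.mem_filter, Finset.mem_filter, Equiv.Perm.mul_apply, s0_apply,
      Finset.mem_Icc, Equiv.Perm.eq_inv_iff_eq]
    have h1 : g z = 1 → z = g⁻¹ 1 := fun h => by rw [← h, perm_inv_apply]
    have h2 : g z = -1 → z = -g⁻¹ 1 := fun h => by
      rw [← hg.inv.map_neg, ← h, perm_inv_apply]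
    split_ifs <;> omega
  rw [negCount, this, Finset.card_insert_of_notMem, negCount]
  rw [Finset.mem_filter, perm_apply_inv]
  omega

lemma negCount_s0_mul_of_neg {l : ℕ} (hl : 1 ≤ l) {g : Equiv.Perm ℤ} (hg : IsSigned l g)
    (h : g⁻¹ 1 < 0) : negCount l (s0 * g) + 1 = negCount l g := by
  have hs : IsSigned l s0 := by simpa using isSigned_s0_pow hl 1
  rw [← negCount_s0_mul_of_pos hl (hs.mul hg), ← mul_assoc, s0_mul_s0, one_mul]
  rw [mul_inv_rev, Equiv.Perm.mul_apply, show s0⁻¹ = s0 from Equiv.swap_inv _ _,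
    show s0 1 = -1 from Equiv.swap_apply_left _ _, hg.inv.map_neg]
  omega

lemma negCount_s0_mul_mod_two {l : ℕ} (hl : 1 ≤ l) {g : Equiv.Perm ℤ} (hg : IsSigned l g) :
    negCount l (s0 * g) % 2 = (negCount l g + 1) % 2 := by
  rcases lt_trichotomy (g⁻¹ 1) 0 with h | h | h
  · have := negCount_s0_mul_of_neg hl hg h
    omega
  · exact absurd h (hg.inv.ne_zero one_ne_zero)
  · have := negCount_s0_mul_of_pos hl hg h
    omega

lemma negCount_s0_pow_mul_mod_two {l : ℕ} (hl : 1 ≤ l) {g : Equiv.Perm ℤ} (hg : IsSigned l g)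
    (t : ℕ) : negCount l (s0 ^ t * g) % 2 = (negCount l g + t) % 2 := by
  induction t with
  | zero => simp
  | succ t ih =>
    rw [pow_succ', mul_assoc, negCount_s0_mul_mod_two hl ((isSigned_s0_pow hl t).mul hg)]
    omega

lemma s0_mul_sPerm_neg_one : sPerm (-1) = s0 * (sPerm 1 * s0) := by
  have e := s0_conj_swap
  have e1 : sPerm 1 = Equiv.swap 1 2 * Equiv.swap (-1) (-2) := by norm_num [sPerm]
  have e2 : s0 * (sPerm 1 * s0) =
      s0 * Equiv.swap 1 2 * s0 * (s0 * Equiv.swap (-1) (-2) * s0) := by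
    rw [e1]
    calc _ = s0 * Equiv.swap 1 2 * 1 * Equiv.swap (-1) (-2) * s0 := by group
      _ = _ := by rw [← s0_mul_s0]; group
  rw [e2, s0_conj_swap, s0_conj_swap, sPerm, if_pos rfl]
  simp [s0_apply]

lemma negCount_sPerm_mul_mod_two {l : ℕ} {g : Equiv.Perm ℤ} (hg : IsSigned l g) (i : Node l) :
    negCount l (sPerm i * g) % 2 = negCount l g % 2 := by
  rcases lo_hi_cases i with ⟨h1, -, hl⟩ | ⟨h1, -⟩
  · have h2 : sPerm i = s0 * (sPerm 1 * s0) := by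
      rw [← s0_mul_sPerm_neg_one]
      exact congrArg sPerm h1
    have hs : IsSigned l s0 := by simpa using isSigned_s0_pow (l := l) (by omega) 1
    have hs1 : IsSigned l (sPerm 1) :=
      isSigned_sPerm (⟨1, Or.inr ⟨le_refl _, by omega⟩⟩ : Node l)
    have hn1 := negCount_sPerm_mul (g := s0 * g)
      (⟨1, Or.inr ⟨le_refl _, by omega⟩⟩ : Node l) (le_refl _)
    rw [h2, mul_assoc, negCount_s0_mul_mod_two (by omega) ((hs1.mul hs).mul hg), mul_assoc, hn1]
    have := negCount_s0_mul_mod_two (by omega) hg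
    omega
  · rw [negCount_sPerm_mul i h1]

/-- Elements of the Weyl group of type `D_l` have an even number of minus signs. -/
lemma even_negCount_coe {l : ℕ} (w : WD l) : negCount l (w : Equiv.Perm ℤ) % 2 = 0 := by
  obtain ⟨w, hw⟩ := w
  induction hw using Subgroup.closure_induction_left with
  | one => simp [negCount_one]
  | mul_left x hx y hy ih =>
    obtain ⟨i, rfl⟩ := hx
    exact (negCount_sPerm_mul_mod_two (isSigned_coe (⟨y, hy⟩ : WD l)) i).trans ih
  | inv_mul_cancel x hx y hy ih =>
    obtain ⟨i, rfl⟩ := hx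
    change negCount l ((sPerm i)⁻¹ * y) % 2 = 0
    rw [sPerm_inv]
    exact (negCount_sPerm_mul_mod_two (isSigned_coe (⟨y, hy⟩ : WD l)) i).trans ih

/-! ### Monotone signed permutations -/

lemma lt_of_forall_lt_succ {f : ℤ → ℤ} {a b : ℤ} (h : ∀ i, a ≤ i → i < b → f i < f (i + 1))
    {i j : ℤ} (hi : a ≤ i) (hij : i < j) (hj : j ≤ b) : f i < f j := by
  have key : ∀ k : ℕ, i + 1 + k ≤ b → f i < f (i + 1 + k) := by
    intro k
    induction k with
    | zero => intro hk; simpa using h i hi (by omega)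
    | succ k ih =>
      intro hk
      have h1 := ih (by push_cast at hk; omega)
      have h2 := h (i + 1 + k) (by omega) (by push_cast at hk; omega)
      rw [show i + 1 + ((k + 1 : ℕ) : ℤ) = i + 1 + k + 1 by push_cast; ring]
      exact h1.trans h2
  obtain ⟨k, hk⟩ := Int.eq_ofNat_of_zero_le (show 0 ≤ j - (i + 1) by omega)
  have := key k (by omega)
  rwa [show i + 1 + (k : ℤ) = j by omega] at this

/-- An increasing map from one interval to another one of the same length is a translation. -/
lemma eq_add_of_increasing {f : ℤ → ℤ} {a b c : ℤ}
    (h : ∀ i, a ≤ i → i < b → f i < f (i + 1))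
    (hf : ∀ i, a ≤ i → i ≤ b → c + a ≤ f i ∧ f i ≤ c + b) {i : ℤ} (ha : a ≤ i) (hb : i ≤ b) :
    f i = c + i := by
  have h1 : ∀ k : ℕ, a + k ≤ b → c + (a + k) ≤ f (a + k) := by
    intro k
    induction k with
    | zero => intro hk; simpa using (hf a le_rfl (by simpa using hk)).1
    | succ k ih =>
      intro hk
      have h1 := ih (by push_cast at hk; omega)
      have h2 := h (a + k) (by omega) (by push_cast at hk; omega)
      rw [show a + ((k + 1 : ℕ) : ℤ) = a + k + 1 by push_cast; ring]
      omega
  have h2 : ∀ k : ℕ, a ≤ b - k → f (b - k) ≤ c + (b - k) := by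
    intro k
    induction k with
    | zero => intro hk; simpa using (hf b (by simpa using hk) le_rfl).2
    | succ k ih =>
      intro hk
      have h1 := ih (by push_cast at hk; omega)
      have h2 := h (b - (k + 1 : ℕ)) (by omega) (by push_cast; omega)
      rw [show b - ((k + 1 : ℕ) : ℤ) + 1 = b - k by push_cast; ring] at h2
      push_cast at *
      omega
  obtain ⟨k, hk⟩ := Int.eq_ofNat_of_zero_le (show 0 ≤ i - a by omega)
  obtain ⟨k', hk'⟩ := Int.eq_ofNat_of_zero_le (show 0 ≤ b - i by omega)
  have e1 := h1 k (by omega)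
  have e2 := h2 k' (by omega)
  rw [show a + (k : ℤ) = i by omega] at e1
  rw [show b - (k' : ℤ) = i by omega] at e2
  omega

lemma eq_sub_of_decreasing {f : ℤ → ℤ} {a b c : ℤ}
    (h : ∀ i, a ≤ i → i < b → f (i + 1) < f i)
    (hf : ∀ i, a ≤ i → i ≤ b → c - b ≤ f i ∧ f i ≤ c - a) {i : ℤ} (ha : a ≤ i) (hb : i ≤ b) :
    f i = c - i := by
  have := eq_add_of_increasing (f := fun i => -f i) (c := -c)
    (fun i h1 h2 => by have := h i h1 h2; omega)
    (fun i h1 h2 => by have := hf i h1 h2; omega) ha hb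
  omega

/-- If `g` is increasing, its minus signs are at the first places. -/
lemma apply_neg_iff_of_increasing {l : ℕ} {g : Equiv.Perm ℤ}
    (h : ∀ i : ℤ, 1 ≤ i → i < l → g i < g (i + 1)) {z : ℤ} (h1 : 1 ≤ z) (h2 : z ≤ l) :
    g z < 0 ↔ z ≤ negCount l g := by
  constructor
  · intro hz
    have hs : Finset.Icc 1 z ⊆ (Finset.Icc (1 : ℤ) l).filter fun z => g z < 0 := by
      intro y hy
      rw [Finset.mem_Icc] at hy
      rw [Finset.mem_filter, Finset.mem_Icc]
      rcases eq_or_ne y z with rfl | hne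
      · omega
      · have := lt_of_forall_lt_succ h hy.1 (lt_of_le_of_ne hy.2 hne) h2
        omega
    have := Finset.card_le_card hs
    rw [Int.card_Icc] at this
    rw [negCount]
    omega
  · intro hz
    by_contra hc
    have hs : ((Finset.Icc (1 : ℤ) l).filter fun z => g z < 0) ⊆ Finset.Icc 1 (z - 1) := by
      intro y hy
      rw [Finset.mem_filter, Finset.mem_Icc] at hy
      rw [Finset.mem_Icc]
      rcases lt_trichotomy y z with hlt | heq | hgt
      · omega
      · subst heq; omega
      · have := lt_of_forall_lt_succ h h1 hgt hy.1.2
        omega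
    have := Finset.card_le_card hs
    rw [Int.card_Icc] at this
    rw [negCount] at hz
    omega

lemma negCount_le (l : ℕ) (g : Equiv.Perm ℤ) : negCount l g ≤ l := by
  refine (Finset.card_filter_le _ _).trans ?_
  rw [Int.card_Icc]
  omega

/-- If `g` is decreasing, its minus signs are at the last places. -/
lemma apply_neg_iff_of_decreasing {l : ℕ} {g : Equiv.Perm ℤ}
    (h : ∀ i : ℤ, 1 ≤ i → i < l → g (i + 1) < g i) {z : ℤ} (h1 : 1 ≤ z) (h2 : z ≤ l) :
    g z < 0 ↔ (l : ℤ) - negCount l g < z := by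
  have h' : ∀ i : ℤ, 1 ≤ i → i < l → -g i < -g (i + 1) := fun i h1 h2 => by
    have := h i h1 h2; omega
  constructor
  · intro hz
    have hs : Finset.Icc z l ⊆ (Finset.Icc (1 : ℤ) l).filter fun z => g z < 0 := by
      intro y hy
      rw [Finset.mem_Icc] at hy
      rw [Finset.mem_filter, Finset.mem_Icc]
      rcases eq_or_ne z y with rfl | hne
      · omega
      · have := lt_of_forall_lt_succ h' h1 (lt_of_le_of_ne hy.1 hne) hy.2
        omega
    have := Finset.card_le_card hs
    rw [Int.card_Icc] at this
    rw [negCount]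
    omega
  · intro hz
    by_contra hc
    have hs : ((Finset.Icc (1 : ℤ) l).filter fun z => g z < 0) ⊆ Finset.Icc (z + 1) l := by
      intro y hy
      rw [Finset.mem_filter, Finset.mem_Icc] at hy
      rw [Finset.mem_Icc]
      rcases lt_trichotomy y z with hlt | heq | hgt
      · have := lt_of_forall_lt_succ h' hy.1.1 hlt h2
        omega
      · subst heq; omega
      · omega
    have := Finset.card_le_card hs
    rw [Int.card_Icc] at this
    rw [negCount] at hz
    omega

/-! ### Minimal and maximal double coset representatives -/

/-- The signed permutation reversing `x₁, …, xₙ` and reversing `xₙ₊₁, …, x_l`. -/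
def revPerm (l n : ℕ) : Equiv.Perm ℤ :=
  if h : n ≤ l then Function.Involutive.toPerm
    (fun z => if 1 ≤ z ∧ z ≤ n then n + 1 - z else if n < z ∧ z ≤ l then l + n + 1 - z else
      if -(n : ℤ) ≤ z ∧ z ≤ -1 then -(n + 1) - z else
      if -(l : ℤ) ≤ z ∧ z < -n then -(l + n + 1) - z else z)
    (by intro z; dsimp only; split_ifs <;> omega)
  else 1

lemma revPerm_apply {l n : ℕ} (h : n ≤ l) (z : ℤ) : revPerm l n z =
    if 1 ≤ z ∧ z ≤ n then n + 1 - z else if n < z ∧ z ≤ l then l + n + 1 - z else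
      if -(n : ℤ) ≤ z ∧ z ≤ -1 then -(n + 1) - z else
      if -(l : ℤ) ≤ z ∧ z < -n then -(l + n + 1) - z else z := by
  rw [revPerm, dif_pos h]
  rfl

lemma revPerm_inv {l n : ℕ} (h : n ≤ l) : (revPerm l n)⁻¹ = revPerm l n := by
  apply inv_eq_of_mul_eq_one_left
  ext z
  rw [revPerm, dif_pos h]
  exact Function.Involutive.toPerm_involutive _ z

lemma isSigned_revPerm {l n : ℕ} (h : n ≤ l) : IsSigned l (revPerm l n) := by
  constructor
  · intro z
    rw [revPerm_apply h, revPerm_apply h]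
    split_ifs <;> omega
  · intro z hz
    rw [revPerm_apply h]
    split_ifs <;> omega

/-- The signed permutation of maximal length among those with `n` minus signs: it sends
`x_j` to `x_(l-n+1-j)` for `j ≤ l - n` and to `-x_j` for `j > l - n`. -/
def maxPerm (l n : ℕ) : Equiv.Perm ℤ :=
  if h : n ≤ l then Function.Involutive.toPerm
    (fun z => if 1 ≤ z ∧ z ≤ l - n then l - n + 1 - z else if l - n < z ∧ z ≤ l then -z else
      if -(l - n : ℤ) ≤ z ∧ z ≤ -1 then -(l - n + 1) - z else
      if -(l : ℤ) ≤ z ∧ z < -(l - n) then -z else z)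
    (by intro z; dsimp only; split_ifs <;> omega)
  else 1

lemma maxPerm_apply {l n : ℕ} (h : n ≤ l) (z : ℤ) : maxPerm l n z =
    if 1 ≤ z ∧ z ≤ l - n then l - n + 1 - z else if l - n < z ∧ z ≤ l then -z else
      if -(l - n : ℤ) ≤ z ∧ z ≤ -1 then -(l - n + 1) - z else
      if -(l : ℤ) ≤ z ∧ z < -(l - n) then -z else z := by
  rw [maxPerm, dif_pos h]
  rfl

lemma maxPerm_inv {l n : ℕ} (h : n ≤ l) : (maxPerm l n)⁻¹ = maxPerm l n := by
  apply inv_eq_of_mul_eq_one_left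
  ext z
  rw [maxPerm, dif_pos h]
  exact Function.Involutive.toPerm_involutive _ z

lemma isSigned_maxPerm {l n : ℕ} (h : n ≤ l) : IsSigned l (maxPerm l n) := by
  constructor
  · intro z
    rw [maxPerm_apply h, maxPerm_apply h]
    split_ifs <;> omega
  · intro z hz
    rw [maxPerm_apply h]
    split_ifs <;> omega

lemma dPerm_inv (n : ℕ) : (dPerm n)⁻¹ = dPerm n := inv_eq_of_mul_eq_one_left (dPerm_mul_self n)

/-- A signed permutation without left and right descents of type `A` is some `dₙ`. -/
lemma IsSigned.eq_dPerm {l : ℕ} {g : Equiv.Perm ℤ} (hg : IsSigned l g)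
    (h1 : ∀ i : ℤ, 1 ≤ i → i < l → g⁻¹ i < g⁻¹ (i + 1))
    (h2 : ∀ i : ℤ, 1 ≤ i → i < l → g i < g (i + 1)) : g = dPerm (negCount l g) := by
  have hn := negCount_le l g
  have s1 := fun z => apply_neg_iff_of_increasing h1 (z := z)
  have s2 := fun z => apply_neg_iff_of_increasing h2 (z := z)
  rw [negCount_inv hg] at s1
  generalize negCount l g = n at *
  refine hg.ext (isSigned_dPerm hn) fun z hz1 hz2 => ?_
  rw [dPerm_apply]
  by_cases hz : z ≤ n
  · rw [if_pos ⟨hz1, hz⟩]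
    have := eq_add_of_increasing (f := g) (a := 1) (b := n) (c := -(n + 1))
      (fun i hi1 hi2 => h2 i hi1 (by omega)) (fun i hi1 hi2 => ?_) hz1 hz
    · omega
    · have e1 := (s2 i hi1 (by omega)).mpr hi2
      have e2 := hg.mem_range (z := i) (by omega) (by omega)
      have e3 := s1 (-g i) (by omega) (by omega)
      rw [hg.inv.map_neg, perm_inv_apply] at e3
      omega
  · rw [if_neg (by omega), if_neg (by omega)]
    have := eq_add_of_increasing (f := g) (a := n + 1) (b := l) (c := 0)
      (fun i hi1 hi2 => h2 i (by omega) (by omega)) (fun i hi1 hi2 => ?_) (by omega) hz2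
    · omega
    · have e1 := s2 i (by omega) (by omega)
      have e2 := hg.mem_range (z := i) (by omega) (by omega)
      have e4 := hg.ne_zero (z := i) (by omega)
      have e3 := s1 (g i) (by omega) (by omega)
      rw [perm_inv_apply] at e3
      omega

/-- A signed permutation with all left and right descents of type `A` is of maximal length. -/
lemma IsSigned.eq_maxPerm {l : ℕ} {g : Equiv.Perm ℤ} (hg : IsSigned l g)
    (h1 : ∀ i : ℤ, 1 ≤ i → i < l → g⁻¹ (i + 1) < g⁻¹ i)
    (h2 : ∀ i : ℤ, 1 ≤ i → i < l → g (i + 1) < g i) : g = maxPerm l (negCount l g) := by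
  have hn := negCount_le l g
  have s1 := fun z => apply_neg_iff_of_decreasing h1 (z := z)
  have s2 := fun z => apply_neg_iff_of_decreasing h2 (z := z)
  rw [negCount_inv hg] at s1
  generalize negCount l g = n at *
  refine hg.ext (isSigned_maxPerm hn) fun z hz1 hz2 => ?_
  rw [maxPerm_apply hn]
  by_cases hz : z ≤ l - n
  · rw [if_pos ⟨hz1, hz⟩]
    refine eq_sub_of_decreasing (f := g) (a := 1) (b := l - n) (c := l - n + 1)
      (fun i hi1 hi2 => h2 i hi1 (by omega)) (fun i hi1 hi2 => ?_) hz1 hz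
    have e1 := s2 i hi1 (by omega)
    have e2 := hg.mem_range (z := i) (by omega) (by omega)
    have e4 := hg.ne_zero (z := i) (by omega)
    have e3 := s1 (g i) (by omega) (by omega)
    rw [perm_inv_apply] at e3
    omega
  · rw [if_neg (by omega), if_pos (by omega)]
    have := eq_sub_of_decreasing (f := g) (a := l - n + 1) (b := l) (c := 0)
      (fun i hi1 hi2 => h2 i (by omega) (by omega)) (fun i hi1 hi2 => ?_) (by omega) hz2
    · omega
    · have e1 := s2 i (by omega) (by omega)
      have e2 := hg.mem_range (z := i) (by omega) (by omega)
      have e3 := s1 (-g i) (by omega) (by omega)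
      rw [hg.inv.map_neg, perm_inv_apply] at e3
      omega

lemma IsSigned.eq_revPerm {l n : ℕ} {g : Equiv.Perm ℤ} (hg : IsSigned l g) (hn : n ≤ l)
    (h : ∀ i : ℤ, 1 ≤ i → i < l → i ≠ n → g (i + 1) < g i)
    (h1 : ∀ i : ℤ, 1 ≤ i → i ≤ n → 1 ≤ g i ∧ g i ≤ n)
    (h2 : ∀ i : ℤ, n < i → i ≤ l → n < g i ∧ g i ≤ l) : g = revPerm l n := by
  refine hg.ext (isSigned_revPerm hn) fun z hz1 hz2 => ?_
  rw [revPerm_apply hn]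
  by_cases hz : z ≤ n
  · rw [if_pos ⟨hz1, hz⟩]
    refine eq_sub_of_decreasing (f := g) (a := 1) (b := n) (c := n + 1)
      (fun i hi1 hi2 => h i hi1 (by omega) (by omega)) (fun i hi1 hi2 => ?_) hz1 hz
    have := h1 i hi1 hi2
    omega
  · rw [if_neg (by omega), if_pos (by omega)]
    refine eq_sub_of_decreasing (f := g) (a := n + 1) (b := l) (c := l + n + 1)
      (fun i hi1 hi2 => h i (by omega) hi2 (by omega)) (fun i hi1 hi2 => ?_) (by omega) hz2
    have := h2 i (by omega) hi2
    omega

lemma IsSigned.eq_one_of_increasing {l : ℕ} {g : Equiv.Perm ℤ} (hg : IsSigned l g)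
    (h : ∀ i : ℤ, 1 ≤ i → i < l → g i < g (i + 1)) (h0 : negCount l g = 0) : g = 1 := by
  refine hg.ext IsSigned.one fun z hz1 hz2 => ?_
  rw [Equiv.Perm.one_apply, eq_add_of_increasing (f := g) (a := 1) (b := l) (c := 0) h ?_ hz1 hz2,
    zero_add]
  intro i hi1 hi2
  have e1 := apply_neg_iff_of_increasing h hi1 hi2
  have e2 := hg.mem_range (z := i) (by omega) hi2
  have e4 := hg.ne_zero (z := i) (by omega)
  omega

/-! ### The length function -/

section length


@[simp] lemma coe_sW (i : Node l) : ((sW i : WD l) : Equiv.Perm ℤ) = sPerm i := rfl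

lemma sW_mul_self (i : Node l) : sW i * sW i = 1 := Subtype.ext (sPerm_mul_self i)

lemma sW_mul_cancel_left (i : Node l) (w : WD l) : sW i * (sW i * w) = w := by
  rw [← mul_assoc, sW_mul_self, one_mul]

lemma sW_mul_cancel_right (i : Node l) (w : WD l) : w * sW i * sW i = w := by
  rw [mul_assoc, sW_mul_self, mul_one]

lemma sW_inv (i : Node l) : (sW i)⁻¹ = sW i := inv_eq_of_mul_eq_one_left (sW_mul_self i)

/-- Only the identity has no descents. -/
lemma eq_one_of_no_descent (w : WD l)
    (h : ∀ i : Node l, (w : Equiv.Perm ℤ)⁻¹ (lo i) < (w : Equiv.Perm ℤ)⁻¹ (hi i)) : w = 1 := by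
  have hs := (isSigned_coe w).inv
  rcases Nat.lt_or_ge l 2 with hl | hl
  · obtain ⟨w, hw⟩ := w
    have : Set.range (fun i : Node l => sPerm i) = ∅ := by
      rw [Set.range_eq_empty_iff]
      exact ⟨fun i => by have := lo_hi_cases i; omega⟩
    have h1 : w ∈ (⊥ : Subgroup (Equiv.Perm ℤ)) := by
      rw [← Subgroup.closure_empty, ← this]; exact hw
    exact Subtype.ext (Subgroup.mem_bot.mp h1)
  have h1 : ∀ i : ℤ, 1 ≤ i → i < l →
      (w : Equiv.Perm ℤ)⁻¹ i < (w : Equiv.Perm ℤ)⁻¹ (i + 1) := by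
    intro i hi1 hi2
    have := h ⟨i, Or.inr ⟨hi1, hi2⟩⟩
    rwa [hi, if_neg (by simp only; omega)] at this
  have h2 : -(w : Equiv.Perm ℤ)⁻¹ 1 < (w : Equiv.Perm ℤ)⁻¹ 2 := by
    have := h ⟨-1, Or.inl ⟨rfl, hl⟩⟩
    rw [hi, if_pos rfl] at this
    rw [← hs.map_neg]
    exact this
  have h3 := apply_neg_iff_of_increasing h1 (z := 1) le_rfl (by omega)
  have h4 := apply_neg_iff_of_increasing h1 (z := 2) (by omega) (by omega)
  have h5 := h1 1 le_rfl (by omega)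
  have h6 := even_negCount_coe w
  rw [← negCount_inv (isSigned_coe w)] at h6
  have h7 := hs.eq_one_of_increasing h1 (by
    rw [show (1 : ℤ) + 1 = 2 by norm_num] at h5; omega)
  exact Subtype.ext (inv_eq_one.mp h7)

lemma invCard_one : invCard l 1 = 0 := by
  rw [invCard, Finset.card_eq_zero, Finset.eq_empty_iff_forall_notMem]
  rintro ⟨c, d⟩ h
  rw [mem_invSet] at h
  have h1 := h.2.1.2.2.2
  have h2 := h.2.2
  rw [inv_one, Equiv.Perm.one_apply, Equiv.Perm.one_apply] at h2
  omega

lemma exists_word (w : WD l) : ∃ ω : List (Node l),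
    (ω.map sW).prod = w ∧ 2 * ω.length = invCard l (w : Equiv.Perm ℤ) := by
  generalize hn : invCard l (w : Equiv.Perm ℤ) = n
  induction n using Nat.strong_induction_on generalizing w with
  | _ n ih =>
    by_cases h : ∀ i : Node l, (w : Equiv.Perm ℤ)⁻¹ (lo i) < (w : Equiv.Perm ℤ)⁻¹ (hi i)
    · refine ⟨[], ?_, ?_⟩
      · rw [eq_one_of_no_descent w h]; rfl
      · rw [← hn, eq_one_of_no_descent w h, Subgroup.coe_one, invCard_one]; rfl
    · push Not at h
      obtain ⟨i, h⟩ := h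
      have hlt : (w : Equiv.Perm ℤ)⁻¹ (hi i) < (w : Equiv.Perm ℤ)⁻¹ (lo i) :=
        lt_of_le_of_ne h fun he => lo_ne_hi i ((w : Equiv.Perm ℤ)⁻¹.injective he).symm
      have hc : invCard l (sW i * w : WD l) + 2 = invCard l w :=
        invCard_sPerm_mul_of_gt (isSigned_coe w) i hlt
      obtain ⟨ω, h1, h2⟩ := ih _ (by omega) (sW i * w) rfl
      refine ⟨i :: ω, ?_, ?_⟩
      · rw [List.map_cons, List.prod_cons, h1, sW_mul_cancel_left]
      · rw [List.length_cons]
        omega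

lemma invCard_word_le (ω : List (Node l)) :
    invCard l ((ω.map sW).prod : WD l) ≤ 2 * ω.length := by
  induction ω with
  | nil => simp [invCard_one]
  | cons i ω ih =>
    rw [List.map_cons, List.prod_cons, List.length_cons]
    set w : WD l := (ω.map sW).prod
    change invCard l (sPerm i * w) ≤ _
    rcases lt_trichotomy ((w : Equiv.Perm ℤ)⁻¹ (lo i)) ((w : Equiv.Perm ℤ)⁻¹ (hi i)) with h | h | h
    · have := invCard_sPerm_mul_of_lt (isSigned_coe w) i h
      omega
    · exact absurd ((w : Equiv.Perm ℤ)⁻¹.injective h) (lo_ne_hi i)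
    · have := invCard_sPerm_mul_of_gt (isSigned_coe w) i h
      omega

lemma len_le_of_word {w : WD l} {ω : List (Node l)} (h : (ω.map sW).prod = w) :
    len w ≤ ω.length := Nat.sInf_le ⟨ω, h, rfl⟩

lemma two_mul_len (w : WD l) : 2 * len w = invCard l (w : Equiv.Perm ℤ) := by
  obtain ⟨ω, h1, h2⟩ := exists_word w
  have hle := len_le_of_word h1
  obtain ⟨ω', h3, h4⟩ := Nat.sInf_mem (s := {n | ∃ ω : List (Node l), (ω.map sW).prod = w ∧
    ω.length = n}) ⟨_, ω, h1, rfl⟩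
  have := invCard_word_le ω'
  rw [h3, h4] at this
  change invCard l w ≤ 2 * len w at this
  omega

lemma exists_reduced_word (w : WD l) : ∃ ω : List (Node l),
    (ω.map sW).prod = w ∧ ω.length = len w := by
  obtain ⟨ω, h1, h2⟩ := exists_word w
  exact ⟨ω, h1, by have := two_mul_len w; omega⟩

lemma redWord_spec (w : WD l) : ((redWord w).map sW).prod = w ∧ (redWord w).length = len w :=
  Classical.epsilon_spec (exists_reduced_word w)

@[simp] lemma len_one : len (1 : WD l) = 0 := by
  have := two_mul_len (1 : WD l)
  rw [Subgroup.coe_one, invCard_one] at this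
  omega

lemma eq_one_of_len_eq_zero {w : WD l} (h : len w = 0) : w = 1 := by
  obtain ⟨ω, h1, h2⟩ := exists_reduced_word w
  rw [h, List.length_eq_zero_iff] at h2
  rw [← h1, h2]
  rfl

lemma len_inv_le (w : WD l) : len w⁻¹ ≤ len w := by
  obtain ⟨ω, h1, h2⟩ := exists_reduced_word w
  rw [← h2, ← List.length_reverse]
  refine len_le_of_word ?_
  rw [← h1, List.prod_inv_reverse, List.map_map, ← List.map_reverse]
  congr 2
  funext i
  exact (sW_inv i).symm

@[simp] lemma len_inv (w : WD l) : len w⁻¹ = len w :=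
  le_antisymm (len_inv_le w) (by simpa using len_inv_le w⁻¹)

lemma len_sW_mul_of_lt {w : WD l} {i : Node l}
    (h : (w : Equiv.Perm ℤ)⁻¹ (lo i) < (w : Equiv.Perm ℤ)⁻¹ (hi i)) :
    len (sW i * w) = len w + 1 := by
  have h1 := invCard_sPerm_mul_of_lt (isSigned_coe w) i h
  have h2 := two_mul_len w
  have h3 := two_mul_len (sW i * w)
  rw [Subgroup.coe_mul, coe_sW] at h3
  omega

lemma len_sW_mul_of_gt {w : WD l} {i : Node l}
    (h : (w : Equiv.Perm ℤ)⁻¹ (hi i) < (w : Equiv.Perm ℤ)⁻¹ (lo i)) :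
    len (sW i * w) + 1 = len w := by
  have h1 := invCard_sPerm_mul_of_gt (isSigned_coe w) i h
  have h2 := two_mul_len w
  have h3 := two_mul_len (sW i * w)
  rw [Subgroup.coe_mul, coe_sW] at h3
  omega

lemma len_sW_mul_lt_iff (w : WD l) (i : Node l) : len (sW i * w) < len w ↔
    (w : Equiv.Perm ℤ)⁻¹ (hi i) < (w : Equiv.Perm ℤ)⁻¹ (lo i) := by
  rcases lt_trichotomy ((w : Equiv.Perm ℤ)⁻¹ (lo i)) ((w : Equiv.Perm ℤ)⁻¹ (hi i)) with h | h | h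
  · have := len_sW_mul_of_lt h
    omega
  · exact absurd ((w : Equiv.Perm ℤ)⁻¹.injective h) (lo_ne_hi i)
  · have := len_sW_mul_of_gt h
    omega

lemma len_sW_mul_cases (w : WD l) (i : Node l) :
    len (sW i * w) = len w + 1 ∨ len (sW i * w) + 1 = len w := by
  rcases lt_trichotomy ((w : Equiv.Perm ℤ)⁻¹ (lo i)) ((w : Equiv.Perm ℤ)⁻¹ (hi i)) with h | h | h
  · exact Or.inl (len_sW_mul_of_lt h)
  · exact absurd ((w : Equiv.Perm ℤ)⁻¹.injective h) (lo_ne_hi i)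
  · exact Or.inr (len_sW_mul_of_gt h)

lemma len_mul_sW (w : WD l) (i : Node l) : len (w * sW i) = len (sW i * w⁻¹) := by
  rw [← len_inv, mul_inv_rev, sW_inv]

lemma len_mul_sW_cases (w : WD l) (i : Node l) :
    len (w * sW i) = len w + 1 ∨ len (w * sW i) + 1 = len w := by
  rw [len_mul_sW, ← len_inv w]
  exact len_sW_mul_cases w⁻¹ i

lemma len_mul_sW_lt_iff (w : WD l) (i : Node l) : len (w * sW i) < len w ↔
    (w : Equiv.Perm ℤ) (hi i) < (w : Equiv.Perm ℤ) (lo i) := by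
  rw [len_mul_sW, ← len_inv w, len_sW_mul_lt_iff]
  simp

/-- If `sᵢ w ≠ w sⱼ`, then left multiplication by `sᵢ` has the same effect on the lengths of `w`
and `w sⱼ`. -/
lemma descent_mul_sW_iff {w : WD l} {i j : Node l} (h : sW i * w ≠ w * sW j) :
    len (sW i * w * sW j) < len (w * sW j) ↔ len (sW i * w) < len w := by
  rw [mul_assoc, len_sW_mul_lt_iff, len_sW_mul_lt_iff]
  have e : ∀ z, ((w * sW j : WD l) : Equiv.Perm ℤ)⁻¹ z =
      sPerm j ((w : Equiv.Perm ℤ)⁻¹ z) := by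
    intro z
    rw [Subgroup.coe_mul, mul_inv_rev, Equiv.Perm.mul_apply, coe_sW, sPerm_inv]
  rw [e, e]
  have hw := (isSigned_coe w).inv
  have hi0 := lo_hi_cases i
  -- otherwise `w⁻¹` maps the simple root of `i` to that of `j`, up to sign
  have key : ∀ a b : ℤ, (a = lo j ∧ b = hi j) ∨ (a = hi j ∧ b = lo j) ∨
      (a = -lo j ∧ b = -hi j) ∨ (a = -hi j ∧ b = -lo j) →
      ¬ ((w : Equiv.Perm ℤ)⁻¹ (lo i) = a ∧ (w : Equiv.Perm ℤ)⁻¹ (hi i) = b) := by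
    rintro a b hab ⟨ha, hb⟩
    apply h
    rw [Equiv.Perm.inv_eq_iff_eq] at ha hb
    apply Subtype.ext
    rw [Subgroup.coe_mul, Subgroup.coe_mul, coe_sW, coe_sW]
    have hwn := (isSigned_coe w).map_neg
    have inj : ∀ {x y : ℤ}, (w : Equiv.Perm ℤ) x = (w : Equiv.Perm ℤ) y → x = y :=
      fun h => (w : Equiv.Perm ℤ).injective h
    ext z
    rw [Equiv.Perm.mul_apply, Equiv.Perm.mul_apply, sPerm_apply, sPerm_apply j]
    have n1 := hwn a
    have n2 := hwn b
    have i1 : (w : Equiv.Perm ℤ) z = lo i ↔ z = a := by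
      rw [ha]; exact (w : Equiv.Perm ℤ).injective.eq_iff
    have i2 : (w : Equiv.Perm ℤ) z = hi i ↔ z = b := by
      rw [hb]; exact (w : Equiv.Perm ℤ).injective.eq_iff
    have i3 : (w : Equiv.Perm ℤ) z = -lo i ↔ z = -a := by
      rw [ha, ← n1]; exact (w : Equiv.Perm ℤ).injective.eq_iff
    have i4 : (w : Equiv.Perm ℤ) z = -hi i ↔ z = -b := by
      rw [hb, ← n2]; exact (w : Equiv.Perm ℤ).injective.eq_iff
    simp only [i1, i2, i3, i4]
    have hj0 := lo_hi_cases j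
    rcases hab with ⟨rfl, rfl⟩ | ⟨rfl, rfl⟩ | ⟨rfl, rfl⟩ | ⟨rfl, rfl⟩ <;>
      (try simp only [neg_neg] at *) <;> split_ifs <;> omega
  have hne : (w : Equiv.Perm ℤ)⁻¹ (hi i) + (w : Equiv.Perm ℤ)⁻¹ (lo i) ≠ 0 := by
    intro h0
    have : (w : Equiv.Perm ℤ)⁻¹ (hi i) = (w : Equiv.Perm ℤ)⁻¹ (-lo i) := by
      rw [hw.map_neg]; omega
    have := (w : Equiv.Perm ℤ)⁻¹.injective this
    omega
  refine sPerm_lt_iff j (hw.ne_zero (by omega)) (hw.ne_zero (by omega)) hne ?_ ?_ ?_ ?_ <;>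
    rintro ⟨h1, h2⟩
  · exact key _ _ (Or.inr (Or.inl ⟨rfl, rfl⟩)) ⟨h2, h1⟩
  · exact key _ _ (Or.inr (Or.inr (Or.inl ⟨rfl, rfl⟩))) ⟨h2, h1⟩
  · exact key _ _ (Or.inl ⟨rfl, rfl⟩) ⟨h2, h1⟩
  · exact key _ _ (Or.inr (Or.inr (Or.inr ⟨rfl, rfl⟩))) ⟨h2, h1⟩

end length

variable {l : ℕ}

/-! ### Twisting by powers of `s₀`

The two maximal parabolic subgroups `W_(O+)` and `W_(O-)` are conjugate under `s₀`. To treat them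
uniformly, `t` stands for `O+` if it is even and for `O-` if it is odd, and an element `w` of `W`
is studied through the signed permutation `s₀ᵗ w s₀ʳ`. -/

/-- The `i`-th node of `O+` (`t` even) or of `O-` (`t` odd). -/
def aNode (t : ℕ) (i : ℤ) (h : 1 ≤ i ∧ i < l) : Node l :=
  ⟨if Even t then i else if i = 1 then -1 else i, by split_ifs <;> omega⟩

/-- The set `O+` (`t` even) or `O-` (`t` odd). -/
def Oset (l t : ℕ) : Set (Node l) := if Even t then Oplus l else Ominus l

lemma Oset_zero : Oset l 0 = Oplus l := if_pos Even.zero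

lemma mem_Oset_iff {t : ℕ} {j : Node l} :
    j ∈ Oset l t ↔ ∃ i : ℤ, ∃ h : 1 ≤ i ∧ i < l, j = aNode t i h := by
  rcases j with ⟨j, hj⟩
  by_cases ht : Even t
  · rw [Oset, if_pos ht]
    constructor
    · intro h
      have h' : j ≠ -1 := h
      exact ⟨j, by omega, Subtype.ext (by simp [aNode, ht])⟩
    · rintro ⟨i, h, he⟩
      have : j = i := by simpa [aNode, ht] using congrArg Subtype.val he
      change j ≠ -1
      omega
  · rw [Oset, if_neg ht]
    constructor
    · intro h
      have h' : j ≠ 1 := h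
      by_cases hm : j = -1
      · exact ⟨1, by omega, Subtype.ext (by simp [aNode, ht, hm])⟩
      · exact ⟨j, by omega, Subtype.ext (by simp [aNode, ht, h'])⟩
    · rintro ⟨i, h, he⟩
      have : j = if i = 1 then -1 else i := by simpa [aNode, ht] using congrArg Subtype.val he
      change j ≠ 1
      split_ifs at this <;> omega

lemma aNode_mem_Oset (t : ℕ) {i : ℤ} (h : 1 ≤ i ∧ i < l) : aNode t i h ∈ Oset l t :=
  mem_Oset_iff.mpr ⟨i, h, rfl⟩

lemma lo_aNode_zero {i : ℤ} (h : 1 ≤ i ∧ i < l) : lo (aNode 0 i h) = i := by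
  simp [aNode]

lemma hi_aNode_zero {i : ℤ} (h : 1 ≤ i ∧ i < l) : hi (aNode 0 i h) = i + 1 := by
  have := lo_hi_cases (aNode 0 i h)
  rw [lo_aNode_zero] at this
  omega

lemma sPerm_eq_aNode_zero {i : ℤ} (h : 1 ≤ i ∧ i < l) : sPerm i = sPerm (aNode 0 i h) := by
  simp [aNode]

lemma sPerm_apply_of_pos {i : ℤ} (h : 1 ≤ i) (z : ℤ) :
    sPerm i z = if z = i then i + 1 else if z = i + 1 then i else
      if z = -i then -(i + 1) else if z = -(i + 1) then -i else z := by
  rw [sPerm, if_neg (by omega), swap_mul_swap_neg_apply (by omega) (by omega) (by omega)]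

lemma s0_pow_of_even {t : ℕ} (h : Even t) : s0 ^ t = 1 := by
  obtain ⟨k, rfl⟩ := h
  rw [pow_add, s0_pow_mul_self]

lemma s0_pow_of_not_even {t : ℕ} (h : ¬ Even t) : s0 ^ t = s0 := by
  obtain ⟨k, rfl⟩ := Nat.not_even_iff_odd.mp h
  rw [pow_succ, s0_pow_of_even (even_two_mul k), one_mul]

lemma s0_pow_mul_sPerm_aNode (t : ℕ) {i : ℤ} (h : 1 ≤ i ∧ i < l) :
    s0 ^ t * sPerm (aNode t i h) = sPerm i * s0 ^ t := by
  by_cases ht : Even t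
  · rw [s0_pow_of_even ht, one_mul, mul_one, aNode]
    simp only [ht, if_true]
  · rw [s0_pow_of_not_even ht]
    have key : sPerm (aNode t i h) = s0 * (sPerm i * s0) := by
      by_cases h1 : i = 1
      · subst h1
        rw [← s0_mul_sPerm_neg_one]
        simp [aNode, ht]
      · have e : sPerm (aNode t i h) = sPerm i := by simp [aNode, ht, h1]
        have hs : ∀ z : ℤ, z ≠ 1 → z ≠ -1 → s0 z = z := fun z h h' => by
          rw [s0_apply, if_neg h, if_neg h']
        have e2 : s0 * (Equiv.swap i (i + 1) * Equiv.swap (-i) (-(i + 1)) * s0) =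
            s0 * Equiv.swap i (i + 1) * s0 * (s0 * Equiv.swap (-i) (-(i + 1)) * s0) := by
          calc _ = s0 * Equiv.swap i (i + 1) * 1 * Equiv.swap (-i) (-(i + 1)) * s0 := by group
            _ = _ := by rw [← s0_mul_s0]; group
        rw [e, sPerm, if_neg (by omega), e2, s0_conj_swap, s0_conj_swap, hs i (by omega) (by omega),
          hs (i + 1) (by omega) (by omega), hs (-i) (by omega) (by omega),
          hs (-(i + 1)) (by omega) (by omega)]
    rw [key, ← mul_assoc, s0_mul_s0, one_mul]

/-- The signed permutation `s₀ᵗ w s₀ʳ`. -/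
def twist (t r : ℕ) (w : WD l) : Equiv.Perm ℤ := s0 ^ t * w * s0 ^ r

lemma isSigned_twist (hl : 2 ≤ l) (t r : ℕ) (w : WD l) : IsSigned l (twist t r w) :=
  ((isSigned_s0_pow (by omega) t).mul (isSigned_coe w)).mul (isSigned_s0_pow (by omega) r)

lemma twist_injective {t r : ℕ} {w w' : WD l} (h : twist t r w = twist t r w') : w = w' := by
  rw [twist, twist, mul_left_inj, mul_right_inj] at h
  exact Subtype.ext h

lemma twist_inv (t r : ℕ) (w : WD l) : (twist t r w)⁻¹ = twist r t w⁻¹ := by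
  rw [twist, mul_inv_rev, mul_inv_rev, s0_pow_inv, s0_pow_inv, twist, mul_assoc]
  rfl

lemma twist_self_mul (t r : ℕ) (x w : WD l) : twist t r (x * w) = twist t t x * twist t r w := by
  simp only [twist, Subgroup.coe_mul]
  rw [show s0 ^ t * (x : Equiv.Perm ℤ) * s0 ^ t * (s0 ^ t * w * s0 ^ r) =
    s0 ^ t * x * (s0 ^ t * s0 ^ t) * w * s0 ^ r by group, s0_pow_mul_self]
  group

lemma twist_self_one (t : ℕ) : twist t t (1 : WD l) = 1 := by
  rw [twist, Subgroup.coe_one, mul_one, s0_pow_mul_self]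

lemma twist_sW (t : ℕ) {i : ℤ} (h : 1 ≤ i ∧ i < l) : twist t t (sW (aNode t i h)) = sPerm i := by
  rw [twist, coe_sW, s0_pow_mul_sPerm_aNode, mul_assoc, s0_pow_mul_self, mul_one]

lemma twist_sW_mul (t r : ℕ) {i : ℤ} (h : 1 ≤ i ∧ i < l) (w : WD l) :
    twist t r (sW (aNode t i h) * w) = sPerm i * twist t r w := by
  rw [twist_self_mul, twist_sW]

lemma twist_mul_sW (t r : ℕ) {i : ℤ} (h : 1 ≤ i ∧ i < l) (w : WD l) :
    twist t r (w * sW (aNode r i h)) = twist t r w * sPerm i := by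
  rw [← inv_inj, twist_inv, mul_inv_rev, mul_inv_rev, sW_inv, twist_sW_mul, twist_inv,
    sPerm_eq_aNode_zero h, sPerm_inv]

lemma two_mul_len_eq_twist (hl : 2 ≤ l) (t r : ℕ) (w : WD l) :
    2 * len w = invCard l (twist t r w) := by
  rw [twist, invCard_mul_s0_pow ((isSigned_s0_pow (by omega) t).mul (isSigned_coe w)),
    invCard_s0_pow_mul, two_mul_len]

lemma len_sW_aNode_mul_of_lt (hl : 2 ≤ l) {t : ℕ} (r : ℕ) {w : WD l} {i : ℤ} (h : 1 ≤ i ∧ i < l)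
    (hd : (twist t r w)⁻¹ i < (twist t r w)⁻¹ (i + 1)) :
    len (sW (aNode t i h) * w) = len w + 1 := by
  have h1 := invCard_sPerm_mul_of_lt (isSigned_twist hl t r w) (aNode 0 i h)
    (by rwa [lo_aNode_zero h, hi_aNode_zero h])
  rw [← sPerm_eq_aNode_zero h, ← twist_sW_mul t r h, ← two_mul_len_eq_twist hl,
    ← two_mul_len_eq_twist hl] at h1
  omega

lemma len_sW_aNode_mul_of_gt (hl : 2 ≤ l) {t : ℕ} (r : ℕ) {w : WD l} {i : ℤ} (h : 1 ≤ i ∧ i < l)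
    (hd : (twist t r w)⁻¹ (i + 1) < (twist t r w)⁻¹ i) :
    len (sW (aNode t i h) * w) + 1 = len w := by
  have h1 := invCard_sPerm_mul_of_gt (isSigned_twist hl t r w) (aNode 0 i h)
    (by rwa [lo_aNode_zero h, hi_aNode_zero h])
  rw [← sPerm_eq_aNode_zero h, ← twist_sW_mul t r h, ← two_mul_len_eq_twist hl,
    ← two_mul_len_eq_twist hl] at h1
  omega

lemma len_sW_aNode_mul_lt_iff (hl : 2 ≤ l) {t : ℕ} (r : ℕ) {w : WD l} {i : ℤ}
    (h : 1 ≤ i ∧ i < l) : len (sW (aNode t i h) * w) < len w ↔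
      (twist t r w)⁻¹ (i + 1) < (twist t r w)⁻¹ i := by
  rcases lt_trichotomy ((twist t r w)⁻¹ i) ((twist t r w)⁻¹ (i + 1)) with hd | hd | hd
  · have := len_sW_aNode_mul_of_lt hl r h hd
    omega
  · have := (twist t r w)⁻¹.injective hd
    omega
  · have := len_sW_aNode_mul_of_gt hl r h hd
    omega

lemma len_mul_sW_aNode_lt_iff (hl : 2 ≤ l) (t : ℕ) {r : ℕ} {w : WD l} {i : ℤ}
    (h : 1 ≤ i ∧ i < l) : len (w * sW (aNode r i h)) < len w ↔
      (twist t r w) (i + 1) < (twist t r w) i := by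
  rw [len_mul_sW, ← len_inv w, len_sW_aNode_mul_lt_iff hl t, ← twist_inv, inv_inv]

lemma perm_lt_succ_of_not_lt {g : Equiv.Perm ℤ} {i : ℤ} (h : ¬ g (i + 1) < g i) :
    g i < g (i + 1) := by
  refine lt_of_le_of_ne (not_lt.mp h) fun he => ?_
  have := g.injective he
  omega

/-! ### Parabolic subgroups and double cosets -/

lemma negCount_twist_parab_mul {t r : ℕ} {x : WD l} (hx : x ∈ parab (Oset l t)) (w : WD l) :
    negCount l (twist t r (x * w)) = negCount l (twist t r w) := by
  induction hx using Subgroup.closure_induction generalizing w with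
  | mem x hx =>
    obtain ⟨j, hj, rfl⟩ := hx
    obtain ⟨i, h, rfl⟩ := mem_Oset_iff.mp hj
    rw [twist_sW_mul, sPerm_eq_aNode_zero h, negCount_sPerm_mul _ (by rw [lo_aNode_zero]; exact h.1)]
  | one => rw [one_mul]
  | mul x y _ _ hx hy => rw [mul_assoc, hx, hy]
  | inv x _ hx => rw [← hx (x⁻¹ * w), mul_inv_cancel_left]

lemma negCount_twist_mul_parab (hl : 2 ≤ l) {t r : ℕ} {y : WD l} (hy : y ∈ parab (Oset l r))
    (w : WD l) : negCount l (twist t r (w * y)) = negCount l (twist t r w) := by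
  rw [← negCount_inv (isSigned_twist hl _ _ _), twist_inv, mul_inv_rev,
    negCount_twist_parab_mul (inv_mem hy), ← twist_inv, negCount_inv (isSigned_twist hl _ _ _)]

lemma sW_mem_parab {I : Set (Node l)} {i : Node l} (h : i ∈ I) : sW i ∈ parab I :=
  Subgroup.subset_closure ⟨i, h, rfl⟩

lemma mem_parab_Oset_iff (hl : 2 ≤ l) {t : ℕ} {w : WD l} :
    w ∈ parab (Oset l t) ↔ negCount l (twist t t w) = 0 := by
  constructor
  · intro h
    have := negCount_twist_parab_mul (r := t) h 1
    rwa [mul_one, twist_self_one, negCount_one] at this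
  · intro h
    generalize hn : len w = n
    induction n using Nat.strong_induction_on generalizing w with
    | _ n ih =>
      by_cases hd : ∃ i : ℤ, ∃ hi : 1 ≤ i ∧ i < l, len (sW (aNode t i hi) * w) < len w
      · obtain ⟨i, hi, hlt⟩ := hd
        have h1 := ih _ (by omega) (w := sW (aNode t i hi) * w)
          (by rw [negCount_twist_parab_mul (sW_mem_parab (aNode_mem_Oset t hi)), h]) rfl
        have := mul_mem (sW_mem_parab (aNode_mem_Oset t hi)) h1
        rwa [sW_mul_cancel_left] at this
      · push Not at hd
        have hs := isSigned_twist hl t t w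
        have := hs.inv.eq_one_of_increasing (fun i h1 h2 => perm_lt_succ_of_not_lt fun h3 =>
          absurd ((len_sW_aNode_mul_lt_iff hl t ⟨h1, h2⟩).mpr h3) (not_lt.mpr (hd i ⟨h1, h2⟩)))
          (by rw [negCount_inv hs, h])
        rw [inv_eq_one, ← twist_self_one t] at this
        rw [twist_injective this]
        exact one_mem _

lemma twist_dW {n : ℕ} (hn : n ≤ l) : twist n 0 (dW hn) = dPerm n := by
  rw [twist, pow_zero, mul_one]
  change s0 ^ n * (s0 ^ n * dPerm n) = _
  rw [← mul_assoc, s0_pow_mul_self, one_mul]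

lemma negCount_dPerm {n : ℕ} (hn : n ≤ l) : negCount l (dPerm n) = n := by
  have : (Finset.Icc (1 : ℤ) l).filter (fun z => dPerm n z < 0) = Finset.Icc (1 : ℤ) n := by
    ext z
    rw [Finset.mem_filter, Finset.mem_Icc, Finset.mem_Icc, dPerm_apply]
    split_ifs <;> omega
  rw [negCount, this, Int.card_Icc]
  omega

/-- The double cosets of `W_(O±)` and `W_(O+)` are given by the number of minus signs. -/
lemma mem_dcoset_iff (hl : 2 ≤ l) {n : ℕ} (hn : n ≤ l) {w : WD l} :
    w ∈ dcoset (Oset l n) (dW hn) (Oplus l) ↔ negCount l (twist n 0 w) = n := by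
  rw [dcoset, DoubleCoset.mem_doubleCoset, ← Oset_zero]
  constructor
  · rintro ⟨x, hx, y, hy, rfl⟩
    rw [negCount_twist_mul_parab hl hy, negCount_twist_parab_mul hx, twist_dW, negCount_dPerm hn]
  · intro h
    generalize hm : len w = m
    induction m using Nat.strong_induction_on generalizing w with
    | _ m ih =>
      by_cases hd : ∃ i : ℤ, ∃ hi : 1 ≤ i ∧ i < l, len (sW (aNode n i hi) * w) < len w
      · obtain ⟨i, hi, hlt⟩ := hd
        obtain ⟨x, hx, y, hy, he⟩ := ih _ (by omega) (w := sW (aNode n i hi) * w)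
          (by rw [negCount_twist_parab_mul (sW_mem_parab (aNode_mem_Oset n hi)), h]) rfl
        refine ⟨_, mul_mem (sW_mem_parab (aNode_mem_Oset n hi)) hx, y, hy, ?_⟩
        rw [mul_assoc, mul_assoc, ← mul_assoc x, ← he, sW_mul_cancel_left]
      by_cases hd' : ∃ i : ℤ, ∃ hi : 1 ≤ i ∧ i < l, len (w * sW (aNode 0 i hi)) < len w
      · obtain ⟨i, hi, hlt⟩ := hd'
        obtain ⟨x, hx, y, hy, he⟩ := ih _ (by omega) (w := w * sW (aNode 0 i hi))
          (by rw [negCount_twist_mul_parab hl (sW_mem_parab (aNode_mem_Oset 0 hi)), h]) rfl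
        refine ⟨x, hx, _, mul_mem hy (sW_mem_parab (aNode_mem_Oset 0 hi)), ?_⟩
        rw [← mul_assoc, ← he, sW_mul_cancel_right]
      push Not at hd hd'
      have hs := isSigned_twist hl n 0 w
      have := hs.eq_dPerm (fun i h1 h2 => perm_lt_succ_of_not_lt fun h3 =>
          absurd ((len_sW_aNode_mul_lt_iff hl 0 ⟨h1, h2⟩).mpr h3) (not_lt.mpr (hd i ⟨h1, h2⟩)))
        (fun i h1 h2 => perm_lt_succ_of_not_lt fun h3 =>
          absurd ((len_mul_sW_aNode_lt_iff hl n ⟨h1, h2⟩).mpr h3) (not_lt.mpr (hd' i ⟨h1, h2⟩)))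
      rw [h, ← twist_dW hn] at this
      exact ⟨1, one_mem _, 1, one_mem _, by rw [twist_injective this, one_mul, mul_one]⟩

lemma longest_spec (I : Set (Node l)) :
    longest I ∈ parab I ∧ ∀ w' ∈ parab I, len w' ≤ len (longest I) := by
  refine Classical.epsilon_spec
    (p := fun w : WD l => w ∈ parab I ∧ ∀ w' ∈ parab I, len w' ≤ len w) ?_
  obtain ⟨w, hw, h⟩ := Set.exists_max_image (parab I : Set (WD l)) len (Set.toFinite _)
    ⟨1, one_mem _⟩
  exact ⟨w, hw, h⟩

lemma len_sW_mul_longest_lt {I : Set (Node l)} {i : Node l} (h : i ∈ I) :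
    len (sW i * longest I) < len (longest I) := by
  have h1 := (longest_spec I).2 _ (mul_mem (sW_mem_parab h) (longest_spec I).1)
  have h2 := len_sW_mul_cases (longest I) i
  omega

/-- An element of `W_(O±)` with all possible left descents is the longest one. -/
lemma twist_eq_revPerm (hl : 2 ≤ l) {t : ℕ} {w : WD l} (hw : w ∈ parab (Oset l t))
    (hd : ∀ i : ℤ, ∀ h : 1 ≤ i ∧ i < l, len (sW (aNode t i h) * w) < len w) :
    twist t t w = revPerm l 0 := by
  have hs := isSigned_twist hl t t w
  have h0 := (mem_parab_Oset_iff hl).mp hw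
  rw [← negCount_inv hs, negCount, Finset.card_eq_zero, Finset.filter_eq_empty_iff] at h0
  rw [← inv_inj, revPerm_inv (Nat.zero_le l)]
  refine hs.inv.eq_revPerm (Nat.zero_le l) (fun i h1 h2 _ => ?_) (fun i h1 h2 => by
    push_cast at h2; omega) (fun i h1 h2 => ?_)
  · exact (len_sW_aNode_mul_lt_iff hl t ⟨h1, h2⟩).mp (hd i ⟨h1, h2⟩)
  · push_cast at *
    have e1 := @h0 i (Finset.mem_Icc.mpr ⟨by omega, h2⟩)
    have e2 := hs.inv.mem_range (z := i) (by omega) h2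
    have e3 := hs.inv.ne_zero (z := i) (by omega)
    omega

lemma twist_longest (hl : 2 ≤ l) (t : ℕ) : twist t t (longest (Oset l t)) = revPerm l 0 :=
  twist_eq_revPerm hl (longest_spec _).1 fun _ h => len_sW_mul_longest_lt (aNode_mem_Oset t h)

/-- The left redundancy of the double coset of `dₙ` omits only the `n`-th node. -/
lemma mem_leftRed_iff {n : ℕ} (hn : n ≤ l) {j : Node l} :
    j ∈ leftRed (Oset l n) (dW hn) (Oplus l) ↔
      ∃ i : ℤ, ∃ h : 1 ≤ i ∧ i < l, j = aNode n i h ∧ i ≠ n := by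
  rw [leftRed, ← Oset_zero]
  constructor
  · rintro ⟨h1, k, hk, he⟩
    obtain ⟨i, h, rfl⟩ := mem_Oset_iff.mp h1
    obtain ⟨k, hk', rfl⟩ := mem_Oset_iff.mp hk
    refine ⟨i, h, rfl, ?_⟩
    rintro rfl
    have h2 := congrArg (twist n 0) he
    rw [twist_sW_mul, twist_mul_sW, twist_dW] at h2
    have h3 := Equiv.congr_fun h2 (n + 1)
    have a1 : dPerm n (n + 1) = n + 1 := by
      rw [dPerm_apply, if_neg (by omega), if_neg (by omega)]
    have a2 : sPerm n ((n : ℤ) + 1) = n := by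
      rw [sPerm_apply_of_pos h.1, if_neg (by omega), if_pos rfl]
    have a3 : 1 ≤ sPerm k ((n : ℤ) + 1) := by
      rw [sPerm_apply_of_pos hk'.1]
      split_ifs <;> omega
    rw [Equiv.Perm.mul_apply, Equiv.Perm.mul_apply, a1, a2] at h3
    generalize sPerm k ((n : ℤ) + 1) = z at a3 h3
    rw [dPerm_apply] at h3
    split_ifs at h3 <;> omega
  · rintro ⟨i, h, rfl, hne⟩
    refine ⟨aNode_mem_Oset n h, ?_⟩
    have key : ∀ k : ℤ, ∀ hk : 1 ≤ k ∧ k < l, (∀ z : ℤ, 1 ≤ z → z ≤ l →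
        sPerm i (dPerm n z) = dPerm n (sPerm k z)) →
        ∃ j ∈ Oset l 0, sW (aNode n i h) * dW hn = dW hn * sW j := by
      intro k hk hz
      refine ⟨aNode 0 k hk, aNode_mem_Oset 0 hk, twist_injective (t := n) (r := 0) ?_⟩
      rw [twist_sW_mul, twist_mul_sW, twist_dW]
      have hd := isSigned_dPerm hn
      refine IsSigned.ext (l := l) ?_ ?_ hz
      · rw [sPerm_eq_aNode_zero h]; exact (isSigned_sPerm _).mul hd
      · rw [sPerm_eq_aNode_zero hk]; exact hd.mul (isSigned_sPerm _)
    have d1 : ∀ z : ℤ, 1 ≤ z → z ≤ n → dPerm n z = z - (n + 1) := fun z h1 h2 => by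
      rw [dPerm_apply, if_pos ⟨h1, h2⟩]
    have d2 : ∀ z : ℤ, n < z → dPerm n z = z := fun z h1 => by
      rw [dPerm_apply, if_neg (by omega), if_neg (by omega)]
    by_cases hi : i < n
    · refine key (n - i) (by omega) fun z hz1 hz2 => ?_
      have e := sPerm_apply_of_pos (i := n - i) (by omega) z
      rcases le_or_gt z n with hz | hz
      · rw [d1 z hz1 hz, sPerm_apply_of_pos h.1, d1 _ (by split_ifs at e <;> omega)
          (by split_ifs at e <;> omega), e]
        split_ifs <;> omega
      · rw [d2 z hz, sPerm_apply_of_pos h.1, d2 _ (by split_ifs at e <;> omega), e]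
        split_ifs <;> omega
    · refine key i h fun z hz1 hz2 => ?_
      have e := sPerm_apply_of_pos h.1 z
      rcases le_or_gt z n with hz | hz
      · rw [d1 z hz1 hz, sPerm_apply_of_pos h.1, d1 _ (by split_ifs at e <;> omega)
          (by split_ifs at e <;> omega), e]
        split_ifs <;> omega
      · rw [d2 z hz, d2 _ (by split_ifs at e <;> omega)]

/-- The longest element of `W_L`, for the left redundancy `L` of `dₙ`, reverses both `x₁, …, xₙ` and
`xₙ₊₁, …, x_l`. -/
lemma twist_longest_leftRed (hl : 2 ≤ l) {n : ℕ} (hn : n ≤ l) :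
    twist n n (longest (leftRed (Oset l n) (dW hn) (Oplus l))) = revPerm l n := by
  set L := leftRed (Oset l n) (dW hn) (Oplus l) with hL
  have hs := isSigned_twist hl n n (longest L)
  have hpres : ∀ x ∈ parab L, ∀ z : ℤ, (1 ≤ twist n n x z ∧ twist n n x z ≤ n ↔ 1 ≤ z ∧ z ≤ n) ∧
      (n < twist n n x z ∧ twist n n x z ≤ l ↔ n < z ∧ z ≤ l) := by
    intro x hx
    induction hx using Subgroup.closure_induction with
    | mem x hx =>
      obtain ⟨j, hj, rfl⟩ := hx
      obtain ⟨i, h, rfl, hne⟩ := (mem_leftRed_iff hn).mp hj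
      intro z
      rw [twist_sW, sPerm_apply_of_pos h.1]
      split_ifs <;> omega
    | one => intro z; rw [twist_self_one]; exact ⟨Iff.rfl, Iff.rfl⟩
    | mul x y _ _ hx hy =>
      intro z
      rw [twist_self_mul, Equiv.Perm.mul_apply, (hx _).1, (hx _).2]
      exact hy z
    | inv x _ hx =>
      intro z
      rw [← twist_inv, ← (hx _).1, ← (hx ((twist n n x)⁻¹ z)).2, perm_apply_inv]
      exact ⟨Iff.rfl, Iff.rfl⟩
  have hp := hpres _ (inv_mem (longest_spec L).1)
  rw [← twist_inv] at hp
  rw [← inv_inj, revPerm_inv hn]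
  refine hs.inv.eq_revPerm hn (fun i h1 h2 hne => ?_) (fun i h1 h2 => (hp i).1.mpr ⟨h1, h2⟩)
    (fun i h1 h2 => (hp i).2.mpr ⟨h1, h2⟩)
  exact (len_sW_aNode_mul_lt_iff hl n ⟨h1, h2⟩).mp
    (len_sW_mul_longest_lt ((mem_leftRed_iff hn).mpr ⟨i, ⟨h1, h2⟩, rfl, hne⟩))

/-- The element called longest in the double coset of `dₙ` is indeed the one of maximal length. -/
lemma twist_dcMax (hl : 2 ≤ l) {n : ℕ} (hn : n ≤ l) :
    twist n 0 (dcMax (Oset l n) (dW hn) (Oplus l)) = maxPerm l n := by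
  have e1 := twist_longest hl n
  have e2 := twist_longest_leftRed hl hn
  have e3 := twist_longest hl 0
  have e4 := twist_dW hn
  rw [Oset_zero] at e3
  have e5 : twist n 0 (dW hn * longest (Oplus l)) = dPerm n * revPerm l 0 := by
    rw [← e3, ← e4]
    simp only [twist, pow_zero, mul_one, one_mul, Subgroup.coe_mul, mul_assoc]
  rw [dcMax, mul_assoc, mul_assoc, twist_self_mul, twist_self_mul, ← twist_inv, e1, e2, e5,
    revPerm_inv hn]
  have h0 := isSigned_revPerm (Nat.zero_le l)
  refine IsSigned.ext (l := l) (h0.mul ((isSigned_revPerm hn).mul ((isSigned_dPerm hn).mul h0)))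
    (isSigned_maxPerm hn) fun z h1 h2 => ?_
  have a1 : revPerm l 0 z = l + 1 - z := by
    rw [revPerm_apply (Nat.zero_le l)]
    push_cast
    split_ifs <;> omega
  rw [Equiv.Perm.mul_apply, Equiv.Perm.mul_apply, Equiv.Perm.mul_apply, a1, maxPerm_apply hn,
    dPerm_apply]
  by_cases hz : z ≤ l - n
  · rw [if_neg (by omega), if_neg (by omega), if_pos ⟨h1, hz⟩, revPerm_apply hn,
      revPerm_apply (Nat.zero_le l)]
    push_cast
    split_ifs <;> omega
  · rw [if_pos (by omega), if_neg (by omega), if_pos (by omega), revPerm_apply hn,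
      revPerm_apply (Nat.zero_le l)]
    push_cast
    split_ifs <;> omega

/-! ### Lengths of the distinguished elements -/

/-- The pairs `i < j` in `[a, b]`. -/
def posPairs (a b : ℤ) : Finset (ℤ × ℤ) :=
  (Finset.Icc a b ×ˢ Finset.Icc a b).filter fun p => p.1 < p.2

lemma mem_posPairs {a b : ℤ} {p : ℤ × ℤ} :
    p ∈ posPairs a b ↔ a ≤ p.1 ∧ p.1 < p.2 ∧ p.2 ≤ b := by
  rw [posPairs, Finset.mem_filter, Finset.mem_product, Finset.mem_Icc, Finset.mem_Icc]
  omega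

lemma card_posPairs {a b : ℤ} {m : ℕ} (h : b = a + m - 1) : (posPairs a b).card = m.choose 2 := by
  induction m generalizing b with
  | zero =>
    rw [Nat.choose_eq_zero_of_lt (by norm_num), Finset.card_eq_zero,
      Finset.eq_empty_iff_forall_notMem]
    intro p hp
    rw [mem_posPairs] at hp
    push_cast at h
    omega
  | succ m ih =>
    have : posPairs a b = posPairs a (b - 1) ∪
        (Finset.Icc a (b - 1)).map ⟨fun i => (i, b), fun i j h => (Prod.mk.inj h).1⟩ := by
      ext ⟨c, d⟩
      simp only [mem_posPairs, Finset.mem_union, Finset.mem_map, Finset.mem_Icc]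
      constructor
      · rintro ⟨h1, h2, h3⟩
        by_cases hd : d = b
        · exact Or.inr ⟨c, by omega, Prod.ext rfl hd.symm⟩
        · exact Or.inl (by omega)
      · rintro (h1 | ⟨i, h1, he⟩)
        · omega
        · obtain ⟨rfl, rfl⟩ := Prod.mk.inj he
          omega
    rw [this, Finset.card_union_of_disjoint, ih (by push_cast at h; omega), Finset.card_map,
      Int.card_Icc, Nat.choose_succ_succ' m 1, Nat.choose_one_right]
    · change _ = m + m.choose 2
      push_cast at h
      omega
    · rw [Finset.disjoint_left]
      rintro ⟨c, d⟩ hp hq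
      rw [mem_posPairs] at hp
      rw [Finset.mem_map] at hq
      obtain ⟨i, -, he⟩ := hq
      have := (Prod.mk.inj he).2
      dsimp only at hp this
      omega

/-- Each inversion is one of the pairs `i < j` of positive indices, or such a pair with the sign
of `i` changed, or the negative of one of these. -/
lemma invCard_eq (g : Equiv.Perm ℤ) (hg : IsSigned l g) :
    invCard l g = 2 * (((posPairs 1 l).filter fun p => g⁻¹ p.2 < g⁻¹ p.1).card +
      ((posPairs 1 l).filter fun p => g⁻¹ p.2 < -g⁻¹ p.1).card) := by
  set S := (posPairs 1 l).filter fun p => g⁻¹ p.2 < g⁻¹ p.1 with hS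
  set T := (posPairs 1 l).filter fun p => g⁻¹ p.2 < -g⁻¹ p.1 with hT
  have hn := hg.inv.map_neg
  have mS : ∀ c d : ℤ, (c, d) ∈ S ↔ (1 ≤ c ∧ c < d ∧ d ≤ l) ∧ g⁻¹ d < g⁻¹ c := fun c d => by
    rw [hS, Finset.mem_filter, mem_posPairs]
  have mT : ∀ c d : ℤ, (c, d) ∈ T ↔ (1 ≤ c ∧ c < d ∧ d ≤ l) ∧ g⁻¹ d < -g⁻¹ c := fun c d => by
    rw [hT, Finset.mem_filter, mem_posPairs]
  let e1 : ℤ × ℤ ≃ ℤ × ℤ := ⟨fun p => (-p.2, -p.1), fun p => (-p.2, -p.1),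
    fun p => by simp, fun p => by simp⟩
  let e2 : ℤ × ℤ ≃ ℤ × ℤ := ⟨fun p => (-p.1, p.2), fun p => (-p.1, p.2),
    fun p => by simp, fun p => by simp⟩
  let e3 : ℤ × ℤ ≃ ℤ × ℤ := ⟨fun p => (-p.2, p.1), fun p => (p.2, -p.1),
    fun p => by simp, fun p => by simp⟩
  have m1 : ∀ c d : ℤ, (c, d) ∈ S.map e1.toEmbedding ↔ (-d, -c) ∈ S := fun c d => by
    rw [Finset.mem_map_equiv]; rfl
  have m2 : ∀ c d : ℤ, (c, d) ∈ T.map e2.toEmbedding ↔ (-c, d) ∈ T := fun c d => by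
    rw [Finset.mem_map_equiv]; rfl
  have m3 : ∀ c d : ℤ, (c, d) ∈ T.map e3.toEmbedding ↔ (d, -c) ∈ T := fun c d => by
    rw [Finset.mem_map_equiv]; rfl
  have key : invSet l g = (S ∪ S.map e1.toEmbedding) ∪
      (T.map e2.toEmbedding ∪ T.map e3.toEmbedding) := by
    ext ⟨c, d⟩
    rw [Finset.mem_union, Finset.mem_union, Finset.mem_union, m1, m2, m3, mS, mS, mT, mT, mem_invSet,
      hn, hn]
    dsimp only
    omega
  rw [invCard, key, Finset.card_union_of_disjoint, Finset.card_union_of_disjoint,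
    Finset.card_union_of_disjoint, Finset.card_map, Finset.card_map, Finset.card_map]
  · ring
  all_goals
    rw [Finset.disjoint_left]
    rintro ⟨c, d⟩ hp hq
    simp only [Finset.mem_union, m1, m2, m3, mS, mT] at hp hq
    omega

lemma filter_posPairs_eq {P : ℤ × ℤ → Prop} [DecidablePred P] {S : Finset (ℤ × ℤ)}
    (h : ∀ c d : ℤ, (1 ≤ c ∧ c < d ∧ d ≤ l) ∧ P (c, d) ↔ (c, d) ∈ S) :
    (posPairs 1 l).filter P = S := by
  ext ⟨c, d⟩
  rw [Finset.mem_filter, mem_posPairs, ← h]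

lemma invCard_revPerm {n : ℕ} (hn : n ≤ l) :
    invCard l (revPerm l n) = 2 * (n.choose 2 + (l - n).choose 2) := by
  rw [invCard_eq _ (isSigned_revPerm hn), revPerm_inv hn,
    filter_posPairs_eq (S := posPairs 1 n ∪ posPairs (n + 1) l),
    filter_posPairs_eq (S := ∅), Finset.card_union_of_disjoint, card_posPairs (m := n) (by ring),
    card_posPairs (m := l - n) (by omega), Finset.card_empty, add_zero]
  · rw [Finset.disjoint_left]
    intro p hp hq
    rw [mem_posPairs] at hp hq
    omega
  · intro c d
    rw [revPerm_apply hn, revPerm_apply hn]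
    simp only [Finset.notMem_empty, iff_false]
    split_ifs <;> omega
  · intro c d
    rw [revPerm_apply hn, revPerm_apply hn, Finset.mem_union, mem_posPairs, mem_posPairs]
    dsimp only
    split_ifs <;> omega

lemma invCard_dPerm {n : ℕ} (hn : n ≤ l) : invCard l (dPerm n) = 2 * n.choose 2 := by
  rw [invCard_eq _ (isSigned_dPerm hn), dPerm_inv,
    filter_posPairs_eq (S := ∅), filter_posPairs_eq (S := posPairs 1 n),
    card_posPairs (m := n) (by ring), Finset.card_empty, zero_add]
  · intro c d
    rw [dPerm_apply, dPerm_apply, mem_posPairs]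
    dsimp only
    split_ifs <;> omega
  · intro c d
    rw [dPerm_apply, dPerm_apply]
    simp only [Finset.notMem_empty, iff_false]
    split_ifs <;> omega

lemma invCard_maxPerm {n : ℕ} (hn : n ≤ l) :
    invCard l (maxPerm l n) + 2 * (l - n).choose 2 = 4 * l.choose 2 := by
  have hsub : posPairs 1 (l - n) ⊆ posPairs 1 l := by
    intro p hp
    rw [mem_posPairs] at *
    omega
  have h1 := Finset.card_sdiff_add_card_eq_card hsub
  have c1 : (posPairs 1 (l : ℤ)).card = l.choose 2 := card_posPairs (by ring)
  have c2 : (posPairs 1 ((l : ℤ) - n)).card = (l - n).choose 2 := card_posPairs (by omega)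
  rw [c1, c2] at h1
  rw [invCard_eq _ (isSigned_maxPerm hn), maxPerm_inv hn,
    filter_posPairs_eq (S := posPairs 1 l),
    filter_posPairs_eq (S := posPairs 1 l \ posPairs 1 (l - n)), c1]
  · omega
  · intro c d
    rw [maxPerm_apply hn, maxPerm_apply hn, Finset.mem_sdiff, mem_posPairs, mem_posPairs]
    dsimp only
    split_ifs <;> omega
  · intro c d
    rw [maxPerm_apply hn, maxPerm_apply hn, mem_posPairs]
    dsimp only
    split_ifs <;> omega

lemma len_longest_Oset (hl : 2 ≤ l) (t : ℕ) : len (longest (Oset l t)) = l.choose 2 := by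
  have h1 := two_mul_len_eq_twist hl t t (longest (Oset l t))
  have h2 := invCard_revPerm (Nat.zero_le l)
  rw [twist_longest hl, h2, Nat.choose_eq_zero_of_lt (by norm_num), zero_add, Nat.sub_zero] at h1
  omega

lemma len_dcMax (hl : 2 ≤ l) {n : ℕ} (hn : n ≤ l) :
    len (dcMax (Oset l n) (dW hn) (Oplus l)) + (l - n).choose 2 = 2 * l.choose 2 := by
  have h1 := two_mul_len_eq_twist hl n 0 (dcMax (Oset l n) (dW hn) (Oplus l))
  have h2 := invCard_maxPerm hn
  rw [twist_dcMax hl] at h1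
  omega

lemma dcLen_eq (hl : 2 ≤ l) {n : ℕ} (hn : n ≤ l) :
    dcLen (Oset l n) (dW hn) (Oplus l) = len (dcMax (Oset l n) (dW hn) (Oplus l)) := by
  have h1 := two_mul_len_eq_twist hl n n (longest (leftRed (Oset l n) (dW hn) (Oplus l)))
  rw [twist_longest_leftRed hl, invCard_revPerm hn] at h1
  have h2 := two_mul_len_eq_twist hl n 0 (dW hn)
  rw [twist_dW, invCard_dPerm hn] at h2
  have h3 := len_dcMax hl hn
  have h4 := len_longest_Oset hl n
  have h5 := len_longest_Oset hl 0
  rw [Oset_zero] at h5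
  rw [dcLen]
  omega

/-! ### The Bruhat order -/

lemma bruhatLT_sW_mul {w : WD l} {i : Node l} (h : len w < len (sW i * w)) :
    BruhatLT w (sW i * w) :=
  Relation.TransGen.single ⟨⟨w⁻¹, i, by group⟩, h⟩

lemma bruhatLT_mul_sW {w : WD l} {i : Node l} (h : len w < len (w * sW i)) :
    BruhatLT w (w * sW i) :=
  Relation.TransGen.single ⟨⟨1, i, by group⟩, h⟩

lemma BruhatLT.len_lt {y w : WD l} (h : BruhatLT y w) : len y < len w := by
  induction h with
  | single h => exact h.2
  | tail _ h ih => exact ih.trans h.2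

/-- All elements with at most `n` minus signs lie below the longest element with `n` minus signs:
one can go up by left and right multiplication with simple reflections. -/
lemma eq_dcMax_or_bruhatLT (hl : 2 ≤ l) {n : ℕ} (hn : n ≤ l) (y : WD l)
    (hy : negCount l (twist n 0 y) ≤ n) :
    y = dcMax (Oset l n) (dW hn) (Oplus l) ∨
      BruhatLT y (dcMax (Oset l n) (dW hn) (Oplus l)) := by
  have hbound : ∀ w : WD l, len w ≤ ∑ w : WD l, len w := fun w =>
    Finset.single_le_sum (f := fun w : WD l => len w) (fun _ _ => Nat.zero_le _)
      (Finset.mem_univ w)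
  generalize (∑ w : WD l, len w) = N at hbound
  generalize hk : N - len y = k
  induction k using Nat.strong_induction_on generalizing y with
  | _ k ih =>
    have hb := hbound y
    by_cases hd : ∃ i : ℤ, ∃ hi : 1 ≤ i ∧ i < l, ¬ len (sW (aNode n i hi) * y) < len y
    · obtain ⟨i, hi, hd⟩ := hd
      have hlt : len y < len (sW (aNode n i hi) * y) := by
        have := len_sW_mul_cases y (aNode n i hi)
        omega
      have hb' := hbound (sW (aNode n i hi) * y)
      right
      rcases ih _ (by omega) (sW (aNode n i hi) * y)
        (by rwa [negCount_twist_parab_mul (sW_mem_parab (aNode_mem_Oset n hi))]) rfl with h | h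
      · rw [← h]; exact bruhatLT_sW_mul hlt
      · exact (bruhatLT_sW_mul hlt).trans h
    by_cases hd' : ∃ i : ℤ, ∃ hi : 1 ≤ i ∧ i < l, ¬ len (y * sW (aNode 0 i hi)) < len y
    · obtain ⟨i, hi, hd'⟩ := hd'
      have hlt : len y < len (y * sW (aNode 0 i hi)) := by
        have := len_mul_sW_cases y (aNode 0 i hi)
        omega
      have hb' := hbound (y * sW (aNode 0 i hi))
      right
      rcases ih _ (by omega) (y * sW (aNode 0 i hi))
        (by rwa [negCount_twist_mul_parab hl (sW_mem_parab (aNode_mem_Oset 0 hi))]) rfl with h | h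
      · rw [← h]; exact bruhatLT_mul_sW hlt
      · exact (bruhatLT_mul_sW hlt).trans h
    push Not at hd hd'
    have hs := isSigned_twist hl n 0 y
    have hmax := hs.eq_maxPerm
      (fun i h1 h2 => (len_sW_aNode_mul_lt_iff hl 0 ⟨h1, h2⟩).mp (hd i ⟨h1, h2⟩))
      (fun i h1 h2 => (len_mul_sW_aNode_lt_iff hl n ⟨h1, h2⟩).mp (hd' i ⟨h1, h2⟩))
    have hpar : negCount l (twist n 0 y) % 2 = n % 2 := by
      have := negCount_s0_pow_mul_mod_two (by omega) (isSigned_coe y) n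
      have h2 := even_negCount_coe y
      rw [twist, pow_zero, mul_one]
      omega
    generalize hm : negCount l (twist n 0 y) = m at *
    rcases eq_or_ne m n with rfl | hne
    · left
      rw [← twist_dcMax hl hn] at hmax
      exact twist_injective hmax
    -- multiplying by `s₋₁` on the right adds two minus signs
    have hm2 : m + 2 ≤ n := by omega
    set j : Node l := ⟨-1, Or.inl ⟨rfl, hl⟩⟩ with hj
    have hlo : lo j = -1 := rfl
    have hhi : hi j = 2 := if_pos rfl
    have hy1 : ∀ z, (y : Equiv.Perm ℤ) z = (s0 ^ n) (maxPerm l m z) := by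
      intro z
      rw [← hmax, twist, pow_zero, mul_one, Equiv.Perm.mul_apply, ← Equiv.Perm.mul_apply,
        s0_pow_mul_self, Equiv.Perm.one_apply]
    have hlt : len y < len (y * sW j) := by
      have h1 := len_mul_sW_cases y j
      have h2 := len_mul_sW_lt_iff y j
      rw [hlo, hhi, hy1, hy1] at h2
      have e1 : maxPerm l m 2 = l - m - 1 := by
        rw [maxPerm_apply (by omega), if_pos (by omega)]; ring
      have e2 : maxPerm l m (-1) = -(l - m) := by
        rw [maxPerm_apply (by omega), if_neg (by omega), if_neg (by omega), if_pos (by omega)]; ring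
      rw [e1, e2, s0_pow_apply, s0_pow_apply] at h2
      have h3 : ¬ len (y * sW j) < len y := by
        rw [h2]
        split_ifs <;> omega
      omega
    have hneg : negCount l (twist n 0 (y * sW j)) ≤ n := by
      have h1 : twist n 0 (y * sW j) = twist n 0 y * sPerm j := by
        simp only [twist, pow_zero, mul_one, Subgroup.coe_mul, coe_sW, mul_assoc]
      have h2 : ((Finset.Icc (1 : ℤ) l).filter fun z => (twist n 0 (y * sW j)) z < 0) ⊆
          insert 1 (insert 2 ((Finset.Icc (1 : ℤ) l).filter fun z => (twist n 0 y) z < 0)) := by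
        intro z hz
        rw [Finset.mem_filter, h1, Equiv.Perm.mul_apply, sPerm_apply, hlo, hhi] at hz
        rw [Finset.mem_insert, Finset.mem_insert, Finset.mem_filter]
        by_contra hc
        push Not at hc
        obtain ⟨hz1, hz2⟩ := hz
        have hz3 := Finset.mem_Icc.mp hz1
        rw [if_neg (by omega), if_neg (by omega), if_neg (by omega), if_neg (by omega)] at hz2
        exact absurd (hc.2.2 hz1) (not_le.mpr hz2)
      have h3 := Finset.card_le_card h2
      have h4 := Finset.card_insert_le (1 : ℤ)
        (insert 2 ((Finset.Icc (1 : ℤ) l).filter fun z => (twist n 0 y) z < 0))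
      have h5 := Finset.card_insert_le (2 : ℤ)
        ((Finset.Icc (1 : ℤ) l).filter fun z => (twist n 0 y) z < 0)
      rw [negCount] at hm ⊢
      omega
    have hb' := hbound (y * sW j)
    right
    rcases ih _ (by omega) (y * sW j) hneg rfl with h | h
    · rw [← h]; exact bruhatLT_mul_sW hlt
    · exact (bruhatLT_mul_sW hlt).trans h

/-! ### The Hecke algebra -/

lemma exists_left_descent {w : WD l} (h : w ≠ 1) : ∃ i, len (sW i * w) + 1 = len w := by
  obtain ⟨ω, h1, h2⟩ := exists_reduced_word w
  cases ω with
  | nil => exact absurd h1.symm h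
  | cons i ω =>
    refine ⟨i, ?_⟩
    rw [List.map_cons, List.prod_cons] at h1
    have h3 : sW i * w = (ω.map sW).prod := by rw [← h1, sW_mul_cancel_left]
    have h4 := len_le_of_word h3.symm
    have h5 := len_sW_mul_cases w i
    rw [List.length_cons] at h2
    omega

lemma len_induction {P : WD l → Prop} (one : P 1)
    (step : ∀ i w, len (sW i * w) = len w + 1 → P w → P (sW i * w)) (w : WD l) : P w := by
  generalize hn : len w = n
  induction n generalizing w with
  | zero => rw [eq_one_of_len_eq_zero hn]; exact one
  | succ n ih =>
    obtain ⟨i, hi⟩ := exists_left_descent (w := w) (by rintro rfl; rw [len_one] at hn; omega)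
    have := step i (sW i * w) (by rw [sW_mul_cancel_left]; omega) (ih _ (by omega))
    rwa [sW_mul_cancel_left] at this

/-- The operator of right multiplication by `hⱼ`, in coordinates. -/
def rightOp (j : Node l) : Module.End A (WD l → A) where
  toFun v w := v (w * sW j) - if len (w * sW j) < len w then (qpow 1 - qpow (-1)) * v w else 0
  map_add' v v' := by funext w; simp only [Pi.add_apply]; split_ifs <;> ring
  map_smul' c v := by
    funext w; simp only [Pi.smul_apply, smul_eq_mul, RingHom.id_apply]; split_ifs <;> ring

lemma heckeOp_apply (i : Node l) (v : WD l → A) (w : WD l) : heckeOp i v w =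
    v (sW i * w) - if len (sW i * w) < len w then (qpow 1 - qpow (-1)) * v w else 0 := rfl

lemma rightOp_apply (j : Node l) (v : WD l → A) (w : WD l) : rightOp j v w =
    v (w * sW j) - if len (w * sW j) < len w then (qpow 1 - qpow (-1)) * v w else 0 := rfl

/-- Left and right multiplications commute: this is the associativity of the Hecke algebra. -/
lemma heckeOp_rightOp (i j : Node l) (v : WD l → A) :
    heckeOp i (rightOp j v) = rightOp j (heckeOp i v) := by
  funext w
  simp only [heckeOp_apply, rightOp_apply, ← mul_assoc]
  by_cases h : sW i * w = w * sW j
  · have h1 : sW i * w * sW j = w := by rw [h, sW_mul_cancel_right]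
    have h2 : sW i * (w * sW j) = w := by rw [← h, sW_mul_cancel_left]
    rw [h1, h]
  · have h1 := descent_mul_sW_iff h
    have h2 := descent_mul_sW_iff (w := w⁻¹) (i := j) (j := i) fun h3 => h (by
      have := congrArg (fun x => x⁻¹) h3
      simpa only [mul_inv_rev, inv_inv, sW_inv] using this.symm)
    rw [← len_inv, ← len_inv (w⁻¹ * sW i), ← len_inv (sW j * w⁻¹), ← len_inv w⁻¹] at h2
    simp only [mul_inv_rev, inv_inv, sW_inv, ← mul_assoc] at h2
    simp only [h1, h2]
    split_ifs <;> ring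

lemma H_rightOp (x : H l) (j : Node l) (v : WD l → A) :
    (x : Module.End A (WD l → A)) (rightOp j v) =
      rightOp j ((x : Module.End A (WD l → A)) v) := by
  obtain ⟨x, hx⟩ := x
  induction hx using Algebra.adjoin_induction generalizing v with
  | mem x hx => obtain ⟨i, rfl⟩ := hx; exact heckeOp_rightOp i j v
  | algebraMap r => simp [Module.algebraMap_end_apply]
  | add x y _ _ hx hy =>
    change x _ + y _ = rightOp j (x v + y v)
    rw [map_add]
    exact congrArg₂ (· + ·) (hx v) (hy v)
  | mul x y _ _ hx hy =>
    change x (y _) = rightOp j (x (y v))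
    rw [show y (rightOp j v) = rightOp j (y v) from hy v]
    exact hx (y v)

open Classical in
/-- The vector of `h_w`. -/
def delta (w : WD l) : WD l → A := Pi.single w 1

open Classical in
lemma delta_apply (w y : WD l) : delta w y = if y = w then 1 else 0 := by
  rw [delta, Pi.single_apply]

lemma delta_self (w : WD l) : delta w w = 1 := by rw [delta_apply, if_pos rfl]

lemma delta_of_ne {w y : WD l} (h : y ≠ w) : delta w y = 0 := by rw [delta_apply, if_neg h]

lemma delta_congr {w y w' y' : WD l} (h : y = w ↔ y' = w') : delta w y = delta w' y' := by
  by_cases h1 : y = w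
  · rw [h1, h.mp h1, delta_self, delta_self]
  · rw [delta_of_ne h1, delta_of_ne fun h2 => h1 (h.mpr h2)]

lemma heckeOp_delta {i : Node l} {w : WD l} (h : len w < len (sW i * w)) :
    heckeOp i (delta w) = delta (sW i * w) := by
  funext y
  rw [heckeOp_apply]
  by_cases h1 : y = w
  · subst h1
    rw [if_neg (by omega), sub_zero]
    exact delta_congr eq_comm
  · rw [delta_of_ne h1, mul_zero, ite_self, sub_zero]
    refine delta_congr ⟨fun h => ?_, fun h => ?_⟩
    · rw [← h, sW_mul_cancel_left]
    · rw [h, sW_mul_cancel_left]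

lemma rightOp_delta {j : Node l} {w : WD l} (h : len w < len (w * sW j)) :
    rightOp j (delta w) = delta (w * sW j) := by
  funext y
  rw [rightOp_apply]
  by_cases h1 : y = w
  · subst h1
    rw [if_neg (by omega), sub_zero]
    exact delta_congr eq_comm
  · rw [delta_of_ne h1, mul_zero, ite_self, sub_zero]
    refine delta_congr ⟨fun h => ?_, fun h => ?_⟩
    · rw [← h, sW_mul_cancel_right]
    · rw [h, sW_mul_cancel_right]

/-- The vector of coefficients of an element of the Hecke algebra. -/
def coefHom : H l →ₗ[A] (WD l → A) where
  toFun x := coef x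
  map_add' _ _ := rfl
  map_smul' _ _ := rfl

lemma coef_eq (x : H l) : coef x = (x : Module.End A (WD l → A)) (delta 1) := rfl

lemma coefHom_apply (x : H l) : coefHom x = coef x := rfl

@[simp] lemma coef_zero (w : WD l) : coef (0 : H l) w = 0 := rfl

lemma coef_add (x y : H l) (w : WD l) : coef (x + y) w = coef x w + coef y w := rfl

lemma coef_sub (x y : H l) (w : WD l) : coef (x - y) w = coef x w - coef y w := rfl

lemma coef_smul (c : A) (x : H l) (w : WD l) : coef (c • x) w = c * coef x w := rfl

lemma coef_sum {ι : Type*} (s : Finset ι) (f : ι → H l) (w : WD l) :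
    coef (∑ i ∈ s, f i) w = ∑ i ∈ s, coef (f i) w := by
  rw [← coefHom_apply, map_sum, Finset.sum_apply]
  rfl

lemma len_sW (i : Node l) : len (sW i) = 1 := by
  have h1 := len_sW_mul_cases 1 i
  rw [mul_one, len_one] at h1
  omega

/-- An element of the Hecke algebra is determined by its coefficients, since it commutes with
right multiplications. -/
lemma coef_injective : Function.Injective (coef : H l → WD l → A) := by
  suffices h : ∀ x : H l, coef x = 0 → x = 0 by
    intro x y hxy
    rw [← sub_eq_zero]
    exact h _ (funext fun w => by rw [coef_sub, hxy, sub_self]; rfl)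
  intro x hx
  have key : ∀ w : WD l, (x : Module.End A (WD l → A)) (delta w⁻¹) = 0 := by
    intro w
    induction w using len_induction with
    | one => rw [inv_one]; exact hx
    | step i w h ih =>
      have h1 : len w⁻¹ < len (w⁻¹ * sW i) := by
        rw [len_mul_sW, inv_inv, len_inv]
        omega
      rw [mul_inv_rev, sW_inv, ← rightOp_delta h1, H_rightOp, ih, map_zero]
  classical
  refine Subtype.ext (LinearMap.pi_ext' fun w => LinearMap.ext_ring ?_)
  have := key w⁻¹
  rw [inv_inv, delta] at this
  convert this using 2
  simp only [LinearMap.comp_apply, LinearMap.single_apply]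
  congr!

lemma coef_ext {x y : H l} (h : ∀ w, coef x w = coef y w) : x = y := coef_injective (funext h)

lemma coef_hGen_mul (i : Node l) (x : H l) (w : WD l) : coef (hGen i * x) w =
    coef x (sW i * w) - if len (sW i * w) < len w then (qpow 1 - qpow (-1)) * coef x w else 0 :=
  rfl

lemma coef_one (w : WD l) : coef (1 : H l) w = delta 1 w := rfl

lemma coef_hGen_mul_eq (i : Node l) (x : H l) : coef (hGen i * x) = heckeOp i (coef x) := rfl

lemma coef_mul_hGen_eq (x : H l) (j : Node l) : coef (x * hGen j) = rightOp j (coef x) := by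
  have h1 : heckeOp j (delta 1) = rightOp j (delta 1) := by
    have h : len (1 : WD l) < len (sW j) := by rw [len_sW, len_one]; exact one_pos
    rw [heckeOp_delta (by rwa [mul_one]), rightOp_delta (by rwa [one_mul]), mul_one, one_mul]
  calc coef (x * hGen j) = (x : Module.End A (WD l → A)) (heckeOp j (delta 1)) := rfl
    _ = _ := by rw [h1, H_rightOp, coef_eq]

lemma coef_mul_hGen (x : H l) (j : Node l) (w : WD l) : coef (x * hGen j) w =
    coef x (w * sW j) - if len (w * sW j) < len w then (qpow 1 - qpow (-1)) * coef x w else 0 := by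
  rw [coef_mul_hGen_eq, rightOp_apply]

lemma coef_word (ω : List (Node l)) (h : len (ω.map sW).prod = ω.length) :
    coef (ω.map hGen).prod = delta (ω.map sW).prod := by
  induction ω with
  | nil => rfl
  | cons i ω ih =>
    rw [List.map_cons, List.prod_cons, List.length_cons] at h
    rw [List.map_cons, List.prod_cons, List.map_cons, List.prod_cons, coef_hGen_mul_eq]
    have h1 : len (ω.map sW).prod ≤ ω.length := len_le_of_word rfl
    have h2 := len_sW_mul_cases (ω.map sW).prod i
    rw [ih (by omega), heckeOp_delta (by omega)]

lemma coef_hB (w : WD l) : coef (hB w) = delta w := by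
  obtain ⟨h1, h2⟩ := redWord_spec w
  have := coef_word (redWord w) (by rw [h1, h2])
  rwa [h1] at this

lemma eq_sum_coef (x : H l) : x = ∑ w, coef x w • hB w := by
  refine coef_ext fun y => ?_
  rw [coef_sum, Finset.sum_eq_single y]
  · rw [coef_smul, coef_hB, delta_self, mul_one]
  · intro w _ hw
    rw [coef_smul, coef_hB, delta_of_ne (Ne.symm hw), mul_zero]
  · exact fun h => absurd (Finset.mem_univ _) h

lemma hB_one : hB (1 : WD l) = 1 := coef_injective (coef_hB 1)

lemma hGen_mul_hB {i : Node l} {w : WD l} (h : len w < len (sW i * w)) :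
    hGen i * hB w = hB (sW i * w) :=
  coef_injective (by rw [coef_hGen_mul_eq, coef_hB, coef_hB, heckeOp_delta h])

lemma hB_mul_hGen {j : Node l} {w : WD l} (h : len w < len (w * sW j)) :
    hB w * hGen j = hB (w * sW j) :=
  coef_injective (by rw [coef_mul_hGen_eq, coef_hB, coef_hB, rightOp_delta h])

/-- To prove a linear statement about the Hecke algebra, multiply by generators on the left. -/
lemma hecke_induction {P : H l → Prop} (one : P 1) (add : ∀ x y, P x → P y → P (x + y))
    (smul : ∀ (c : A) x, P x → P (c • x)) (gen : ∀ i x, P x → P (hGen i * x)) (x : H l) : P x := by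
  have h : ∀ w : WD l, P (hB w) := by
    intro w
    induction w using len_induction with
    | one => rw [hB_one]; exact one
    | step i w h ih => rw [← hGen_mul_hB (by omega)]; exact gen i _ ih
  rw [eq_sum_coef x]
  refine Finset.sum_induction _ P add ?_ fun w _ => smul _ _ (h w)
  rw [← zero_smul A (1 : H l)]
  exact smul _ _ one

lemma hGen_mul_hGen_mul (i : Node l) (x : H l) :
    hGen i * (hGen i * x) + (qpow 1 - qpow (-1)) • (hGen i * x) = x := by
  refine coef_ext fun w => ?_
  rw [coef_add, coef_smul, coef_hGen_mul i (hGen i * x), coef_hGen_mul i x, coef_hGen_mul i x,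
    sW_mul_cancel_left]
  have := len_sW_mul_cases w i
  by_cases h : len (sW i * w) < len w
  · simp only [if_pos h, if_neg (show ¬ len w < len (sW i * w) by omega)]
    ring
  · simp only [if_neg h, if_pos (show len w < len (sW i * w) by omega)]
    ring

/-- The inverse `hᵢ + (q - q⁻¹)` of `hᵢ`. -/
def hInv (i : Node l) : H l := hGen i + (qpow 1 - qpow (-1)) • 1

lemma hInv_mul (i : Node l) (x : H l) :
    hInv i * x = hGen i * x + (qpow 1 - qpow (-1)) • x := by
  rw [hInv, add_mul, smul_mul_assoc, one_mul]

lemma hGen_mul_hInv_mul (i : Node l) (x : H l) : hGen i * (hInv i * x) = x := by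
  rw [hInv_mul, mul_add, mul_smul_comm, hGen_mul_hGen_mul]

lemma hInv_mul_hGen_mul (i : Node l) (x : H l) : hInv i * (hGen i * x) = x := by
  rw [hInv_mul, hGen_mul_hGen_mul]

/-- The element `hᵢ` as a unit. -/
def hUnit (i : Node l) : (H l)ˣ where
  val := hGen i
  inv := hInv i
  val_inv := by have := hGen_mul_hInv_mul i 1; rwa [mul_one] at this
  inv_val := by have := hInv_mul_hGen_mul i 1; rwa [mul_one] at this

lemma isUnit_hB (w : WD l) : IsUnit (hB w) := by
  induction w using len_induction with
  | one => rw [hB_one]; exact isUnit_one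
  | step i w h ih =>
    rw [← hGen_mul_hB (by omega)]
    exact (hUnit i).isUnit.mul ih

lemma inverse_hB_mul_hGen (i : Node l) (w : WD l) :
    Ring.inverse (hB w * hGen i) = hInv i * Ring.inverse (hB w) := by
  obtain ⟨u, hu⟩ := isUnit_hB w
  rw [← hu, show hGen i = ((hUnit i : (H l)ˣ) : H l) from rfl, ← Units.val_mul, Ring.inverse_unit,
    Ring.inverse_unit, mul_inv_rev]
  rfl

/-! ### The involutions of the Hecke algebra -/

lemma inverse_hB_step {i : Node l} {w : WD l} (h : len w < len (sW i * w)) :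
    Ring.inverse (hB (sW i * w)⁻¹) = hInv i * Ring.inverse (hB w⁻¹) := by
  rw [← inverse_hB_mul_hGen, hB_mul_hGen, mul_inv_rev, sW_inv]
  rw [len_mul_sW, inv_inv, len_inv]
  exact h

/-- The bar involution is triangular with respect to the length. -/
lemma coef_inverse_hB {w y : WD l} (h : len w ≤ len y) :
    coef (Ring.inverse (hB w⁻¹)) y = delta w y := by
  induction w using len_induction generalizing y with
  | one => rw [inv_one, hB_one, Ring.inverse_one, coef_one]
  | step i w hw ih =>
    have h2 := len_sW_mul_cases y i
    have h3 : delta w y = 0 := delta_of_ne (by rintro rfl; omega)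
    rw [inverse_hB_step (by omega), hInv_mul, coef_add, coef_smul, coef_hGen_mul, ih (by omega),
      ih (by omega), h3, mul_zero, ite_self, sub_zero, add_zero]
    refine delta_congr ⟨fun h => ?_, fun h => ?_⟩
    · rw [← h, sW_mul_cancel_left]
    · rw [h, sW_mul_cancel_left]

lemma coef_barH (x : H l) (y : WD l) :
    coef (barH x) y = ∑ w, barA (coef x w) * coef (Ring.inverse (hB w⁻¹)) y := by
  rw [barH, coef_sum]
  rfl

lemma coef_barH_of_maximal {x : H l} {y : WD l} (h : ∀ w, len y < len w → coef x w = 0) :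
    coef (barH x) y = barA (coef x y) := by
  rw [coef_barH, Finset.sum_eq_single y]
  · rw [coef_inverse_hB le_rfl, delta_self, mul_one]
  · intro w _ hw
    rcases Nat.lt_or_ge (len y) (len w) with h1 | h1
    · rw [h w h1, map_zero, zero_mul]
    · rw [coef_inverse_hB h1, delta_of_ne (Ne.symm hw), mul_zero]
  · exact fun h => absurd (Finset.mem_univ _) h

lemma barH_add (x y : H l) : barH (x + y) = barH x + barH y := by
  simp only [barH, coef_add, map_add, add_smul, Finset.sum_add_distrib]

lemma barH_smul (c : A) (x : H l) : barH (c • x) = barA c • barH x := by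
  simp only [barH, coef_smul, map_mul, Finset.smul_sum, smul_smul]

lemma barH_zero : barH (0 : H l) = 0 := by
  have := barH_smul 0 (0 : H l)
  rwa [map_zero, zero_smul, zero_smul] at this

lemma barH_one : barH (1 : H l) = 1 := by
  refine coef_ext fun y => ?_
  rw [coef_barH, Finset.sum_eq_single 1]
  · rw [coef_one, delta_self, map_one, one_mul, inv_one, hB_one, Ring.inverse_one]
  · intro w _ hw
    rw [coef_one, delta_of_ne hw, map_zero, zero_mul]
  · exact fun h => absurd (Finset.mem_univ _) h

/-- Left multiplication by a simple reflection permutes `W`. -/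
def sWMulEquiv (i : Node l) : WD l ≃ WD l :=
  ⟨fun w => sW i * w, fun w => sW i * w, sW_mul_cancel_left i, sW_mul_cancel_left i⟩

lemma sum_sW_mul {M : Type*} [AddCommMonoid M] (i : Node l) (f : WD l → M) :
    ∑ w, f (sW i * w) = ∑ w, f w :=
  (sWMulEquiv i).sum_comp f

lemma barA_zeta : barA (qpow 1 - qpow (-1)) = -(qpow 1 - qpow (-1)) := by
  rw [map_sub, barA_qpow, barA_qpow, neg_neg, neg_sub]

lemma barH_hGen_mul (i : Node l) (x : H l) : barH (hGen i * x) = hInv i * barH x := by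
  have h1 : barH (hGen i * x) = ∑ w, barA (coef x w) • (Ring.inverse (hB (sW i * w)⁻¹) +
      if len (sW i * w) < len w then
        (qpow 1 - qpow (-1)) • Ring.inverse (hB w⁻¹) else 0) := by
    simp only [smul_add, Finset.sum_add_distrib]
    rw [← sum_sW_mul i (fun w => barA (coef x w) • Ring.inverse (hB (sW i * w)⁻¹)), barH,
      ← Finset.sum_add_distrib]
    refine Finset.sum_congr rfl fun w _ => ?_
    have e : barA (coef (hGen i * x) w) = barA (coef x (sW i * w)) +
        if len (sW i * w) < len w then barA (coef x w) * (qpow 1 - qpow (-1)) else 0 := by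
      rw [coef_hGen_mul, map_sub]
      split_ifs
      · rw [map_mul, barA_zeta]
        ring
      · rw [map_zero, sub_zero, add_zero]
    rw [e, add_smul, sW_mul_cancel_left]
    congr 1
    split_ifs
    · rw [smul_smul]
    · rw [zero_smul, smul_zero]
  rw [h1, barH, Finset.mul_sum]
  refine Finset.sum_congr rfl fun w _ => ?_
  rw [mul_smul_comm]
  congr 1
  have := len_sW_mul_cases w i
  split_ifs with h
  · have h2 := inverse_hB_step (i := i) (w := sW i * w) (by rwa [sW_mul_cancel_left])
    rw [sW_mul_cancel_left] at h2
    rw [hInv_mul, h2, hGen_mul_hInv_mul]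
  · rw [inverse_hB_step (by omega), add_zero]

lemma barH_mul (x y : H l) : barH (x * y) = barH x * barH y := by
  induction x using hecke_induction with
  | one => rw [one_mul, barH_one, one_mul]
  | add x x' hx hx' => rw [add_mul, barH_add, hx, hx', barH_add, add_mul]
  | smul c x hx => rw [smul_mul_assoc, barH_smul, hx, barH_smul, smul_mul_assoc]
  | gen i x hx => rw [mul_assoc, barH_hGen_mul, hx, barH_hGen_mul, mul_assoc]

lemma barH_hGen (i : Node l) : barH (hGen i) = hInv i := by
  rw [← mul_one (hGen i), barH_hGen_mul, barH_one, mul_one]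

lemma coef_sum_smul_hB (f : WD l → A) (e : WD l ≃ WD l) (y : WD l) :
    coef (∑ w, f w • hB (e w)) y = f (e.symm y) := by
  rw [coef_sum, Finset.sum_eq_single (e.symm y)]
  · rw [coef_smul, coef_hB, Equiv.apply_symm_apply, delta_self, mul_one]
  · intro w _ hw
    rw [coef_smul, coef_hB, delta_of_ne, mul_zero]
    rintro rfl
    exact hw (e.symm_apply_apply w).symm
  · exact fun h => absurd (Finset.mem_univ _) h

lemma coef_rhoH (x : H l) (w : WD l) : coef (rhoH x) w = coef x w⁻¹ :=
  coef_sum_smul_hB (coef x) (Equiv.inv _) w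

lemma rhoH_rhoH (x : H l) : rhoH (rhoH x) = x :=
  coef_ext fun w => by rw [coef_rhoH, coef_rhoH, inv_inv]

lemma rhoH_add (x y : H l) : rhoH (x + y) = rhoH x + rhoH y :=
  coef_ext fun w => by rw [coef_rhoH, coef_add, coef_add, coef_rhoH, coef_rhoH]

lemma rhoH_smul (c : A) (x : H l) : rhoH (c • x) = c • rhoH x :=
  coef_ext fun w => by rw [coef_rhoH, coef_smul, coef_smul, coef_rhoH]

lemma rhoH_one : rhoH (1 : H l) = 1 :=
  coef_ext fun w => by
    rw [coef_rhoH, coef_one]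
    exact delta_congr inv_eq_one

lemma rhoH_hGen_mul (i : Node l) (x : H l) : rhoH (hGen i * x) = rhoH x * hGen i :=
  coef_ext fun w => by
    rw [coef_rhoH, coef_hGen_mul, coef_mul_hGen, coef_rhoH, coef_rhoH, len_mul_sW, len_inv,
      mul_inv_rev, sW_inv]

lemma rhoH_mul (x y : H l) : rhoH (x * y) = rhoH y * rhoH x := by
  induction x using hecke_induction with
  | one => rw [one_mul, rhoH_one, mul_one]
  | add x x' hx hx' => rw [add_mul, rhoH_add, hx, hx', rhoH_add, mul_add]
  | smul c x hx => rw [smul_mul_assoc, rhoH_smul, hx, rhoH_smul, mul_smul_comm]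
  | gen i x hx => rw [mul_assoc, rhoH_hGen_mul, hx, rhoH_hGen_mul, mul_assoc]

lemma rhoH_hGen (i : Node l) : rhoH (hGen i) = hGen i := by
  rw [← mul_one (hGen i), rhoH_hGen_mul, rhoH_one, mul_one, one_mul]

/-- The operators of left multiplication by the generators are self-adjoint for the form making
the standard basis orthonormal. -/
lemma sum_heckeOp_mul (i : Node l) (u v : WD l → A) :
    ∑ w, heckeOp i u w * v w = ∑ w, u w * heckeOp i v w := by
  have h1 : ∑ w, u (sW i * w) * v w = ∑ w, u w * v (sW i * w) := by
    rw [← sum_sW_mul i (fun w => u w * v (sW i * w))]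
    simp only [sW_mul_cancel_left]
  simp only [heckeOp_apply, sub_mul, mul_sub, Finset.sum_sub_distrib, h1]
  congr 1
  refine Finset.sum_congr rfl fun w _ => ?_
  split_ifs <;> ring

lemma trH_rhoH_mul (x y : H l) : trH (rhoH x * y) = ∑ w, coef x w * coef y w := by
  induction x using hecke_induction generalizing y with
  | one =>
    rw [rhoH_one, one_mul, trH, Finset.sum_eq_single 1]
    · rw [coef_one, delta_self, one_mul]
    · intro w _ hw
      rw [coef_one, delta_of_ne hw, zero_mul]
    · exact fun h => absurd (Finset.mem_univ _) h
  | add x x' hx hx' =>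
    rw [rhoH_add, add_mul, trH, coef_add, ← trH, ← trH, hx, hx', ← Finset.sum_add_distrib]
    exact Finset.sum_congr rfl fun w _ => by rw [coef_add, add_mul]
  | smul c x hx =>
    rw [rhoH_smul, smul_mul_assoc, trH, coef_smul, ← trH, hx, Finset.mul_sum]
    exact Finset.sum_congr rfl fun w _ => by rw [coef_smul, mul_assoc]
  | gen i x hx =>
    rw [rhoH_hGen_mul, mul_assoc, hx, coef_hGen_mul_eq, coef_hGen_mul_eq, sum_heckeOp_mul]

/-! ### The diagram automorphism -/

lemma gammaW_gammaW (w : WD l) : gammaW (gammaW w) = w := by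
  refine Subtype.ext ?_
  change s0 * (s0 * w * s0) * s0 = w
  rw [show s0 * (s0 * (w : Equiv.Perm ℤ) * s0) * s0 = (s0 * s0) * w * (s0 * s0) by group,
    s0_mul_s0, one_mul, mul_one]

lemma gammaW_mul (w y : WD l) : gammaW (w * y) = gammaW w * gammaW y := by
  refine Subtype.ext ?_
  change s0 * (w * y) * s0 = s0 * w * s0 * (s0 * y * s0)
  rw [show s0 * (w : Equiv.Perm ℤ) * s0 * (s0 * y * s0) = s0 * w * (s0 * s0) * y * s0 by group,
    s0_mul_s0, mul_one]
  group

lemma twist_add (t r : ℕ) (w : WD l) :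
    twist (t + 1) (r + 1) (gammaW w) = twist t r w := by
  change s0 ^ (t + 1) * (s0 * w * s0) * s0 ^ (r + 1) = s0 ^ t * w * s0 ^ r
  rw [pow_succ, pow_succ']
  rw [show s0 ^ t * s0 * (s0 * (w : Equiv.Perm ℤ) * s0) * (s0 * s0 ^ r) =
    s0 ^ t * (s0 * s0) * w * (s0 * s0) * s0 ^ r by group, s0_mul_s0, mul_one, mul_one]

lemma gammaW_sW_aNode (t : ℕ) {i : ℤ} (h : 1 ≤ i ∧ i < l) :
    gammaW (sW (aNode t i h)) = sW (aNode (t + 1) i h) := by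
  refine twist_injective (t := t + 1) (r := t + 1) ?_
  rw [twist_add, twist_sW, twist_sW]

lemma aNode_add_two (t : ℕ) {i : ℤ} (h : 1 ≤ i ∧ i < l) : aNode (t + 2) i h = aNode t i h := by
  refine Subtype.ext ?_
  simp only [aNode, Nat.even_add, even_two, iff_true]

lemma exists_eq_aNode (j : Node l) : ∃ (t : ℕ) (i : ℤ) (h : 1 ≤ i ∧ i < l), j = aNode t i h := by
  by_cases hj : j.1 = -1
  · have : j ∈ Oset l 1 := by
      rw [Oset, if_neg (by decide)]
      change j.1 ≠ 1
      omega
    obtain ⟨i, h, e⟩ := mem_Oset_iff.mp this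
    exact ⟨1, i, h, e⟩
  · have : j ∈ Oset l 0 := by rw [Oset_zero]; exact hj
    obtain ⟨i, h, e⟩ := mem_Oset_iff.mp this
    exact ⟨0, i, h, e⟩

lemma len_gammaW (hl : 2 ≤ l) (w : WD l) : len (gammaW w) = len w := by
  have h1 := two_mul_len_eq_twist hl 1 1 (gammaW w)
  rw [twist_add, ← two_mul_len_eq_twist hl] at h1
  omega

lemma coef_gammaH (x : H l) (w : WD l) : coef (gammaH x) w = coef x (gammaW w) :=
  coef_sum_smul_hB (coef x) ⟨gammaW, gammaW, gammaW_gammaW, gammaW_gammaW⟩ w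

lemma gammaH_gammaH (x : H l) : gammaH (gammaH x) = x :=
  coef_ext fun w => by rw [coef_gammaH, coef_gammaH, gammaW_gammaW]

lemma gammaH_add (x y : H l) : gammaH (x + y) = gammaH x + gammaH y :=
  coef_ext fun w => by rw [coef_gammaH, coef_add, coef_add, coef_gammaH, coef_gammaH]

lemma gammaH_smul (c : A) (x : H l) : gammaH (c • x) = c • gammaH x :=
  coef_ext fun w => by rw [coef_gammaH, coef_smul, coef_smul, coef_gammaH]

lemma gammaH_zero : gammaH (0 : H l) = 0 := coef_ext fun w => by rw [coef_gammaH]; rfl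

lemma gammaH_one : gammaH (1 : H l) = 1 := by
  refine coef_ext fun w => ?_
  have h1 : gammaW (1 : WD l) = 1 := Subtype.ext (by
    change s0 * 1 * s0 = 1
    rw [mul_one, s0_mul_s0])
  rw [coef_gammaH, coef_one, coef_one]
  refine delta_congr ⟨fun h => ?_, fun h => ?_⟩
  · rw [← gammaW_gammaW w, h, h1]
  · rw [h, h1]

lemma gammaH_hGen_mul (hl : 2 ≤ l) (t : ℕ) {i : ℤ} (h : 1 ≤ i ∧ i < l) (x : H l) :
    gammaH (hGen (aNode t i h) * x) = hGen (aNode (t + 1) i h) * gammaH x := by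
  refine coef_ext fun w => ?_
  have e : sW (aNode t i h) * gammaW w = gammaW (sW (aNode (t + 1) i h) * w) := by
    rw [gammaW_mul, gammaW_sW_aNode, aNode_add_two]
  rw [coef_gammaH, coef_hGen_mul, coef_hGen_mul, coef_gammaH, coef_gammaH, e, len_gammaW hl,
    len_gammaW hl]

lemma gammaH_mul (hl : 2 ≤ l) (x y : H l) : gammaH (x * y) = gammaH x * gammaH y := by
  induction x using hecke_induction with
  | one => rw [one_mul, gammaH_one, one_mul]
  | add x x' hx hx' => rw [add_mul, gammaH_add, hx, hx', gammaH_add, add_mul]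
  | smul c x hx => rw [smul_mul_assoc, gammaH_smul, hx, gammaH_smul, smul_mul_assoc]
  | gen j x hx =>
    obtain ⟨t, i, h, rfl⟩ := exists_eq_aNode j
    rw [mul_assoc, gammaH_hGen_mul hl, hx, gammaH_hGen_mul hl, mul_assoc]

lemma gammaH_barH (hl : 2 ≤ l) (x : H l) : gammaH (barH x) = barH (gammaH x) := by
  induction x using hecke_induction with
  | one => rw [barH_one, gammaH_one, barH_one]
  | add x x' hx hx' => rw [barH_add, gammaH_add, hx, hx', gammaH_add, barH_add]
  | smul c x hx => rw [barH_smul, gammaH_smul, hx, gammaH_smul, barH_smul]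
  | gen j x hx =>
    obtain ⟨t, i, h, rfl⟩ := exists_eq_aNode j
    rw [barH_hGen_mul, gammaH_hGen_mul hl, barH_hGen_mul, hInv_mul, hInv_mul, gammaH_add,
      gammaH_hGen_mul hl, gammaH_smul, hx]

/-! ### Minimal coset representatives -/

lemma len_mul_le (w y : WD l) : len (w * y) ≤ len w + len y := by
  obtain ⟨ω, h1, h2⟩ := exists_reduced_word w
  obtain ⟨ω', h3, h4⟩ := exists_reduced_word y
  rw [← h2, ← h4, ← List.length_append]
  exact len_le_of_word (by rw [List.map_append, List.prod_append, h1, h3])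

/-- `w` has minimal length in its left coset `W_(O±) w`. -/
def LeftMin (t : ℕ) (w : WD l) : Prop :=
  ∀ i : ℤ, ∀ h : 1 ≤ i ∧ i < l, len w < len (sW (aNode t i h) * w)

lemma exists_leftMin (t : ℕ) (w : WD l) :
    ∃ x ∈ parab (Oset l t), ∃ d, LeftMin t d ∧ w = x * d := by
  generalize hn : len w = n
  induction n using Nat.strong_induction_on generalizing w with
  | _ n ih =>
    by_cases hd : LeftMin t w
    · exact ⟨1, one_mem _, w, hd, (one_mul w).symm⟩
    · rw [LeftMin] at hd
      push Not at hd
      obtain ⟨i, h, hi⟩ := hd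
      have := len_sW_mul_cases w (aNode t i h)
      obtain ⟨x, hx, d, h1, h2⟩ := ih _ (by omega) (sW (aNode t i h) * w) rfl
      refine ⟨_, mul_mem (sW_mem_parab (aNode_mem_Oset t h)) hx, d, h1, ?_⟩
      rw [mul_assoc, ← h2, sW_mul_cancel_left]

lemma parab_induction (hl : 2 ≤ l) {t : ℕ} {P : WD l → Prop} (one : P 1)
    (step : ∀ (i : ℤ) (h : 1 ≤ i ∧ i < l) (w : WD l), w ∈ parab (Oset l t) →
      len (sW (aNode t i h) * w) = len w + 1 → P w → P (sW (aNode t i h) * w))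
    {w : WD l} (hw : w ∈ parab (Oset l t)) : P w := by
  generalize hn : len w = n
  induction n using Nat.strong_induction_on generalizing w with
  | _ n ih =>
    by_cases hd : LeftMin t w
    · have hs := isSigned_twist hl t t w
      have h0 := (mem_parab_Oset_iff hl).mp hw
      have h1 := hs.inv.eq_one_of_increasing (fun i h1 h2 => perm_lt_succ_of_not_lt fun h3 =>
        absurd ((len_sW_aNode_mul_lt_iff hl t ⟨h1, h2⟩).mpr h3) (hd i ⟨h1, h2⟩).le.not_gt)
        (by rw [negCount_inv hs, h0])
      rw [inv_eq_one, ← twist_self_one t] at h1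
      rw [twist_injective h1]
      exact one
    · rw [LeftMin] at hd
      push Not at hd
      obtain ⟨i, h, hi⟩ := hd
      have := len_sW_mul_cases w (aNode t i h)
      have hm := mul_mem (sW_mem_parab (aNode_mem_Oset t h)) hw
      have h2 := step i h (sW (aNode t i h) * w) hm (by rw [sW_mul_cancel_left]; omega)
        (ih _ (by omega) hm rfl)
      rwa [sW_mul_cancel_left] at h2

lemma parab_apply_mem (hl : 2 ≤ l) {t : ℕ} {x : WD l} (hx : x ∈ parab (Oset l t)) {z : ℤ}
    (h1 : 1 ≤ z) (h2 : z ≤ l) : 1 ≤ twist t t x z ∧ twist t t x z ≤ l := by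
  have hs := isSigned_twist hl t t x
  have h0 := (mem_parab_Oset_iff hl).mp hx
  rw [negCount, Finset.card_eq_zero, Finset.filter_eq_empty_iff] at h0
  have e1 := @h0 z (Finset.mem_Icc.mpr ⟨by omega, h2⟩)
  have e2 := hs.mem_range (z := z) (by omega) h2
  have e3 := hs.ne_zero (z := z) (by omega)
  omega

lemma LeftMin.strictMono (hl : 2 ≤ l) {t : ℕ} (r : ℕ) {d : WD l} (hd : LeftMin t d) {y z : ℤ}
    (h1 : 1 ≤ y) (h2 : y < z) (h3 : z ≤ l) : (twist t r d)⁻¹ y < (twist t r d)⁻¹ z := by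
  obtain ⟨k, rfl⟩ : ∃ k : ℕ, z = y + 1 + k := ⟨(z - y - 1).toNat, by omega⟩
  clear h2
  have hstep : ∀ i : ℤ, 1 ≤ i → i < l → (twist t r d)⁻¹ i < (twist t r d)⁻¹ (i + 1) :=
    fun i h1 h2 => perm_lt_succ_of_not_lt fun h3 =>
      absurd ((len_sW_aNode_mul_lt_iff hl r ⟨h1, h2⟩).mpr h3) (hd i ⟨h1, h2⟩).le.not_gt
  induction k with
  | zero => rw [Nat.cast_zero, add_zero] at *; exact hstep y h1 (by omega)
  | succ k ih =>
    have := ih (by push_cast at h3; omega)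
    refine this.trans ?_
    have h4 := hstep (y + 1 + k) (by omega) (by push_cast at h3; omega)
    push_cast
    rwa [← add_assoc]

lemma len_parab_mul (hl : 2 ≤ l) {t : ℕ} {d : WD l} (hd : LeftMin t d) {x : WD l}
    (hx : x ∈ parab (Oset l t)) : len (x * d) = len x + len d := by
  refine parab_induction hl (P := fun x => len (x * d) = len x + len d) ?_ ?_ hx
  · rw [one_mul, len_one, zero_add]
  · intro i h w hw hlen ih
    have h1 : ¬ len (sW (aNode t i h) * w) < len w := by omega
    rw [len_sW_aNode_mul_lt_iff hl t h] at h1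
    have h2 := perm_lt_succ_of_not_lt h1
    have hw' := inv_mem hw
    have m1 := parab_apply_mem hl hw' h.1 (by omega)
    have m2 := parab_apply_mem hl hw' (z := i + 1) (by omega) (by omega)
    rw [← twist_inv] at m1 m2
    have h3 := hd.strictMono hl 0 m1.1 h2 m2.2
    have h4 : len (sW (aNode t i h) * (w * d)) = len (w * d) + 1 := by
      refine len_sW_aNode_mul_of_lt hl 0 h ?_
      rwa [twist_self_mul, mul_inv_rev, Equiv.Perm.mul_apply, Equiv.Perm.mul_apply]
    rw [mul_assoc, h4, ih, hlen]
    omega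

lemma eq_one_of_leftMin_mul (hl : 2 ≤ l) {t : ℕ} {d x : WD l} (hd : LeftMin t d)
    (hx : x ∈ parab (Oset l t)) (hxd : LeftMin t (x * d)) : x = 1 := by
  revert hxd
  refine parab_induction hl (P := fun x => LeftMin t (x * d) → x = 1) ?_ ?_ hx
  · exact fun _ => rfl
  · intro i h w hw hlen _ hxd
    have h1 := hxd i h
    rw [← mul_assoc, sW_mul_cancel_left, len_parab_mul hl hd hw,
      len_parab_mul hl hd (mul_mem (sW_mem_parab (aNode_mem_Oset t h)) hw)] at h1
    omega

/-! ### Spherical elements of the Hecke algebra -/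

/-- `x` is an eigenvector for left multiplication by `W_(O±)`. -/
def LSph (t : ℕ) (x : H l) : Prop :=
  ∀ i : ℤ, ∀ h : 1 ≤ i ∧ i < l, hGen (aNode t i h) * x = qpow (-1) • x

/-- `x` is an eigenvector for right multiplication by `W_(O±)`. -/
def RSph (r : ℕ) (x : H l) : Prop :=
  ∀ i : ℤ, ∀ h : 1 ≤ i ∧ i < l, x * hGen (aNode r i h) = qpow (-1) • x

/-- The coefficient of `q^(-ℓ(w)) h_w`. -/
def ncoef (x : H l) (w : WD l) : A := coef x w * qpow (len w)

lemma coef_eq_ncoef (x : H l) (w : WD l) : coef x w = ncoef x w * qpow (-len w) := by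
  rw [ncoef, mul_assoc, qpow_mul_neg, mul_one]

/-- Left spherical elements are those whose normalized coefficients are constant on the cosets
`W_(O±) w`. -/
lemma lsph_iff {t : ℕ} {x : H l} : LSph t x ↔ ∀ (i : ℤ) (h : 1 ≤ i ∧ i < l) (w : WD l),
    ncoef x (sW (aNode t i h) * w) = ncoef x w := by
  have e1 : ∀ n : ℕ, qpow ((n + 1 : ℕ) : ℤ) = qpow 1 * qpow n := fun n => by
    rw [← qpow_add]; congr 1; push_cast; ring
  have e2 := qpow_mul_neg 1
  refine forall_congr' fun i => forall_congr' fun h => ?_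
  constructor
  · intro hx w
    have h1 := congrArg (fun y => coef y w) hx
    simp only [coef_hGen_mul, coef_smul] at h1
    rw [ncoef, ncoef]
    rcases len_sW_mul_cases w (aNode t i h) with h2 | h2
    · rw [if_neg (by omega), sub_zero] at h1
      rw [h1, h2, e1]
      linear_combination (coef x w * qpow (len w)) * e2
    · rw [if_pos (by omega)] at h1
      rw [← h2, e1]
      linear_combination qpow (len (sW (aNode t i h) * w)) * h1
  · intro hx
    refine coef_ext fun w => ?_
    rw [coef_hGen_mul, coef_smul]
    have h1 := hx w
    rw [ncoef, ncoef] at h1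
    rcases len_sW_mul_cases w (aNode t i h) with h2 | h2
    · rw [if_neg (by omega), sub_zero]
      rw [h2, e1] at h1
      refine mul_right_cancel₀ (qpow_ne_zero (len w)) ?_
      linear_combination qpow (-1) * h1 -
        (coef x (sW (aNode t i h) * w) * qpow (len w)) * e2
    · rw [if_pos (by omega)]
      rw [← h2, e1] at h1
      refine mul_right_cancel₀ (qpow_ne_zero (len (sW (aNode t i h) * w))) ?_
      linear_combination h1

lemma ncoef_rhoH (x : H l) (w : WD l) : ncoef (rhoH x) w = ncoef x w⁻¹ := by
  rw [ncoef, ncoef, coef_rhoH, len_inv]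

lemma rsph_iff_rhoH {r : ℕ} {x : H l} : RSph r x ↔ LSph r (rhoH x) := by
  refine forall_congr' fun i => forall_congr' fun h => ?_
  constructor
  · intro hx
    rw [← rhoH_smul, ← hx, rhoH_mul, rhoH_hGen]
  · intro hx
    have := congrArg rhoH hx
    rwa [rhoH_smul, rhoH_mul, rhoH_rhoH, rhoH_hGen] at this

lemma rsph_iff {r : ℕ} {x : H l} : RSph r x ↔ ∀ (i : ℤ) (h : 1 ≤ i ∧ i < l) (w : WD l),
    ncoef x (w * sW (aNode r i h)) = ncoef x w := by
  rw [rsph_iff_rhoH, lsph_iff]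
  refine forall_congr' fun i => forall_congr' fun h => ?_
  constructor
  · intro hx w
    have := hx w⁻¹
    rwa [ncoef_rhoH, ncoef_rhoH, mul_inv_rev, inv_inv, sW_inv] at this
  · intro hx w
    rw [ncoef_rhoH, ncoef_rhoH, mul_inv_rev, sW_inv, hx]

lemma LSph.ncoef_mul {t : ℕ} {x : H l} (hx : LSph t x) {y : WD l} (hy : y ∈ parab (Oset l t))
    (w : WD l) : ncoef x (y * w) = ncoef x w := by
  induction hy using Subgroup.closure_induction generalizing w with
  | mem y hy =>
    obtain ⟨j, hj, rfl⟩ := hy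
    obtain ⟨i, h, rfl⟩ := mem_Oset_iff.mp hj
    exact lsph_iff.mp hx i h w
  | one => rw [one_mul]
  | mul y z _ _ hy hz => rw [mul_assoc, hy, hz]
  | inv y _ hy => rw [← hy (y⁻¹ * w), mul_inv_cancel_left]

lemma RSph.ncoef_mul {r : ℕ} {x : H l} (hx : RSph r x) {y : WD l} (hy : y ∈ parab (Oset l r))
    (w : WD l) : ncoef x (w * y) = ncoef x w := by
  have := (rsph_iff_rhoH.mp hx).ncoef_mul (inv_mem hy) w⁻¹
  rwa [ncoef_rhoH, ncoef_rhoH, mul_inv_rev, inv_inv, inv_inv] at this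

lemma LSph.ext {t : ℕ} {x y : H l} (hx : LSph t x) (hy : LSph t y)
    (h : ∀ d, LeftMin t d → coef x d = coef y d) : x = y := by
  refine coef_ext fun w => ?_
  obtain ⟨z, hz, d, hd, rfl⟩ := exists_leftMin t w
  rw [coef_eq_ncoef, coef_eq_ncoef y, hx.ncoef_mul hz, hy.ncoef_mul hz, ncoef, ncoef, h d hd]

lemma LSph.mul {t : ℕ} {x : H l} (hx : LSph t x) (y : H l) : LSph t (x * y) := fun i h => by
  rw [← mul_assoc, hx i h, smul_mul_assoc]

lemma RSph.mul {r : ℕ} {x : H l} (hx : RSph r x) (y : H l) : RSph r (y * x) := fun i h => by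
  rw [mul_assoc, hx i h, mul_smul_comm]

lemma LSph.smul {t : ℕ} {x : H l} (hx : LSph t x) (c : A) : LSph t (c • x) := fun i h => by
  rw [mul_smul_comm, hx i h, smul_comm]

lemma RSph.smul {r : ℕ} {x : H l} (hx : RSph r x) (c : A) : RSph r (c • x) := fun i h => by
  rw [smul_mul_assoc, hx i h, smul_comm]

lemma LSph.add {t : ℕ} {x y : H l} (hx : LSph t x) (hy : LSph t y) : LSph t (x + y) :=
  fun i h => by rw [mul_add, hx i h, hy i h, smul_add]

lemma RSph.add {r : ℕ} {x y : H l} (hx : RSph r x) (hy : RSph r y) : RSph r (x + y) :=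
  fun i h => by rw [add_mul, hx i h, hy i h, smul_add]

lemma LSph.zero (t : ℕ) : LSph t (0 : H l) := fun i h => by rw [mul_zero, smul_zero]

lemma RSph.zero (r : ℕ) : RSph r (0 : H l) := fun i h => by rw [zero_mul, smul_zero]

lemma LSph.barH {t : ℕ} {x : H l} (hx : LSph t x) : LSph t (barH x) := by
  intro i h
  have h1 := congrArg ISchur.barH (hx i h)
  rw [barH_hGen_mul, barH_smul, barA_qpow, neg_neg, hInv_mul] at h1
  refine coef_ext fun w => ?_
  have h2 := congrArg (fun y => coef y w) h1
  simp only [coef_add, coef_smul] at h2 ⊢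
  linear_combination h2

lemma RSph.barH {r : ℕ} {x : H l} (hx : RSph r x) : RSph r (barH x) := by
  intro i h
  have h1 := congrArg ISchur.barH (hx i h)
  rw [barH_mul, barH_hGen, barH_smul, barA_qpow, neg_neg, hInv, mul_add, mul_smul_comm,
    mul_one] at h1
  refine coef_ext fun w => ?_
  have h2 := congrArg (fun y => coef y w) h1
  simp only [coef_add, coef_smul] at h2 ⊢
  linear_combination h2

lemma LSph.gammaH (hl : 2 ≤ l) {t : ℕ} {x : H l} (hx : LSph t x) :
    LSph (t + 1) (gammaH x) := fun i h => by
  rw [← gammaH_hGen_mul hl, hx i h, gammaH_smul]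

lemma LSph.hB_mul (hl : 2 ≤ l) {t : ℕ} {x : H l} (hx : LSph t x) {w : WD l}
    (hw : w ∈ parab (Oset l t)) : hB w * x = qpow (-len w) • x := by
  refine parab_induction hl (P := fun w => hB w * x = qpow (-len w) • x) ?_ ?_ hw
  · rw [hB_one, one_mul, len_one, Nat.cast_zero, neg_zero, qpow_zero, one_smul]
  · intro i h w _ hlen ih
    rw [← hGen_mul_hB (by omega), mul_assoc, ih, mul_smul_comm, hx i h, smul_smul, ← qpow_add, hlen]
    congr 2
    push_cast
    ring

/-! ### Parity -/

lemma s0_pow_congr {t n : ℕ} (h : t % 2 = n % 2) : s0 ^ t = s0 ^ n := by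
  by_cases ht : Even t
  · rw [s0_pow_of_even ht, s0_pow_of_even (by rw [Nat.even_iff] at *; omega)]
  · rw [s0_pow_of_not_even ht, s0_pow_of_not_even (by rw [Nat.even_iff] at *; omega)]

lemma twist_congr {t n : ℕ} (h : t % 2 = n % 2) (r : ℕ) (w : WD l) :
    twist t r w = twist n r w := by
  rw [twist, s0_pow_congr h, twist]

lemma aNode_congr {t n : ℕ} (h : t % 2 = n % 2) {i : ℤ} (hi : 1 ≤ i ∧ i < l) :
    aNode t i hi = aNode n i hi := by
  refine Subtype.ext ?_
  have : Even t ↔ Even n := by rw [Nat.even_iff, Nat.even_iff, h]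
  simp only [aNode, this]

lemma Oset_congr {t n : ℕ} (h : t % 2 = n % 2) : Oset l t = Oset l n := by
  have : Even t ↔ Even n := by rw [Nat.even_iff, Nat.even_iff, h]
  simp only [Oset, this]

lemma LSph.congr {t n : ℕ} (h : t % 2 = n % 2) {x : H l} (hx : LSph t x) : LSph n x :=
  fun i hi => by rw [← aNode_congr h]; exact hx i hi

lemma negCount_twist_mod_two (hl : 2 ≤ l) (t : ℕ) (w : WD l) :
    negCount l (twist t 0 w) % 2 = t % 2 := by
  have h1 := negCount_s0_pow_mul_mod_two (by omega) (isSigned_coe w) t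
  have h2 := even_negCount_coe w
  rw [twist, pow_zero, mul_one]
  omega

/-- The coefficients of a bi-spherical element depend on the number of minus signs only. -/
lemma ncoef_eq_of_negCount_eq (hl : 2 ≤ l) {t : ℕ} {x : H l} (hx : LSph t x) (hx' : RSph 0 x)
    {w y : WD l} (h : negCount l (twist t 0 w) = negCount l (twist t 0 y)) :
    ncoef x w = ncoef x y := by
  obtain ⟨n, hn⟩ : ∃ n, n = negCount l (twist t 0 y) := ⟨_, rfl⟩
  have hmod : t % 2 = n % 2 := by rw [hn, negCount_twist_mod_two hl]
  have hle : n ≤ l := by rw [hn]; exact negCount_le _ _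
  have key : ∀ w : WD l, negCount l (twist t 0 w) = n → ncoef x w = ncoef x (dW hle) := by
    intro w hw
    rw [twist_congr hmod] at hw
    obtain ⟨a, ha, b, hb, rfl⟩ := DoubleCoset.mem_doubleCoset.mp ((mem_dcoset_iff hl hle).mpr hw)
    rw [← Oset_zero] at hb
    rw [← Oset_congr hmod] at ha
    rw [SetLike.mem_coe] at ha hb
    rw [hx'.ncoef_mul hb, hx.ncoef_mul ha]
  rw [key w (by rw [h, hn]), key y hn.symm]

/-- The longest element with `n` minus signs. -/
def maxW {n : ℕ} (hn : n ≤ l) : WD l := dcMax (Oset l n) (dW hn) (Oplus l)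

lemma negCount_dW {n : ℕ} (hn : n ≤ l) : negCount l (twist n 0 (dW hn)) = n := by
  rw [twist_dW, negCount_dPerm hn]

lemma negCount_maxPerm {n : ℕ} (hn : n ≤ l) : negCount l (maxPerm l n) = n := by
  have : (Finset.Icc (1 : ℤ) l).filter (fun z => maxPerm l n z < 0) =
      Finset.Icc (l - n + 1 : ℤ) l := by
    ext z
    rw [Finset.mem_filter, Finset.mem_Icc, Finset.mem_Icc, maxPerm_apply hn]
    split_ifs <;> omega
  rw [negCount, this, Int.card_Icc]
  omega

lemma negCount_maxW (hl : 2 ≤ l) {n : ℕ} (hn : n ≤ l) :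
    negCount l (twist n 0 (maxW hn)) = n := by
  rw [maxW, twist_dcMax hl, negCount_maxPerm hn]

lemma sph_ext (hl : 2 ≤ l) {t : ℕ} {x y : H l} (hx : LSph t x) (hx' : RSph 0 x) (hy : LSph t y)
    (hy' : RSph 0 y) (e : ∀ n ≤ l, WD l)
    (he : ∀ n (hn : n ≤ l), negCount l (twist n 0 (e n hn)) = n)
    (h : ∀ n (hn : n ≤ l), n % 2 = t % 2 → coef x (e n hn) = coef y (e n hn)) : x = y := by
  refine coef_ext fun w => ?_
  have hmod := negCount_twist_mod_two hl t w
  have h1 : negCount l (twist t 0 w) =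
      negCount l (twist t 0 (e _ (negCount_le l (twist t 0 w)))) := by
    rw [twist_congr hmod.symm 0 (e _ _), he]
  rw [coef_eq_ncoef, coef_eq_ncoef y, ncoef_eq_of_negCount_eq hl hx hx' h1,
    ncoef_eq_of_negCount_eq hl hy hy' h1, ncoef, ncoef, h _ _ hmod]

/-! ### Uniqueness of Kazhdan-Lusztig elements -/

/-- The element `a` of `ℤ[q,q⁻¹]` lies in `qℤ[q]`. -/
def QPos (a : A) : Prop := ∃ p : ℤ[X], a = qpow 1 * p.toLaurent

lemma QPos.zero : QPos 0 := ⟨0, by rw [map_zero, mul_zero]⟩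

lemma QPos.add {a b : A} (ha : QPos a) (hb : QPos b) : QPos (a + b) := by
  obtain ⟨p, rfl⟩ := ha
  obtain ⟨r, rfl⟩ := hb
  exact ⟨p + r, by rw [map_add, mul_add]⟩

lemma QPos.neg {a : A} (ha : QPos a) : QPos (-a) := by
  obtain ⟨p, rfl⟩ := ha
  exact ⟨-p, by rw [map_neg, mul_neg]⟩

lemma toLaurent_X_pow' (k : ℕ) : (Polynomial.X ^ k : ℤ[X]).toLaurent = qpow k :=
  Polynomial.toLaurent_X_pow k

lemma QPos.mul_qpow {a : A} (ha : QPos a) {k : ℤ} (hk : 0 ≤ k) : QPos (a * qpow k) := by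
  obtain ⟨p, rfl⟩ := ha
  lift k to ℕ using hk
  exact ⟨p * Polynomial.X ^ k, by rw [map_mul, toLaurent_X_pow', mul_assoc]⟩

lemma QPos.qpow {k : ℤ} (hk : 0 < k) : QPos (qpow k) := by
  have : QPos (ISchur.qpow 1) := ⟨1, by rw [map_one, mul_one]⟩
  have := this.mul_qpow (k := k - 1) (by omega)
  rwa [← qpow_add, add_sub_cancel] at this

/-- There are no bar invariants in `qℤ[q]`. -/
lemma QPos.eq_zero {a : A} (ha : QPos a) (h : barA a = a) : a = 0 := by
  obtain ⟨p, rfl⟩ := ha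
  by_cases hp : p = 0
  · rw [hp, map_zero, mul_zero]
  exfalso
  have h1 : barA p.toLaurent = p.reverse.toLaurent * ISchur.qpow (-p.natDegree) := by
    rw [LaurentPolynomial.toLaurent_reverse]
    change _ = barA _ * ISchur.qpow p.natDegree * _
    rw [mul_assoc, qpow_mul_neg, mul_one]
  rw [map_mul, barA_qpow, h1] at h
  have h2 : (Polynomial.X ^ (p.natDegree + 2) * p).toLaurent = p.reverse.toLaurent := by
    rw [map_mul, toLaurent_X_pow']
    have e1 : ISchur.qpow ((p.natDegree + 2 : ℕ) : ℤ) =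
        ISchur.qpow p.natDegree * ISchur.qpow 1 * ISchur.qpow 1 := by
      rw [← qpow_add, ← qpow_add]
      congr 1
    have e2 := qpow_mul_neg 1
    have e3 := qpow_mul_neg p.natDegree
    rw [e1]
    linear_combination (-ISchur.qpow p.natDegree * ISchur.qpow 1) * h +
      (p.reverse.toLaurent) * e3 +
      (p.reverse.toLaurent * ISchur.qpow p.natDegree * ISchur.qpow (-p.natDegree)) * e2
  have h3 := congrArg Polynomial.natDegree (Polynomial.toLaurent_injective h2)
  rw [Polynomial.natDegree_mul (pow_ne_zero _ Polynomial.X_ne_zero) hp,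
    Polynomial.natDegree_X_pow] at h3
  have h4 := Polynomial.reverse_natDegree_le p
  omega

lemma eq_zero_of_barH_eq {x : H l} (h : barH x = x) (hq : ∀ w, QPos (coef x w)) : x = 0 := by
  by_contra hx
  have hne : ∃ w, coef x w ≠ 0 := by
    by_contra hc
    push Not at hc
    exact hx (coef_ext hc)
  obtain ⟨w, hw, hmax⟩ := Set.exists_max_image {w | coef x w ≠ 0} len (Set.toFinite _) hne
  refine hw (QPos.eq_zero (hq w) ?_)
  rw [← coef_barH_of_maximal fun y hy => ?_, h]
  by_contra hc
  exact absurd (hmax y hc) hy.not_ge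

/-- The difference of two Kazhdan-Lusztig elements is bar invariant with coefficients in `qℤ[q]`; its
coefficients at elements of maximal length vanish, since the bar involution is triangular. -/
lemma IsKL.unique {w : WD l} {x y : H l} (hx : IsKL w x) (hy : IsKL w y) : x = y := by
  have h : x + (-1 : A) • y = 0 := by
    refine eq_zero_of_barH_eq ?_ fun z => ?_
    · rw [barH_add, barH_smul, hx.1, hy.1, map_neg, map_one]
    · rw [coef_add, coef_smul, neg_one_mul]
      by_cases h1 : z = w
      · rw [h1, hx.2.1, hy.2.1, add_neg_cancel]
        exact QPos.zero
      by_cases h2 : BruhatLT z w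
      · exact QPos.add (hx.2.2.1 z h2) (QPos.neg (hy.2.2.1 z h2))
      · rw [hx.2.2.2 z h1 h2, hy.2.2.2 z h1 h2, neg_zero, add_zero]
        exact QPos.zero
  refine coef_ext fun z => ?_
  have := congrArg (fun u => coef u z) h
  simp only [coef_add, coef_smul, neg_one_mul, coef_zero] at this
  linear_combination this

lemma IsKL.klB_eq {w : WD l} {x : H l} (hx : IsKL w x) : klB w = x :=
  IsKL.unique (Classical.epsilon_spec (p := IsKL w) ⟨x, hx⟩) hx

/-! ### The standard spherical elements -/

/-- The length of the longest element with `n` minus signs. -/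
def maxLen (l n : ℕ) : ℤ := 2 * l.choose 2 - (l - n).choose 2

lemma len_maxW (hl : 2 ≤ l) {n : ℕ} (hn : n ≤ l) : (len (maxW hn) : ℤ) = maxLen l n := by
  have := len_dcMax hl hn
  rw [maxW, maxLen]
  omega

/-- The normalized sum over all elements with `n` minus signs. It is the component of the standard
basis element `h_((O±) dₙ (O+))` of `V`, and is zero for `n > l`. -/
def sElt (l n : ℕ) : H l :=
  ∑ w, (if negCount l (twist n 0 w) = n then qpow (maxLen l n - len w) else 0) • hB w

lemma coef_sElt (n : ℕ) (w : WD l) : coef (sElt l n) w =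
    if negCount l (twist n 0 w) = n then qpow (maxLen l n - len w) else 0 :=
  coef_sum_smul_hB (fun w : WD l =>
    if negCount l (twist n 0 w) = n then qpow (maxLen l n - len w) else 0) (Equiv.refl _) w

lemma ncoef_sElt (n : ℕ) (w : WD l) : ncoef (sElt l n) w =
    if negCount l (twist n 0 w) = n then qpow (maxLen l n) else 0 := by
  rw [ncoef, coef_sElt]
  split_ifs
  · rw [← qpow_add, sub_add_cancel]
  · rw [zero_mul]

lemma lsph_sElt (l n : ℕ) : LSph n (sElt l n) := by
  rw [lsph_iff]
  intro i h w
  rw [ncoef_sElt, ncoef_sElt, negCount_twist_parab_mul (sW_mem_parab (aNode_mem_Oset n h))]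

lemma rsph_sElt (hl : 2 ≤ l) (n : ℕ) : RSph 0 (sElt l n) := by
  rw [rsph_iff]
  intro i h w
  rw [ncoef_sElt, ncoef_sElt, negCount_twist_mul_parab hl (sW_mem_parab (aNode_mem_Oset 0 h))]

lemma hS_eq (hl : 2 ≤ l) {n : ℕ} (hn : n ≤ l) :
    hS (Oset l n) (dW hn) (Oplus l) = comp (Oset l n) (Oplus l) (sElt l n) := by
  classical
  rw [hS, sElt, Finset.sum_filter]
  congr 1
  refine Finset.sum_congr rfl fun w _ => ?_
  rw [dcLen_eq hl, ← len_maxW hl hn]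
  by_cases h : negCount l (twist n 0 w) = n
  · rw [if_pos h, if_pos ((mem_dcoset_iff hl hn).mpr h)]
    rfl
  · rw [if_neg h, if_neg (mt (mem_dcoset_iff hl hn).mp h), zero_smul]

lemma len_le_maxLen (hl : 2 ≤ l) {n : ℕ} {w : WD l} (h : negCount l (twist n 0 w) = n) :
    (len w : ℤ) ≤ maxLen l n := by
  have hn : n ≤ l := by rw [← h]; exact negCount_le _ _
  rw [← len_maxW hl hn]
  rcases eq_dcMax_or_bruhatLT hl hn w h.le with h1 | h1
  · rw [h1]; rfl
  · exact_mod_cast h1.len_lt.le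

/-- Combinations of the standard spherical elements are Kazhdan-Lusztig elements as soon as they
are bar invariant and triangular. -/
lemma isKL_maxW (hl : 2 ≤ l) {n : ℕ} (hn : n ≤ l) {f : ℕ → A} (hf : f n = 1)
    (hf0 : ∀ m, m % 2 ≠ n % 2 → f m = 0) (hfq : ∀ m < n, QPos (f m))
    (hbar : barH (∑ m ∈ Finset.range (n + 1), f m • sElt l m) =
      ∑ m ∈ Finset.range (n + 1), f m • sElt l m) :
    IsKL (maxW hn) (∑ m ∈ Finset.range (n + 1), f m • sElt l m) := by
  have hcoef : ∀ w : WD l, coef (∑ m ∈ Finset.range (n + 1), f m • sElt l m) w =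
      if negCount l (twist n 0 w) ≤ n then f (negCount l (twist n 0 w)) *
        qpow (maxLen l (negCount l (twist n 0 w)) - len w) else 0 := by
    intro w
    have hmod := negCount_twist_mod_two hl n w
    set k := negCount l (twist n 0 w) with hk
    have hterm : ∀ m, m ≠ k → coef (f m • sElt l m) w = 0 := by
      intro m hm
      rw [coef_smul, coef_sElt]
      by_cases hp : m % 2 = n % 2
      · rw [if_neg, mul_zero]
        rw [twist_congr hp, ← hk]
        exact Ne.symm hm
      · rw [hf0 m hp, zero_mul]
    rw [coef_sum]
    split_ifs with hle
    · rw [Finset.sum_eq_single k (fun m _ hm => hterm m hm)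
        (fun h => absurd (Finset.mem_range.mpr (by omega)) h), coef_smul, coef_sElt, if_pos]
      rw [twist_congr hmod]
    · exact Finset.sum_eq_zero fun m hm => hterm m (by have := Finset.mem_range.mp hm; omega)
  refine ⟨hbar, ?_, fun y hy => ?_, fun y hy1 hy2 => ?_⟩
  · rw [hcoef, negCount_maxW hl, if_pos le_rfl, hf, len_maxW hl, sub_self, qpow_zero, mul_one]
  · change QPos _
    rw [hcoef]
    split_ifs with h
    · have hmod := negCount_twist_mod_two hl n y
      rcases h.lt_or_eq with h1 | h1
      · refine (hfq _ h1).mul_qpow ?_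
        have := len_le_maxLen hl (n := negCount l (twist n 0 y)) (w := y) (by
          rw [twist_congr hmod])
        omega
      · rw [h1, hf, one_mul]
        refine QPos.qpow ?_
        have := hy.len_lt
        rw [← len_maxW hl hn]
        omega
    · exact QPos.zero
  · rw [hcoef, if_neg]
    intro h
    rcases eq_dcMax_or_bruhatLT hl hn y h with h1 | h1
    · exact hy1 h1
    · exact hy2 h1

/-- The standard spherical elements in the two minimal double cosets are bar invariant. -/
lemma barH_sElt_of_le_one (hl : 2 ≤ l) {n : ℕ} (hn : n ≤ 1) : barH (sElt l n) = sElt l n := by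
  refine sph_ext hl (lsph_sElt l n).barH (rsph_sElt hl n).barH (lsph_sElt l n) (rsph_sElt hl n)
    (fun m hm => maxW hm) (fun m hm => negCount_maxW hl hm) fun m hm hmod => ?_
  have hc : ∀ w : WD l, negCount l (twist n 0 w) = n → len w ≤ len (maxW hm) := by
    intro w hw
    have h1 := len_le_maxLen hl hw
    have h2 := len_maxW hl hm
    have h3 : (l - m).choose 2 ≤ (l - n).choose 2 := Nat.choose_le_choose 2 (by omega)
    rw [maxLen] at h1 h2
    omega
  have hm' := negCount_maxW hl hm
  rw [coef_barH_of_maximal fun w hw => ?_]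
  · rw [coef_sElt, twist_congr hmod.symm, hm']
    split_ifs with h
    · subst h
      rw [len_maxW hl, sub_self, qpow_zero, map_one]
    · rw [map_zero]
  · rw [coef_sElt, if_neg fun h => absurd (hc w h) hw.not_ge]

lemma klB_maxW_of_le_one (hl : 2 ≤ l) {n : ℕ} (hn : n ≤ l) (h1 : n ≤ 1) :
    klB (maxW hn) = sElt l n := by
  have e : ∑ m ∈ Finset.range (n + 1), (if m = n then (1 : A) else 0) • sElt l m = sElt l n := by
    rw [Finset.sum_eq_single n, if_pos rfl, one_smul]
    · intro m _ hm
      rw [if_neg hm, zero_smul]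
    · exact fun h => absurd (Finset.self_mem_range_succ n) h
  have h2 := isKL_maxW hl hn (f := fun m => if m = n then 1 else 0) (if_pos rfl)
    (fun m hm => if_neg fun h => hm (by rw [h]))
    (fun m hm => by rw [if_neg hm.ne]; exact QPos.zero)
    (by rw [e, barH_sElt_of_le_one hl h1])
  rw [e] at h2
  exact h2.klB_eq

/-! ### The idempotents -/

/-- The normalized sum over `W_(O±)`. -/
def pElt (l t : ℕ) : H l :=
  ∑ w, (if negCount l (twist t t w) = 0 then qpow (l.choose 2 - len w) else 0) • hB w

lemma coef_pElt (t : ℕ) (w : WD l) : coef (pElt l t) w =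
    if negCount l (twist t t w) = 0 then qpow (l.choose 2 - len w) else 0 :=
  coef_sum_smul_hB (fun w : WD l =>
    if negCount l (twist t t w) = 0 then qpow (l.choose 2 - len w) else 0) (Equiv.refl _) w

lemma pElt_zero (l : ℕ) : pElt l 0 = sElt l 0 := by
  refine coef_ext fun w => ?_
  rw [coef_pElt, coef_sElt, maxLen, Nat.sub_zero]
  congr 2
  ring

lemma gammaH_pElt (hl : 2 ≤ l) (t : ℕ) : gammaH (pElt l t) = pElt l (t + 1) := by
  refine coef_ext fun w => ?_
  rw [coef_gammaH, coef_pElt, coef_pElt, len_gammaW hl, ← twist_add t, gammaW_gammaW]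

lemma barH_pElt (hl : 2 ≤ l) (t : ℕ) : barH (pElt l t) = pElt l t := by
  induction t with
  | zero => rw [pElt_zero, barH_sElt_of_le_one hl (Nat.zero_le _)]
  | succ t ih => rw [← gammaH_pElt hl, ← gammaH_barH hl, ih]

lemma rhoH_pElt (hl : 2 ≤ l) (t : ℕ) : rhoH (pElt l t) = pElt l t := by
  refine coef_ext fun w => ?_
  rw [coef_rhoH, coef_pElt, coef_pElt, len_inv, ← twist_inv, negCount_inv (isSigned_twist hl _ _ _)]

lemma lsph_pElt (l t : ℕ) : LSph t (pElt l t) := by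
  rw [lsph_iff]
  intro i h w
  rw [ncoef, ncoef, coef_pElt, coef_pElt,
    negCount_twist_parab_mul (sW_mem_parab (aNode_mem_Oset t h))]
  split_ifs
  · rw [← qpow_add, ← qpow_add, sub_add_cancel, sub_add_cancel]
  · rw [zero_mul, zero_mul]

lemma rsph_pElt (hl : 2 ≤ l) (t : ℕ) : RSph t (pElt l t) := by
  rw [rsph_iff_rhoH, rhoH_pElt hl]
  exact lsph_pElt l t

lemma eq_longest_or_bruhatLT (hl : 2 ≤ l) {t : ℕ} (y : WD l) (hy : y ∈ parab (Oset l t)) :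
    y = longest (Oset l t) ∨ BruhatLT y (longest (Oset l t)) := by
  generalize hk : len (longest (Oset l t)) - len y = k
  induction k using Nat.strong_induction_on generalizing y with
  | _ k ih =>
    by_cases hd : ∃ i : ℤ, ∃ hi : 1 ≤ i ∧ i < l, ¬ len (sW (aNode t i hi) * y) < len y
    · obtain ⟨i, hi, hd⟩ := hd
      have hlt : len y < len (sW (aNode t i hi) * y) := by
        have := len_sW_mul_cases y (aNode t i hi)
        omega
      have hm := mul_mem (sW_mem_parab (aNode_mem_Oset t hi)) hy
      have hb := (longest_spec (Oset l t)).2 _ hm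
      right
      rcases ih _ (by omega) _ hm rfl with h | h
      · rw [← h]; exact bruhatLT_sW_mul hlt
      · exact (bruhatLT_sW_mul hlt).trans h
    · push Not at hd
      left
      have := twist_eq_revPerm hl hy hd
      rw [← twist_longest hl t] at this
      exact twist_injective this

/-- The Kazhdan-Lusztig element of the longest element of `W_(O±)` is the normalized sum. -/
lemma klB_longest (hl : 2 ≤ l) (t : ℕ) : klB (longest (Oset l t)) = pElt l t := by
  have h1 := len_longest_Oset hl t
  refine IsKL.klB_eq ⟨barH_pElt hl t, ?_, fun y hy => ?_, fun y hy1 hy2 => ?_⟩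
  · rw [coef_pElt, if_pos ((mem_parab_Oset_iff hl).mp (longest_spec _).1), h1, sub_self, qpow_zero]
  · change QPos _
    rw [coef_pElt]
    split_ifs
    · refine QPos.qpow ?_
      have := hy.len_lt
      omega
    · exact QPos.zero
  · rw [coef_pElt, if_neg]
    intro h
    rcases eq_longest_or_bruhatLT hl y ((mem_parab_Oset_iff hl).mpr h) with h2 | h2
    · exact hy1 h2
    · exact hy2 h2

lemma pElt_mul_aux (hl : 2 ≤ l) {t : ℕ} {x : H l} (hx : LSph t x) :
    pElt l t * x = barA (poin (Oset l t)) • x := by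
  classical
  rw [pElt, Finset.sum_mul, poin, map_sum, Finset.sum_smul, Finset.sum_filter]
  refine Finset.sum_congr rfl fun w _ => ?_
  by_cases h : w ∈ parab (Oset l t)
  · rw [if_pos ((mem_parab_Oset_iff hl).mp h), if_pos h, smul_mul_assoc, hx.hB_mul hl h, smul_smul,
      ← qpow_add, barA_qpow, len_longest_Oset hl]
    congr 2
    ring
  · rw [if_neg (mt (mem_parab_Oset_iff hl).mpr h), if_neg h, zero_smul, zero_mul]

/-- The Poincaré polynomial is bar invariant, being the eigenvalue of a bar invariant element on a
bar invariant eigenvector. -/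
lemma barA_poin (hl : 2 ≤ l) (t : ℕ) : barA (poin (Oset l t)) = poin (Oset l t) := by
  have h1 := pElt_mul_aux hl (lsph_pElt l t)
  have h2 := congrArg barH h1
  rw [barH_mul, barH_smul, barH_pElt hl, h1, barA_barA] at h2
  have h3 := congrArg (fun x => coef x (longest (Oset l t))) h2
  simp only [coef_smul] at h3
  rw [coef_pElt, if_pos ((mem_parab_Oset_iff hl).mp (longest_spec _).1)] at h3
  exact mul_right_cancel₀ (qpow_ne_zero _) h3

lemma pElt_mul (hl : 2 ≤ l) {t : ℕ} {x : H l} (hx : LSph t x) :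
    pElt l t * x = poin (Oset l t) • x := by
  rw [pElt_mul_aux hl hx, barA_poin hl]

lemma mul_pElt (hl : 2 ≤ l) {t : ℕ} {x : H l} (hx : RSph t x) :
    x * pElt l t = poin (Oset l t) • x := by
  have := congrArg rhoH (pElt_mul hl (rsph_iff_rhoH.mp hx))
  rwa [rhoH_mul, rhoH_smul, rhoH_rhoH, rhoH_pElt hl] at this

/-- At `q = 1` the Poincaré polynomial becomes the order of the parabolic subgroup. -/
lemma poin_ne_zero (I : Set (Node l)) : poin I ≠ 0 := by
  classical
  intro h0
  have h1 := congrArg evalOne h0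
  rw [poin, map_sum, map_zero] at h1
  simp only [evalOne_qpow, Finset.sum_const, nsmul_eq_mul, mul_one, Nat.cast_eq_zero,
    Finset.card_eq_zero, Finset.filter_eq_empty_iff] at h1
  exact h1 (Finset.mem_univ 1) (one_mem _)

lemma poin_Oset (hl : 2 ≤ l) (t : ℕ) : poin (Oset l t) = poin (Oplus l) := by
  classical
  have step : ∀ t, poin (Oset l (t + 1)) = poin (Oset l t) := by
    intro t
    rw [poin, poin, Finset.sum_filter, Finset.sum_filter, len_longest_Oset hl, len_longest_Oset hl]
    rw [← Equiv.sum_comp (⟨gammaW, gammaW, gammaW_gammaW, gammaW_gammaW⟩ : WD l ≃ WD l)]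
    refine Finset.sum_congr rfl fun w _ => ?_
    have : gammaW w ∈ parab (Oset l (t + 1)) ↔ w ∈ parab (Oset l t) := by
      rw [mem_parab_Oset_iff hl, mem_parab_Oset_iff hl, twist_add]
    simp only [Equiv.coe_fn_mk, this, len_gammaW hl]
  induction t with
  | zero => rw [Oset_zero]
  | succ t ih => rw [step, ih]

/-! ### Divisibility of spherical elements by the idempotents -/

lemma coef_hB_mul {w y : WD l} (z : H l) (h : len (w⁻¹ * y) = len w + len y) :
    coef (hB w * z) y = coef z (w⁻¹ * y) := by
  induction w using len_induction generalizing y with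
  | one => rw [hB_one, one_mul, inv_one, one_mul]
  | step i w hw ih =>
    rw [mul_inv_rev, sW_inv, mul_assoc] at h ⊢
    have h1 := len_mul_le w⁻¹ (sW i * y)
    have h2 := len_sW_mul_cases y i
    rw [len_inv] at h1
    rw [← hGen_mul_hB (by omega), mul_assoc, coef_hGen_mul, if_neg (by omega), sub_zero,
      ih (by omega)]

open Classical in
/-- The part of `x` supported on minimal coset representatives, normalized. -/
def minPart (t : ℕ) (x : H l) : H l :=
  ∑ d, (if LeftMin t d then qpow (-l.choose 2) * coef x d else 0) • hB d

open Classical in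
lemma coef_minPart (t : ℕ) (x : H l) (d : WD l) : coef (minPart t x) d =
    if LeftMin t d then qpow (-l.choose 2) * coef x d else 0 :=
  coef_sum_smul_hB (fun d : WD l => if LeftMin t d then qpow (-l.choose 2) * coef x d else 0)
    (Equiv.refl _) d

/-- Left spherical elements lie in the right ideal of the idempotent. So a component of the `q`-Schur
algebra consists of all bi-spherical elements. -/
lemma LSph.eq_pElt_mul (hl : 2 ≤ l) {t : ℕ} {x : H l} (hx : LSph t x) :
    x = pElt l t * minPart t x := by
  refine hx.ext ((lsph_pElt l t).mul _) fun d hd => ?_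
  rw [pElt, Finset.sum_mul, coef_sum, Finset.sum_eq_single 1]
  · rw [twist_self_one, negCount_one, if_pos rfl, hB_one, smul_mul_assoc, one_mul, coef_smul,
      coef_minPart, if_pos hd, len_one, ← mul_assoc, Nat.cast_zero, sub_zero, qpow_mul_neg, one_mul]
  · intro w _ hw
    split_ifs with h
    · have hw' := inv_mem ((mem_parab_Oset_iff hl).mpr h)
      rw [smul_mul_assoc, coef_smul, coef_hB_mul _ (by rw [len_parab_mul hl hd hw', len_inv]),
        coef_minPart, if_neg, mul_zero]
      intro h1
      exact hw (inv_eq_one.mp (eq_one_of_leftMin_mul hl hd hw' h1))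
    · rw [zero_smul, zero_mul, coef_zero]
  · exact fun h => absurd (Finset.mem_univ _) h

lemma RSph.eq_mul_pElt (hl : 2 ≤ l) {t : ℕ} {x : H l} (hx : RSph t x) :
    x = rhoH (minPart t (rhoH x)) * pElt l t := by
  have := congrArg rhoH (LSph.eq_pElt_mul hl (rsph_iff_rhoH.mp hx))
  rwa [rhoH_mul, rhoH_rhoH, rhoH_pElt hl] at this

/-! ### The element `b` -/

/-- The minimal representatives of the cosets `x W_(O±)` in the double coset of `b`: the cycles
`sₖ ⋯ s₂ s₁` in `W_(O∓)`. -/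
def cyc (l t : ℕ) : ℕ → WD l
  | 0 => 1
  | k + 1 => if h : (k : ℤ) + 1 < l then sW (aNode t (k + 1) ⟨by omega, h⟩) * cyc l t k else 1

lemma cyc_succ {t k : ℕ} (h : (k : ℤ) + 1 < l) :
    cyc l t (k + 1) = sW (aNode t (k + 1) ⟨by omega, h⟩) * cyc l t k := dif_pos h

lemma cyc_mem (t k : ℕ) : cyc l t k ∈ parab (Oset l t) := by
  induction k with
  | zero => exact one_mem _
  | succ k ih =>
    rw [cyc]
    split_ifs with h
    · exact mul_mem (sW_mem_parab (aNode_mem_Oset t _)) ih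
    · exact one_mem _

lemma twist_cyc_inv (t : ℕ) {k : ℕ} (hk : k < l) {z : ℤ} (hz : 1 ≤ z) :
    (twist t t (cyc l t k))⁻¹ z = if z = k + 1 then 1 else if z ≤ k then z + 1 else z := by
  induction k generalizing z with
  | zero =>
    rw [cyc, twist_self_one, inv_one, Equiv.Perm.one_apply]
    push_cast
    split_ifs <;> omega
  | succ k ih =>
    rw [cyc_succ (by omega), twist_self_mul, twist_sW, mul_inv_rev, sPerm_eq_aNode_zero
      (l := l) ⟨by omega, by omega⟩, sPerm_inv, ← sPerm_eq_aNode_zero, Equiv.Perm.mul_apply,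
      sPerm_apply_of_pos (by omega), ih (by omega) (by split_ifs <;> omega)]
    push_cast
    split_ifs <;> omega

lemma len_cyc (hl : 2 ≤ l) (t : ℕ) {k : ℕ} (hk : k < l) : len (cyc l t k) = k := by
  induction k with
  | zero => exact len_one
  | succ k ih =>
    rw [cyc_succ (by omega), len_sW_aNode_mul_of_lt hl t, ih (by omega)]
    rw [twist_cyc_inv t (by omega) (by omega), twist_cyc_inv t (by omega) (by omega)]
    split_ifs <;> omega

lemma gammaW_cyc (t k : ℕ) : gammaW (cyc l t k) = cyc l (t + 1) k := by
  have h1 : gammaW (1 : WD l) = 1 := Subtype.ext (by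
    change s0 * 1 * s0 = 1
    rw [mul_one, s0_mul_s0])
  induction k with
  | zero => exact h1
  | succ k ih =>
    rw [cyc, cyc]
    split_ifs
    · rw [gammaW_mul, ih, gammaW_sW_aNode]
    · exact h1

/-- The element by which `b` acts, with the idempotent split off. -/
def aElt (l t : ℕ) : H l := ∑ k ∈ Finset.range l, qpow ((l : ℤ) - 1 - k) • hB (cyc l t k)

lemma gammaH_hB (w : WD l) : gammaH (hB w) = hB (gammaW w) := by
  refine coef_ext fun y => ?_
  rw [coef_gammaH, coef_hB, coef_hB]
  refine delta_congr ⟨fun h => ?_, fun h => ?_⟩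
  · rw [← h, gammaW_gammaW]
  · rw [h, gammaW_gammaW]

lemma gammaH_sum {ι : Type*} (s : Finset ι) (f : ι → H l) :
    gammaH (∑ i ∈ s, f i) = ∑ i ∈ s, gammaH (f i) := by
  classical
  induction s using Finset.induction_on with
  | empty => rw [Finset.sum_empty, Finset.sum_empty, gammaH_zero]
  | insert a s ha ih => rw [Finset.sum_insert ha, Finset.sum_insert ha, gammaH_add, ih]

lemma gammaH_aElt (t : ℕ) : gammaH (aElt l t) = aElt l (t + 1) := by
  rw [aElt, gammaH_sum]
  exact Finset.sum_congr rfl fun k _ => by rw [gammaH_smul, gammaH_hB, gammaW_cyc]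

/-- A signed permutation without minus signs that increases on `2, …, l` is determined by its
value at `1`. -/
lemma twist_eq_twist_cyc (hl : 2 ≤ l) {d : WD l} (hd : d ∈ parab (Oset l 1)) {k : ℕ}
    (hk : twist 1 1 d 1 = k + 1)
    (hinc : ∀ i : ℤ, 2 ≤ i → i < l → twist 1 1 d i < twist 1 1 d (i + 1)) : d = cyc l 1 k := by
  have m1 := parab_apply_mem hl hd (z := 1) le_rfl (by omega)
  have hkl : k < l := by omega
  have key : (cyc l 1 k)⁻¹ * d = 1 := by
    have hm := mul_mem (inv_mem (cyc_mem 1 k)) hd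
    refine twist_injective (t := 1) (r := 1) ?_
    rw [twist_self_one]
    refine (isSigned_twist hl 1 1 _).eq_one_of_increasing (fun i h1 h2 => ?_)
      ((mem_parab_Oset_iff hl).mp hm)
    have a1 := parab_apply_mem hl hd (z := i) h1 h2.le
    have a2 := parab_apply_mem hl hd (z := i + 1) (by omega) (by omega)
    have n2 : twist 1 1 d (i + 1) ≠ k + 1 := fun h => by
      have := (twist 1 1 d).injective (h.trans hk.symm)
      omega
    rw [twist_self_mul, ← twist_inv, Equiv.Perm.mul_apply, Equiv.Perm.mul_apply,
      twist_cyc_inv 1 hkl a1.1, twist_cyc_inv 1 hkl a2.1]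
    rcases h1.lt_or_eq with h3 | h3
    · have h4 := hinc i (by omega) h2
      split_ifs <;> omega
    · obtain rfl : i = 1 := h3.symm
      rw [hk, if_pos rfl, if_neg n2]
      split_ifs <;> omega
  rw [← mul_one (cyc l 1 k), ← key, mul_inv_cancel_left]

lemma twist_one_zero (w : WD l) : twist 1 0 w = twist 1 1 w * s0 := by
  rw [twist, twist, pow_one, pow_zero, mul_one, mul_assoc, s0_mul_s0, mul_one]

/-- The representatives of the cosets of `W_(O+)` in the double coset of `b`. -/
lemma leftMin_inv_iff (hl : 2 ≤ l) {d : WD l} :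
    LeftMin 0 d⁻¹ ∧ negCount l (twist 1 0 d) = 1 ↔ ∃ k < l, d = cyc l 1 k := by
  have s1 : s0 1 = -1 := by rw [s0_apply, if_pos rfl]
  have s2 : ∀ z : ℤ, 2 ≤ z → s0 z = z := fun z hz => by
    rw [s0_apply, if_neg (by omega), if_neg (by omega)]
  constructor
  · rintro ⟨h1, h2⟩
    have hs := isSigned_twist hl 1 1 d
    have hinc : ∀ y z : ℤ, 1 ≤ y → y < z → z ≤ l → twist 1 0 d y < twist 1 0 d z := by
      intro y z h3 h4 h5
      have := h1.strictMono hl 1 h3 h4 h5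
      rwa [← twist_inv, inv_inv] at this
    have h3 : twist 1 0 d 1 < 0 := by
      by_contra h
      have : negCount l (twist 1 0 d) = 0 := by
        rw [negCount, Finset.card_eq_zero, Finset.filter_eq_empty_iff]
        intro z hz
        rw [Finset.mem_Icc] at hz
        rcases hz.1.lt_or_eq with h4 | h4
        · have := hinc 1 z le_rfl h4 hz.2
          omega
        · rw [← h4]; exact h
      omega
    rw [twist_one_zero, Equiv.Perm.mul_apply, s1, hs.map_neg] at h3
    have hpar : d ∈ parab (Oset l 1) := by
      rw [mem_parab_Oset_iff hl]
      have e1 := negCount_s0_mul_of_neg (l := l) (by omega) (isSigned_twist hl 1 0 d).inv (by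
        rw [inv_inv, twist_one_zero, Equiv.Perm.mul_apply, s1, hs.map_neg]
        exact h3)
      rw [negCount_inv (isSigned_twist hl 1 0 d), h2] at e1
      rw [← negCount_inv hs]
      have e2 : (twist 1 1 d)⁻¹ = s0 * (twist 1 0 d)⁻¹ := by
        rw [twist_one_zero, mul_inv_rev, ← mul_assoc, mul_inv_cancel, one_mul]
      rw [e2]
      omega
    have m1 := parab_apply_mem hl hpar (z := 1) le_rfl (by omega)
    refine ⟨(twist 1 1 d 1 - 1).toNat, by omega, twist_eq_twist_cyc hl hpar (by omega) ?_⟩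
    intro i hi1 hi2
    have := hinc i (i + 1) (by omega) (by omega) (by omega)
    rwa [twist_one_zero, Equiv.Perm.mul_apply, Equiv.Perm.mul_apply, s2 i hi1,
      s2 _ (by omega)] at this
  · rintro ⟨k, hk, rfl⟩
    have hs := isSigned_twist hl 1 1 (cyc l 1 k)
    have v1 : twist 1 1 (cyc l 1 k) 1 = k + 1 := by
      have := twist_cyc_inv 1 hk (z := k + 1) (by omega)
      rw [if_pos rfl] at this
      have h2 := congrArg (twist 1 1 (cyc l 1 k)) this
      rw [perm_apply_inv] at h2
      exact h2.symm
    have v2 : ∀ z : ℤ, 2 ≤ z → z ≤ l → twist 1 1 (cyc l 1 k) z = if z ≤ k + 1 then z - 1 else z := by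
      intro z h1 h2
      have e1 := twist_cyc_inv 1 hk (z := if z ≤ k + 1 then z - 1 else z) (by split_ifs <;> omega)
      have e2 : (twist 1 1 (cyc l 1 k))⁻¹ (if z ≤ k + 1 then z - 1 else z) = z := by
        rw [e1]
        split_ifs <;> omega
      rw [← e2, perm_apply_inv, e2]
    constructor
    · intro i h
      have := (len_sW_aNode_mul_lt_iff hl 1 (t := 0) (w := (cyc l 1 k)⁻¹) h)
      rw [← twist_inv, inv_inv, twist_one_zero, Equiv.Perm.mul_apply, Equiv.Perm.mul_apply,
        s2 (i + 1) (by omega), v2 (i + 1) (by omega) (by omega)] at this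
      have h2 := len_sW_mul_cases (cyc l 1 k)⁻¹ (aNode 0 i h)
      have h3 : ¬ len (sW (aNode 0 i h) * (cyc l 1 k)⁻¹) < len (cyc l 1 k)⁻¹ := by
        rw [this]
        rcases h.1.lt_or_eq with h4 | h4
        · rw [s2 i (by omega), v2 i (by omega) (by omega)]
          split_ifs <;> omega
        · rw [← h4, s1, hs.map_neg, v1]
          split_ifs <;> omega
      omega
    · have e2 : (twist 1 0 (cyc l 1 k))⁻¹ = s0 * (twist 1 1 (cyc l 1 k))⁻¹ := by
        rw [twist_one_zero, mul_inv_rev]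
        rfl
      rw [← negCount_inv (isSigned_twist hl 1 0 _), e2, negCount_s0_mul_of_pos (by omega) hs.inv (by
        rw [inv_inv, v1]; omega), negCount_inv hs, (mem_parab_Oset_iff hl).mp (cyc_mem 1 k)]

lemma choose_two_step {n : ℕ} (h : 1 ≤ n) : n.choose 2 = (n - 1).choose 2 + (n - 1) := by
  obtain ⟨m, rfl⟩ : ∃ m, n = m + 1 := ⟨n - 1, by omega⟩
  rw [Nat.add_sub_cancel, Nat.choose_succ_succ' m 1, Nat.choose_one_right]
  exact add_comm _ _

lemma maxLen_succ {n : ℕ} (h : n < l) : maxLen l (n + 1) = maxLen l n + (l - n - 1) := by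
  have := choose_two_step (n := l - n) (by omega)
  rw [maxLen, maxLen, show l - (n + 1) = l - n - 1 by omega]
  omega

lemma cyc_injective {k k' : ℕ} (hl : 2 ≤ l) (hk : k < l) (hk' : k' < l)
    (h : cyc l 1 k = cyc l 1 k') : k = k' := by
  rw [← len_cyc hl 1 hk, h, len_cyc hl 1 hk']

/-- The element `b_(O-,O+)` factors through the idempotent of `O+`. -/
lemma sElt_one (hl : 2 ≤ l) : sElt l 1 = aElt l 1 * pElt l 0 := by
  rw [(rsph_sElt hl 1).eq_mul_pElt hl]
  congr 1
  refine coef_ext fun d => ?_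
  rw [coef_rhoH, coef_minPart, coef_rhoH, inv_inv, coef_sElt, aElt, coef_sum]
  simp only [coef_smul, coef_hB]
  by_cases h : ∃ k < l, d = cyc l 1 k
  · obtain ⟨k, hk, rfl⟩ := h
    obtain ⟨h1, h2⟩ := (leftMin_inv_iff hl).mpr ⟨k, hk, rfl⟩
    rw [if_pos h1, if_pos h2, Finset.sum_eq_single k, delta_self, mul_one, ← qpow_add,
      maxLen_succ (by omega), len_cyc hl 1 hk, maxLen, Nat.sub_zero]
    · congr 1
      push_cast
      ring
    · intro k' hk' hne
      rw [delta_of_ne, mul_zero]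
      exact fun h => hne (cyc_injective hl (Finset.mem_range.mp hk') hk h.symm)
    · exact fun h => absurd (Finset.mem_range.mpr hk) h
  · rw [Finset.sum_eq_zero]
    · by_cases h1 : LeftMin 0 d⁻¹
      · rw [if_pos h1, if_neg, mul_zero]
        exact fun h2 => h ((leftMin_inv_iff hl).mp ⟨h1, h2⟩)
      · rw [if_neg h1]
    · intro k hk
      rw [delta_of_ne, mul_zero]
      exact fun h1 => h ⟨k, Finset.mem_range.mp hk, h1⟩

/-- The element `b_(O-,O+)` (`t` odd) or its conjugate under the diagram automorphism (`t` even). -/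
def bElt (l t : ℕ) : H l := aElt l t * pElt l (t + 1)

lemma aElt_congr {t n : ℕ} (h : t % 2 = n % 2) : aElt l t = aElt l n := by
  have : ∀ k, cyc l t k = cyc l n k := by
    intro k
    induction k with
    | zero => rfl
    | succ k ih =>
      rw [cyc, cyc]
      split_ifs
      · rw [ih, aNode_congr h]
      · rfl
  simp only [aElt, this]

lemma pElt_congr {t n : ℕ} (h : t % 2 = n % 2) : pElt l t = pElt l n := by
  have : ∀ w : WD l, twist t t w = twist n n w := fun w => by
    rw [twist, twist, s0_pow_congr h]
  simp only [pElt, this]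

lemma bElt_congr {t n : ℕ} (h : t % 2 = n % 2) : bElt l t = bElt l n := by
  rw [bElt, bElt, aElt_congr h, pElt_congr (t := t + 1) (n := n + 1) (by omega)]

lemma bElt_one (hl : 2 ≤ l) : bElt l 1 = sElt l 1 := by
  rw [sElt_one hl, bElt, pElt_congr (t := 1 + 1) (n := 0) rfl]

lemma gammaH_bElt (hl : 2 ≤ l) (t : ℕ) : gammaH (bElt l t) = bElt l (t + 1) := by
  rw [bElt, gammaH_mul hl, gammaH_aElt, gammaH_pElt hl, bElt]

lemma bElt_zero (hl : 2 ≤ l) : bElt l 0 = gammaH (sElt l 1) := by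
  rw [← bElt_one hl, gammaH_bElt hl, bElt_congr (t := 1 + 1) (n := 0) rfl]

lemma lsph_bElt (hl : 2 ≤ l) (t : ℕ) : LSph t (bElt l t) := by
  induction t with
  | zero => rw [bElt_zero hl]; exact ((lsph_sElt l 1).gammaH hl).congr rfl
  | succ t ih => rw [← gammaH_bElt hl]; exact ih.gammaH hl

lemma barH_bElt (hl : 2 ≤ l) (t : ℕ) : barH (bElt l t) = bElt l t := by
  have h1 : barH (bElt l 1) = bElt l 1 := by rw [bElt_one hl, barH_sElt_of_le_one hl le_rfl]
  rcases Nat.mod_two_eq_zero_or_one t with h | h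
  · rw [bElt_congr (n := 0) h, bElt_zero hl, ← gammaH_barH hl, barH_sElt_of_le_one hl le_rfl]
  · rw [bElt_congr (n := 1) h, h1]

/-- The anti-involution exchanges `b_(O-,O+)` and its conjugate. -/
lemma rhoH_bElt (hl : 2 ≤ l) (t : ℕ) : rhoH (bElt l t) = bElt l (t + 1) := by
  have h1 : rhoH (bElt l 1) = bElt l 0 := by
    rw [bElt_zero hl, bElt_one hl]
    refine coef_ext fun w => ?_
    have e : negCount l (twist 1 0 w⁻¹) = negCount l (twist 1 0 (gammaW w)) := by
      rw [← negCount_inv (isSigned_twist hl _ _ _), twist_inv, inv_inv, ← twist_add 1 0,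
        gammaW_gammaW, twist_congr (t := 1 + 1) (n := 0) rfl]
    rw [coef_rhoH, coef_gammaH, coef_sElt, coef_sElt, len_inv, len_gammaW hl, e]
  rcases Nat.mod_two_eq_zero_or_one t with h | h
  · rw [bElt_congr (n := 0) h, ← h1, rhoH_rhoH, bElt_congr (t := t + 1) (n := 1) (by omega)]
  · rw [bElt_congr (n := 1) h, h1, bElt_congr (t := t + 1) (n := 0) (by omega)]

/-- Multiplication by `b_(O-,O+)` on a spherical element is divisible by the Poincaré polynomial. -/
lemma bElt_mul (hl : 2 ≤ l) {t : ℕ} {x : H l} (hx : LSph (t + 1) x) :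
    bElt l t * x = poin (Oplus l) • (aElt l t * x) := by
  rw [bElt, mul_assoc, pElt_mul hl hx, mul_smul_comm, poin_Oset hl]

lemma eq_of_smul_eq {c : A} (hc : c ≠ 0) {x y : H l} (h : c • x = c • y) : x = y := by
  refine coef_ext fun w => mul_left_cancel₀ hc ?_
  have := congrArg (fun x => coef x w) h
  simpa only [coef_smul] using this

lemma LSph.aElt_mul (hl : 2 ≤ l) {t : ℕ} {x : H l} (hx : LSph (t + 1) x) :
    LSph t (aElt l t * x) := by
  intro i h
  refine eq_of_smul_eq (poin_ne_zero (Oplus l)) ?_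
  rw [← mul_smul_comm, ← bElt_mul hl hx, smul_comm, ← bElt_mul hl hx]
  exact (lsph_bElt hl t).mul x i h

/-! ### Multiplication by `b` on the standard spherical elements -/

lemma leftMin_dW (hl : 2 ≤ l) {m : ℕ} (hm : m ≤ l) : LeftMin m (dW hm) := by
  intro i h
  rw [len_sW_aNode_mul_of_lt hl 0 h]
  · exact Nat.lt_succ_self _
  · rw [twist_dW, dPerm_inv, dPerm_apply, dPerm_apply]
    split_ifs <;> omega

lemma len_dW (hl : 2 ≤ l) {m : ℕ} (hm : m ≤ l) : len (dW hm) = m.choose 2 := by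
  have h2 := two_mul_len_eq_twist hl m 0 (dW hm)
  rw [twist_dW, invCard_dPerm hm] at h2
  omega

/-- The cycle `sₖ ⋯ s₁` moves the value `k + 1` of `d_m` to the position `1`, whose sign is then
changed by `s₀`. -/
lemma negCount_cyc_inv_mul_dW (hl : 2 ≤ l) {n m : ℕ} (hm : m ≤ l) (hmod : m % 2 = (n + 1) % 2)
    {k : ℕ} (hk : k < l) :
    negCount l (twist n 0 ((cyc l m k)⁻¹ * dW hm)) = if k < m then m - 1 else m + 1 := by
  have hs := isSigned_twist hl m m (cyc l m k)⁻¹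
  have hd := isSigned_dPerm hm
  have e1 : twist n 0 ((cyc l m k)⁻¹ * dW hm) =
      s0 * (twist m m (cyc l m k)⁻¹ * dPerm m) := by
    rw [← twist_dW hm, ← twist_self_mul, twist_congr (t := n) (n := m + 1) (by omega), twist, twist,
      pow_succ']
    simp only [mul_assoc]
  have e2 : negCount l (twist m m (cyc l m k)⁻¹ * dPerm m) = m := by
    rw [← twist_dW hm, ← twist_self_mul, negCount_twist_parab_mul (inv_mem (cyc_mem m k)),
      negCount_dW hm]
  have e3 : (twist m m (cyc l m k)⁻¹ * dPerm m)⁻¹ 1 = dPerm m (k + 1) := by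
    rw [mul_inv_rev, dPerm_inv, Equiv.Perm.mul_apply, ← twist_inv]
    congr 1
    rw [Equiv.Perm.inv_eq_iff_eq, twist_cyc_inv m hk (by omega), if_pos rfl]
  rw [e1]
  split_ifs with h
  · have := negCount_s0_mul_of_neg (l := l) (by omega) (hs.mul hd) (by
      rw [e3, dPerm_apply, if_pos (by omega)]; omega)
    omega
  · rw [negCount_s0_mul_of_pos (l := l) (by omega) (hs.mul hd), e2]
    rw [e3, dPerm_apply, if_neg (by omega), if_neg (by omega)]
    omega

lemma coef_aElt_mul_sElt (hl : 2 ≤ l) (n : ℕ) {m : ℕ} (hm : m ≤ l) (hmod : m % 2 = (n + 1) % 2) :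
    coef (aElt l (n + 1) * sElt l n) (dW hm) = ∑ k ∈ Finset.range l,
      if (if k < m then m - 1 else m + 1) = n then
        qpow (l - 1 - 2 * k + maxLen l n - m.choose 2) else 0 := by
  rw [aElt_congr hmod.symm, aElt, Finset.sum_mul, coef_sum]
  refine Finset.sum_congr rfl fun k hk => ?_
  have hk := Finset.mem_range.mp hk
  have hlen := len_parab_mul hl (leftMin_dW hl hm) (inv_mem (cyc_mem m k))
  rw [len_inv] at hlen
  rw [smul_mul_assoc, coef_smul, coef_hB_mul _ hlen, coef_sElt,
    negCount_cyc_inv_mul_dW hl hm hmod hk, hlen, len_cyc hl m hk, len_dW hl hm]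
  split_ifs with h
  · rw [← qpow_add]
    congr 1
    push_cast
    ring
  · rw [mul_zero]
  · rw [← qpow_add]
    congr 1
    push_cast
    ring
  · rw [mul_zero]

/-- The action of `b` on the standard basis of `V` is the same as on the bar conjugate of the
standard basis of `V(l)`. -/
lemma aElt_mul_sElt (hl : 2 ≤ l) {n : ℕ} (hn : n ≤ l) :
    aElt l (n + 1) * sElt l n = qnum (n + 1) • sElt l (n + 1) +
      (qpow (l + 1 - 2 * n) * qnum (l + 1 - n)) • (if n = 0 then 0 else sElt l (n - 1)) := by
  have hL : LSph (n + 1) (if n = 0 then (0 : H l) else sElt l (n - 1)) := by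
    split_ifs
    · exact LSph.zero _
    · exact (lsph_sElt l (n - 1)).congr (by omega)
  have hR : RSph 0 (if n = 0 then (0 : H l) else sElt l (n - 1)) := by
    split_ifs
    · exact RSph.zero _
    · exact rsph_sElt hl (n - 1)
  refine sph_ext hl (((lsph_sElt l n).congr (n := n + 1 + 1) (by omega)).aElt_mul hl)
    ((rsph_sElt hl n).mul _) (((lsph_sElt l (n + 1)).smul _).add (hL.smul _))
    (((rsph_sElt hl (n + 1)).smul _).add (hR.smul _)) (fun m hm => dW hm)
    (fun m hm => negCount_dW hm) fun m hm hmod => ?_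
  rw [coef_aElt_mul_sElt hl n hm hmod, coef_add, coef_smul, coef_smul, coef_sElt,
    twist_congr hmod.symm, negCount_dW hm, len_dW hl hm]
  have hlow : coef (if n = 0 then (0 : H l) else sElt l (n - 1)) (dW hm) =
      if m + 1 = n then qpow (maxLen l m - m.choose 2) else 0 := by
    by_cases h0 : n = 0
    · rw [if_pos h0, if_neg (by omega), coef_zero]
    · rw [if_neg h0, coef_sElt, twist_congr (t := n - 1) (n := m) (by omega), negCount_dW hm,
        len_dW hl hm]
      by_cases h : m + 1 = n
      · subst h
        rw [if_pos (by omega), if_pos rfl, Nat.add_sub_cancel]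
      · rw [if_neg (by omega), if_neg h]
  rw [hlow]
  by_cases h1 : m = n + 1
  · subst h1
    rw [if_pos rfl, if_neg (by omega), mul_zero, add_zero, ← Finset.sum_subset
      (Finset.range_subset_range.mpr hm) (fun k hk1 hk2 => if_neg (by
        rw [Finset.mem_range] at hk2; rw [if_neg hk2]; omega)), qnum, Finset.sum_mul]
    refine Finset.sum_congr rfl fun k hk => ?_
    rw [Finset.mem_range] at hk
    rw [if_pos (by rw [if_pos hk]; omega), ← qpow_add, maxLen_succ (by omega)]
    congr 1
    push_cast
    ring
  by_cases h2 : m + 1 = n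
  · subst h2
    rw [if_neg h1, if_pos rfl, mul_zero, zero_add, Finset.range_eq_Ico,
      ← Finset.sum_Ico_consecutive _ (Nat.zero_le m) hm, Finset.sum_eq_zero, zero_add,
      Finset.sum_Ico_eq_sum_range, qnum, Finset.mul_sum, Finset.sum_mul]
    · rw [show l + 1 - (m + 1) = l - m by omega]
      refine Finset.sum_congr rfl fun k hk => ?_
      rw [if_pos (by rw [if_neg (by omega)]), ← qpow_add, ← qpow_add, maxLen_succ (by omega)]
      congr 1
      push_cast [Nat.cast_sub hm]
      ring
    · intro k hk
      rw [Finset.mem_Ico] at hk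
      rw [if_neg (by rw [if_pos hk.2]; omega)]
  · rw [if_neg h1, if_neg h2, mul_zero, mul_zero, add_zero]
    refine Finset.sum_eq_zero fun k _ => if_neg ?_
    split_ifs <;> omega

/-! ### Products in the extended Schur algebra -/

lemma divBy_smul_H {p : A} (hp : p ≠ 0) (x : H l) : divBy p (p • x) = x :=
  eq_of_smul_eq hp (Classical.epsilon_spec (p := fun z => p • z = p • x) ⟨x, rfl⟩)

lemma divBy_mul_A {p : A} (hp : p ≠ 0) (x : A) : divBy p (p * x) = x :=
  mul_left_cancel₀ hp (Classical.epsilon_spec (p := fun z => p • z = p • x) ⟨x, rfl⟩)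

lemma divBy_zero_H {p : A} (hp : p ≠ 0) : divBy p (0 : H l) = 0 := by
  have := divBy_smul_H hp (0 : H l)
  rwa [smul_zero] at this

lemma divBy_zero_A {p : A} (hp : p ≠ 0) : divBy p (0 : A) = 0 := by
  have := divBy_mul_A hp (0 : A)
  rwa [mul_zero] at this

lemma comp_self (I J : Set (Node l)) (x : H l) : comp I J x I J = x := if_pos ⟨rfl, rfl⟩

lemma comp_of_ne {I J I' J' : Set (Node l)} (x : H l) (h : ¬ (I' = I ∧ J' = J)) :
    comp I J x I' J' = 0 := if_neg h

lemma comp_zero (I J : Set (Node l)) : comp I J (0 : H l) = 0 := by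
  funext I' J'
  rw [comp]
  split_ifs <;> rfl

lemma comp_add (I J : Set (Node l)) (x y : H l) : comp I J (x + y) = comp I J x + comp I J y := by
  funext I' J'
  by_cases h : I' = I ∧ J' = J
  · obtain ⟨rfl, rfl⟩ := h
    rw [comp_self, Pi.add_apply, Pi.add_apply, comp_self, comp_self]
  · rw [comp_of_ne _ h, Pi.add_apply, Pi.add_apply, comp_of_ne _ h, comp_of_ne _ h, add_zero]

lemma comp_smul (I J : Set (Node l)) (c : A) (x : H l) : comp I J (c • x) = c • comp I J x := by
  funext I' J'
  by_cases h : I' = I ∧ J' = J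
  · obtain ⟨rfl, rfl⟩ := h
    rw [comp_self, Pi.smul_apply, Pi.smul_apply, comp_self]
  · rw [comp_of_ne _ h, Pi.smul_apply, Pi.smul_apply, comp_of_ne _ h, smul_zero]

lemma schurMul_comp_left (I J : Set (Node l)) (x : H l) (Y : Fam l) (L : Set (Node l)) :
    schurMul (comp I J x) Y I L = divBy (poin J) (x * Y J L) := by
  rw [schurMul, Finset.sum_eq_single J]
  · rw [comp_self]
  · intro J' _ h
    rw [comp_of_ne _ (fun h' => h h'.2), zero_mul, divBy_zero_H (poin_ne_zero _)]
  · exact fun h => absurd (Finset.mem_univ _) h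

lemma schurMul_comp_left_of_ne {I I' : Set (Node l)} (h : I' ≠ I) (J : Set (Node l)) (x : H l)
    (Y : Fam l) (L : Set (Node l)) : schurMul (comp I J x) Y I' L = 0 :=
  Finset.sum_eq_zero fun J' _ => by
    rw [comp_of_ne _ (fun h' => h h'.1), zero_mul, divBy_zero_H (poin_ne_zero _)]

lemma schurMul_comp_right (J K : Set (Node l)) (X : Fam l) (y : H l) (I : Set (Node l)) :
    schurMul X (comp J K y) I K = divBy (poin J) (X I J * y) := by
  rw [schurMul, Finset.sum_eq_single J]
  · rw [comp_self]
  · intro J' _ h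
    rw [comp_of_ne _ (fun h' => h h'.1), mul_zero, divBy_zero_H (poin_ne_zero _)]
  · exact fun h => absurd (Finset.mem_univ _) h

lemma schurMul_comp_right_of_ne {K L : Set (Node l)} (h : L ≠ K) (J : Set (Node l)) (X : Fam l)
    (y : H l) (I : Set (Node l)) : schurMul X (comp J K y) I L = 0 :=
  Finset.sum_eq_zero fun J' _ => by
    rw [comp_of_ne _ (fun h' => h h'.2), mul_zero, divBy_zero_H (poin_ne_zero _)]

lemma schurMul_comp (I J K : Set (Node l)) (x y : H l) :
    schurMul (comp I J x) (comp J K y) = comp I K (divBy (poin J) (x * y)) := by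
  funext I' L
  by_cases h : I' = I
  · subst h
    by_cases h' : L = K
    · subst h'
      rw [schurMul_comp_left, comp_self, comp_self]
    · rw [schurMul_comp_right_of_ne h', comp_of_ne _ (fun h2 => h' h2.2)]
  · rw [schurMul_comp_left_of_ne h, comp_of_ne _ (fun h2 => h h2.1)]

lemma zero_schurMul (Y : Fam l) : schurMul 0 Y = 0 := by
  funext I L
  exact Finset.sum_eq_zero fun J _ => by
    rw [Pi.zero_apply, Pi.zero_apply, zero_mul, divBy_zero_H (poin_ne_zero _)]

lemma schurMul_zero (X : Fam l) : schurMul X 0 = 0 := by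
  funext I L
  exact Finset.sum_eq_zero fun J _ => by
    rw [Pi.zero_apply, Pi.zero_apply, mul_zero, divBy_zero_H (poin_ne_zero _)]

lemma gammaSet_gammaSet (I : Set (Node l)) : gammaSet (gammaSet I) = I := by
  have key : ∀ i : Node l, ∃ j : Node l, j.1 = gammaN i ∧ gammaN j = i.1 := by
    rintro ⟨i, hi⟩
    refine ⟨⟨gammaN ⟨i, hi⟩, ?_⟩, rfl, ?_⟩
    · simp only [gammaN]
      split_ifs <;> omega
    · by_cases h1 : i = 1
      · simp [gammaN, h1]
      · by_cases h2 : i = -1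
        · simp [gammaN, h2]
        · simp [gammaN, h1, h2]
  ext i
  constructor
  · rintro ⟨j, ⟨k, hk, h1⟩, h2⟩
    obtain ⟨m, h3, h4⟩ := key k
    have : m = j := Subtype.ext (h3.trans h1)
    rw [← this, h4] at h2
    rwa [← Subtype.ext h2]
  · intro hi
    obtain ⟨j, h1, h2⟩ := key i
    exact ⟨j, ⟨i, hi, h1.symm⟩, h2⟩

lemma gammaSet_Oplus (l : ℕ) : gammaSet (Oplus l) = Ominus l := by
  ext ⟨i, hi⟩
  constructor
  · rintro ⟨⟨j, hj⟩, h1, h2⟩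
    change i ≠ 1
    have h1 : j ≠ -1 := h1
    simp only [gammaN] at h2
    split_ifs at h2 <;> omega
  · intro h
    have h : i ≠ 1 := h
    by_cases hm : i = -1
    · refine ⟨⟨1, by omega⟩, ?_, ?_⟩
      · change (1 : ℤ) ≠ -1
        decide
      · simp [gammaN, hm]
    · exact ⟨⟨i, hi⟩, hm, by simp [gammaN, hm, h]⟩

lemma gammaSet_Ominus (l : ℕ) : gammaSet (Ominus l) = Oplus l := by
  rw [← gammaSet_Oplus, gammaSet_gammaSet]

lemma gammaS_comp (I J : Set (Node l)) (x : H l) :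
    gammaS (comp I J x) = comp (gammaSet I) (gammaSet J) (gammaH x) := by
  funext I' J'
  rw [gammaS]
  by_cases h : I' = gammaSet I ∧ J' = gammaSet J
  · rw [h.1, h.2, gammaSet_gammaSet, gammaSet_gammaSet, comp_self, comp_self]
  · rw [comp_of_ne _ h, comp_of_ne, gammaH_zero]
    rintro ⟨rfl, rfl⟩
    exact h ⟨(gammaSet_gammaSet _).symm, (gammaSet_gammaSet _).symm⟩

lemma gammaS_zero : gammaS (0 : Fam l) = 0 := by
  funext I J
  exact gammaH_zero

lemma Oset_one (l : ℕ) : Oset l 1 = Ominus l := if_neg (by decide)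

lemma poin_Ominus (hl : 2 ≤ l) : poin (Ominus l) = poin (Oplus l) := by
  rw [← Oset_one, poin_Oset hl]

/-! ### The algebra `V` -/

/-- The element `x + s₀ y` for `x` in the component `(O+, O+)` and `y` in the component
`(O-, O+)`. -/
def mkV (l : ℕ) : H l × H l →ₗ[A] Fam l × Fam l where
  toFun X := (comp (Oplus l) (Oplus l) X.1, comp (Ominus l) (Oplus l) X.2)
  map_add' _ _ := Prod.ext (comp_add _ _ _ _) (comp_add _ _ _ _)
  map_smul' _ _ := Prod.ext (comp_smul _ _ _ _) (comp_smul _ _ _ _)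

lemma mkV_apply (X : H l × H l) :
    mkV l X = (comp (Oplus l) (Oplus l) X.1, comp (Ominus l) (Oplus l) X.2) := rfl

lemma mkV_injective : Function.Injective (mkV l) := by
  intro X Y h
  have h1 := congrFun (congrFun (congrArg Prod.fst h) (Oplus l)) (Oplus l)
  have h2 := congrFun (congrFun (congrArg Prod.snd h) (Ominus l)) (Oplus l)
  simp only [mkV_apply, comp_self] at h1 h2
  exact Prod.ext h1 h2

/-- The pairs of bi-spherical elements that are the components of the elements of `V`. -/
def sphV (l : ℕ) : Submodule A (H l × H l) where
  carrier := {X | LSph 0 X.1 ∧ RSph 0 X.1 ∧ LSph 1 X.2 ∧ RSph 0 X.2}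
  add_mem' h h' := ⟨h.1.add h'.1, h.2.1.add h'.2.1, h.2.2.1.add h'.2.2.1, h.2.2.2.add h'.2.2.2⟩
  zero_mem' := ⟨LSph.zero _, RSph.zero _, LSph.zero _, RSph.zero _⟩
  smul_mem' c _ h := ⟨h.1.smul c, h.2.1.smul c, h.2.2.1.smul c, h.2.2.2.smul c⟩

lemma poin_smul_divBy (hl : 2 ≤ l) {r : ℕ} {x y : H l} (hx : RSph r x) (hy : LSph r y) :
    poin (Oplus l) • divBy (poin (Oplus l)) (x * y) = x * y := by
  have : x * y = poin (Oplus l) • (x * minPart r y) := by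
    conv_lhs => rw [LSph.eq_pElt_mul hl hy]
    rw [← mul_assoc, mul_pElt hl hx, poin_Oset hl, smul_mul_assoc]
  rw [this, divBy_smul_H (poin_ne_zero _)]

lemma RSph.gammaH (hl : 2 ≤ l) {r : ℕ} {x : H l} (hx : RSph r x) : RSph (r + 1) (gammaH x) := by
  intro i h
  have h1 := gammaH_hGen_mul hl r h 1
  rw [mul_one, gammaH_one, mul_one] at h1
  rw [← h1, ← gammaH_mul hl, hx i h, gammaH_smul]

/-- The product of `V` in terms of components. -/
def mulV (X Y : H l × H l) : H l × H l :=
  (divBy (poin (Oplus l)) (X.1 * Y.1) + divBy (poin (Oplus l)) (gammaH X.2 * Y.2),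
    divBy (poin (Oplus l)) (X.2 * Y.1) + divBy (poin (Oplus l)) (gammaH X.1 * Y.2))

lemma extMul_mkV (hl : 2 ≤ l) (X Y : H l × H l) :
    extMul (mkV l X) (mkV l Y) = mkV l (mulV X Y) := by
  rw [extMul, mkV_apply, mkV_apply, mkV_apply, mulV]
  simp only [gammaS_comp, gammaSet_Oplus, gammaSet_Ominus, schurMul_comp, poin_Ominus hl, comp_add]

/-- On `V` the division by the Poincaré polynomial in the product is exact. -/
lemma poin_smul_mulV (hl : 2 ≤ l) {X Y : H l × H l} (hX : X ∈ sphV l) (hY : Y ∈ sphV l) :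
    poin (Oplus l) • mulV X Y =
      (X.1 * Y.1 + gammaH X.2 * Y.2, X.2 * Y.1 + gammaH X.1 * Y.2) := by
  obtain ⟨-, h1, -, h2⟩ := hX
  obtain ⟨h3, -, h4, -⟩ := hY
  refine Prod.ext ?_ ?_
  · change poin (Oplus l) • (_ + _) = _
    rw [smul_add, poin_smul_divBy hl h1 h3, poin_smul_divBy hl (h2.gammaH hl) h4]
  · change poin (Oplus l) • (_ + _) = _
    rw [smul_add, poin_smul_divBy hl h2 h3, poin_smul_divBy hl (h1.gammaH hl) h4]

lemma eq_of_smul_eq_prod {c : A} (hc : c ≠ 0) {X Y : H l × H l} (h : c • X = c • Y) : X = Y :=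
  Prod.ext (eq_of_smul_eq hc (congrArg Prod.fst h)) (eq_of_smul_eq hc (congrArg Prod.snd h))

lemma LSph.of_smul {t : ℕ} {c : A} (hc : c ≠ 0) {x : H l} (hx : LSph t (c • x)) : LSph t x :=
  fun i h => eq_of_smul_eq hc (by rw [← mul_smul_comm, hx i h, smul_comm])

lemma RSph.of_smul {t : ℕ} {c : A} (hc : c ≠ 0) {x : H l} (hx : RSph t (c • x)) : RSph t x :=
  fun i h => eq_of_smul_eq hc (by rw [← smul_mul_assoc, hx i h, smul_comm])

lemma sphV_of_smul {c : A} (hc : c ≠ 0) {X : H l × H l} (hX : c • X ∈ sphV l) : X ∈ sphV l :=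
  ⟨hX.1.of_smul hc, hX.2.1.of_smul hc, hX.2.2.1.of_smul hc, hX.2.2.2.of_smul hc⟩

lemma mulV_mem (hl : 2 ≤ l) {X Y : H l × H l} (hX : X ∈ sphV l) (hY : Y ∈ sphV l) :
    mulV X Y ∈ sphV l := by
  refine sphV_of_smul (poin_ne_zero (Oplus l)) ?_
  rw [poin_smul_mulV hl hX hY]
  obtain ⟨h1, -, h2, -⟩ := hX
  obtain ⟨-, h3, -, h4⟩ := hY
  exact ⟨(h1.mul _).add (((h2.gammaH hl).congr rfl).mul _), (h3.mul _).add (h4.mul _),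
    (h2.mul _).add ((h1.gammaH hl).mul _), (h3.mul _).add (h4.mul _)⟩

lemma add_mulV (hl : 2 ≤ l) {X Y Z : H l × H l} (hX : X ∈ sphV l) (hY : Y ∈ sphV l)
    (hZ : Z ∈ sphV l) : mulV (X + Y) Z = mulV X Z + mulV Y Z := by
  refine eq_of_smul_eq_prod (poin_ne_zero (Oplus l)) ?_
  rw [smul_add, poin_smul_mulV hl hX hZ, poin_smul_mulV hl hY hZ,
    poin_smul_mulV hl (add_mem hX hY) hZ]
  refine Prod.ext ?_ ?_
  · change (_ + _) * _ + gammaH (_ + _) * _ = _ * _ + _ * _ + (_ * _ + _ * _)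
    rw [gammaH_add, add_mul, add_mul, add_add_add_comm]
  · change (_ + _) * _ + gammaH (_ + _) * _ = _ * _ + _ * _ + (_ * _ + _ * _)
    rw [gammaH_add, add_mul, add_mul, add_add_add_comm]

lemma smul_mulV (hl : 2 ≤ l) (c : A) {X Y : H l × H l} (hX : X ∈ sphV l) (hY : Y ∈ sphV l) :
    mulV (c • X) Y = c • mulV X Y := by
  refine eq_of_smul_eq_prod (poin_ne_zero (Oplus l)) ?_
  rw [smul_comm, poin_smul_mulV hl hX hY, poin_smul_mulV hl (Submodule.smul_mem _ c hX) hY]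
  refine Prod.ext ?_ ?_
  · change (c • _) * _ + gammaH (c • _) * _ = c • (_ * _ + _ * _)
    rw [gammaH_smul, smul_mul_assoc, smul_mul_assoc, smul_add]
  · change (c • _) * _ + gammaH (c • _) * _ = c • (_ * _ + _ * _)
    rw [gammaH_smul, smul_mul_assoc, smul_mul_assoc, smul_add]

/-- After multiplication by the square of the Poincaré polynomial, this is associativity in the Hecke
algebra. -/
lemma mulV_assoc (hl : 2 ≤ l) {X Y Z : H l × H l} (hX : X ∈ sphV l) (hY : Y ∈ sphV l)
    (hZ : Z ∈ sphV l) : mulV (mulV X Y) Z = mulV X (mulV Y Z) := by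
  have hp := poin_ne_zero (Oplus l)
  have hXY := mulV_mem hl hX hY
  have hYZ := mulV_mem hl hY hZ
  have e1 := poin_smul_mulV hl hX hY
  have e2 := poin_smul_mulV hl hY hZ
  have e3 := poin_smul_mulV hl hXY hZ
  have e4 := poin_smul_mulV hl hX hYZ
  have a1 := congrArg Prod.fst e1
  have a2 := congrArg Prod.snd e1
  have b1 := congrArg Prod.fst e2
  have b2 := congrArg Prod.snd e2
  simp only [Prod.smul_fst, Prod.smul_snd] at a1 a2 b1 b2
  have c1 : ∀ z, poin (Oplus l) • ((mulV X Y).1 * z) = (X.1 * Y.1 + gammaH X.2 * Y.2) * z :=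
    fun z => by rw [← smul_mul_assoc, a1]
  have c2 : ∀ z, poin (Oplus l) • ((mulV X Y).2 * z) = (X.2 * Y.1 + gammaH X.1 * Y.2) * z :=
    fun z => by rw [← smul_mul_assoc, a2]
  have c3 : ∀ z, poin (Oplus l) • (gammaH (mulV X Y).1 * z) =
      gammaH (X.1 * Y.1 + gammaH X.2 * Y.2) * z :=
    fun z => by rw [← smul_mul_assoc, ← gammaH_smul, a1]
  have c4 : ∀ z, poin (Oplus l) • (gammaH (mulV X Y).2 * z) =
      gammaH (X.2 * Y.1 + gammaH X.1 * Y.2) * z :=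
    fun z => by rw [← smul_mul_assoc, ← gammaH_smul, a2]
  have d1 : ∀ z, poin (Oplus l) • (z * (mulV Y Z).1) = z * (Y.1 * Z.1 + gammaH Y.2 * Z.2) :=
    fun z => by rw [← mul_smul_comm, b1]
  have d2 : ∀ z, poin (Oplus l) • (z * (mulV Y Z).2) = z * (Y.2 * Z.1 + gammaH Y.1 * Z.2) :=
    fun z => by rw [← mul_smul_comm, b2]
  refine eq_of_smul_eq_prod hp (eq_of_smul_eq_prod hp ?_)
  rw [e3, e4]
  refine Prod.ext ?_ ?_
  · simp only [Prod.smul_fst, smul_add, c1, c4, d1, d2]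
    simp only [gammaH_add, gammaH_mul hl, gammaH_gammaH, add_mul, mul_add, mul_assoc]
    abel
  · simp only [Prod.smul_snd, smul_add, c2, c3, d1, d2]
    simp only [gammaH_add, gammaH_mul hl, gammaH_gammaH, add_mul, mul_add, mul_assoc]
    abel

lemma extOne_eq (hl : 2 ≤ l) : extOne l = mkV l (pElt l 0, 0) := by
  rw [extOne, idem, ← Oset_zero, klB_longest hl, mkV_apply, comp_zero, Oset_zero]

lemma one_mem_sphV (hl : 2 ≤ l) : (pElt l 0, 0) ∈ sphV l :=
  ⟨lsph_pElt l 0, rsph_pElt hl 0, LSph.zero _, RSph.zero _⟩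

lemma one_mulV (hl : 2 ≤ l) {X : H l × H l} (hX : X ∈ sphV l) : mulV (pElt l 0, 0) X = X := by
  refine eq_of_smul_eq_prod (poin_ne_zero (Oplus l)) ?_
  rw [poin_smul_mulV hl (one_mem_sphV hl) hX]
  refine Prod.ext ?_ ?_
  · change _ * _ + gammaH 0 * _ = _
    rw [gammaH_zero, zero_mul, add_zero, pElt_mul hl hX.1, Oset_zero]
    rfl
  · change 0 * _ + gammaH (pElt l 0) * _ = _
    rw [gammaH_pElt hl, zero_mul, zero_add, pElt_mul hl hX.2.2.1, poin_Oset hl]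
    rfl

/-- Multiplying by `1_(O+)` on both sides keeps the components `(O+, O+)` of `x` and `(O-, O+)` of `y`
in `x + s₀ y`. -/
lemma extMul_extOne_extOne (hl : 2 ≤ l) {X : Fam l × Fam l} (hX : X ∈ extSchur l) :
    extMul (extMul (extOne l) X) (extOne l) =
      mkV l (X.1 (Oplus l) (Oplus l), X.2 (Ominus l) (Oplus l)) := by
  have hl1 : ∀ I : Set (Node l), (∃ t, I = Oset l t) → ∀ Y ∈ schur l, ∀ J,
      divBy (poin I) (klB (longest I) * Y I J) = Y I J := by
    rintro I ⟨t, rfl⟩ Y hY J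
    obtain ⟨a, ha⟩ := (hY (Oset l t) J).1
    rw [ha, klB_longest hl, ← mul_assoc, pElt_mul hl (lsph_pElt l t), smul_mul_assoc,
      divBy_smul_H (poin_ne_zero _)]
  have hr1 : ∀ I : Set (Node l), ∀ Y ∈ schur l,
      divBy (poin (Oplus l)) (Y I (Oplus l) * klB (longest (Oplus l))) = Y I (Oplus l) := by
    intro I Y hY
    obtain ⟨a, ha⟩ := (hY I (Oplus l)).2
    rw [ha, ← Oset_zero, klB_longest hl, mul_assoc, pElt_mul hl (lsph_pElt l 0), mul_smul_comm,
      divBy_smul_H (poin_ne_zero _)]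
  have e1 : gammaH (klB (longest (Oplus l))) = klB (longest (Ominus l)) := by
    rw [← Oset_zero, klB_longest hl, gammaH_pElt hl, ← Oset_one, klB_longest hl]
  simp only [extMul, extOne, idem, gammaS_zero, schurMul_zero, zero_schurMul, add_zero, zero_add,
    gammaS_comp, gammaSet_Oplus, e1]
  rw [mkV_apply]
  refine Prod.ext ?_ ?_
  · funext I J
    change schurMul _ _ I J = comp _ _ _ I J
    by_cases hJ : J = Oplus l
    · subst hJ
      rw [schurMul_comp_right]
      by_cases hI : I = Oplus l
      · subst hI
        rw [schurMul_comp_left, hl1 _ ⟨0, Oset_zero.symm⟩ _ hX.1, hr1 _ _ hX.1, comp_self]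
      · rw [schurMul_comp_left_of_ne hI, zero_mul, divBy_zero_H (poin_ne_zero _),
          comp_of_ne _ fun h => hI h.1]
    · rw [schurMul_comp_right_of_ne hJ, comp_of_ne _ fun h => hJ h.2]
  · funext I J
    change schurMul _ _ I J = comp _ _ _ I J
    by_cases hJ : J = Oplus l
    · subst hJ
      rw [schurMul_comp_right]
      by_cases hI : I = Ominus l
      · subst hI
        rw [schurMul_comp_left, hl1 _ ⟨1, (Oset_one l).symm⟩ _ hX.2, hr1 _ _ hX.2, comp_self]
      · rw [schurMul_comp_left_of_ne hI, zero_mul, divBy_zero_H (poin_ne_zero _),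
          comp_of_ne _ fun h => hI h.1]
    · rw [schurMul_comp_right_of_ne hJ, comp_of_ne _ fun h => hJ h.2]

/-- The module `V` consists of the pairs of bi-spherical elements. -/
lemma VS_eq (hl : 2 ≤ l) : VS l = (sphV l).map (mkV l) := by
  refine le_antisymm (Submodule.span_le.mpr ?_) ?_
  · rintro _ ⟨X, hX, rfl⟩
    rw [extMul_extOne_extOne hl hX]
    refine ⟨_, ?_, rfl⟩
    have h1 : ∀ t, ∀ Y ∈ schur l, LSph t (Y (Oset l t) (Oplus l)) := by
      intro t Y hY
      obtain ⟨a, ha⟩ := (hY (Oset l t) (Oplus l)).1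
      rw [ha, klB_longest hl]
      exact (lsph_pElt l t).mul a
    have h2 : ∀ I, ∀ Y ∈ schur l, RSph 0 (Y I (Oplus l)) := by
      intro I Y hY
      obtain ⟨a, ha⟩ := (hY I (Oplus l)).2
      rw [ha, ← Oset_zero, klB_longest hl]
      exact (rsph_pElt hl 0).mul a
    have h3 := h1 0 _ hX.1
    have h4 := h1 1 _ hX.2
    rw [Oset_zero] at h3
    rw [Oset_one] at h4
    exact ⟨h3, h2 _ _ hX.1, h4, h2 _ _ hX.2⟩
  · rintro _ ⟨X, hX, rfl⟩
    have hcomp : ∀ t, ∀ x : H l, LSph t x → RSph 0 x → comp (Oset l t) (Oplus l) x ∈ schur l := by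
      intro t x hx hx' I J
      by_cases h : I = Oset l t ∧ J = Oplus l
      · obtain ⟨rfl, rfl⟩ := h
        rw [comp_self, klB_longest hl, ← Oset_zero, klB_longest hl]
        exact ⟨⟨_, hx.eq_pElt_mul hl⟩, _, hx'.eq_mul_pElt hl⟩
      · rw [comp_of_ne _ h]
        exact ⟨⟨0, (mul_zero _).symm⟩, 0, (zero_mul _).symm⟩
    have h1 := hcomp 0 X.1 hX.1 hX.2.1
    have h2 := hcomp 1 X.2 hX.2.2.1 hX.2.2.2
    rw [Oset_zero] at h1
    rw [Oset_one] at h2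
    have hm : mkV l X ∈ extSchur l := ⟨h1, h2⟩
    refine Submodule.subset_span ⟨_, hm, ?_⟩
    rw [extMul_extOne_extOne hl hm]
    change mkV l X = mkV l (comp _ _ X.1 _ _, comp _ _ X.2 _ _)
    rw [comp_self, comp_self]

/-- The algebra `V` in terms of components. -/
def sphVEquiv (hl : 2 ≤ l) : sphV l ≃ₗ[A] VS l :=
  ((sphV l).equivMapOfInjective (mkV l) mkV_injective).trans (LinearEquiv.ofEq _ _ (VS_eq hl).symm)

lemma sphVEquiv_coe (hl : 2 ≤ l) (X : sphV l) :
    (sphVEquiv hl X : Fam l × Fam l) = mkV l (X : H l × H l) := rfl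

/-- The components of the standard basis elements of `V`. -/
def stdElt (l n : ℕ) : H l × H l := if Even n then (sElt l n, 0) else (0, sElt l n)

lemma stdElt_mem (hl : 2 ≤ l) (n : ℕ) : stdElt l n ∈ sphV l := by
  rw [stdElt]
  split_ifs with h
  · exact ⟨(lsph_sElt l n).congr (by rw [Nat.even_iff] at h; omega), rsph_sElt hl n, LSph.zero _,
      RSph.zero _⟩
  · exact ⟨LSph.zero _, RSph.zero _, (lsph_sElt l n).congr (by rw [Nat.even_iff] at h; omega),
      rsph_sElt hl n⟩

lemma stdVS_eq (hl : 2 ≤ l) {n : ℕ} (hn : n ≤ l) : stdVS hn = mkV l (stdElt l n) := by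
  have h := hS_eq hl hn
  rw [stdVS, stdElt, mkV_apply]
  split_ifs with he
  · rw [Oset, if_pos he] at h
    rw [h, comp_zero]
  · rw [Oset, if_neg he] at h
    rw [h, comp_zero]

/-- The coordinates with respect to the standard basis of `V`. -/
def stdCoord (l : ℕ) : H l × H l →ₗ[A] (Fin (l + 1) → A) where
  toFun X n := coef (if Even (n : ℕ) then X.1 else X.2) (maxW (Nat.le_of_lt_succ n.2))
  map_add' X Y := by
    funext n
    rw [Pi.add_apply]
    split_ifs <;> rfl
  map_smul' c X := by
    funext n
    rw [Pi.smul_apply]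
    split_ifs <;> rfl

lemma stdCoord_apply (X : H l × H l) (n : Fin (l + 1)) : stdCoord l X n =
    coef (if Even (n : ℕ) then X.1 else X.2) (maxW (Nat.le_of_lt_succ n.2)) := rfl

lemma coef_sElt_maxW (hl : 2 ≤ l) {n m : ℕ} (hm : m ≤ l) (h : n % 2 = m % 2) :
    coef (sElt l n) (maxW hm) = if n = m then 1 else 0 := by
  rw [coef_sElt, twist_congr h, negCount_maxW hl, len_maxW hl]
  by_cases h : n = m
  · rw [if_pos h, if_pos h.symm, h, sub_self, qpow_zero]
  · rw [if_neg h, if_neg (Ne.symm h)]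

lemma stdCoord_stdElt (hl : 2 ≤ l) (m n : Fin (l + 1)) :
    stdCoord l (stdElt l m) n = (Pi.single m 1 : Fin (l + 1) → A) n := by
  have hn := Nat.le_of_lt_succ n.2
  rw [stdCoord_apply, stdElt, Pi.single_apply]
  by_cases h1 : Even (n : ℕ) <;> by_cases h2 : Even (m : ℕ)
  · rw [if_pos h1, if_pos h2, coef_sElt_maxW hl _ (by rw [Nat.even_iff] at *; omega)]
    exact if_congr (by rw [Fin.ext_iff, eq_comm]) rfl rfl
  · rw [if_pos h1, if_neg h2, if_neg, coef_zero]
    rintro rfl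
    exact h2 h1
  · rw [if_neg h1, if_pos h2, if_neg, coef_zero]
    rintro rfl
    exact h1 h2
  · rw [if_neg h1, if_neg h2, coef_sElt_maxW hl _ (by rw [Nat.even_iff] at *; omega)]
    exact if_congr (by rw [Fin.ext_iff, eq_comm]) rfl rfl

lemma stdCoord_injective (hl : 2 ≤ l) {X : H l × H l} (hX : X ∈ sphV l) {Y : H l × H l}
    (hY : Y ∈ sphV l) (h : stdCoord l X = stdCoord l Y) : X = Y := by
  have h' : ∀ n (hn : n ≤ l), coef (if Even n then X.1 else X.2) (maxW hn) =
      coef (if Even n then Y.1 else Y.2) (maxW hn) := fun n hn =>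
    congrFun h ⟨n, Nat.lt_succ_of_le hn⟩
  refine Prod.ext (sph_ext hl hX.1 hX.2.1 hY.1 hY.2.1 (fun m hm => maxW hm)
    (fun m hm => negCount_maxW hl hm) fun n hn hmod => ?_)
    (sph_ext hl hX.2.2.1 hX.2.2.2 hY.2.2.1 hY.2.2.2 (fun m hm => maxW hm)
    (fun m hm => negCount_maxW hl hm) fun n hn hmod => ?_)
  · have := h' n hn
    rwa [if_pos (by rw [Nat.even_iff]; omega), if_pos (by rw [Nat.even_iff]; omega)] at this
  · have := h' n hn
    rwa [if_neg (by rw [Nat.even_iff]; omega), if_neg (by rw [Nat.even_iff]; omega)] at this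

/-- The coordinates of an element of `V` with respect to the standard basis. -/
def sphVCoordEquiv (hl : 2 ≤ l) : sphV l ≃ₗ[A] (Fin (l + 1) → A) :=
  LinearEquiv.ofBijective ((stdCoord l).comp (sphV l).subtype) (by
    have hc : ∀ m : Fin (l + 1), stdCoord l (stdElt l m) = Pi.single m 1 := fun m =>
      funext fun n => stdCoord_stdElt hl m n
    constructor
    · intro X Y h
      exact Subtype.ext (stdCoord_injective hl X.2 Y.2 h)
    · intro c
      refine ⟨∑ m, c m • ⟨stdElt l m, stdElt_mem hl m⟩, ?_⟩
      rw [map_sum]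
      simp only [map_smul, LinearMap.comp_apply, Submodule.subtype_apply, hc]
      funext n
      simp [Finset.sum_apply, Pi.single_apply])

/-- The standard basis of `V`. -/
def stdBasisV (hl : 2 ≤ l) : Module.Basis (Fin (l + 1)) A (VS l) :=
  Module.Basis.ofEquivFun ((sphVEquiv hl).symm.trans (sphVCoordEquiv hl))

lemma stdBasisV_apply (hl : 2 ≤ l) (n : Fin (l + 1)) :
    stdBasisV hl n = sphVEquiv hl ⟨stdElt l n, stdElt_mem hl n⟩ := by
  rw [stdBasisV, Module.Basis.coe_ofEquivFun]
  change LinearEquiv.symm _ _ = _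
  rw [LinearEquiv.symm_apply_eq, LinearEquiv.trans_apply, LinearEquiv.symm_apply_apply]
  funext m
  exact (stdCoord_stdElt hl n m).symm

/-! ### Multiplication by `b`, the bar involution and the form on `V` -/

lemma bV_eq (hl : 2 ≤ l) : bV l = mkV l (0, bElt l 1) := by
  have h1 : dW (show 1 ≤ l by omega) = 1 := by
    refine twist_injective (t := 1) (r := 0) ?_
    rw [twist_dW]
    ext z
    rw [twist, dPerm_apply, pow_one, pow_zero, mul_one, Subgroup.coe_one, mul_one, s0_apply]
    push_cast
    split_ifs <;> omega
  have h2 := klB_maxW_of_le_one hl (show 1 ≤ l by omega) le_rfl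
  rw [maxW, h1, Oset_one, ← bElt_one hl] at h2
  rw [bV, bS, h2, mkV_apply, comp_zero]

lemma b_mem_sphV (hl : 2 ≤ l) : (0, bElt l 1) ∈ sphV l :=
  ⟨LSph.zero _, RSph.zero _, lsph_bElt hl 1, by rw [bElt_one hl]; exact rsph_sElt hl 1⟩

/-- Multiplication by `b` in terms of components. -/
def bMul (X : H l × H l) : H l × H l := (aElt l 0 * X.2, aElt l 1 * X.1)

/-- The division by the Poincaré polynomial cancels the idempotent in `b_(O-,O+)`. -/
lemma mulV_b (hl : 2 ≤ l) {X : H l × H l} (hX : X ∈ sphV l) : mulV (0, bElt l 1) X = bMul X := by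
  refine eq_of_smul_eq_prod (poin_ne_zero (Oplus l)) ?_
  rw [poin_smul_mulV hl (b_mem_sphV hl) hX]
  have h1 := bElt_mul hl (t := 0) hX.2.2.1
  have h2 := bElt_mul hl (t := 1) (hX.1.congr rfl)
  refine Prod.ext ?_ ?_
  · change 0 * _ + gammaH (bElt l 1) * _ = _ • (_ * _)
    rw [gammaH_bElt hl, zero_mul, zero_add, bElt_congr (t := 1 + 1) (n := 0) rfl, h1]
  · change bElt l 1 * _ + gammaH 0 * _ = _ • (_ * _)
    rw [gammaH_zero, zero_mul, add_zero, h2]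

lemma bMul_mem (hl : 2 ≤ l) {X : H l × H l} (hX : X ∈ sphV l) : bMul X ∈ sphV l := by
  rw [← mulV_b hl hX]
  exact mulV_mem hl (b_mem_sphV hl) hX

/-- In terms of the standard basis, `b` acts on `V` by the same formula as on the ibar conjugates of
the standard basis of `V(l)`, see `actV_bU_ibar_stdV`. -/
lemma bMul_stdElt (hl : 2 ≤ l) {n : ℕ} (hn : n ≤ l) :
    bMul (stdElt l n) = qnum (n + 1) • stdElt l (n + 1) +
      (qpow (l + 1 - 2 * n) * qnum (l + 1 - n)) • (if n = 0 then 0 else stdElt l (n - 1)) := by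
  have key := aElt_mul_sElt hl hn
  rcases Nat.even_or_odd n with he | ho
  · have h1 : ¬ Even (n + 1) := by rw [Nat.even_iff] at *; omega
    have h2 : (if n = 0 then (0 : H l × H l) else stdElt l (n - 1)) =
        (0, if n = 0 then 0 else sElt l (n - 1)) := by
      split_ifs with h0
      · rfl
      · rw [stdElt, if_neg (by rw [Nat.even_iff] at *; omega)]
    rw [h2, stdElt, if_pos he, stdElt, if_neg h1]
    refine Prod.ext ?_ ?_
    · change _ * (0 : H l) = _ • 0 + _ • 0
      rw [mul_zero, smul_zero, smul_zero, add_zero]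
    · rw [aElt_congr (n := 1) (by rw [Nat.even_iff] at *; omega)] at key
      exact key
  · have he : ¬ Even n := by rwa [Nat.not_even_iff_odd]
    have h1 : Even (n + 1) := by rw [Nat.even_iff] at *; omega
    have h2 : (if n = 0 then (0 : H l × H l) else stdElt l (n - 1)) =
        (if n = 0 then 0 else sElt l (n - 1), 0) := by
      split_ifs with h0
      · rfl
      · rw [stdElt, if_pos (by rw [Nat.even_iff] at *; omega)]
    rw [h2, stdElt, if_neg he, stdElt, if_pos h1]
    refine Prod.ext ?_ ?_
    · rw [aElt_congr (n := 0) (by rw [Nat.even_iff] at *; omega)] at key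
      exact key
    · change _ * (0 : H l) = _ • 0 + _ • 0
      rw [mul_zero, smul_zero, smul_zero, add_zero]

/-- The bar involution of `V` in terms of components. -/
def barV (X : H l × H l) : H l × H l := (barH X.1, barH X.2)

lemma barV_add (X Y : H l × H l) : barV (X + Y) = barV X + barV Y :=
  Prod.ext (barH_add _ _) (barH_add _ _)

lemma barV_smul (c : A) (X : H l × H l) : barV (c • X) = barA c • barV X :=
  Prod.ext (barH_smul _ _) (barH_smul _ _)

lemma extBar_mkV (X : H l × H l) : extBar (mkV l X) = mkV l (barV X) := by
  have key : ∀ (I J : Set (Node l)) (x : H l), barS (comp I J x) = comp I J (barH x) := by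
    intro I J x
    funext I' J'
    rw [barS]
    by_cases h : I' = I ∧ J' = J
    · obtain ⟨rfl, rfl⟩ := h
      rw [comp_self, comp_self]
    · rw [comp_of_ne _ h, comp_of_ne _ h, barH_zero]
  rw [extBar, mkV_apply, mkV_apply, key, key, barV]

lemma barV_bMul (hl : 2 ≤ l) {X : H l × H l} (hX : X ∈ sphV l) :
    barV (bMul X) = bMul (barV X) := by
  have hp : barA (poin (Oplus l)) = poin (Oplus l) := by rw [← Oset_zero, barA_poin hl]
  have key : ∀ t, ∀ x : H l, LSph (t + 1) x → barH (aElt l t * x) = aElt l t * barH x := by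
    intro t x hx
    refine eq_of_smul_eq (poin_ne_zero (Oplus l)) ?_
    conv_lhs => rw [← hp]
    rw [← barH_smul, ← bElt_mul hl hx, barH_mul, barH_bElt hl, bElt_mul hl hx.barH]
  exact Prod.ext (key 0 _ hX.2.2.1) (key 1 _ (hX.1.congr rfl))

/-- The form making the standard basis of the Hecke algebra orthonormal. -/
def pairH (x y : H l) : A := trH (rhoH x * y)

lemma pairH_eq (x y : H l) : pairH x y = ∑ w, coef x w * coef y w := trH_rhoH_mul x y

lemma pairH_add_right (x y z : H l) : pairH x (y + z) = pairH x y + pairH x z := by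
  rw [pairH, mul_add]
  rfl

lemma pairH_smul_right (c : A) (x y : H l) : pairH x (c • y) = c * pairH x y := by
  rw [pairH, mul_smul_comm]
  rfl

lemma pairH_add_left (x y z : H l) : pairH (x + y) z = pairH x z + pairH y z := by
  rw [pairH, rhoH_add, add_mul]
  rfl

lemma pairH_smul_left (c : A) (x y : H l) : pairH (c • x) y = c * pairH x y := by
  rw [pairH, rhoH_smul, smul_mul_assoc]
  rfl

lemma pairH_zero_left (x : H l) : pairH 0 x = 0 := by
  have := pairH_smul_left 0 0 x
  rwa [zero_smul, zero_mul] at this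

lemma pairH_zero_right (x : H l) : pairH x 0 = 0 := by
  have := pairH_smul_right 0 x 0
  rwa [zero_smul, zero_mul] at this

lemma pairH_mul_left (z x y : H l) : pairH (z * x) y = pairH x (rhoH z * y) := by
  rw [pairH, rhoH_mul, mul_assoc, pairH]

/-- On `V` the division by the Poincaré polynomial in the form is exact. -/
lemma poin_mul_extForm (hl : 2 ≤ l) {X Y : H l × H l} (hX : X ∈ sphV l) (hY : Y ∈ sphV l) :
    poin (Oplus l) * extForm (mkV l X) (mkV l Y) = pairH X.1 Y.1 + pairH X.2 Y.2 := by
  have h1 : ∀ (I J : Set (Node l)) (x y : H l), formS (comp I J x) (comp I J y) =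
      divBy (poin I) (pairH x y) := by
    intro I J x y
    rw [formS, Finset.sum_eq_single I, Finset.sum_eq_single J]
    · rw [comp_self, comp_self, pairH]
    · intro J' _ h
      rw [comp_of_ne y fun h' => h h'.2, mul_zero]
      exact divBy_zero_A (poin_ne_zero _)
    · exact fun h => absurd (Finset.mem_univ _) h
    · intro I' _ h
      refine Finset.sum_eq_zero fun J' _ => ?_
      rw [comp_of_ne y fun h' => h h'.1, mul_zero]
      exact divBy_zero_A (poin_ne_zero _)
    · exact fun h => absurd (Finset.mem_univ _) h
  have h2 : ∀ t, ∀ x y : H l, LSph t x → LSph t y →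
      poin (Oplus l) * divBy (poin (Oplus l)) (pairH x y) = pairH x y := by
    intro t x y hx hy
    have hx' : RSph t (rhoH x) := by rwa [rsph_iff_rhoH, rhoH_rhoH]
    have h3 := poin_smul_divBy hl hx' hy
    have h4 : pairH x y = poin (Oplus l) * trH (divBy (poin (Oplus l)) (rhoH x * y)) := by
      rw [pairH]
      conv_lhs => rw [← h3]
      rfl
    rw [h4, divBy_mul_A (poin_ne_zero _)]
  rw [extForm, mkV_apply, mkV_apply]
  dsimp only
  rw [h1, h1, poin_Ominus hl, mul_add, h2 0 _ _ hX.1 hY.1, h2 1 _ _ hX.2.2.1 hY.2.2.1]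

lemma extForm_add_right (hl : 2 ≤ l) {X Y Z : H l × H l} (hX : X ∈ sphV l) (hY : Y ∈ sphV l)
    (hZ : Z ∈ sphV l) : extForm (mkV l X) (mkV l (Y + Z)) =
      extForm (mkV l X) (mkV l Y) + extForm (mkV l X) (mkV l Z) := by
  refine mul_left_cancel₀ (poin_ne_zero (Oplus l)) ?_
  rw [mul_add, poin_mul_extForm hl hX (add_mem hY hZ), poin_mul_extForm hl hX hY,
    poin_mul_extForm hl hX hZ, Prod.fst_add, Prod.snd_add, pairH_add_right, pairH_add_right]
  ring

lemma extForm_add_left (hl : 2 ≤ l) {X Y Z : H l × H l} (hX : X ∈ sphV l) (hY : Y ∈ sphV l)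
    (hZ : Z ∈ sphV l) : extForm (mkV l (X + Y)) (mkV l Z) =
      extForm (mkV l X) (mkV l Z) + extForm (mkV l Y) (mkV l Z) := by
  refine mul_left_cancel₀ (poin_ne_zero (Oplus l)) ?_
  rw [mul_add, poin_mul_extForm hl (add_mem hX hY) hZ, poin_mul_extForm hl hX hZ,
    poin_mul_extForm hl hY hZ, Prod.fst_add, Prod.snd_add, pairH_add_left, pairH_add_left]
  ring

lemma extForm_smul_right (hl : 2 ≤ l) (c : A) {X Y : H l × H l} (hX : X ∈ sphV l)
    (hY : Y ∈ sphV l) :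
    extForm (mkV l X) (mkV l (c • Y)) = c * extForm (mkV l X) (mkV l Y) := by
  refine mul_left_cancel₀ (poin_ne_zero (Oplus l)) ?_
  rw [mul_left_comm, poin_mul_extForm hl hX (Submodule.smul_mem _ c hY), poin_mul_extForm hl hX hY,
    Prod.smul_fst, Prod.smul_snd, pairH_smul_right, pairH_smul_right, mul_add]

lemma extForm_smul_left (hl : 2 ≤ l) (c : A) {X Y : H l × H l} (hX : X ∈ sphV l)
    (hY : Y ∈ sphV l) :
    extForm (mkV l (c • X)) (mkV l Y) = c * extForm (mkV l X) (mkV l Y) := by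
  refine mul_left_cancel₀ (poin_ne_zero (Oplus l)) ?_
  rw [mul_left_comm, poin_mul_extForm hl (Submodule.smul_mem _ c hX) hY, poin_mul_extForm hl hX hY,
    Prod.smul_fst, Prod.smul_snd, pairH_smul_left, pairH_smul_left, mul_add]

/-- Multiplication by `b` is self-adjoint, since the anti-involution exchanges `b_(O-,O+)` and its
conjugate. -/
lemma extForm_bMul (hl : 2 ≤ l) {X Y : H l × H l} (hX : X ∈ sphV l) (hY : Y ∈ sphV l) :
    extForm (mkV l (bMul X)) (mkV l Y) = extForm (mkV l X) (mkV l (bMul Y)) := by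
  have hp := poin_ne_zero (Oplus l)
  have key : ∀ t, ∀ x y : H l, LSph (t + 1) x → LSph t y →
      poin (Oplus l) * pairH (aElt l t * x) y = poin (Oplus l) * pairH x (aElt l (t + 1) * y) := by
    intro t x y hx hy
    rw [← pairH_smul_left, ← bElt_mul hl hx, ← pairH_smul_right, ← bElt_mul hl (hy.congr (by omega)),
      pairH_mul_left, rhoH_bElt hl]
  refine mul_left_cancel₀ hp (mul_left_cancel₀ hp ?_)
  rw [poin_mul_extForm hl (bMul_mem hl hX) hY, poin_mul_extForm hl hX (bMul_mem hl hY), mul_add,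
    mul_add, bMul, bMul]
  dsimp only
  rw [key 0 _ _ hX.2.2.1 hY.1, key 1 _ _ (hX.1.congr rfl) hY.2.2.1,
    aElt_congr (t := 1 + 1) (n := 0) rfl, add_comm]

lemma extForm_one_stdElt (hl : 2 ≤ l) (n : ℕ) :
    extForm (mkV l (pElt l 0, 0)) (mkV l (stdElt l n)) =
      if n = 0 then qpow (l.choose 2) else 0 := by
  refine mul_left_cancel₀ (poin_ne_zero (Oplus l)) ?_
  rw [poin_mul_extForm hl (one_mem_sphV hl) (stdElt_mem hl n)]
  dsimp only
  rw [pairH_zero_left, add_zero, stdElt]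
  by_cases h0 : n = 0
  · subst h0
    rw [if_pos Even.zero, if_pos rfl, pairH, rhoH_pElt hl, ← pElt_zero, pElt_mul hl (lsph_pElt l 0),
      Oset_zero, trH, coef_smul, coef_pElt, twist_self_one, negCount_one, if_pos rfl, len_one,
      Nat.cast_zero, sub_zero]
  · rw [if_neg h0, mul_zero]
    split_ifs with he
    · rw [pairH_eq]
      refine Finset.sum_eq_zero fun w _ => ?_
      rw [coef_pElt, coef_sElt, twist_congr (t := n) (n := 0) (by rw [Nat.even_iff] at he; omega)]
      by_cases h1 : negCount l (twist 0 0 w) = 0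
      · rw [h1, if_neg (Ne.symm h0), mul_zero]
      · rw [if_neg h1, zero_mul]
    · exact pairH_zero_right _

lemma sElt_eq_zero {n : ℕ} (hn : l < n) : sElt l n = 0 := by
  refine coef_ext fun w => ?_
  rw [coef_sElt, if_neg, coef_zero]
  have := negCount_le l (twist n 0 w)
  omega

lemma stdElt_eq_zero {n : ℕ} (hn : l < n) : stdElt l n = 0 := by
  rw [stdElt, sElt_eq_zero hn, ite_self]
  rfl

/-! ### The isomorphism -/

/-- The isomorphism from `V(l)` to `V`, which matches the ibar conjugates of the standard basis
vectors of `V(l)` with the standard basis of `V`. -/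
def phi (hl : 2 ≤ l) : VZ l ≃ₗ[A] VS l := (ibarStdBasis l).equiv (stdBasisV hl) (Equiv.refl _)

/-- The isomorphism `phi` in terms of components. -/
def phiC (hl : 2 ≤ l) : VZ l →ₗ[A] H l × H l :=
  (sphV l).subtype ∘ₗ ((phi hl).trans (sphVEquiv hl).symm).toLinearMap

lemma phi_coe (hl : 2 ≤ l) (v : VZ l) : (phi hl v : Fam l × Fam l) = mkV l (phiC hl v) := by
  change _ = mkV l ((sphVEquiv hl).symm (phi hl v) : H l × H l)
  rw [← sphVEquiv_coe hl, LinearEquiv.apply_symm_apply]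

lemma phiC_mem (hl : 2 ≤ l) (v : VZ l) : phiC hl v ∈ sphV l :=
  Subtype.prop ((sphVEquiv hl).symm (phi hl v))

lemma phiC_injective (hl : 2 ≤ l) : Function.Injective (phiC hl) := fun v w h =>
  (phi hl).injective (Subtype.ext (by rw [phi_coe, phi_coe, h]))

lemma exists_phiC_eq (hl : 2 ≤ l) {X : H l × H l} (hX : X ∈ sphV l) : ∃ v, phiC hl v = X := by
  refine ⟨(phi hl).symm (sphVEquiv hl ⟨X, hX⟩), ?_⟩
  refine mkV_injective ?_
  rw [← phi_coe, LinearEquiv.apply_symm_apply, sphVEquiv_coe]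

lemma phiC_ibar_stdV (hl : 2 ≤ l) (n : ℕ) : phiC hl (ibar l (stdV l n)) = stdElt l n := by
  rcases Nat.lt_or_ge l n with h | h
  · rw [stdV_eq_zero h, map_zero, map_zero, stdElt_eq_zero h]
  · have h1 := ibarStdBasis_apply (⟨n, by omega⟩ : Fin (l + 1))
    refine mkV_injective ?_
    rw [← phi_coe, ← h1, phi, Module.Basis.equiv_apply, stdBasisV_apply, sphVEquiv_coe]
    rfl

lemma phiC_etaV (hl : 2 ≤ l) : phiC hl (etaV l) = (pElt l 0, 0) := by
  rw [← (isIBar_ibar l).1, ← stdV_zero, phiC_ibar_stdV, stdElt, if_pos Even.zero, pElt_zero]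

lemma bMul_add (X Y : H l × H l) : bMul (X + Y) = bMul X + bMul Y :=
  Prod.ext (mul_add _ _ _) (mul_add _ _ _)

lemma bMul_smul (c : A) (X : H l × H l) : bMul (c • X) = c • bMul X :=
  Prod.ext (mul_smul_comm _ _ _) (mul_smul_comm _ _ _)

/-- Both sides are given by the same coefficients on the matching bases. -/
lemma phiC_actV_bU (hl : 2 ≤ l) (v : VZ l) : phiC hl (actV bU v) = bMul (phiC hl v) := by
  let g : H l × H l →ₗ[A] H l × H l :=
    { toFun := bMul, map_add' := bMul_add, map_smul' := bMul_smul }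
  have : phiC hl ∘ₗ bLin l = g ∘ₗ phiC hl := by
    refine (ibarStdBasis l).ext fun n => ?_
    have hn : (n : ℕ) ≤ l := by omega
    change phiC hl (actV bU (ibarStdBasis l n)) = bMul (phiC hl (ibarStdBasis l n))
    rw [ibarStdBasis_apply, phiC_ibar_stdV, bMul_stdElt hl hn, actV_bU_ibar_stdV hn, map_add,
      map_smul, map_smul, phiC_ibar_stdV, apply_ite (phiC hl), map_zero, phiC_ibar_stdV]
  exact LinearMap.congr_fun this v

/-! ### Compatibility with the bar involutions -/

/-- The images of the icanonical basis vectors are bar invariant, as `[n + 1] b⁽ⁿ⁺¹⁾ η_l` is obtained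
from the preceding ones by `b`, which commutes with the bar involution of `V`. -/
lemma barV_phiC_icV (hl : 2 ≤ l) (n : ℕ) : barV (phiC hl (icV l n)) = phiC hl (icV l n) := by
  induction n using Nat.strong_induction_on with
  | _ n ih =>
    rcases n with _ | n
    · rw [icV_zero, phiC_etaV, barV, barH_pElt hl, barH_zero]
    · have h1 := barV_bMul hl (phiC_mem hl (icV l n))
      rw [ih n (by omega), ← phiC_actV_bU, actV_bU_icV, map_add, map_smul, barV_add, barV_smul,
        barA_qnum] at h1
      have h2 : barV (phiC hl (if n % 2 = l % 2 then qnum n • icV l (n - 1) else 0)) =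
          phiC hl (if n % 2 = l % 2 then qnum n • icV l (n - 1) else 0) := by
        split_ifs
        · rw [map_smul, barV_smul, ih _ (by omega), barA_qnum]
        · rw [map_zero]
          exact Prod.ext barH_zero barH_zero
      rw [h2] at h1
      exact eq_of_smul_eq_prod (qnum_ne_zero (Nat.succ_ne_zero n)) (add_right_cancel h1)

lemma phiC_ibar (hl : 2 ≤ l) (v : VZ l) : phiC hl (ibar l v) = barV (phiC hl v) := by
  let g : H l × H l →ₛₗ[barA] H l × H l :=
    { toFun := barV, map_add' := barV_add, map_smul' := barV_smul }
  have : (phiC hl).comp (ibar l) = g.comp (phiC hl) := by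
    refine (icanBasis l).ext fun n => ?_
    change phiC hl (ibar l (icanBasis l n)) = barV (phiC hl (icanBasis l n))
    rw [icanBasis_apply, barV_phiC_icV, (isIBar_ibar l).icV_fixed]
  exact LinearMap.congr_fun this v

/-! ### The icanonical basis and the Kazhdan-Lusztig basis -/

lemma qPos_icanCoef {n m : ℕ} (h : m < n) : QPos (icanCoef (qpow 1) l n m) := by
  by_cases hp : n % 2 = m % 2
  · obtain ⟨c, hc⟩ : ∃ c, n = m + 2 * c := ⟨(n - m) / 2, by omega⟩
    rw [icanCoef_of_eq _ hc, icoef]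
    obtain ⟨k, hk⟩ : ∃ k, (if Even (l - m) then c * (2 * c - 1) else c * (2 * c + 1)) = k + 1 := by
      refine Nat.exists_eq_succ_of_ne_zero ?_
      have hc0 : c ≠ 0 := by omega
      split_ifs
      · exact mul_ne_zero hc0 (by omega)
      · exact mul_ne_zero hc0 (by omega)
    have hq : qpow 1 = (Polynomial.toLaurent (R := ℤ)) Polynomial.X :=
      (Polynomial.toLaurent_X).symm
    refine ⟨Polynomial.X ^ k * gauss (Polynomial.X ^ 4) ((l - m) / 2) c, ?_⟩
    rw [hk, map_mul, map_pow, map_gauss, map_pow, ← hq, pow_succ', mul_assoc]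
  · rw [icanCoef_of_not _ (Or.inr hp)]
    exact QPos.zero

/-- The expansion of `b⁽ⁿ⁾ η_l` in the ibar conjugate of the standard basis has coefficients in
`qℤ[q]` below the leading term, so its bar invariant image is a Kazhdan-Lusztig element. -/
lemma phiC_icV (hl : 2 ≤ l) {n : ℕ} (hn : n ≤ l) :
    phiC hl (icV l n) = if Even n then (klB (maxW hn), 0) else (0, klB (maxW hn)) := by
  have h1 : phiC hl (icV l n) =
      ∑ m ∈ Finset.range (n + 1), icanCoef (qpow 1) l n m • stdElt l m := by
    rw [icV_eq_sum_ibar_stdV, map_sum]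
    simp only [map_smul, phiC_ibar_stdV]
    rw [← Finset.sum_range fun m => icanCoef (qpow 1) l n m • stdElt l m]
    refine (Finset.sum_subset (Finset.range_mono (by omega)) fun m _ hm => ?_).symm
    rw [Finset.mem_range] at hm
    rw [icanCoef_of_not _ (Or.inl (by omega)), zero_smul]
  have h2 : ∀ m, icanCoef (qpow 1) l n m • stdElt l m =
      if Even n then (icanCoef (qpow 1) l n m • sElt l m, 0)
        else (0, icanCoef (qpow 1) l n m • sElt l m) := by
    intro m
    by_cases hp : n % 2 = m % 2
    · by_cases he : Even n
      · rw [if_pos he, stdElt, if_pos (by rw [Nat.even_iff] at *; omega), Prod.smul_mk, smul_zero]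
      · rw [if_neg he, stdElt, if_neg (by rw [Nat.even_iff] at *; omega), Prod.smul_mk, smul_zero]
    · rw [icanCoef_of_not _ (Or.inr hp), zero_smul, zero_smul]
      exact (ite_self _).symm
  have h3 : phiC hl (icV l n) =
      if Even n then (∑ m ∈ Finset.range (n + 1), icanCoef (qpow 1) l n m • sElt l m, 0)
        else (0, ∑ m ∈ Finset.range (n + 1), icanCoef (qpow 1) l n m • sElt l m) := by
    rw [h1]
    simp only [h2]
    split_ifs
    · refine Prod.ext ?_ ?_
      · rw [Prod.fst_sum]
      · rw [Prod.snd_sum]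
        exact Finset.sum_const_zero
    · refine Prod.ext ?_ ?_
      · rw [Prod.fst_sum]
        exact Finset.sum_const_zero
      · rw [Prod.snd_sum]
  have hbar := barV_phiC_icV hl n
  rw [h3] at hbar
  rw [h3, (isKL_maxW hl hn (f := icanCoef (qpow 1) l n) (icanCoef_self _ _ _)
    (fun m hm => icanCoef_of_not _ (Or.inr hm.symm)) (fun m hm => qPos_icanCoef hm) ?_).klB_eq]
  split_ifs at hbar
  · exact congrArg Prod.fst hbar
  · exact congrArg Prod.snd hbar

lemma phi_icV (hl : 2 ≤ l) {n : ℕ} (hn : n ≤ l) : (phi hl (icV l n) : Fam l × Fam l) = klVS hn := by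
  rw [phi_coe, phiC_icV hl hn, klVS]
  split_ifs with he
  · rw [mkV_apply, comp_zero, bS, maxW, Oset, if_pos he]
  · rw [mkV_apply, comp_zero, bS, maxW, Oset, if_neg he]

/-! ### The algebra structure -/

/-- The product of `V(l)` corresponding to the product of `V`. -/
def mulVZ (hl : 2 ≤ l) (v w : VZ l) : VZ l :=
  (exists_phiC_eq hl (mulV_mem hl (phiC_mem hl v) (phiC_mem hl w))).choose

lemma phiC_mulVZ (hl : 2 ≤ l) (v w : VZ l) :
    phiC hl (mulVZ hl v w) = mulV (phiC hl v) (phiC hl w) :=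
  (exists_phiC_eq hl (mulV_mem hl (phiC_mem hl v) (phiC_mem hl w))).choose_spec

lemma mulVZ_add_left (hl : 2 ≤ l) (v v' w : VZ l) :
    mulVZ hl (v + v') w = mulVZ hl v w + mulVZ hl v' w := by
  refine phiC_injective hl ?_
  rw [map_add, phiC_mulVZ, phiC_mulVZ, phiC_mulVZ, map_add, add_mulV hl] <;> exact phiC_mem hl _

lemma mulVZ_smul_left (hl : 2 ≤ l) (c : A) (v w : VZ l) :
    mulVZ hl (c • v) w = c • mulVZ hl v w := by
  refine phiC_injective hl ?_
  rw [map_smul, phiC_mulVZ, phiC_mulVZ, map_smul, smul_mulV hl] <;> exact phiC_mem hl _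

lemma mulVZ_assoc (hl : 2 ≤ l) (u v w : VZ l) :
    mulVZ hl (mulVZ hl u v) w = mulVZ hl u (mulVZ hl v w) := by
  refine phiC_injective hl ?_
  rw [phiC_mulVZ, phiC_mulVZ, phiC_mulVZ, phiC_mulVZ, mulV_assoc hl] <;> exact phiC_mem hl _

lemma etaV_mulVZ (hl : 2 ≤ l) (v : VZ l) : mulVZ hl (etaV l) v = v := by
  refine phiC_injective hl ?_
  rw [phiC_mulVZ, phiC_etaV, one_mulV hl (phiC_mem hl v)]

lemma actV_bU_mulVZ (hl : 2 ≤ l) (v w : VZ l) :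
    actV bU (mulVZ hl v w) = mulVZ hl (actV bU v) w := by
  refine phiC_injective hl ?_
  have hv := phiC_mem hl v
  have hw := phiC_mem hl w
  rw [phiC_mulVZ, phiC_actV_bU, phiC_actV_bU, phiC_mulVZ, ← mulV_b hl hv,
    ← mulV_b hl (mulV_mem hl hv hw), mulV_assoc hl (b_mem_sphV hl) hv hw]

/-- The idivided powers act on `V(l)` by multiplication by icanonical basis vectors. -/
lemma repV_idivPow (hl : 2 ≤ l) (n : ℕ) (v : VZ l) :
    repV l (Polynomial.aeval (bU : Uq) (idivPow l n)) v = mulVZ hl (icV l n) v := by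
  induction n using Nat.strong_induction_on with
  | _ n ih =>
    rcases n with _ | n
    · rw [show idivPow l 0 = 1 by simp [idivPow, qfact], map_one, map_one, icV_zero, etaV_mulVZ]
      rfl
    · have h1 := congrArg (fun u => repV l (Polynomial.aeval (bU : Uq) u) (v : Fin (l + 1) → K))
        (idivPow_recurrence l n)
      have h2 : actV bU (mulVZ hl (icV l n) v) = qnum (n + 1) • mulVZ hl (icV l (n + 1)) v +
          if n % 2 = l % 2 then qnum n • mulVZ hl (icV l (n - 1)) v else 0 := by
        rw [actV_bU_mulVZ, actV_bU_icV, mulVZ_add_left, mulVZ_smul_left]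
        congr 1
        split_ifs
        · rw [mulVZ_smul_left]
        · have := mulVZ_smul_left hl 0 0 v
          rwa [zero_smul, zero_smul] at this
      have h3 := congrArg (Subtype.val : VZ l → Fin (l + 1) → K) h2
      change repV l (bU : Uq) _ = _ at h3
      rw [← ih n (by omega)] at h3
      have h4 : ((if n % 2 = l % 2 then qnum n • mulVZ hl (icV l (n - 1)) v else 0 : VZ l) :
          Fin (l + 1) → K) = repV l (Polynomial.aeval (bU : Uq)
            (if n % 2 = l % 2 then Polynomial.C (qint n) * idivPow l (n - 1) else 0)) v := by
        split_ifs
        · rw [Polynomial.C_mul', map_smul, map_smul, LinearMap.smul_apply, ih _ (by omega)]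
          funext j
          rw [VZ_smul_apply, algebraMap_qnum]
          rfl
        · simp
      rw [Submodule.coe_add, h4] at h3
      simp only [map_sub, map_mul, Polynomial.aeval_X, LinearMap.sub_apply,
        Module.End.mul_apply] at h1
      rw [h3] at h1
      funext j
      have h5 := congrFun h1 j
      rw [Pi.sub_apply, Pi.add_apply, add_sub_cancel_right, VZ_smul_apply, algebraMap_qnum] at h5
      refine mul_left_cancel₀ (?_ : qint ((n + 1 : ℕ) : ℤ) ≠ 0) (Eq.trans ?_ h5)
      · rw [← algebraMap_qnum]
        exact algebraMap_A_ne_zero (qnum_ne_zero (Nat.succ_ne_zero n))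
      · simp

/-- An element `u` of the iquantum group acts on `V(l)` by multiplication by `u η_l`. -/
lemma exists_repV_eq_mulVZ (hl : 2 ≤ l) {u : Polynomial K} (hu : u ∈ UI l) :
    ∃ z : VZ l, (z : Fin (l + 1) → K) = iact l u ∧
      ∀ v : VZ l, repV l (Polynomial.aeval (bU : Uq) u) v = mulVZ hl z v := by
  induction hu using Algebra.adjoin_induction with
  | mem x hx =>
    obtain ⟨n, rfl⟩ := hx
    exact ⟨icV l n, icV_coe l n, repV_idivPow hl n⟩
  | algebraMap r =>
    have h : ∀ v : VZ l, repV l (Polynomial.aeval (bU : Uq) (algebraMap A K[X] r)) v =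
        (r • v : VZ l) := by
      intro v
      rw [IsScalarTower.algebraMap_apply A K K[X], Polynomial.algebraMap_eq, Polynomial.aeval_C,
        AlgHom.commutes]
      funext j
      rw [VZ_smul_apply]
      rfl
    refine ⟨r • etaV l, (h (etaV l)).symm, fun v => ?_⟩
    rw [h, mulVZ_smul_left, etaV_mulVZ]
  | add x y _ _ hx hy =>
    obtain ⟨z, hz, h⟩ := hx
    obtain ⟨z', hz', h'⟩ := hy
    refine ⟨z + z', ?_, fun v => ?_⟩
    · rw [iact_add, Submodule.coe_add, hz, hz']
    · rw [map_add, map_add, LinearMap.add_apply, h, h', mulVZ_add_left, Submodule.coe_add]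
  | mul x y _ _ hx hy =>
    obtain ⟨z, hz, h⟩ := hx
    obtain ⟨z', hz', h'⟩ := hy
    have h2 : ∀ v : Fin (l + 1) → K, repV l (Polynomial.aeval (bU : Uq) (x * y)) v =
        repV l (Polynomial.aeval (bU : Uq) x) (repV l (Polynomial.aeval (bU : Uq) y) v) := by
      intro v
      rw [map_mul, map_mul, Module.End.mul_apply]
    refine ⟨mulVZ hl z z', ?_, fun v => ?_⟩
    · rw [iact, h2, ← h, hz']
      rfl
    · rw [h2, h', h, mulVZ_assoc]

/-- The linear map `u ↦ u η_l` from the iquantum group to `V(l)`. -/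
def etaMap (hl : 2 ≤ l) : UI l →ₗ[A] VZ l where
  toFun u := ⟨iact l u, by
    obtain ⟨z, hz, -⟩ := exists_repV_eq_mulVZ hl u.2
    rw [← hz]
    exact z.2⟩
  map_add' u v := Subtype.ext (iact_add l u v)
  map_smul' c u := by
    refine Subtype.ext (funext fun j => ?_)
    rw [RingHom.id_apply, VZ_smul_apply]
    change iact l (c • (u : K[X])) j = _
    rw [← algebraMap_smul K c (u : K[X]), ← Polynomial.C_mul', iact_C_mul]
    rfl

lemma etaMap_coe (hl : 2 ≤ l) (u : UI l) : (etaMap hl u : Fin (l + 1) → K) = iact l u := rfl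

lemma etaMap_mul (hl : 2 ≤ l) (u v : UI l) :
    etaMap hl (u * v) = mulVZ hl (etaMap hl u) (etaMap hl v) := by
  obtain ⟨z, hz, h⟩ := exists_repV_eq_mulVZ hl u.2
  have hz' : etaMap hl u = z := Subtype.ext hz.symm
  refine Subtype.ext ?_
  rw [hz', ← h, etaMap_coe, etaMap_coe, iact, iact]
  change repV l (Polynomial.aeval (bU : Uq) ((u : K[X]) * (v : K[X]))) _ = _
  rw [map_mul, map_mul, Module.End.mul_apply]

lemma etaMap_surjective (hl : 2 ≤ l) : Function.Surjective (etaMap hl) := by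
  rw [← LinearMap.range_eq_top, eq_top_iff, ← (icanBasis l).span_eq, Submodule.span_le]
  rintro _ ⟨n, rfl⟩
  refine ⟨⟨idivPow l n, Algebra.subset_adjoin ⟨n, rfl⟩⟩, Subtype.ext ?_⟩
  rw [icanBasis_apply, icV_coe, etaMap_coe]

lemma ker_etaMap (hl : 2 ≤ l) : LinearMap.ker (etaMap hl) = (annEta l).restrictScalars A := by
  ext u
  rw [LinearMap.mem_ker]
  exact Subtype.ext_iff

/-- The isomorphism from the quotient of the iquantum group by the annihilator of `η_l` to
`V(l)`. -/
def quotEquiv (hl : 2 ≤ l) : (UI l ⧸ annEta l) ≃ₗ[A] VZ l :=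
  (Submodule.Quotient.restrictScalarsEquiv A (annEta l)).symm.trans
    ((Submodule.quotEquivOfEq _ _ (ker_etaMap hl).symm).trans
      ((etaMap hl).quotKerEquivOfSurjective (etaMap_surjective hl)))

lemma quotEquiv_mk (hl : 2 ≤ l) (u : UI l) :
    quotEquiv hl (Ideal.Quotient.mk (annEta l) u) = etaMap hl u := rfl

/-! ### The bilinear forms -/

/-- A bilinear form for which `b` is self-adjoint is determined by its values on the pairs
`(η_l, w)`, since `η_l` generates `V(l)` under `b` up to torsion. -/
lemma bilinForm_ext {D E : LinearMap.BilinForm A (VZ l)}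
    (hD : ∀ v w, D (actV bU v) w = D v (actV bU w)) (hE : ∀ v w, E (actV bU v) w = E v (actV bU w))
    (h : D (etaV l) = E (etaV l)) : D = E := by
  have key : ∀ n, D (icV l n) = E (icV l n) := by
    intro n
    induction n using Nat.strong_induction_on with
    | _ n ih =>
      rcases n with _ | n
      · rw [icV_zero, h]
      · refine LinearMap.ext fun w => mul_left_cancel₀ (qnum_ne_zero (Nat.succ_ne_zero n)) ?_
        have h1 := hD (icV l n) w
        rw [ih n (by omega), ← hE, actV_bU_icV, map_add, map_add, map_smul, map_smul,
          LinearMap.add_apply, LinearMap.add_apply] at h1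
        have h2 : D (if n % 2 = l % 2 then qnum n • icV l (n - 1) else 0) =
            E (if n % 2 = l % 2 then qnum n • icV l (n - 1) else 0) := by
          split_ifs
          · rw [map_smul, map_smul, ih _ (by omega)]
          · rw [map_zero, map_zero]
        rw [h2] at h1
        exact add_right_cancel h1
  exact (icanBasis l).ext fun n => by rw [icanBasis_apply, key]

/-- Both sides are bilinear and self-adjoint for `b`, so they need only be compared at `(η_l, w)`. -/
lemma barA_contraForm_ibar (hl : 2 ≤ l) (v w : VZ l) :
    barA (contraForm l (ibar l v) (ibar l w)) =
      qpow (-(l.choose 2 : ℤ)) * extForm (mkV l (phiC hl v)) (mkV l (phiC hl w)) := by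
  have hm := phiC_mem hl
  let D : LinearMap.BilinForm A (VZ l) := LinearMap.mk₂ A
    (fun v w => barA (contraForm l (ibar l v) (ibar l w)))
    (fun v v' w => by simp only [map_add, LinearMap.add_apply])
    (fun c v w => by
      simp only [map_smulₛₗ, LinearMap.smul_apply, smul_eq_mul, map_mul, barA_barA, RingHom.id_apply])
    (fun v w w' => by simp only [map_add])
    (fun c v w => by
      simp only [map_smulₛₗ, smul_eq_mul, map_mul, barA_barA, RingHom.id_apply])
  let E : LinearMap.BilinForm A (VZ l) := LinearMap.mk₂ A
    (fun v w => qpow (-(l.choose 2 : ℤ)) * extForm (mkV l (phiC hl v)) (mkV l (phiC hl w)))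
    (fun v v' w => by rw [map_add, extForm_add_left hl (hm _) (hm _) (hm _), mul_add])
    (fun c v w => by rw [map_smul, extForm_smul_left hl c (hm _) (hm _), mul_left_comm, smul_eq_mul])
    (fun v w w' => by rw [map_add, extForm_add_right hl (hm _) (hm _) (hm _), mul_add])
    (fun c v w => by
      rw [map_smul, extForm_smul_right hl c (hm _) (hm _), mul_left_comm, smul_eq_mul])
  have hDE : D = E := by
    refine bilinForm_ext (fun v w => ?_) (fun v w => ?_) ?_
    · change barA (contraForm l (ibar l _) _) = barA (contraForm l _ (ibar l _))
      rw [(isIBar_ibar l).2, (isIBar_ibar l).2, (isContraForm_contraForm l).2.2, rhoZ_bU]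
    · change _ * extForm (mkV l (phiC hl _)) _ = _ * extForm _ (mkV l (phiC hl _))
      rw [phiC_actV_bU, phiC_actV_bU, extForm_bMul hl (hm _) (hm _)]
    · refine (ibarStdBasis l).ext fun n => ?_
      change barA (contraForm l (ibar l (etaV l)) (ibar l (ibarStdBasis l n))) =
        _ * extForm (mkV l (phiC hl (etaV l))) (mkV l (phiC hl (ibarStdBasis l n)))
      rw [ibarStdBasis_apply, ibar_ibar, (isIBar_ibar l).1, contraForm_etaV_left, phiC_etaV,
        phiC_ibar_stdV, extForm_one_stdElt hl, stdV_eq_toVZ, LinearEquiv.symm_apply_apply,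
        Pi.single_apply]
      by_cases h0 : n = 0
      · subst h0
        rw [if_pos rfl, Fin.val_zero, if_pos rfl, map_one, mul_comm, qpow_mul_neg]
      · rw [if_neg (Ne.symm h0), if_neg fun h : (n : ℕ) = 0 => h0 (Fin.ext h), map_zero, mul_zero]
  exact LinearMap.congr_fun (LinearMap.congr_fun hDE v) w

end ISchur

end

open ISchur

theorem theorem4p4 (l : ℕ) (hl : 2 ≤ l) :
    (∃! β : VZ l →ₛₗ[barA] VZ l, IsIBar l β) ∧
    (∃! B : LinearMap.BilinForm A (VZ l), IsContraForm l B) ∧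
    Module.Free A (VZ l) ∧ Module.Free A (VS l) ∧
    ∀ (β : VZ l →ₛₗ[barA] VZ l) (B : LinearMap.BilinForm A (VZ l)),
      IsIBar l β → IsContraForm l B →
      ∃ φ : VZ l ≃ₗ[A] VS l,
        -- `φ` is the unique isomorphism with the prescribed values
        IsPhi l β φ ∧ (∀ φ' : VZ l ≃ₗ[A] VS l, IsPhi l β φ' → φ' = φ) ∧
        -- `V(l)` is the quotient of the iquantum group by `I_l`, and `φ` is an algebra isomorphism
        (∃ ψ : (UI l ⧸ annEta l) ≃ₗ[A] VZ l,
          (∀ u : UI l, (ψ (Ideal.Quotient.mk (annEta l) u) : Fin (l + 1) → K) = iact l u) ∧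
          (φ (ψ 1) : Fam l × Fam l) = extOne l ∧
          ∀ x y, (φ (ψ (x * y)) : Fam l × Fam l) = extMul (φ (ψ x)) (φ (ψ y))) ∧
        -- compatibility with `b`, with the bar involutions and with the bilinear forms
        (∀ v : VZ l, (φ (actV bU v) : Fam l × Fam l) = extMul (bV l) (φ v)) ∧
        (∀ v : VZ l, (φ (β v) : Fam l × Fam l) = extBar (φ v)) ∧
        ∀ v w : VZ l,
          barA (B (β v) (β w)) = qpow (-(l.choose 2 : ℤ)) * extForm (φ v : Fam l × Fam l) (φ w) := by
  refine ⟨⟨ibar l, isIBar_ibar l, fun β h => h.eq_ibar⟩,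
    ⟨contraForm l, isContraForm_contraForm l, fun B h => h.eq_contraForm⟩,
    Module.Free.of_basis (icanBasis l), Module.Free.of_basis (stdBasisV hl), ?_⟩
  rintro β B hβ hB
  obtain rfl := hβ.eq_ibar
  obtain rfl := hB.eq_contraForm
  have hstd : ∀ (n : ℕ) (hn : n ≤ l),
      (phi hl (ibar l (stdV l n)) : Fam l × Fam l) = stdVS hn := fun n hn => by
    rw [phi_coe, phiC_ibar_stdV, stdVS_eq hl hn]
  refine ⟨phi hl, ⟨hstd, fun n hn => ⟨icV l n, icV_coe l n, phi_icV hl hn⟩⟩, fun φ' h => ?_,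
    ⟨quotEquiv hl, fun u => by rw [quotEquiv_mk, etaMap_coe], ?_, fun x y => ?_⟩, fun v => ?_,
    fun v => ?_, fun v w => ?_⟩
  · refine LinearEquiv.toLinearMap_injective ((ibarStdBasis l).ext fun n => Subtype.ext ?_)
    have hn : (n : ℕ) ≤ l := by omega
    rw [ibarStdBasis_apply, LinearEquiv.coe_coe, LinearEquiv.coe_coe, h.1 n hn, hstd n hn]
  · have h1 : quotEquiv hl 1 = etaV l := Subtype.ext (iact_one l)
    rw [h1, phi_coe, phiC_etaV, extOne_eq hl]
  · obtain ⟨u, rfl⟩ := Ideal.Quotient.mk_surjective x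
    obtain ⟨v, rfl⟩ := Ideal.Quotient.mk_surjective y
    rw [← map_mul, quotEquiv_mk, quotEquiv_mk, quotEquiv_mk, etaMap_mul, phi_coe, phi_coe, phi_coe,
      phiC_mulVZ, extMul_mkV hl]
  · rw [phi_coe, phi_coe, phiC_actV_bU, bV_eq hl, extMul_mkV hl, mulV_b hl (phiC_mem hl v)]
  · rw [phi_coe, phi_coe, phiC_ibar, extBar_mkV]
  · rw [phi_coe, phi_coe, barA_contraForm_ibar hl]
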